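/- Let $M\subset\mathbb C^n$ ($n\ge1$) be a semisimple Frobenius manifold with flat coordinates $v^1,\dots,v^n$: a domain with a holomorphic potential $F(v)$, a constant nondegenerate symmetric matrix $\eta_{\alpha\beta}=\partial_1\partial_\alpha\partial_\beta F$, an associative product $c^\gamma_{\alpha\beta}=\eta^{\gamma\epsilon}\partial_\epsilon\partial_\alpha\partial_\beta F$ on $T_vM$ with unity $e=\partial/\partial v^1$, and an affine Euler field $E$ with $[e,E]=e$, $\partial_EF=(3-d)F+\text{quadratic}$; semisimple means that the set $M_{ss}$ of points where $E\cdot$ has simple spectrum is dense. For $v\in M_{ss}$ let $u_1,\dots,u_n$ be the eigenvalues of $E\cdot$ and $\pi_i=\partial/\partial u_i$ the basic idempotents of $T_vM$. Put $\mathcal V=\frac{2-d}2-\nabla E$, $\mathcal U=E\cdot$, let ${}^*$ be the adjoint for $\eta$, and fix a Levelt system of deformed flat coordinates $(\theta_1(v;z),\dots,\theta_n(v;z))z^{\mu}z^{R}$, $\theta_\alpha(v;z)=\sum_{p\ge0}\theta_{\alpha,p}(v)z^p$: $\mathcal V=\mu+R_0$ with $\mu$ diagonalizable and $R_0$ nilpotent,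 $[\mu,R_k]=kR_k$, $R_k^*=(-1)^{k+1}R_k$, $R=\sum_{k\ge0}R_k$, $\theta_{\alpha,0}=\eta_{\alpha\epsilon}v^\epsilon$, $\partial_\lambda\partial_\mu\theta_{\alpha,p+1}=c_{\lambda\mu}^\nu\partial_\nu\theta_{\alpha,p}$, and the matrices $\Theta_p=(\nabla^\alpha\theta_{\beta,p})$ satisfy $(p+1)\Theta_{p+1}+[\Theta_{p+1},\mathcal V]=\mathcal U\Theta_p-\sum_{k\ge1}\Theta_{p+1-k}R_k$ and $\sum_{j}(-1)^j\Theta_j^*\Theta_{p-j}=\delta_{p,0}$. Let $\Omega_{\alpha,p;\beta,q}(v)$ be the coefficients of $(\langle\nabla\theta_\alpha(v;z),\nabla\theta_\beta(v;w)\rangle-\eta_{\alpha\beta})/(z+w)$. For $M\ge0$ put $P_{M,x,r}=\sum_{j}\frac1{j!}[R^j]_r\,f^{(j)}(\mu)$, $f(y)=\prod_{i=0}^{M-1}(y+x+i)$, where $[R^j]_r=\sum_{k_1+\dots+k_j=r}R_{k_1}\cdots R_{k_j}$ (and $P_{M,x,r}=0$ for $r<0$). The Virasoro operators of $M$ are $$L_m=\epsilon^2\sum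 a_m^{\alpha,p;\beta,q}\partial_{t^{\alpha,p}}\partial_{t^{\beta,q}}+\sum {b_m}^{\alpha,p}_{\beta,q}t^{\beta,q}\partial_{t^{\alpha,p}}+\epsilon^{-2}\sum c^m_{\alpha,p;\beta,q}t^{\alpha,p}t^{\beta,q},\qquad m\ge-1,$$ $$a_m^{\alpha,p;\beta,q}=\tfrac{(-1)^{q+1}}2\big(P_{m+1,-q-\frac12,m-1-p-q}\,\eta^{-1}\big)^{\alpha\beta},\quad {b_m}^{\alpha,p}_{\beta,q}=\big(P_{m+1,q+\frac12,m+q-p}\big)^\alpha_\beta,\quad c^m_{\alpha,p;\beta,q}=\tfrac{(-1)^p}2\big(\eta P_{m+1,q+\frac12,m+1+p+q}\big)_{\alpha\beta},$$ and $\hat L_m=L_m+\kappa_0\delta_{m,0}$ with a constant $\kappa_0$. Consider the monotone solutions $v(\mathbf t)$ of the Principal Hierarchy given by $\sum\tilde t^{\alpha,p}\nabla\theta_{\alpha,p}(v)=0$, $\tilde t=t-c$, with finitely many nonzero constants $c^{\alpha,p}$ ($x$ is absorbed into $t^{1,0}$, $\partial_x=\partial_{t^{1,0}}$; monotone: $v_x$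 is invertible in $T_vM$ at $\mathbf t=0$), and put $\mathcal F_0=\frac12\sum\tilde t^{\alpha,p}\tilde t^{\beta,q}\Omega_{\alpha,p;\beta,q}(v(\mathbf t))$. For functions $\mathcal F^{[k]}(v;v_x,\dots,v^{(n_k)})$, $k\ge1$, holomorphic on open sets of the jet space of $M$, consider the Virasoro constraints $$\hat L_m(\epsilon^{-1}\tilde{\mathbf t},\epsilon\,\partial/\partial\mathbf t)\,\tau=0,\quad m\ge-1,\qquad \tau=\exp\Big[\epsilon^{-2}\mathcal F_0+\sum_{k\ge1}\epsilon^{k-2}\mathcal F^{[k]}(v;v_x,\dots)\Big]\qquad(*)$$ for all these solutions $v(\mathbf t)$, understood order by order in $\epsilon$: the equation of order $\epsilon^{k-2}$ is imposed on every solution whose jet at $\mathbf t=0$ lies in the domains of $\mathcal F^{[1]},\dots,\mathcal F^{[k]}$. Then: 1. Let $G(v;v_x,\dots,v^{(N)})$ be a holomorphic function on an open set of the jet space. On every such solution with $v\in M_{ss}$ at $\mathbf t=0$ and with jet in the domain of $G$, the generating function of the linearized Virasoro constraints $$\sum_{m\ge-1}\frac1{\lambda^{m+2}}\Big[2a_m^{\alpha,p;\beta,q}\frac{\partial\mathcal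 F_0}{\partial t^{\alpha,p}}\frac{\partial G}{\partial t^{\beta,q}}+{b_m}^{\alpha,p}_{\beta,q}\tilde t^{\beta,q}\frac{\partial G}{\partial t^{\alpha,p}}\Big]$$ at $\mathbf t=0$ converges for $|\lambda|>\max_i|u_i|$ to a rational function of $\lambda$ that vanishes at infinity and has poles only at $\lambda=u_1,\dots,u_n$, of order at most $N+1$. The coefficient of $(\lambda-u_i)^{-N-1}$ equals $$-(u_i')^N\Big[N!+2^{-N}\sum_{k=1}^N\binom Nk(2k-3)!!\,(2N-2k+1)!!\Big]\sum_\gamma\pi_i^\gamma\frac{\partial G}{\partial v^{\gamma,N}},$$ where $v_x=\sum_iu_i'\pi_i$, and the factor in front of the sum over $\gamma$ is nonzero. 2. If the linearized Virasoro constraints annihilate $G$ for all these solutions with jet in the domain of $G$, then $dG=0$ on the domain of $G$. 3. The solution of $(*)$ is unique: if $(\mathcal F^{[k]})$ with $\kappa_0$ and $(\mathcal F'^{[k]})$ with $\kappa_0'$ both satisfy $(*)$, then for every $k\ge1$ all first partial derivatives of $\mathcal F^{[k]}$ and $\mathcal F'^{[k]}$ coincide at each jet lying in the domains of $\mathcal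 F^{[l]}$, $\mathcal F'^{[l]}$ for all $1\le l\le k$ (so that $\mathcal F^{[k]}$ is determined up to an additive constant, locally); and $\kappa_0=\kappa_0'$ as soon as such jets exist for $k=2$. 4. If the transformation $v_\alpha\mapsto w_\alpha=v_\alpha+\partial_x\partial_{t^{\alpha,0}}\sum_{k\ge1}\epsilon^k\mathcal F^{[k]}$ linearizes the Virasoro symmetries, i.e. $\partial\tau/\partial\hat s_m=\hat L_m(\epsilon^{-1}\mathbf t,\epsilon\,\partial/\partial\mathbf t)\tau$, $m\ge-1$, where $\partial_{\hat s_m}\log\tau=\epsilon^{-2}\partial_{s_m}\mathcal F_0+\sum_{k\ge1}\epsilon^{k-2}\sum_{r,\gamma}\frac{\partial\mathcal F^{[k]}}{\partial v^{\gamma,r}}\partial_x^r\partial_{s_m}v^\gamma$, $\;\partial_{s_m}\mathcal F_0=a_m\partial\mathcal F_0\,\partial\mathcal F_0+b_m\,t\,\partial\mathcal F_0+c_m\,t\,t$, $\;\partial_{s_m}v_\gamma=\partial_x\partial_{t^{\gamma,0}}\partial_{s_m}\mathcal F_0$ (order by order in $\epsilon$, on the same solutions as in $(*)$), then $(*)$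 holds. 5. If $(*)$ holds, then the transformation contains only even powers of $\epsilon$, $$w_\alpha=v_\alpha+\partial_x\partial_{t^{\alpha,0}}\sum_{g\ge1}\epsilon^{2g}\mathcal F_g(v;v_x,\dots,v^{(3g-2)}),\qquad \mathcal F_g=\mathcal F^{[2g]}:$$ at each jet in the domains of $\mathcal F^{[1]},\dots,\mathcal F^{[k]}$, all first partial derivatives of $\mathcal F^{[k]}$ vanish when $k$ is odd, and $\partial\mathcal F^{[k]}/\partial v^{\gamma,r}=0$ for all $r>3g-2$ when $k=2g$, $g\ge1$; and on every such solution whose jet at $\mathbf t=0$ lies in all the domains, the coefficients of the odd powers of $\epsilon$ in $w_\alpha$ vanish at $\mathbf t=0$. -/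

import Mathlib

open scoped BigOperators Topology

noncomputable section

namespace Dubrovin

/-! ### Frobenius manifolds in flat coordinates -/

/-- The partial derivative `∂f/∂v^α` of a function on `ℂⁿ`. -/
def pd {n : ℕ} (α : Fin n) (f : (Fin n → ℂ) → ℂ) : (Fin n → ℂ) → ℂ :=
  fun v => fderiv ℂ f v (Pi.single α 1)

/-- A Frobenius manifold, given by its potential `F` in flat coordinates `v^1, …, v^n` on a domain
of `ℂⁿ`: a constant nondegenerate metric `η`, the unity vector field `e = ∂/∂v^1` (the index `1` is
`0 : Fin n`), the associativity equations, and an affine Euler vector field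
`E^α(v) = ∑ A^α_β v^β + B^α` with `[e, E] = e` and `∂_E F = (3 - d) F + quadratic`. -/
structure FrobeniusManifold (n : ℕ) [NeZero n] where
  carrier : Set (Fin n → ℂ)
  isOpen_carrier : IsOpen carrier
  isConnected_carrier : IsConnected carrier
  F : (Fin n → ℂ) → ℂ
  analytic_F : AnalyticOnNhd ℂ F carrier
  η : Matrix (Fin n) (Fin n) ℂ
  η_symm : η.IsSymm
  η_nondeg : IsUnit η.det
  unity : ∀ v ∈ carrier, ∀ α β, pd 0 (pd α (pd β F)) v = η α β
  assoc : ∀ v ∈ carrier, ∀ α β γ δ,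
    ∑ l, ∑ m, pd α (pd β (pd l F)) v * η⁻¹ l m * pd m (pd γ (pd δ F)) v =
      ∑ l, ∑ m, pd γ (pd β (pd l F)) v * η⁻¹ l m * pd m (pd α (pd δ F)) v
  A : Matrix (Fin n) (Fin n) ℂ
  B : Fin n → ℂ
  d : ℂ
  bracket : ∀ α, A α 0 = if α = 0 then 1 else 0
  quasihomogeneous : ∃ (q : Matrix (Fin n) (Fin n) ℂ) (l : Fin n → ℂ) (c : ℂ), ∀ v ∈ carrier,
    ∑ α, (∑ β, A α β * v β + B α) * pd α F v =
      (3 - d) * F v + ∑ α, ∑ β, q α β * v α * v β + ∑ α, l α * v α + c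

namespace FrobeniusManifold

variable {n : ℕ} [NeZero n] (S : FrobeniusManifold n)

/-- The Euler vector field. -/
def E (v : Fin n → ℂ) : Fin n → ℂ := fun α => ∑ β, S.A α β * v β + S.B α

/-- The matrix of multiplication by the tangent vector `a ∈ T_v M`; its `(γ, β)` entry is
`a^α c^γ_{αβ}(v)`, `c^γ_{αβ} = η^{γε} ∂_ε ∂_α ∂_β F`. -/
def mulMatrix (v a : Fin n → ℂ) : Matrix (Fin n) (Fin n) ℂ :=
  fun γ β => ∑ α, ∑ ε, a α * (S.η⁻¹ γ ε * pd ε (pd α (pd β S.F)) v)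

/-- The product of tangent vectors at `v`. -/
def mul (v a b : Fin n → ℂ) : Fin n → ℂ := (S.mulMatrix v a).mulVec b

/-- Multiplication by the Euler vector field. -/
def U (v : Fin n → ℂ) : Matrix (Fin n) (Fin n) ℂ := S.mulMatrix v (S.E v)

/-- The operator `𝒱 = (2 - d)/2 - ∇E`. -/
def V : Matrix (Fin n) (Fin n) ℂ := ((2 - S.d) / 2) • (1 : Matrix (Fin n) (Fin n) ℂ) - S.A

/-- The adjoint with respect to `η`. -/
def adj (X : Matrix (Fin n) (Fin n) ℂ) : Matrix (Fin n) (Fin n) ℂ := S.η⁻¹ * X.transpose * S.η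

/-- The points where multiplication by `E` has simple spectrum. -/
def Mss : Set (Fin n → ℂ) := {v | v ∈ S.carrier ∧ (S.U v).charpoly.roots.Nodup}

/-- `M` is semisimple: `M_ss` is dense in `M`. -/
def IsSemisimple : Prop := S.carrier ⊆ closure S.Mss

/-- `u_1, …, u_n` are the canonical coordinates of `v ∈ M_ss` (the pairwise distinct eigenvalues of
multiplication by `E`) and `π_i = ∂/∂u_i` the basic idempotents of `T_v M`.  In terms of the
orthonormal frame, `π_i^γ = ψ_{i1} ψ_i^γ`. -/
def IsCanonicalFrame (v u : Fin n → ℂ) (π : Fin n → Fin n → ℂ) : Prop :=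
  Function.Injective u ∧ (∀ i, π i ≠ 0) ∧
    (∀ i j, S.mul v (π i) (π j) = if i = j then π i else 0) ∧
    ∀ i, S.mul v (S.E v) (π i) = u i • π i

end FrobeniusManifold

/-! ### Levelt systems of deformed flat coordinates, and the Virasoro operators -/

/-- The matrix `Θ_p(v) = (∇^α θ_{β,p}(v))`. -/
def gradMatrix {n : ℕ} [NeZero n] (S : FrobeniusManifold n) (θ : Fin n → ℕ → (Fin n → ℂ) → ℂ)
    (p : ℕ) (v : Fin n → ℂ) : Matrix (Fin n) (Fin n) ℂ :=
  fun α β => ∑ γ, S.η⁻¹ α γ * pd γ (θ β p) v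

/-- A choice of the Levelt system `(θ_1(v;z), …, θ_n(v;z)) z^μ z^R` of deformed flat coordinates,
`θ_α(v;z) = ∑_p θ_{α,p}(v) z^p`, with `R = R_0 + R_1 + ⋯`, `[μ, R_k] = k R_k`. -/
structure LeveltSystem {n : ℕ} [NeZero n] (S : FrobeniusManifold n) where
  μ : Matrix (Fin n) (Fin n) ℂ
  R : ℕ → Matrix (Fin n) (Fin n) ℂ
  θ : Fin n → ℕ → (Fin n → ℂ) → ℂ
  μ_semisimple : ∃ (P : Matrix (Fin n) (Fin n) ℂ) (D : Fin n → ℂ),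
    IsUnit P.det ∧ μ * P = P * Matrix.diagonal D
  V_eq : S.V = μ + R 0
  nilpotent_R_zero : IsNilpotent (R 0)
  comm_R : ∀ k, μ * R k - R k * μ = (k : ℂ) • R k
  adj_R : ∀ k, S.adj (R k) = (-1 : ℂ) ^ (k + 1) • R k
  analytic_θ : ∀ α p, AnalyticOnNhd ℂ (θ α p) S.carrier
  θ_zero : ∀ v ∈ S.carrier, ∀ α, θ α 0 v = ∑ ε, S.η α ε * v ε
  θ_succ : ∀ v ∈ S.carrier, ∀ α p l m, pd l (pd m (θ α (p + 1))) v =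
    ∑ ν, ∑ ε, S.η⁻¹ ν ε * pd ε (pd l (pd m S.F)) v * pd ν (θ α p) v
  /-- `(p+1) Θ_{p+1} + [Θ_{p+1}, 𝒱] = 𝒰 Θ_p - ∑_{k ≥ 1} Θ_{p+1-k} R_k`. -/
  levelt : ∀ v ∈ S.carrier, ∀ p : ℕ,
    ((p : ℂ) + 1) • gradMatrix S θ (p + 1) v +
        (gradMatrix S θ (p + 1) v * S.V - S.V * gradMatrix S θ (p + 1) v) =
      S.U v * gradMatrix S θ p v -
        ∑ k ∈ Finset.range (p + 1), gradMatrix S θ (p - k) v * R (k + 1)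
  /-- `Θ^*(v;-z) Θ(v;z) = 1`. -/
  orthogonal : ∀ v ∈ S.carrier, ∀ p : ℕ,
    ∑ j ∈ Finset.range (p + 1),
        (-1 : ℂ) ^ j • (S.adj (gradMatrix S θ j v) * gradMatrix S θ (p - j) v) =
      if p = 0 then 1 else 0

/-- The times `t^{α,p}`; only finitely many are nonzero. -/
abbrev Times (n : ℕ) := (Fin n × ℕ) →₀ ℂ

namespace LeveltSystem

variable {n : ℕ} [NeZero n] {S : FrobeniusManifold n} (L : LeveltSystem S)

/-- The functions `Ω_{α,p;β,q}(v)`, i.e. the coefficients of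
`(⟨∇θ_α(v;z), ∇θ_β(v;w)⟩ - η_{αβ}) / (z + w)`. -/
def Ω (i j : Fin n × ℕ) (v : Fin n → ℂ) : ℂ :=
  ∑ s ∈ Finset.range (j.2 + 1), (-1 : ℂ) ^ s *
    ∑ γ, ∑ δ, pd γ (L.θ i.1 (i.2 + 1 + s)) v * S.η⁻¹ γ δ * pd δ (L.θ j.1 (j.2 - s)) v

/-- `[e^{R ∂_ν}]_r f(μ + ν)` at `ν = 0` for the polynomial `f(y) = ∏_{i < M} (y + x + i)`; here
`[R^j]_r` is the sum of the products `R_{k_1} ⋯ R_{k_j}` with `k_1 + ⋯ + k_j = r`. -/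
def expR (M : ℕ) (x : ℂ) (r : ℕ) : Matrix (Fin n) (Fin n) ℂ :=
  ∑ j ∈ Finset.range (M + 1), PowerSeries.coeff r (PowerSeries.mk L.R ^ j) *
    Polynomial.aeval L.μ (Polynomial.hasseDeriv j
      (∏ i ∈ Finset.range M, (Polynomial.X + Polynomial.C (x + (i : ℂ)))))

/-! The coefficients of the Virasoro operators
`L_m = ε² ∑ a_m ∂∂ + ∑ b_m t ∂ + ε⁻² ∑ c_m t t`, `m ≥ -1`, indexed by `M = m + 1 ∈ ℕ`.
By the reflection formula the matrices
`N^p_q(r) = π⁻¹ [e^{R∂_ν}]_r Γ(μ+ν+p+r+1) cos π(μ+ν) Γ(-μ-ν+q+1)` at `ν = 0`, with half-integers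
`p`, `q` such that `p + q + r = m`, are equal to
`(-1)^{q+1/2} [e^{R∂_ν}]_r ∏_{i=0}^{m} (μ + ν - q + i)`, also when `μ` has half-integer
eigenvalues and the Gamma functions have to be regularized. -/

/-- `a_m^{α,p;β,q}`, `m = M - 1`, with `i = (α,p)`, `j = (β,q)`. -/
def a (M : ℕ) (i j : Fin n × ℕ) : ℂ :=
  if i.2 + j.2 + 2 ≤ M then
    1 / 2 * (-1 : ℂ) ^ (j.2 + 1) *
      (L.expR M (-(j.2 : ℂ) - 1 / 2) (M - (i.2 + j.2 + 2)) * S.η⁻¹) i.1 j.1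
  else 0

/-- The coefficient `b_m` of `t^{β,q} ∂/∂t^{α,p}`, `m = M - 1`, with `i = (α,p)`, `j = (β,q)`. -/
def b (M : ℕ) (i j : Fin n × ℕ) : ℂ :=
  if i.2 + 1 ≤ M + j.2 then L.expR M ((j.2 : ℂ) + 1 / 2) (M + j.2 - (i.2 + 1)) i.1 j.1 else 0

/-- The coefficient `c_m` of `t^{α,p} t^{β,q}`, `m = M - 1`, with `i = (α,p)`, `j = (β,q)`. -/
def c (M : ℕ) (i j : Fin n × ℕ) : ℂ :=
  1 / 2 * (-1 : ℂ) ^ i.2 * (S.η * L.expR M ((j.2 : ℂ) + 1 / 2) (M + i.2 + j.2)) i.1 j.1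

end LeveltSystem

/-! ### Functions of the times -/

/-- `∂/∂t^{α,p}` for `i = (α,p)`. -/
def dt {n : ℕ} (i : Fin n × ℕ) (f : Times n → ℂ) : Times n → ℂ :=
  fun t => deriv (fun s : ℂ => f (t + Finsupp.single i s)) 0

/-- The point with coordinates `t^{α,p} = y (α,p)` for `p < N` and `t^{α,p} = 0` for `p ≥ N`. -/
def emb {n : ℕ} (N : ℕ) (y : Fin n × Fin N → ℂ) : Times n :=
  ∑ i, Finsupp.single (i.1, (i.2 : ℕ)) (y i)

/-- `P` holds for small times: near the origin of each space `{t^{α,p} = 0 for p ≥ N}`. -/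
def HoldsNear {n : ℕ} (P : Times n → Prop) : Prop :=
  ∀ N : ℕ, ∀ᶠ y in 𝓝 (0 : Fin n × Fin N → ℂ), P (emb N y)

/-! ### Solutions of the Principal Hierarchy -/

/-- The monotone solutions `v(x, t, c)` of the Principal Hierarchy
`∂v/∂t^{α,p} = ∇θ_{α,p}(v) · v_x`: the analytic solutions of
`∑ (t^{α,p} - c^{α,p}) ∇θ_{α,p}(v) = 0` with finitely many nonzero constants `c^{α,p}`.
The variable `x` enters only through `t^{1,0} ↦ t^{1,0} + x` and is absorbed into `t^{1,0}`. -/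
structure Solution {n : ℕ} [NeZero n] {S : FrobeniusManifold n} (L : LeveltSystem S) where
  c : Times n
  v : Times n → Fin n → ℂ
  analytic : ∀ N : ℕ, AnalyticAt ℂ (fun y : Fin n × Fin N → ℂ => v (emb N y)) 0
  mem : v 0 ∈ S.carrier
  tsarev : HoldsNear fun t => ∀ γ,
    (t - c).sum (fun i x => x * ∑ δ, S.η⁻¹ γ δ * pd δ (L.θ i.1 i.2) (v t)) = 0
  monotone : IsUnit (S.mulMatrix (v 0) fun γ => dt (0, 0) (fun t => v t γ) 0).det

/-- A holomorphic function `G(v; v_x, …, v^{(N)})`, `N = order`, on an open set of the jet space of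
`M`; the argument `y r γ` is the jet coordinate `v^{γ,r}`. -/
structure JetFunction {n : ℕ} [NeZero n] (S : FrobeniusManifold n) where
  order : ℕ
  dom : Set (Fin (order + 1) → Fin n → ℂ)
  isOpen_dom : IsOpen dom
  dom_sub : ∀ y ∈ dom, y 0 ∈ S.carrier
  toFun : (Fin (order + 1) → Fin n → ℂ) → ℂ
  analytic : AnalyticOnNhd ℂ toFun dom

namespace JetFunction

variable {n : ℕ} [NeZero n] {S : FrobeniusManifold n} (G : JetFunction S)

/-- Truncation of an infinite jet. -/
def trunc (j : ℕ → Fin n → ℂ) : Fin (G.order + 1) → Fin n → ℂ := fun r => j r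

/-- `∂G/∂v^{γ,r}`. -/
def partialDeriv (γ : Fin n) (r : ℕ) (j : ℕ → Fin n → ℂ) : ℂ :=
  if h : r < G.order + 1 then
    fderiv ℂ G.toFun (G.trunc j) (Pi.single ⟨r, h⟩ (Pi.single γ 1))
  else 0

end JetFunction

namespace Solution

variable {n : ℕ} [NeZero n] {S : FrobeniusManifold n} {L : LeveltSystem S} (s : Solution L)

/-- The jet `v^{γ,r} = ∂_x^r v^γ` of the solution at `t`; `∂_x = ∂/∂t^{1,0}`. -/
def jet (t : Times n) : ℕ → Fin n → ℂ := fun r γ => (dt (0, 0))^[r] (fun t => s.v t γ) t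

/-- The jet function `G` evaluated on the solution. -/
def eval (G : JetFunction S) : Times n → ℂ := fun t => G.toFun (G.trunc (s.jet t))

/-- `𝓕_0 = (1/2) ∑ t̃^{α,p} t̃^{β,q} Ω_{α,p;β,q}(v)`, `t̃ = t - c`. -/
def F0 : Times n → ℂ := fun t =>
  1 / 2 * (t - s.c).sum fun i x => (t - s.c).sum fun j y => x * y * L.Ω i j (s.v t)

/-- The linearized Virasoro constraint
`2 a_m (∂𝓕_0/∂t^i) (∂G/∂t^j) + b_m t̃^j ∂G/∂t^i`, `m = M - 1`. -/
def linearized (M : ℕ) (G : JetFunction S) : Times n → ℂ := fun t =>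
  (∑ i ∈ (Finset.univ : Finset (Fin n)) ×ˢ Finset.range M,
    ∑ j ∈ (Finset.univ : Finset (Fin n)) ×ˢ Finset.range M,
      2 * L.a M i j * dt i s.F0 t * dt j (s.eval G) t) +
  (t - s.c).sum fun j x =>
    ∑ i ∈ (Finset.univ : Finset (Fin n)) ×ˢ Finset.range (M + j.2),
      L.b M i j * x * dt i (s.eval G) t

/-- The coefficients `𝓕^{[k]}`, `k ≥ 0`, of
`log τ = ε⁻² 𝓕_0 + ∑_{k ≥ 1} ε^{k-2} 𝓕^{[k]}(v; v_x, …)` on the solution. -/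
def logTau (F : ℕ → JetFunction S) (k : ℕ) : Times n → ℂ :=
  if k = 0 then s.F0 else s.eval (F k)

/-- The coefficient of `ε^{k-2}` in `τ⁻¹ L̂_m(ε⁻¹ t', ε ∂/∂t) τ` at the point `t`, where
`L̂_m = L_m + κ δ_{m,0}`, `m = M - 1`. -/
def virasoroCoeff (F : ℕ → JetFunction S) (κ : ℂ) (M k : ℕ) (t' t : Times n) : ℂ :=
  (∑ l ∈ Finset.range (k + 1),
    ∑ i ∈ (Finset.univ : Finset (Fin n)) ×ˢ Finset.range M,
      ∑ j ∈ (Finset.univ : Finset (Fin n)) ×ˢ Finset.range M,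
        L.a M i j * dt i (s.logTau F l) t * dt j (s.logTau F (k - l)) t) +
  (if 2 ≤ k then
    ∑ i ∈ (Finset.univ : Finset (Fin n)) ×ˢ Finset.range M,
      ∑ j ∈ (Finset.univ : Finset (Fin n)) ×ˢ Finset.range M,
        L.a M i j * dt i (dt j (s.logTau F (k - 2))) t
  else 0) +
  (t'.sum fun j x =>
    ∑ i ∈ (Finset.univ : Finset (Fin n)) ×ˢ Finset.range (M + j.2),
      L.b M i j * x * dt i (s.logTau F k) t) +
  (if k = 0 then t'.sum fun i x => t'.sum fun j y => L.c M i j * x * y else 0) +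
  (if M = 1 ∧ k = 2 then κ else 0)

/-- The genus zero Virasoro symmetry
`∂f/∂s_m = a_m f_i f_j + b_m t^j f_i + c_m t^i t^j`, `f = 𝓕_0`, `m = M - 1`. -/
def symF0 (M : ℕ) : Times n → ℂ := fun t =>
  (∑ i ∈ (Finset.univ : Finset (Fin n)) ×ˢ Finset.range M,
    ∑ j ∈ (Finset.univ : Finset (Fin n)) ×ˢ Finset.range M,
      L.a M i j * dt i s.F0 t * dt j s.F0 t) +
  (t.sum fun j x =>
    ∑ i ∈ (Finset.univ : Finset (Fin n)) ×ˢ Finset.range (M + j.2),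
      L.b M i j * x * dt i s.F0 t) +
  t.sum fun i x => t.sum fun j y => L.c M i j * x * y

/-- `∂v^γ/∂s_m = η^{γα} ∂_x ∂_{t^{α,0}} ∂f/∂s_m`. -/
def symV (M : ℕ) (γ : Fin n) : Times n → ℂ := fun t =>
  ∑ α, S.η⁻¹ γ α * dt (0, 0) (dt (α, 0) (s.symF0 M)) t

/-- The flow `∂/∂ŝ_m` on the coefficient of `ε^{k-2}` in `log τ`:
`∂f/∂s_m` for `k = 0` and `∑ (∂𝓕^{[k]}/∂v^{γ,r}) ∂_x^r ∂v^γ/∂s_m` for `k ≥ 1`. -/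
def symLogTau (F : ℕ → JetFunction S) (M k : ℕ) : Times n → ℂ := fun t =>
  if k = 0 then s.symF0 M t
  else ∑ r ∈ Finset.range ((F k).order + 1), ∑ γ,
    (F k).partialDeriv γ r (s.jet t) * (dt (0, 0))^[r] (s.symV M γ) t

/-- The quasi-Miura transform `w_α = v_α + ∂_x ∂_{t^{α,0}} ∑_{k ≥ 1} ε^k 𝓕^{[k]}` of the solution,
at `t = 0`, as a power series in `ε`. -/
def quasiMiura (F : ℕ → JetFunction S) (α : Fin n) : PowerSeries ℂ :=
  PowerSeries.mk fun k =>
    if k = 0 then ∑ β, S.η α β * s.v 0 β else dt (0, 0) (dt (α, 0) (s.eval (F k))) 0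

end Solution

section

variable {n : ℕ} [NeZero n] {S : FrobeniusManifold n}

/-- The jet `j` lies in the domains of `𝓕^{[1]}, …, 𝓕^{[k]}`. -/
def InDom (F : ℕ → JetFunction S) (k : ℕ) (j : ℕ → Fin n → ℂ) : Prop :=
  ∀ l, 1 ≤ l → l ≤ k → (F l).trunc j ∈ (F l).dom

/-- The system of Virasoro constraints `L̂_m(ε⁻¹ t̃, ε ∂/∂t) τ = 0`, `m ≥ -1`, for the
tau-functions `τ = exp(ε⁻² 𝓕_0 + ∑_{k ≥ 1} ε^{k-2} 𝓕^{[k]})` of all the solutions, order by order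
in `ε`; the constraint of order `ε^{k-2}` involves only `𝓕_0, 𝓕^{[1]}, …, 𝓕^{[k]}` and is imposed
on all the solutions on which these are defined.  (`F 0` is not used.) -/
def VirasoroConstraints (L : LeveltSystem S) (F : ℕ → JetFunction S) (κ : ℂ) : Prop :=
  ∀ s : Solution L, ∀ k, InDom F k (s.jet 0) →
    ∀ M : ℕ, HoldsNear fun t => s.virasoroCoeff F κ M k (t - s.c) t = 0

/-- The quasitriviality transformation given by the `𝓕^{[k]}` linearizes the Virasoro symmetries:
`∂τ/∂ŝ_m = L̂_m(ε⁻¹ t, ε ∂/∂t) τ`, `m ≥ -1`, with `L̂_m = L_m + κ δ_{m,0}`. -/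
def LinearizesVirasoro (L : LeveltSystem S) (F : ℕ → JetFunction S) (κ : ℂ) : Prop :=
  ∀ s : Solution L, ∀ k, InDom F k (s.jet 0) →
    ∀ M : ℕ, HoldsNear fun t => s.virasoroCoeff F κ M k t t = s.symLogTau F M k t

/-- `N! + 2^{-N} ∑_{k=1}^N (N choose k) (2k-3)!! (2N-2k+1)!!`, with `(-1)!! = 1`. -/
def poleConst (N : ℕ) : ℂ :=
  (N.factorial : ℂ) + ((2 : ℂ) ^ N)⁻¹ * ∑ k ∈ Finset.Icc 1 N,
    (N.choose k : ℂ) * ((2 * k - 3).doubleFactorial : ℂ) *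
      ((2 * N - 2 * k + 1).doubleFactorial : ℂ)

end

end Dubrovin

end

open scoped BigOperators Topology

noncomputable section

set_option linter.unusedSectionVars false

namespace Dubrovin

/-! ### Calculus in flat coordinates and the algebra of a Frobenius manifold -/

section

/-! ### Directional derivatives of analytic functions -/

section Calculus

variable {E F : Type*} [NormedAddCommGroup E] [NormedSpace ℂ E] [NormedAddCommGroup F]
  [NormedSpace ℂ F] [CompleteSpace F]

/-! The proof rests on one change of coordinates and one operator. On a solution put y_q = ∑
t̃^{α,p} ∇θ_{α,p-q}(v). The equation of the solution is y_0 = 0; differentiating it gives v_x =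
-y_1⁻¹ and the Principal Hierarchy, and ∂y_q/∂t^{α,p} = ∇θ_{α,p-q} + (∂v/∂t^{α,p}) · y_{q+1}. Hence
v, y_1, …, y_N serve as coordinates on the jets of order N with v_x invertible: the derivative of
v^{(r)} along y_r is multiplication by v_x^{r+1} (`fderiv_Phi_top`), and every point of the chart is
taken by a solution (`exists_solution_Ych`, by the implicit function theorem).

The coefficients a_m, b_m, c_m are the blocks of the quadratic form -(1/2)⟨f, J^{m+1} f⟩ on vector
Laurent series, where J = z⁻¹(μ + R(z) - 1/2 - z d/dz) is self-adjoint for a residue pairing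
(`a_eq`, `b_eq`, `c_eq`). Negative powers of z carry the times, nonnegative ones the first
derivatives of 𝓕_0. The gauge transformation Θ(v;z) is an isometry and turns J into 𝒰 + z⁻¹(𝒱 - 1/2
- z d/dz), while the series of times and derivatives of 𝓕_0 becomes ∑_{q≥1} y_q z^{-q-1}. Counting
degrees gives the constraints of genus zero (`genus_zero`). It also turns the linearized constraints
into explicit vector fields on the chart: a polynomial p in place of X^{m+1} yields the coefficients
of p(𝒰 + z⁻¹(𝒱 - 1/2 - z d/dz)) ∑ y_q z^{-q-1} (`linearized_zero`).

Let χ be the characteristic polynomial of 𝒰. By Cayley-Hamilton, χ of the operator lowers the degree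
in z; since 𝒱 is antisymmetric, the leading part is a scalar times χ'(𝒰), and r iterations produce
the scalar (3/2)(5/2)⋯(r+1/2) (`cf_charpoly_pow`). So the constraint at χ^r p has no components
along v, y_1, …, y_{r-1}, and its components along y_r span everything as p varies. By this
triangularity a covector killed by all the constraints vanishes (`constraint_nondegenerate`). The
poles come from the same fact: p ↦ dG(constraint at p) kills the multiples of χ^{N+1}, hence is a
combination of Taylor coefficients of order at most N at the u_i. The stated constant is the scalar
above by a Vandermonde identity (`poleConst_eq`).

Uniqueness is an induction on the order in ε, carried out on the dense set of jets with v ∈ M_ss and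
with E and v_x invertible, where κ_0 is determined too. Odd orders vanish by uniqueness applied to ε
↦ -ε. If the Virasoro symmetries are linearized, the genus zero constraint in the shifted times
shows that they act on v by the linear flow ∑ b c ∂/∂t, which is exactly the difference between the
operators in t and in t̃ (`virasoroConstraints_of_linearizes`).

For the order 3g - 2, give y_q the weight q - 1, so that v and y_1 count for nothing. Testing the
constraint on χ^r X^m lowers all weights by r, and a downward induction on q (`filt_of_constraint`)
shows that ∂𝓕_g/∂y_q has weight 3g - 2 - q, hence vanishes for q > 3g - 2. In genus one the
inhomogeneous term is handled separately: it is killed by high powers of χ, and differentiation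
along the unity lowers the power down to χ² (`polyT_genusOne_descend`). -/

theorem analyticAt_fderiv_apply {f : E → F} {x : E} (hf : AnalyticAt ℂ f x) (w : E) :
    AnalyticAt ℂ (fun y => fderiv ℂ f y w) x :=
  ((ContinuousLinearMap.apply ℂ F w).analyticAt _).comp hf.fderiv

theorem fderiv_fderiv_comm {f : E → F} {x : E} (hf : AnalyticAt ℂ f x) (a b : E) :
    fderiv ℂ (fun y => fderiv ℂ f y a) x b = fderiv ℂ (fun y => fderiv ℂ f y b) x a := by
  have hs : IsSymmSndFDerivAt ℂ f x :=
    (hf.contDiffAt (n := 2)).isSymmSndFDerivAt (by simp)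
  have hd : DifferentiableAt ℂ (fderiv ℂ f) x := hf.fderiv.differentiableAt
  have key : ∀ w u : E, fderiv ℂ (fun y => fderiv ℂ f y w) x u = fderiv ℂ (fderiv ℂ f) x u w := by
    intro w u
    rw [fderiv_clm_apply hd (differentiableAt_const w)]
    simp
  rw [key, key]
  exact hs.eq b a

theorem fderiv_eq_of_eqOn {f g : E → F} {s : Set E} (hs : IsOpen s) (h : Set.EqOn f g s)
    {x : E} (hx : x ∈ s) : fderiv ℂ f x = fderiv ℂ g x :=
  Filter.EventuallyEq.fderiv_eq (Filter.eventuallyEq_of_mem (hs.mem_nhds hx) h)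

end Calculus

section Pd

variable {n : ℕ}

theorem analyticAt_pd {f : (Fin n → ℂ) → ℂ} {v : Fin n → ℂ} (hf : AnalyticAt ℂ f v) (α : Fin n) :
    AnalyticAt ℂ (pd α f) v := analyticAt_fderiv_apply hf _

theorem pd_comm {f : (Fin n → ℂ) → ℂ} {v : Fin n → ℂ} (hf : AnalyticAt ℂ f v) (α β : Fin n) :
    pd α (pd β f) v = pd β (pd α f) v := fderiv_fderiv_comm hf _ _

theorem pd_congr {f g : (Fin n → ℂ) → ℂ} {s : Set (Fin n → ℂ)} (hs : IsOpen s)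
    (h : ∀ v ∈ s, f v = g v) {v : Fin n → ℂ} (hv : v ∈ s) (α : Fin n) : pd α f v = pd α g v := by
  simp only [pd, fderiv_eq_of_eqOn hs h hv]

theorem fderiv_eq_sum_pd (f : (Fin n → ℂ) → ℂ) (v w : Fin n → ℂ) :
    fderiv ℂ f v w = ∑ α, w α * pd α f v := by
  conv_lhs => rw [← LinearMap.sum_single_apply (fun _ : Fin n => ℂ) w]
  rw [map_sum]
  refine Finset.sum_congr rfl fun α _ => ?_
  have : (Pi.single α (w α) : Fin n → ℂ) = w α • Pi.single α 1 := by
    rw [← Pi.single_smul]; simp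
  rw [this, map_smul]; rfl

theorem pd_const (c : ℂ) (α : Fin n) (v : Fin n → ℂ) : pd α (fun _ => c) v = 0 := by
  simp [pd]

theorem pd_add {f g : (Fin n → ℂ) → ℂ} {v : Fin n → ℂ} (hf : AnalyticAt ℂ f v)
    (hg : AnalyticAt ℂ g v) (α : Fin n) : pd α (fun v => f v + g v) v = pd α f v + pd α g v := by
  simp only [pd]
  rw [fderiv_fun_add hf.differentiableAt hg.differentiableAt]; rfl

theorem pd_mul {f g : (Fin n → ℂ) → ℂ} {v : Fin n → ℂ} (hf : AnalyticAt ℂ f v)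
    (hg : AnalyticAt ℂ g v) (α : Fin n) :
    pd α (fun v => f v * g v) v = pd α f v * g v + f v * pd α g v := by
  simp only [pd]
  rw [fderiv_fun_mul hf.differentiableAt hg.differentiableAt]
  simp; ring

theorem pd_const_mul {g : (Fin n → ℂ) → ℂ} {v : Fin n → ℂ} (c : ℂ)
    (hg : AnalyticAt ℂ g v) (α : Fin n) :
    pd α (fun v => c * g v) v = c * pd α g v := by
  rw [pd_mul analyticAt_const hg, pd_const]; ring

theorem pd_sum {ι : Type*} (s : Finset ι) {f : ι → (Fin n → ℂ) → ℂ} {v : Fin n → ℂ}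
    (hf : ∀ i ∈ s, AnalyticAt ℂ (f i) v) (α : Fin n) :
    pd α (fun v => ∑ i ∈ s, f i v) v = ∑ i ∈ s, pd α (f i) v := by
  simp only [pd]
  rw [fderiv_fun_sum fun i hi => (hf i hi).differentiableAt]
  simp

theorem analyticAt_coord (β : Fin n) (v : Fin n → ℂ) : AnalyticAt ℂ (fun v : Fin n → ℂ => v β) v :=
  (ContinuousLinearMap.proj (R := ℂ) (φ := fun _ : Fin n => ℂ) β).analyticAt v

theorem pd_coord (α β : Fin n) (v : Fin n → ℂ) :
    pd α (fun v : Fin n → ℂ => v β) v = if β = α then 1 else 0 := by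
  simp only [pd]
  rw [show (fun v : Fin n → ℂ => v β) =
    (ContinuousLinearMap.proj (R := ℂ) (φ := fun _ : Fin n => ℂ) β) from rfl,
    ContinuousLinearMap.fderiv]
  simp [Pi.single_apply]

theorem pd_affine (a : Fin n → ℂ) (b : ℂ) (α : Fin n) (v : Fin n → ℂ) :
    pd α (fun v => ∑ β, a β * v β + b) v = a α := by
  have h : ∀ β ∈ Finset.univ, AnalyticAt ℂ (fun v : Fin n → ℂ => a β * v β) v :=
    fun β _ => analyticAt_const.fun_mul (analyticAt_coord β v)
  rw [pd_add (Finset.analyticAt_fun_sum _ h) analyticAt_const, pd_const, pd_sum _ h]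
  rw [Finset.sum_congr rfl fun β _ => pd_const_mul (a β) (analyticAt_coord β v) α]
  simp [pd_coord]

end Pd

namespace FrobeniusManifold

variable {n : ℕ} [NeZero n] (S : FrobeniusManifold n)

/-- The matrix of third derivatives of the potential in a coordinate direction. -/
def third (v : Fin n → ℂ) (α : Fin n) : Matrix (Fin n) (Fin n) ℂ :=
  fun β γ => pd α (pd β (pd γ S.F)) v

variable {S} {v : Fin n → ℂ}

theorem analyticAt_third (hv : v ∈ S.carrier) (α β γ : Fin n) :
    AnalyticAt ℂ (fun v => S.third v α β γ) v :=
  analyticAt_pd (analyticAt_pd (analyticAt_pd (S.analytic_F v hv) γ) β) α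

theorem third_swap_left (hv : v ∈ S.carrier) (α β γ : Fin n) :
    S.third v α β γ = S.third v β α γ :=
  pd_comm (analyticAt_pd (S.analytic_F v hv) γ) α β

theorem third_swap_right (hv : v ∈ S.carrier) (α β γ : Fin n) :
    S.third v α β γ = S.third v α γ β :=
  pd_congr S.isOpen_carrier (fun w hw => pd_comm (S.analytic_F w hw) β γ) hv α

theorem η_mul_inv : S.η * S.η⁻¹ = 1 := Matrix.mul_nonsing_inv _ S.η_nondeg

theorem η_inv_mul : S.η⁻¹ * S.η = 1 := Matrix.nonsing_inv_mul _ S.η_nondeg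

theorem η_transpose : S.η.transpose = S.η := S.η_symm

theorem η_inv_transpose : S.η⁻¹.transpose = S.η⁻¹ := by
  rw [Matrix.transpose_nonsing_inv, η_transpose]

theorem third_transpose (hv : v ∈ S.carrier) (α : Fin n) :
    (S.third v α).transpose = S.third v α := by
  ext β γ; exact third_swap_right hv α γ β

theorem third_zero (hv : v ∈ S.carrier) : S.third v 0 = S.η := by
  ext α β; exact S.unity v hv α β

theorem mulMatrix_eq (hv : v ∈ S.carrier) (a : Fin n → ℂ) :
    S.mulMatrix v a = ∑ α, a α • (S.η⁻¹ * S.third v α) := by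
  ext γ β
  simp only [mulMatrix, Matrix.sum_apply, Matrix.smul_apply, Matrix.mul_apply, smul_eq_mul,
    Finset.mul_sum]
  refine Finset.sum_congr rfl fun α _ => Finset.sum_congr rfl fun ε _ => ?_
  rw [show pd ε (pd α (pd β S.F)) v = S.third v α ε β from third_swap_left hv ε α β]

theorem mulMatrix_add (v a b : Fin n → ℂ) :
    S.mulMatrix v (a + b) = S.mulMatrix v a + S.mulMatrix v b := by
  ext γ β
  simp [mulMatrix, add_mul, Finset.sum_add_distrib]

theorem mulMatrix_smul (v a : Fin n → ℂ) (c : ℂ) :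
    S.mulMatrix v (c • a) = c • S.mulMatrix v a := by
  ext γ β
  simp [mulMatrix, Finset.mul_sum, mul_assoc]

theorem mulMatrix_zero (v : Fin n → ℂ) : S.mulMatrix v 0 = 0 := by
  ext γ β; simp [mulMatrix]

theorem mulMatrix_neg (v a : Fin n → ℂ) : S.mulMatrix v (-a) = -S.mulMatrix v a := by
  rw [← neg_one_smul ℂ, mulMatrix_smul, neg_one_smul]

theorem mulMatrix_sum {ι : Type*} (s : Finset ι) (v : Fin n → ℂ) (a : ι → Fin n → ℂ) :
    S.mulMatrix v (∑ i ∈ s, a i) = ∑ i ∈ s, S.mulMatrix v (a i) := by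
  classical
  induction s using Finset.induction_on with
  | empty => simp [mulMatrix_zero]
  | insert i s hi ih => rw [Finset.sum_insert hi, Finset.sum_insert hi, mulMatrix_add, ih]

theorem mulMatrix_mulVec_comm (hv : v ∈ S.carrier) (a b : Fin n → ℂ) :
    (S.mulMatrix v a).mulVec b = (S.mulMatrix v b).mulVec a := by
  ext γ
  simp only [Matrix.mulVec, dotProduct, mulMatrix, Finset.sum_mul]
  rw [Finset.sum_comm]
  refine Finset.sum_congr rfl fun α _ => Finset.sum_congr rfl fun β _ =>
    Finset.sum_congr rfl fun ε _ => ?_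
  rw [show pd ε (pd α (pd β S.F)) v = pd ε (pd β (pd α S.F)) v from third_swap_right hv ε α β]
  ring

/-- In this matrix form the associativity equations say that the multiplication operators commute.
Associativity of the product of vectors then follows from its commutativity, in
`mulMatrix_mulMatrix`. -/
theorem third_assoc (hv : v ∈ S.carrier) (α γ : Fin n) :
    S.third v α * S.η⁻¹ * S.third v γ = S.third v γ * S.η⁻¹ * S.third v α := by
  ext β δ
  have h := S.assoc v hv α β γ δ
  simp only [Matrix.mul_apply, Finset.sum_mul]
  rw [Finset.sum_comm, Finset.sum_comm (s := Finset.univ) (t := Finset.univ)]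
  rw [Finset.sum_comm, Finset.sum_comm (s := Finset.univ) (t := Finset.univ)] at h
  have e1 : ∀ α β l, pd α (pd β (pd l S.F)) v = S.third v α β l := fun _ _ _ => rfl
  simp only [e1] at h
  rw [Finset.sum_comm, Finset.sum_comm (s := Finset.univ) (t := Finset.univ)]
  rw [Finset.sum_comm, Finset.sum_comm (s := Finset.univ) (t := Finset.univ)] at h
  rw [Finset.sum_comm] at h
  refine Eq.trans ?_ (h.trans ?_)
  · exact Finset.sum_congr rfl fun l _ => Finset.sum_congr rfl fun m _ => by
      rw [third_swap_left hv γ l δ]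
  · rw [Finset.sum_comm]
    exact Finset.sum_congr rfl fun l _ => Finset.sum_congr rfl fun m _ => by
      rw [third_swap_left hv α _ δ]

theorem mulMatrix_comm (hv : v ∈ S.carrier) (a b : Fin n → ℂ) :
    S.mulMatrix v a * S.mulMatrix v b = S.mulMatrix v b * S.mulMatrix v a := by
  rw [mulMatrix_eq hv a, mulMatrix_eq hv b, Finset.sum_mul_sum, Finset.sum_mul_sum,
    Finset.sum_comm]
  refine Finset.sum_congr rfl fun β _ => Finset.sum_congr rfl fun α _ => ?_
  rw [smul_mul_smul_comm, smul_mul_smul_comm, mul_comm (a α)]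
  congr 1
  have := third_assoc hv α β
  simp only [Matrix.mul_assoc] at this ⊢
  rw [this]

theorem mulMatrix_mulMatrix (hv : v ∈ S.carrier) (a b : Fin n → ℂ) :
    S.mulMatrix v ((S.mulMatrix v a).mulVec b) = S.mulMatrix v a * S.mulMatrix v b := by
  refine Matrix.ext_of_mulVec_single fun i => ?_
  rw [mulMatrix_mulVec_comm hv, Matrix.mulVec_mulVec, mulMatrix_comm hv, ← Matrix.mulVec_mulVec,
    mulMatrix_mulVec_comm hv _ b, Matrix.mulVec_mulVec]

variable (n) in
/-- The unity vector `e = ∂/∂v^1`. -/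
def unit : Fin n → ℂ := Pi.single 0 1

theorem mulMatrix_unit (hv : v ∈ S.carrier) : S.mulMatrix v (unit n) = 1 := by
  rw [mulMatrix_eq hv, Finset.sum_eq_single 0]
  · simp [unit, third_zero hv, η_inv_mul]
  · intro b _ hb; simp [unit, hb]
  · simp

theorem mulMatrix_mulVec_unit (hv : v ∈ S.carrier) (a : Fin n → ℂ) :
    (S.mulMatrix v a).mulVec (unit n) = a := by
  rw [mulMatrix_mulVec_comm hv, mulMatrix_unit hv, Matrix.one_mulVec]

theorem η_mul_mulMatrix (hv : v ∈ S.carrier) (a : Fin n → ℂ) :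
    S.η * S.mulMatrix v a = (S.mulMatrix v a).transpose * S.η := by
  rw [mulMatrix_eq hv, Matrix.transpose_sum, Finset.mul_sum, Finset.sum_mul]
  refine Finset.sum_congr rfl fun α _ => ?_
  rw [Matrix.transpose_smul, Matrix.transpose_mul, third_transpose hv, η_inv_transpose,
    Matrix.smul_mul, Matrix.mul_smul, ← Matrix.mul_assoc, η_mul_inv, Matrix.mul_assoc, η_inv_mul]
  simp

theorem adj_mulMatrix (hv : v ∈ S.carrier) (a : Fin n → ℂ) :
    S.adj (S.mulMatrix v a) = S.mulMatrix v a := by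
  rw [adj, Matrix.mul_assoc, ← η_mul_mulMatrix hv, ← Matrix.mul_assoc, η_inv_mul, Matrix.one_mul]

theorem adj_mul (X Y : Matrix (Fin n) (Fin n) ℂ) : S.adj (X * Y) = S.adj Y * S.adj X := by
  simp only [adj, Matrix.transpose_mul]
  calc _ = S.η⁻¹ * Y.transpose * 1 * X.transpose * S.η := by
        simp [Matrix.mul_assoc]
    _ = _ := by rw [← η_mul_inv (S := S)]; simp only [Matrix.mul_assoc]

theorem η_mul_adj (X : Matrix (Fin n) (Fin n) ℂ) : S.η * S.adj X = X.transpose * S.η := by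
  rw [adj, ← Matrix.mul_assoc, ← Matrix.mul_assoc, η_mul_inv, Matrix.one_mul]

theorem analyticAt_mulMatrix (hv : v ∈ S.carrier) (a : Fin n → ℂ) (γ β : Fin n) :
    AnalyticAt ℂ (fun v => S.mulMatrix v a γ β) v := by
  unfold mulMatrix
  refine Finset.analyticAt_fun_sum _ fun α _ => Finset.analyticAt_fun_sum _ fun ε _ => ?_
  exact analyticAt_const.fun_mul (analyticAt_const.fun_mul (analyticAt_third hv _ _ _))

theorem analyticAt_E (v : Fin n → ℂ) (α : Fin n) : AnalyticAt ℂ (fun v => S.E v α) v :=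
  (Finset.analyticAt_fun_sum _ fun β _ =>
    analyticAt_const.fun_mul (analyticAt_coord β v)).fun_add analyticAt_const

theorem pd_E (α β : Fin n) (v : Fin n → ℂ) : pd β (fun v => S.E v α) v = S.A α β :=
  pd_affine (fun β => S.A α β) (S.B α) β v

theorem analyticAt_U (hv : v ∈ S.carrier) (γ β : Fin n) :
    AnalyticAt ℂ (fun v => S.U v γ β) v := by
  unfold U mulMatrix
  refine Finset.analyticAt_fun_sum _ fun α _ => Finset.analyticAt_fun_sum _ fun ε _ => ?_
  exact (analyticAt_E (S := S) v α).fun_mul (analyticAt_const.fun_mul (analyticAt_third hv _ _ _))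

/-- The fourth derivatives commute, and a third derivative taken in the direction of the unity is
the constant `η`. -/
theorem pd_zero_third (hv : v ∈ S.carrier) (α β γ : Fin n) :
    pd 0 (fun v => S.third v α β γ) v = 0 := by
  have h1 : ∀ w ∈ S.carrier, pd 0 (fun v => S.third v α β γ) w =
      pd α (fun v => S.third v 0 β γ) w := fun w hw =>
    pd_comm (analyticAt_pd (analyticAt_pd (S.analytic_F w hw) γ) β) 0 α
  rw [h1 v hv, pd_congr S.isOpen_carrier (g := fun _ => S.η β γ) _ hv, pd_const]
  intro w hw; rw [third_zero hw]

/-- Differentiate the quasihomogeneity of `F` along `γ`, `β` and the unity: the quadratic correction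
disappears and third derivatives containing the unity become `η`. The condition `[e, E] = e`
contributes one more copy of `η`, which turns `3 - d` into `2 - d`. This is the source of the
antisymmetry of `𝒱`. -/
theorem A_adj : S.A.transpose * S.η + S.η * S.A = (2 - S.d) • S.η := by
  obtain ⟨v, hv⟩ := S.isConnected_carrier.nonempty
  obtain ⟨q, l, c, hq⟩ := S.quasihomogeneous
  have aF : ∀ w ∈ S.carrier, ∀ α, AnalyticAt ℂ (pd α S.F) w :=
    fun w hw α => analyticAt_pd (S.analytic_F w hw) α
  have aFF : ∀ w ∈ S.carrier, ∀ α β, AnalyticAt ℂ (pd β (pd α S.F)) w :=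
    fun w hw α β => analyticAt_pd (aF w hw α) β
  ext β γ
  have h1 : ∀ w ∈ S.carrier, ∑ α, (S.A α γ * pd α S.F w + S.E w α * pd γ (pd α S.F) w) =
      (3 - S.d) * pd γ S.F w + (∑ δ, (q γ δ + q δ γ) * w δ + l γ) := by
    intro w hw
    have e := pd_congr S.isOpen_carrier hq hw γ
    have l1 : pd γ (fun v => ∑ α, S.E v α * pd α S.F v) w =
        ∑ α, (S.A α γ * pd α S.F w + S.E w α * pd γ (pd α S.F) w) := by
      rw [pd_sum _ fun α _ => (analyticAt_E (S := S) w α).fun_mul (aF w hw α)]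
      refine Finset.sum_congr rfl fun α _ => ?_
      rw [pd_mul (analyticAt_E (S := S) w α) (aF w hw α), pd_E]
    have aq : ∀ α ∈ Finset.univ, AnalyticAt ℂ (fun v : Fin n → ℂ => ∑ β, q α β * v α * v β) w :=
      fun α _ => Finset.analyticAt_fun_sum _ fun β _ =>
        (analyticAt_const.fun_mul (analyticAt_coord α w)).fun_mul (analyticAt_coord β w)
    have al : AnalyticAt ℂ (fun v : Fin n → ℂ => ∑ α, l α * v α + c) w :=
      (Finset.analyticAt_fun_sum _ fun β _ =>
        analyticAt_const.fun_mul (analyticAt_coord β w)).fun_add analyticAt_const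
    have l2 : pd γ (fun v => (3 - S.d) * S.F v + ∑ α, ∑ β, q α β * v α * v β + ∑ α, l α * v α + c)
        w = (3 - S.d) * pd γ S.F w + (∑ δ, (q γ δ + q δ γ) * w δ + l γ) := by
      simp only [add_assoc]
      rw [pd_add (analyticAt_const.fun_mul (S.analytic_F w hw)) ((Finset.analyticAt_fun_sum _ aq).fun_add al),
        pd_const_mul _ (S.analytic_F w hw), pd_add (Finset.analyticAt_fun_sum _ aq) al, pd_affine,
        pd_sum _ aq]
      congr 2
      have : ∀ α, pd γ (fun v : Fin n → ℂ => ∑ β, q α β * v α * v β) w =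
          ∑ β, ((if α = γ then q α β * w β else 0) + (if β = γ then q α β * w α else 0)) := by
        intro α
        rw [pd_sum _ fun β _ =>
          (analyticAt_const.fun_mul (analyticAt_coord α w)).fun_mul (analyticAt_coord β w)]
        refine Finset.sum_congr rfl fun β _ => ?_
        rw [pd_mul (analyticAt_const.fun_mul (analyticAt_coord α w)) (analyticAt_coord β w),
          pd_const_mul _ (analyticAt_coord α w), pd_coord, pd_coord]
        split_ifs <;> ring
      simp only [this, Finset.sum_add_distrib, add_mul]
      congr 1
      · rw [Finset.sum_comm]; simp
      · simp
    rw [← l1]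
    exact e.trans l2
  have h2 : ∀ w ∈ S.carrier, ∑ α, (S.A α γ * pd β (pd α S.F) w + (S.A α β * pd γ (pd α S.F) w +
      S.E w α * S.third w β γ α)) = (3 - S.d) * pd β (pd γ S.F) w + (q γ β + q β γ) := by
    intro w hw
    have e := pd_congr S.isOpen_carrier h1 hw β
    rw [pd_sum _ fun α _ => (analyticAt_const.fun_mul (aF w hw α)).fun_add
      ((analyticAt_E (S := S) w α).fun_mul (aFF w hw α γ)), pd_add (analyticAt_const.fun_mul (aF w hw γ))
      ((Finset.analyticAt_fun_sum _ fun β _ =>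
        analyticAt_const.fun_mul (analyticAt_coord β w)).fun_add analyticAt_const),
      pd_const_mul _ (aF w hw γ), pd_affine] at e
    rw [← e]
    refine Finset.sum_congr rfl fun α _ => ?_
    rw [pd_add (analyticAt_const.fun_mul (aF w hw α)) ((analyticAt_E (S := S) w α).fun_mul (aFF w hw α γ)),
      pd_const_mul _ (aF w hw α), pd_mul (analyticAt_E (S := S) w α) (aFF w hw α γ), pd_E]
    rfl
  have e := pd_congr S.isOpen_carrier h2 hv 0
  rw [pd_sum _ fun α _ => (analyticAt_const.fun_mul (aFF v hv α β)).fun_add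
      ((analyticAt_const.fun_mul (aFF v hv α γ)).fun_add ((analyticAt_E (S := S) v α).fun_mul (analyticAt_third hv β γ α))),
    pd_add (analyticAt_const.fun_mul (aFF v hv γ β)) analyticAt_const,
    pd_const_mul _ (aFF v hv γ β), pd_const, S.unity v hv] at e
  have e2 : ∀ α ∈ Finset.univ, pd 0 (fun v => S.A α γ * pd β (pd α S.F) v +
      (S.A α β * pd γ (pd α S.F) v + S.E v α * S.third v β γ α)) v =
      S.A α γ * S.η β α + S.A α β * S.η γ α + (if α = 0 then S.η γ β else 0) := by
    intro α _
    rw [pd_add (analyticAt_const.fun_mul (aFF v hv α β))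
      ((analyticAt_const.fun_mul (aFF v hv α γ)).fun_add ((analyticAt_E (S := S) v α).fun_mul (analyticAt_third hv β γ α))),
      pd_add (analyticAt_const.fun_mul (aFF v hv α γ)) ((analyticAt_E (S := S) v α).fun_mul (analyticAt_third hv β γ α)),
      pd_const_mul _ (aFF v hv α β), pd_const_mul _ (aFF v hv α γ),
      pd_mul (analyticAt_E (S := S) v α) (analyticAt_third hv β γ α), pd_zero_third hv, pd_E, S.bracket,
      S.unity v hv, S.unity v hv]
    split_ifs with h
    · subst h
      rw [third_swap_right hv β γ 0, third_swap_left hv β 0 γ, third_zero hv,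
        S.η_symm.apply γ β]; ring
    · ring
  rw [Finset.sum_congr rfl e2, Finset.sum_add_distrib, Finset.sum_add_distrib] at e
  simp only [Matrix.add_apply, Matrix.mul_apply, Matrix.transpose_apply, Matrix.smul_apply,
    smul_eq_mul]
  simp only [Finset.sum_ite_eq', Finset.mem_univ, if_true] at e
  have s1 : ∑ α, S.A α γ * S.η β α = ∑ α, S.η β α * S.A α γ :=
    Finset.sum_congr rfl fun _ _ => mul_comm _ _
  have s2 : ∑ α, S.A α β * S.η γ α = ∑ α, S.A α β * S.η α γ :=
    Finset.sum_congr rfl fun α _ => by rw [S.η_symm.apply α γ]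
  rw [s1, s2, S.η_symm.apply β γ] at e
  linear_combination e

theorem V_transpose_η : S.V.transpose * S.η = -(S.η * S.V) := by
  have h := A_adj (S := S)
  simp only [V, Matrix.transpose_sub, Matrix.transpose_smul, Matrix.transpose_one, Matrix.sub_mul,
    Matrix.mul_sub, Matrix.smul_mul, Matrix.mul_smul, Matrix.one_mul, Matrix.mul_one]
  have : S.A.transpose * S.η = (2 - S.d) • S.η - S.η * S.A := eq_sub_of_add_eq h
  rw [this]
  ext i j
  simp; ring

theorem adj_V : S.adj S.V = -S.V := by
  rw [adj, Matrix.mul_assoc, V_transpose_η, Matrix.mul_neg, ← Matrix.mul_assoc, η_inv_mul,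
    Matrix.one_mul]

end FrobeniusManifold

end

/-! ### The spectrum of `𝒰`, idempotents, and gradients of the deformed flat coordinates -/

section

namespace FrobeniusManifold

variable {n : ℕ} [NeZero n] {S : FrobeniusManifold n} {v : Fin n → ℂ}

/-! ### Shifts along the unity -/

/-- The structure constants do not depend on `v^1`, so only `E` is differentiated, and by `[e, E] =
e` its derivative is the unity. -/
theorem pd_zero_U (hv : v ∈ S.carrier) (γ β : Fin n) :
    pd 0 (fun v => S.U v γ β) v = (1 : Matrix (Fin n) (Fin n) ℂ) γ β := by
  have a1 : ∀ α ε, AnalyticAt ℂ (fun v => S.E v α * (S.η⁻¹ γ ε * S.third v ε α β)) v :=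
    fun α ε => (analyticAt_E v α).fun_mul (analyticAt_const.fun_mul (analyticAt_third hv ε α β))
  change pd 0 (fun v => ∑ α, ∑ ε, S.E v α * (S.η⁻¹ γ ε * S.third v ε α β)) v = _
  rw [pd_sum _ fun α _ => Finset.analyticAt_fun_sum _ fun ε _ => a1 α ε,
    Finset.sum_congr rfl fun α _ => pd_sum _ (fun ε _ => a1 α ε) 0]
  have h : ∀ α ε, pd 0 (fun v => S.E v α * (S.η⁻¹ γ ε * S.third v ε α β)) v =
      if α = 0 then S.η⁻¹ γ ε * S.η ε β else 0 := by
    intro α ε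
    rw [pd_mul (analyticAt_E v α) (analyticAt_const.fun_mul (analyticAt_third hv ε α β)), pd_E,
      pd_const_mul _ (analyticAt_third hv ε α β), pd_zero_third hv, S.bracket]
    split_ifs with h
    · subst h; rw [third_swap_left hv, third_zero hv]; ring
    · ring
  simp only [h]
  rw [Finset.sum_comm]
  simp only [Finset.sum_ite_eq', Finset.mem_univ, if_true]
  rw [← Matrix.mul_apply, η_inv_mul]

theorem eventually_shift_mem (hv : v ∈ S.carrier) :
    ∀ᶠ s in 𝓝 (0 : ℂ), v + s • unit n ∈ S.carrier := by
  have : Continuous fun s : ℂ => v + s • unit n := by fun_prop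
  exact this.continuousAt.eventually_mem (S.isOpen_carrier.mem_nhds (by simpa using hv))

theorem hasDerivAt_shift (f : (Fin n → ℂ) → ℂ) (v : Fin n → ℂ) (s : ℂ)
    (hf : DifferentiableAt ℂ f (v + s • unit n)) :
    HasDerivAt (fun s : ℂ => f (v + s • unit n)) (pd 0 f (v + s • unit n)) s := by
  have h1 : HasDerivAt (fun s : ℂ => v + s • unit n) (unit n) s := by
    simpa using ((hasDerivAt_id s).smul_const (unit n)).const_add v
  exact hf.hasFDerivAt.comp_hasDerivAt s h1

/-- Integrates `pd_zero_U` on a small disc. Moving along the unity translates the spectrum of `𝒰`;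
this serves to make `E` invertible and, in genus one, to differentiate the characteristic
polynomial. -/
theorem eventually_U_shift (hv : v ∈ S.carrier) :
    ∀ᶠ s in 𝓝 (0 : ℂ), S.U (v + s • unit n) = S.U v + s • 1 := by
  obtain ⟨r, hr, hb⟩ := Metric.eventually_nhds_iff_ball.1 (eventually_shift_mem hv)
  refine Metric.eventually_nhds_iff_ball.2 ⟨r, hr, fun s hs => ?_⟩
  ext γ β
  have hd : ∀ s ∈ Metric.ball (0 : ℂ) r, HasDerivAt
      (fun s : ℂ => S.U (v + s • unit n) γ β - s * (1 : Matrix (Fin n) (Fin n) ℂ) γ β) 0 s := by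
    intro s hs
    have h1 := hasDerivAt_shift (fun v => S.U v γ β) v s
      (analyticAt_U (hb s hs) γ β).differentiableAt
    rw [pd_zero_U (hb s hs)] at h1
    have h2 := (hasDerivAt_id s).mul_const ((1 : Matrix (Fin n) (Fin n) ℂ) γ β)
    simpa using h1.fun_sub h2
  have := Metric.isOpen_ball.is_const_of_deriv_eq_zero
    (convex_ball (0 : ℂ) r).isPreconnected
    (fun s hs => (hd s hs).differentiableAt.differentiableWithinAt)
    (fun s hs => (hd s hs).deriv) hs (Metric.mem_ball_self hr)
  simp only [zero_smul, add_zero, zero_mul, sub_zero] at this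
  simp only [Matrix.add_apply, Matrix.smul_apply, smul_eq_mul]
  linear_combination this

/-! ### Canonical frames -/

/-- A polynomial in `𝒰` is multiplication by its value on the unity. Idempotent polynomials in `𝒰`
therefore give idempotent vectors. -/
theorem mulMatrix_aeval_U (hv : v ∈ S.carrier) (p : Polynomial ℂ) :
    S.mulMatrix v ((Polynomial.aeval (S.U v) p).mulVec (unit n)) = Polynomial.aeval (S.U v) p := by
  induction p using Polynomial.induction_on' with
  | add p q hp hq => rw [map_add, Matrix.add_mulVec, mulMatrix_add, hp, hq]
  | monomial m c =>
    rw [Polynomial.aeval_monomial, ← Algebra.smul_def, Matrix.smul_mulVec, mulMatrix_smul]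
    congr 1
    induction m with
    | zero => simp [mulMatrix_unit hv]
    | succ m ih => rw [pow_succ', ← Matrix.mulVec_mulVec, U, mulMatrix_mulMatrix hv]; rw [U] at ih; rw [ih]

/-- The canonical coordinates and the basic idempotents at a point, together with their spanning
property. -/
structure Frame (S : FrobeniusManifold n) (v : Fin n → ℂ) where
  u : Fin n → ℂ
  π : Fin n → Fin n → ℂ
  inj : Function.Injective u
  ne_zero : ∀ i, π i ≠ 0
  mul_π : ∀ i j, (S.mulMatrix v (π i)).mulVec (π j) = if i = j then π i else 0
  eigen : ∀ i, (S.U v).mulVec (π i) = u i • π i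
  span : ∀ w : Fin n → ℂ, ∃ c : Fin n → ℂ, w = ∑ i, c i • π i
  charpoly_eq : (S.U v).charpoly = ∏ i, (Polynomial.X - Polynomial.C (u i))

theorem exists_charpoly_eq_prod (A : Matrix (Fin n) (Fin n) ℂ) (h : A.charpoly.roots.Nodup) :
    ∃ u : Fin n → ℂ, Function.Injective u ∧
      A.charpoly = ∏ i, (Polynomial.X - Polynomial.C (u i)) := by
  have hs := IsAlgClosed.splits A.charpoly
  have hc : A.charpoly.roots.card = n := by
    rw [← hs.natDegree_eq_card_roots, Matrix.charpoly_natDegree_eq_dim, Fintype.card_fin]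
  have hc2 : A.charpoly.roots.toFinset.card = n := by
    rw [Multiset.toFinset_card_of_nodup h, hc]
  let e := A.charpoly.roots.toFinset.equivFinOfCardEq hc2
  refine ⟨fun i => (e.symm i : ℂ), fun i j hij => e.symm.injective (Subtype.ext hij), ?_⟩
  have h1 := hs.eq_prod_roots_of_monic (Matrix.charpoly_monic A)
  rw [Equiv.prod_comp e.symm (fun x => Polynomial.X - Polynomial.C (x : ℂ)),
    Finset.prod_coe_sort A.charpoly.roots.toFinset (fun x => Polynomial.X - Polynomial.C x)]
  conv_lhs => rw [h1]
  rw [Finset.prod, Multiset.toFinset_val, Multiset.dedup_eq_self.2 h]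

/-- As the eigenvalues are distinct, agreement at all of them means that the difference is divisible
by the characteristic polynomial; Cayley-Hamilton does the rest. -/
theorem aeval_eq_of_eval_eq {A : Matrix (Fin n) (Fin n) ℂ} {u : Fin n → ℂ}
    (hu : Function.Injective u)
    (hA : A.charpoly = ∏ i, (Polynomial.X - Polynomial.C (u i))) {p q : Polynomial ℂ}
    (h : ∀ i, p.eval (u i) = q.eval (u i)) : Polynomial.aeval A p = Polynomial.aeval A q := by
  have hd : A.charpoly ∣ p - q := by
    rw [hA]
    refine Finset.prod_dvd_of_coprime ?_ fun i _ => ?_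
    · exact fun i _ j _ hij => Polynomial.pairwise_coprime_X_sub_C hu hij
    · rw [Polynomial.dvd_iff_isRoot]; simp [h i]
  obtain ⟨k, hk⟩ := hd
  rw [← sub_eq_zero, ← map_sub, hk, map_mul, Matrix.aeval_self_charpoly, zero_mul]

theorem aeval_mulVec_eigen {A : Matrix (Fin n) (Fin n) ℂ} {c : ℂ} {f : Fin n → ℂ}
    (h : A.mulVec f = c • f) (p : Polynomial ℂ) :
    (Polynomial.aeval A p).mulVec f = p.eval c • f := by
  induction p using Polynomial.induction_on' with
  | add p q hp hq => rw [map_add, Matrix.add_mulVec, hp, hq, Polynomial.eval_add, add_smul]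
  | monomial m a =>
    rw [Polynomial.aeval_monomial, ← Algebra.smul_def, Matrix.smul_mulVec, Polynomial.eval_monomial,
      mul_smul]
    congr 1
    induction m with
    | zero => simp
    | succ m ih => rw [pow_succ, ← Matrix.mulVec_mulVec, h, Matrix.mulVec_smul, ih, pow_succ', mul_smul]

/-- The idempotents are the Lagrange interpolation polynomials of the eigenvalues, evaluated at `𝒰`
and applied to the unity. They span because eigenvectors with distinct eigenvalues are independent.
-/
theorem exists_frame (hv : v ∈ S.Mss) : Nonempty (Frame S v) := by
  obtain ⟨hc, hn⟩ := hv
  obtain ⟨u, hu, hA⟩ := exists_charpoly_eq_prod _ hn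
  let P : Fin n → Polynomial ℂ := fun i => Lagrange.basis Finset.univ u i
  have hP : ∀ i j, (P i).eval (u j) = if i = j then 1 else 0 := by
    intro i j
    split_ifs with h
    · subst h; exact Lagrange.eval_basis_self (hu.injOn) (Finset.mem_univ _)
    · exact Lagrange.eval_basis_of_ne h (Finset.mem_univ _)
  let π : Fin n → Fin n → ℂ := fun i => (Polynomial.aeval (S.U v) (P i)).mulVec (unit n)
  have hπ : ∀ i, S.mulMatrix v (π i) = Polynomial.aeval (S.U v) (P i) :=
    fun i => mulMatrix_aeval_U hc (P i)
  have heig : ∀ i, (S.U v).mulVec (π i) = u i • π i := by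
    intro i
    have : Polynomial.aeval (S.U v) (Polynomial.X * P i) =
        Polynomial.aeval (S.U v) (Polynomial.C (u i) * P i) :=
      aeval_eq_of_eval_eq hu hA fun j => by
        simp only [Polynomial.eval_mul, Polynomial.eval_X, Polynomial.eval_C, hP]
        split_ifs with h
        · rw [h]
        · simp
    rw [map_mul, map_mul, Polynomial.aeval_X, Polynomial.aeval_C, ← Algebra.smul_def] at this
    change (S.U v).mulVec ((Polynomial.aeval (S.U v) (P i)).mulVec (unit n)) = _
    rw [Matrix.mulVec_mulVec, this, Matrix.smul_mulVec]
  -- If `π i` vanished, so would the interpolation polynomial at `𝒰`; but it acts as the identity on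
  -- an eigenvector with eigenvalue `u i`.
  have hne : ∀ i, π i ≠ 0 := by
    intro i h0
    have h1 : Polynomial.aeval (S.U v) (P i) = 0 := by rw [← hπ, h0, mulMatrix_zero]
    have hroot : (S.U v).charpoly.IsRoot (u i) := by
      rw [hA, Polynomial.IsRoot, Polynomial.eval_prod]
      exact Finset.prod_eq_zero (Finset.mem_univ i) (by simp)
    have : (Matrix.scalar (Fin n) (u i) - S.U v).det = 0 := by
      rw [Polynomial.IsRoot, Matrix.eval_charpoly] at hroot; exact hroot
    obtain ⟨f, hf, hf0⟩ := Matrix.exists_mulVec_eq_zero_iff.2 this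
    have hf1 : (S.U v).mulVec f = u i • f := by
      rw [Matrix.sub_mulVec, sub_eq_zero] at hf0
      rw [← hf0]; ext j; simp [Matrix.scalar_apply, Matrix.mulVec_diagonal]
    have h2 := aeval_mulVec_eigen hf1 (P i)
    rw [h1, hP, if_pos rfl, one_smul, Matrix.zero_mulVec] at h2
    exact hf h2.symm
  have hli : LinearIndependent ℂ π :=
    Module.End.eigenvectors_linearIndependent' (Matrix.toLin' (S.U v)) u hu π fun i =>
      ⟨Module.End.mem_eigenspace_iff.2 (by simpa using heig i), hne i⟩
  refine ⟨⟨u, π, hu, hne, ?_, heig, ?_, hA⟩⟩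
  · intro i j
    rw [hπ, aeval_mulVec_eigen (heig j), hP]
    split_ifs with h
    · rw [h, one_smul]
    · rw [zero_smul]
  · intro w
    let b := basisOfLinearIndependentOfCardEqFinrank hli (by simp)
    refine ⟨fun i => b.repr w i, ?_⟩
    conv_lhs => rw [← b.sum_repr w]
    simp [b]

namespace Frame

variable (f : Frame S v)

theorem isCanonicalFrame : S.IsCanonicalFrame v f.u f.π :=
  ⟨f.inj, f.ne_zero, f.mul_π, f.eigen⟩

theorem mulMatrix_π_sum (c : Fin n → ℂ) (i : Fin n) :
    (S.mulMatrix v (f.π i)).mulVec (∑ j, c j • f.π j) = c i • f.π i := by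
  rw [Matrix.mulVec_sum]
  simp [Matrix.mulVec_smul, f.mul_π]

theorem sum_π (hv : v ∈ S.carrier) : ∑ i, f.π i = unit n := by
  obtain ⟨c, hc⟩ := f.span (unit n)
  rw [hc]
  refine Finset.sum_congr rfl fun i _ => ?_
  have := f.mulMatrix_π_sum c i
  rw [← hc, mulMatrix_mulVec_unit hv] at this
  exact this

theorem exists_π (i : Fin n) (w : Fin n → ℂ) :
    ∃ c : ℂ, (S.mulMatrix v (f.π i)).mulVec w = c • f.π i := by
  obtain ⟨c, hc⟩ := f.span w
  exact ⟨c i, by rw [hc, f.mulMatrix_π_sum]⟩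

theorem sum_mulMatrix_π (hv : v ∈ S.carrier) : ∑ i, S.mulMatrix v (f.π i) = 1 := by
  rw [← mulMatrix_sum, f.sum_π hv, mulMatrix_unit hv]

/-- `π_i 𝒱 π_i = 0`: the operator `𝒱` is antisymmetric. -/
theorem π_V_π (hv : v ∈ S.carrier) (i : Fin n) :
    S.mulMatrix v (f.π i) * S.V * S.mulMatrix v (f.π i) = 0 := by
  set X := S.mulMatrix v (f.π i) with hX
  obtain ⟨c, hc⟩ := f.exists_π i (S.V.mulVec (f.π i))
  -- The image of `X` is the line of `π_i`, so `X 𝒱 X` is a multiple of `X`. It is then both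
  -- self-adjoint, like `X`, and anti-self-adjoint, like `𝒱`.
  have h1 : X * S.V * X = c • X := by
    refine Matrix.ext_of_mulVec_single fun j => ?_
    obtain ⟨b, hb⟩ := f.exists_π i (Pi.single j 1)
    rw [← Matrix.mulVec_mulVec, hX, hb, Matrix.mulVec_smul, ← Matrix.mulVec_mulVec, hc,
      Matrix.smul_mulVec, hb, smul_comm]
  have h2 : S.adj (X * S.V * X) = -(X * S.V * X) := by
    rw [adj_mul, adj_mul, adj_V, hX, adj_mulMatrix hv, ← hX]
    simp [Matrix.mul_assoc]
  have h3 : S.adj (c • X) = c • X := by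
    have : S.adj (c • X) = c • S.adj X := by simp [adj]
    rw [this, hX, adj_mulMatrix hv]
  rw [h1, h3] at h2
  rw [h1]
  have : (2 : ℂ) • (c • X) = 0 := by
    rw [two_smul]; nth_rw 1 [h2]; simp
  simpa using this

theorem mulMatrix_π_mul_U (hv : v ∈ S.carrier) (i : Fin n) :
    S.mulMatrix v (f.π i) * S.U v = f.u i • S.mulMatrix v (f.π i) := by
  rw [U, mulMatrix_comm hv, ← mulMatrix_mulMatrix hv, ← mulMatrix_smul]
  congr 1
  exact f.eigen i

theorem U_mul_mulMatrix_π (hv : v ∈ S.carrier) (i : Fin n) :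
    S.U v * S.mulMatrix v (f.π i) = f.u i • S.mulMatrix v (f.π i) := by
  rw [← f.mulMatrix_π_mul_U hv, U, mulMatrix_comm hv]

theorem aeval_derivative_ne (i : Fin n) : (S.U v).charpoly.derivative.eval (f.u i) ≠ 0 := by
  rw [f.charpoly_eq, Polynomial.derivative_prod_finset, Polynomial.eval_finsetSum,
    Finset.sum_eq_single i]
  · simp only [Polynomial.eval_prod, Polynomial.derivative_sub, Polynomial.derivative_X,
      Polynomial.derivative_C, sub_zero, mul_one]
    refine Finset.prod_ne_zero_iff.2 fun j hj => ?_
    simp only [Polynomial.eval_sub, Polynomial.eval_X, Polynomial.eval_C]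
    exact sub_ne_zero.2 fun h => (Finset.mem_erase.1 hj).1 (f.inj h.symm)
  · intro j _ hj
    simp only [Polynomial.eval_mul, Polynomial.eval_prod]
    rw [Finset.prod_eq_zero (Finset.mem_erase.2 ⟨hj.symm, Finset.mem_univ i⟩) (by simp), zero_mul]
  · simp

/-- A covector that annihilates all the vectors `p(𝒰) w`, where `w` is invertible, is zero. -/
theorem eq_zero_of_forall_pow (f : Frame S v) (hv : v ∈ S.carrier) {w : Fin n → ℂ}
    (hw : IsUnit (S.mulMatrix v w).det) (r : ℕ) (l : Fin n → ℂ)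
    (h : ∀ m : ℕ, dotProduct l ((Polynomial.aeval (S.U v)
      ((S.U v).charpoly.derivative ^ r * Polynomial.X ^ m)).mulVec w) = 0) : l = 0 := by
  have h1 : ∀ p : Polynomial ℂ, dotProduct l ((Polynomial.aeval (S.U v)
      ((S.U v).charpoly.derivative ^ r * p)).mulVec w) = 0 := by
    intro p
    induction p using Polynomial.induction_on' with
    | add p q hp hq => rw [mul_add, map_add, Matrix.add_mulVec, dotProduct_add, hp, hq, add_zero]
    | monomial m c =>
      rw [← Polynomial.C_mul_X_pow_eq_monomial, mul_left_comm, map_mul, Polynomial.aeval_C,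
        ← Algebra.smul_def, Matrix.smul_mulVec, dotProduct_smul, h, smul_zero]
  have hπ : ∀ i, dotProduct l ((S.mulMatrix v (f.π i)).mulVec w) = 0 := by
    intro i
    -- On this polynomial the operator is multiplication by `π_i` times a power of `χ'(u_i)`, which
    -- is nonzero since the roots are simple.
    have h2 := h1 (Lagrange.basis Finset.univ f.u i)
    have h3 : Polynomial.aeval (S.U v) ((S.U v).charpoly.derivative ^ r *
        Lagrange.basis Finset.univ f.u i) =
        ((S.U v).charpoly.derivative.eval (f.u i)) ^ r • S.mulMatrix v (f.π i) := by
      rw [← mulMatrix_aeval_U hv, ← mulMatrix_smul]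
      congr 1
      rw [← f.sum_π hv, Matrix.mulVec_sum, Finset.sum_eq_single i]
      · rw [aeval_mulVec_eigen (f.eigen i), Polynomial.eval_mul, Polynomial.eval_pow,
          Lagrange.eval_basis_self f.inj.injOn (Finset.mem_univ _), mul_one]
      · intro j _ hj
        rw [aeval_mulVec_eigen (f.eigen j), Polynomial.eval_mul,
          Lagrange.eval_basis_of_ne hj.symm (Finset.mem_univ _), mul_zero, zero_smul]
      · simp
    rw [h3, Matrix.smul_mulVec, dotProduct_smul, smul_eq_mul] at h2
    exact (mul_eq_zero.1 h2).resolve_left (pow_ne_zero _ (f.aeval_derivative_ne i))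
  have hl : Matrix.vecMul l (S.mulMatrix v w) = 0 := by
    refine dotProduct_eq_zero _ fun x => ?_
    obtain ⟨c, hc⟩ := f.span x
    rw [← Matrix.dotProduct_mulVec, hc, Matrix.mulVec_sum, dotProduct_sum]
    refine Finset.sum_eq_zero fun i _ => ?_
    rw [Matrix.mulVec_smul, mulMatrix_mulVec_comm hv, dotProduct_smul, hπ, smul_zero]
  have h4 := congrArg (fun l => Matrix.vecMul l (S.mulMatrix v w)⁻¹) hl
  simpa [Matrix.vecMul_vecMul, Matrix.mul_nonsing_inv _ hw] using h4

end Frame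

end FrobeniusManifold

/-! ### The gradients of the deformed flat coordinates -/

namespace LeveltSystem

variable {n : ℕ} [NeZero n] {S : FrobeniusManifold n} (L : LeveltSystem S) {v : Fin n → ℂ}

/-- The matrices `Θ_p(v)`. -/
abbrev Th (p : ℕ) (v : Fin n → ℂ) : Matrix (Fin n) (Fin n) ℂ := gradMatrix S L.θ p v

theorem Th_zero (hv : v ∈ S.carrier) : L.Th 0 v = 1 := by
  ext α β
  have : ∀ γ, pd γ (L.θ β 0) v = S.η γ β := by
    intro γ
    rw [pd_congr S.isOpen_carrier (g := fun v => ∑ ε, S.η β ε * v ε + 0) _ hv, pd_affine,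
      S.η_symm.apply]
    intro w hw; rw [L.θ_zero w hw, add_zero]
  simp only [Th, gradMatrix, this]
  rw [← Matrix.mul_apply, FrobeniusManifold.η_inv_mul]

theorem analyticAt_Th (hv : v ∈ S.carrier) (p : ℕ) (α β : Fin n) :
    AnalyticAt ℂ (fun v => L.Th p v α β) v := by
  unfold Th gradMatrix
  exact Finset.analyticAt_fun_sum _ fun γ _ =>
    analyticAt_const.fun_mul (analyticAt_pd (L.analytic_θ β p v hv) γ)

theorem fderiv_Th_zero (hv : v ∈ S.carrier) (α β : Fin n) (w : Fin n → ℂ) :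
    fderiv ℂ (fun v => L.Th 0 v α β) v w = 0 := by
  rw [fderiv_eq_of_eqOn (g := fun _ => (1 : Matrix (Fin n) (Fin n) ℂ) α β) S.isOpen_carrier
    (fun w hw => by simp only [L.Th_zero hw]) hv]
  simp

theorem fderiv_Th_succ (hv : v ∈ S.carrier) (p : ℕ) (α β : Fin n) (w : Fin n → ℂ) :
    fderiv ℂ (fun v => L.Th (p + 1) v α β) v w = (S.mulMatrix v w * L.Th p v) α β := by
  rw [fderiv_eq_sum_pd, FrobeniusManifold.mulMatrix_eq hv, Finset.sum_mul, Matrix.sum_apply]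
  refine Finset.sum_congr rfl fun l _ => ?_
  rw [Matrix.smul_mul, Matrix.smul_apply, smul_eq_mul]
  congr 1
  change pd l (fun v => ∑ γ, S.η⁻¹ α γ * pd γ (L.θ β (p + 1)) v) v = _
  rw [pd_sum _ fun γ _ => analyticAt_const.fun_mul (analyticAt_pd (L.analytic_θ β _ v hv) γ),
    Matrix.mul_assoc, Matrix.mul_apply]
  refine Finset.sum_congr rfl fun γ _ => ?_
  rw [pd_const_mul _ (analyticAt_pd (L.analytic_θ β _ v hv) γ), L.θ_succ v hv, Matrix.mul_apply,
    Finset.sum_comm]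
  congr 1
  refine Finset.sum_congr rfl fun ε _ => ?_
  simp only [Th, gradMatrix, Finset.mul_sum]
  refine Finset.sum_congr rfl fun ν _ => ?_
  have e1 : pd ε (pd l (pd γ S.F)) v = S.third v l γ ε := by
    rw [← FrobeniusManifold.third_swap_right hv l ε γ]
    exact FrobeniusManifold.third_swap_left hv ε l γ
  have e2 : S.η⁻¹ ν ε = S.η⁻¹ ε ν := by
    conv_lhs => rw [← FrobeniusManifold.η_inv_transpose]
    rfl
  rw [e1, e2]; ring

theorem μ_transpose_η : L.μ.transpose * S.η = -(S.η * L.μ) := by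
  have h := FrobeniusManifold.V_transpose_η (S := S)
  have h0 := L.adj_R 0
  have h1 : (L.R 0).transpose * S.η = -(S.η * L.R 0) := by
    rw [← FrobeniusManifold.η_mul_adj, h0]; simp
  rw [L.V_eq, Matrix.transpose_add, Matrix.add_mul, h1, Matrix.mul_add] at h
  have : L.μ.transpose * S.η = -(S.η * L.μ + S.η * L.R 0) + S.η * L.R 0 := by rw [← h]; abel
  rw [this]; abel

theorem R_transpose_η (k : ℕ) : (L.R k).transpose * S.η = (-1 : ℂ) ^ (k + 1) • (S.η * L.R k) := by
  rw [← FrobeniusManifold.η_mul_adj, L.adj_R, Matrix.mul_smul]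

end LeveltSystem

end

section

/-! ### Germs of analytic functions of the times -/

section Germs

variable {n : ℕ}

theorem emb_apply (N : ℕ) (y : Fin n × Fin N → ℂ) (α : Fin n) (p : ℕ) :
    emb N y (α, p) = if h : p < N then y (α, ⟨p, h⟩) else 0 := by
  simp only [emb, Finsupp.finsetSum_apply, Finsupp.single_apply]
  split_ifs with h
  · rw [Finset.sum_eq_single (α, ⟨p, h⟩)]
    · simp
    · rintro ⟨β, q⟩ _ hb
      rw [if_neg]
      rintro hh
      simp only [Prod.mk.injEq] at hh
      exact hb (by ext <;> simp [hh.1, ← hh.2])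
    · simp
  · refine Finset.sum_eq_zero fun b _ => if_neg ?_
    rintro hh
    simp only [Prod.mk.injEq] at hh
    exact h (hh.2 ▸ b.2.2)

/-- Inclusion of the spaces `{t^{α,p} = 0 for p ≥ N}` into each other. -/
def extend (N N' : ℕ) : (Fin n × Fin N → ℂ) →L[ℂ] (Fin n × Fin N' → ℂ) :=
  LinearMap.toContinuousLinearMap
    { toFun := fun y i => if h : (i.2 : ℕ) < N then y (i.1, ⟨i.2, h⟩) else 0
      map_add' := fun x y => by ext i; simp only [Pi.add_apply]; split_ifs <;> simp
      map_smul' := fun c y => by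
        ext i; simp only [Pi.smul_apply, smul_eq_mul, RingHom.id_apply]; split_ifs <;> simp }

theorem extend_apply (N N' : ℕ) (y : Fin n × Fin N → ℂ) (i : Fin n × Fin N') :
    extend N N' y i = if h : (i.2 : ℕ) < N then y (i.1, ⟨i.2, h⟩) else 0 := rfl

theorem emb_extend {N N' : ℕ} (h : N ≤ N') (y : Fin n × Fin N → ℂ) :
    emb N' (extend N N' y) = emb N y := by
  ext ⟨α, p⟩
  rw [emb_apply, emb_apply]
  simp only [extend_apply]
  split_ifs with h1 h2 h2
  · rfl
  · rfl
  · omega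
  · rfl

theorem emb_add (N : ℕ) (y z : Fin n × Fin N → ℂ) : emb N (y + z) = emb N y + emb N z := by
  simp [emb, Finset.sum_add_distrib]

theorem emb_zero (N : ℕ) : emb N (0 : Fin n × Fin N → ℂ) = 0 := by
  simp [emb]

/-- The coordinate vector of the time `i` in `{t^{α,p} = 0 for p ≥ N}`. -/
def dir (N : ℕ) (i : Fin n × ℕ) : Fin n × Fin N → ℂ :=
  fun j => if j.1 = i.1 ∧ (j.2 : ℕ) = i.2 then 1 else 0

theorem emb_smul_dir {N : ℕ} {i : Fin n × ℕ} (h : i.2 < N) (s : ℂ) :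
    emb N (s • dir N i) = Finsupp.single i s := by
  ext ⟨α, p⟩
  rw [emb_apply, Finsupp.single_apply]
  obtain ⟨β, q⟩ := i
  simp only [dir, Pi.smul_apply, smul_eq_mul, mul_ite, mul_one, mul_zero, Prod.mk.injEq]
  simp only at h
  split_ifs with h1 h2 h3 h3 h4
  · rfl
  · exact absurd ⟨h2.1.symm, h2.2.symm⟩ h3
  · exact absurd ⟨h3.1.symm, h3.2.symm⟩ h2
  · rfl
  · omega
  · rfl

namespace HoldsNear

theorem mono {P Q : Times n → Prop} (hP : HoldsNear P) (h : ∀ t, P t → Q t) : HoldsNear Q :=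
  fun N => (hP N).mono fun _ hy => h _ hy

theorem and {P Q : Times n → Prop} (hP : HoldsNear P) (hQ : HoldsNear Q) :
    HoldsNear fun t => P t ∧ Q t := fun N => (hP N).and (hQ N)

theorem at_zero {P : Times n → Prop} (hP : HoldsNear P) : P 0 := by
  have := (hP 0).self_of_nhds
  rwa [emb_zero] at this

theorem forall_fintype {ι : Type*} [Finite ι] {P : ι → Times n → Prop}
    (h : ∀ i, HoldsNear (P i)) : HoldsNear fun t => ∀ i, P i t :=
  fun N => Filter.eventually_all.2 fun i => h i N

theorem forall_finset {ι : Type*} (s : Finset ι) {P : ι → Times n → Prop}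
    (h : ∀ i ∈ s, HoldsNear (P i)) : HoldsNear fun t => ∀ i ∈ s, P i t :=
  fun N => (Filter.eventually_all_finset s).2 fun i hi => h i hi N

/-- Each slice embeds by zeros into every larger one, so the slices may be assumed to contain any
given finite set of times. -/
theorem of_large {P : Times n → Prop} (K : ℕ)
    (h : ∀ N, K ≤ N → ∀ᶠ y in 𝓝 (0 : Fin n × Fin N → ℂ), P (emb N y)) : HoldsNear P := by
  intro N
  have h1 := h (max N K) (le_max_right _ _)
  have hc : Filter.Tendsto (extend (n := n) N (max N K)) (𝓝 0) (𝓝 0) := by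
    have := (extend (n := n) N (max N K)).continuous.tendsto 0
    rwa [map_zero] at this
  filter_upwards [hc.eventually h1] with y hy
  rwa [emb_extend (le_max_left _ _)] at hy

/-- Needed before differentiating an identity in the time `i`: it must hold along a short segment in
that direction, which requires a slice with `i.2 < N`. -/
theorem line {P : Times n → Prop} (hP : HoldsNear P) (i : Fin n × ℕ) :
    HoldsNear fun t => ∀ᶠ s in 𝓝 (0 : ℂ), P (t + Finsupp.single i s) := by
  refine of_large (i.2 + 1) fun N hN => ?_
  filter_upwards [(hP N).eventually_nhds] with y hy
  have hc : Filter.Tendsto (fun s : ℂ => y + s • dir N i) (𝓝 0) (𝓝 y) := by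
    have : Continuous fun s : ℂ => y + s • dir N i := by fun_prop
    simpa using this.tendsto 0
  filter_upwards [hc.eventually hy] with s hs
  rwa [emb_add, emb_smul_dir (by omega)] at hs

theorem dt_congr {f g : Times n → ℂ} (h : HoldsNear fun t => f t = g t) (i : Fin n × ℕ) :
    HoldsNear fun t => dt i f t = dt i g t :=
  (h.line i).mono fun _ ht => Filter.EventuallyEq.deriv_eq ht

end HoldsNear

/-- `f` is analytic at the origin of each space `{t^{α,p} = 0 for p ≥ N}`. -/
def AnalyticGerm {E : Type*} [NormedAddCommGroup E] [NormedSpace ℂ E] (f : Times n → E) : Prop :=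
  ∀ N : ℕ, AnalyticAt ℂ (fun y : Fin n × Fin N → ℂ => f (emb N y)) 0

namespace AnalyticGerm

variable {E F : Type*} [NormedAddCommGroup E] [NormedSpace ℂ E] [NormedAddCommGroup F]
  [NormedSpace ℂ F]

theorem of_large {f : Times n → E} (K : ℕ)
    (h : ∀ N, K ≤ N → AnalyticAt ℂ (fun y : Fin n × Fin N → ℂ => f (emb N y)) 0) :
    AnalyticGerm f := by
  intro N
  have h1 := h (max N K) (le_max_right _ _)
  have h2 : AnalyticAt ℂ (extend (n := n) N (max N K)) 0 := ContinuousLinearMap.analyticAt _ _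
  rw [← map_zero (extend (n := n) N (max N K))] at h1
  refine (h1.comp h2).congr (Filter.Eventually.of_forall fun y => ?_)
  simp [emb_extend (le_max_left _ _)]

theorem const (c : E) : AnalyticGerm fun _ : Times n => c := fun _ => analyticAt_const

theorem comp {f : Times n → E} (hf : AnalyticGerm f) {H : E → F} (hH : AnalyticAt ℂ H (f 0)) :
    AnalyticGerm fun t => H (f t) := fun N =>
  AnalyticAt.fun_comp (by simpa [emb_zero] using hH) (hf N)

theorem sub {f g : Times n → E} (hf : AnalyticGerm f) (hg : AnalyticGerm g) :
    AnalyticGerm fun t => f t - g t := fun N => (hf N).fun_sub (hg N)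

theorem mul {f g : Times n → ℂ} (hf : AnalyticGerm f) (hg : AnalyticGerm g) :
    AnalyticGerm fun t => f t * g t := fun N => (hf N).fun_mul (hg N)

theorem sum {ι : Type*} (s : Finset ι) {f : ι → Times n → E} (hf : ∀ i ∈ s, AnalyticGerm (f i)) :
    AnalyticGerm fun t => ∑ i ∈ s, f i t := fun N =>
  Finset.analyticAt_fun_sum _ fun i hi => hf i hi N

theorem pi {ι : Type*} [Fintype ι] {f : Times n → ι → E}
    (hf : ∀ i, AnalyticGerm fun t => f t i) : AnalyticGerm f := fun N =>
  AnalyticAt.pi fun i => hf i N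

theorem apply {ι : Type*} [Fintype ι] {f : Times n → ι → E} (hf : AnalyticGerm f) (i : ι) :
    AnalyticGerm fun t => f t i :=
  hf.comp ((ContinuousLinearMap.proj (R := ℂ) (φ := fun _ : ι => E) i).analyticAt _)

theorem coord (i : Fin n × ℕ) : AnalyticGerm fun t : Times n => t i := by
  intro N
  have h : ∀ y : Fin n × Fin N → ℂ, emb N y i = if h : i.2 < N then y (i.1, ⟨i.2, h⟩) else 0 :=
    fun y => emb_apply N y i.1 i.2
  simp only [h]
  split_ifs with hi
  · exact (ContinuousLinearMap.proj (R := ℂ) (φ := fun _ : Fin n × Fin N => ℂ) _).analyticAt 0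
  · exact analyticAt_const

theorem eventually_mem {f : Times n → E} (hf : AnalyticGerm f) {s : Set E} (hs : IsOpen s)
    (h0 : f 0 ∈ s) : HoldsNear fun t => f t ∈ s := fun N =>
  (hf N).continuousAt.eventually_mem (hs.mem_nhds (by simpa [emb_zero] using h0))

/-- Links `dt`, a derivative along one line, with the Fréchet derivative on a finite-dimensional
slice, where analyticity and the symmetry of second derivatives are available. -/
theorem eventually_dt_eq {f : Times n → ℂ} (hf : AnalyticGerm f) {N : ℕ} {i : Fin n × ℕ}
    (h : i.2 < N) : ∀ᶠ y in 𝓝 (0 : Fin n × Fin N → ℂ),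
      DifferentiableAt ℂ (fun s : ℂ => f (emb N y + Finsupp.single i s)) 0 ∧
      dt i f (emb N y) = fderiv ℂ (fun y : Fin n × Fin N → ℂ => f (emb N y)) y (dir N i) := by
  filter_upwards [(hf N).eventually_analyticAt] with y hy
  have h1 : HasDerivAt (fun s : ℂ => y + s • dir N i) (dir N i) 0 := by
    simpa using ((hasDerivAt_id (0 : ℂ)).smul_const (dir N i)).const_add y
  have h2 : HasFDerivAt (fun y : Fin n × Fin N → ℂ => f (emb N y))
      (fderiv ℂ (fun y : Fin n × Fin N → ℂ => f (emb N y)) y) (y + (0 : ℂ) • dir N i) := by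
    simpa using hy.differentiableAt.hasFDerivAt
  have h3 := h2.comp_hasDerivAt (0 : ℂ) h1
  have e : (fun y : Fin n × Fin N → ℂ => f (emb N y)) ∘ (fun s : ℂ => y + s • dir N i) =
      fun s : ℂ => f (emb N y + Finsupp.single i s) := by
    ext s; simp [emb_add, emb_smul_dir h]
  rw [e] at h3
  exact ⟨h3.differentiableAt, h3.deriv⟩

theorem differentiableAt {f : Times n → ℂ} (hf : AnalyticGerm f) (i : Fin n × ℕ) :
    HoldsNear fun t => DifferentiableAt ℂ (fun s : ℂ => f (t + Finsupp.single i s)) 0 :=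
  HoldsNear.of_large (i.2 + 1) fun N hN =>
    (hf.eventually_dt_eq (N := N) (i := i) (by omega)).mono fun _ hy => hy.1

theorem hasDerivAt {f : Times n → ℂ} (hf : AnalyticGerm f) (i : Fin n × ℕ) :
    HoldsNear fun t => HasDerivAt (fun s : ℂ => f (t + Finsupp.single i s)) (dt i f t) 0 :=
  (hf.differentiableAt i).mono fun _ h => h.hasDerivAt

theorem dt {f : Times n → ℂ} (hf : AnalyticGerm f) (i : Fin n × ℕ) : AnalyticGerm (dt i f) :=
  of_large (i.2 + 1) fun N hN =>
    (analyticAt_fderiv_apply (hf N) (dir N i)).congr <|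
      (hf.eventually_dt_eq (N := N) (i := i) (by omega)).mono fun _ hy => hy.2.symm

theorem dt_comm {f : Times n → ℂ} (hf : AnalyticGerm f) (i j : Fin n × ℕ) :
    HoldsNear fun t => Dubrovin.dt i (Dubrovin.dt j f) t = Dubrovin.dt j (Dubrovin.dt i f) t := by
  refine HoldsNear.of_large (max i.2 j.2 + 1) fun N hN => ?_
  have hi : i.2 < N := lt_of_le_of_lt (le_max_left _ _) hN
  have hj : j.2 < N := lt_of_le_of_lt (le_max_right _ _) hN
  filter_upwards [(hf.dt j).eventually_dt_eq hi, (hf.dt i).eventually_dt_eq hj,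
    (hf.eventually_dt_eq hi).eventually_nhds, (hf.eventually_dt_eq hj).eventually_nhds,
    (hf N).eventually_analyticAt] with y h1 h2 h3 h4 h5
  have e3 : (fun y : Fin n × Fin N → ℂ => Dubrovin.dt i f (emb N y)) =ᶠ[𝓝 y]
    fun y => fderiv ℂ (fun y : Fin n × Fin N → ℂ => f (emb N y)) y (dir N i) :=
    h3.mono fun _ h => h.2
  have e4 : (fun y : Fin n × Fin N → ℂ => Dubrovin.dt j f (emb N y)) =ᶠ[𝓝 y]
    fun y => fderiv ℂ (fun y : Fin n × Fin N → ℂ => f (emb N y)) y (dir N j) :=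
    h4.mono fun _ h => h.2
  rw [h1.2, h2.2, e3.fderiv_eq, e4.fderiv_eq]
  exact fderiv_fderiv_comm h5 _ _

theorem iterate_dt {f : Times n → ℂ} (hf : AnalyticGerm f) (i : Fin n × ℕ) (r : ℕ) :
    AnalyticGerm ((Dubrovin.dt i)^[r] f) := by
  induction r with
  | zero => exact hf
  | succ r ih => rw [Function.iterate_succ_apply']; exact ih.dt i

theorem differentiableAt_line [CompleteSpace E] {f : Times n → E} (hf : AnalyticGerm f) (i : Fin n × ℕ) :
    HoldsNear fun t => DifferentiableAt ℂ (fun s : ℂ => f (t + Finsupp.single i s)) 0 := by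
  refine HoldsNear.of_large (i.2 + 1) fun N hN => ?_
  filter_upwards [(hf N).eventually_analyticAt] with y hy
  have h1 : DifferentiableAt ℂ (fun s : ℂ => y + s • dir N i) 0 := by fun_prop
  have h2 : DifferentiableAt ℂ (fun y : Fin n × Fin N → ℂ => f (emb N y)) (y + (0 : ℂ) • dir N i) := by
    simpa using hy.differentiableAt
  have h3 := DifferentiableAt.fun_comp' (0 : ℂ) h2 h1
  refine h3.congr_of_eventuallyEq (Filter.Eventually.of_forall fun s => ?_)
  simp [emb_add, emb_smul_dir (N := N) (i := i) (by omega)]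

/-- The chain rule along the times. -/
theorem dt_comp [CompleteSpace E] {f : Times n → E} (hf : AnalyticGerm f)
    (i : Fin n × ℕ) {H : E → ℂ} (hH : AnalyticAt ℂ H (f 0)) :
    HoldsNear fun t => AnalyticAt ℂ H (f t) ∧ Dubrovin.dt i (fun t => H (f t)) t =
      fderiv ℂ H (f t) (deriv (fun s : ℂ => f (t + Finsupp.single i s)) 0) := by
  have h1 : HoldsNear fun t => AnalyticAt ℂ H (f t) := fun N => by
    have hc : ContinuousAt (fun y : Fin n × Fin N → ℂ => f (emb N y)) 0 := (hf N).continuousAt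
    have := hH.eventually_analyticAt
    refine hc.tendsto.eventually ?_
    simpa [emb_zero] using this
  refine (h1.and (hf.differentiableAt_line i)).mono fun t ht => ⟨ht.1, ?_⟩
  have h4 : HasFDerivAt H (fderiv ℂ H (f t)) (f (t + Finsupp.single i 0)) := by
    simpa using ht.1.differentiableAt.hasFDerivAt
  exact (h4.comp_hasDerivAt (0 : ℂ) ht.2.hasDerivAt).deriv

theorem dt_mul {f g : Times n → ℂ} (hf : AnalyticGerm f) (hg : AnalyticGerm g) (i : Fin n × ℕ) :
    HoldsNear fun t => Dubrovin.dt i (fun t => f t * g t) t =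
      Dubrovin.dt i f t * g t + f t * Dubrovin.dt i g t :=
  ((hf.hasDerivAt i).and (hg.hasDerivAt i)).mono fun t h => by
    have := (h.1.fun_mul h.2).deriv
    change deriv _ 0 = _
    simpa using this

theorem dt_sum {ι : Type*} (s : Finset ι) {f : ι → Times n → ℂ}
    (hf : ∀ k ∈ s, AnalyticGerm (f k)) (i : Fin n × ℕ) :
    HoldsNear fun t => Dubrovin.dt i (fun t => ∑ k ∈ s, f k t) t =
      ∑ k ∈ s, Dubrovin.dt i (f k) t :=
  (HoldsNear.forall_finset s fun k hk => (hf k hk).hasDerivAt i).mono fun _ h =>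
    (HasDerivAt.fun_sum h).deriv

end AnalyticGerm

theorem dt_const (c : ℂ) (i : Fin n × ℕ) (t : Times n) : dt i (fun _ => c) t = 0 := by
  simp [dt]

theorem dt_const_mul (c : ℂ) {f : Times n → ℂ} (i : Fin n × ℕ) (t : Times n) :
    dt i (fun t => c * f t) t = c * dt i f t := by
  simp only [dt]; exact deriv_const_mul_field c

theorem dt_sub_coord (c : Times n) (i j : Fin n × ℕ) (t : Times n) :
    dt i (fun t => (t - c) j) t = if i = j then 1 else 0 := by
  simp only [dt, Finsupp.sub_apply, Finsupp.add_apply, Finsupp.single_apply]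
  split_ifs with h
  · rw [deriv_sub_const, deriv_const_add]; simp
  · simp

/-- A bound for the indices of the nonzero times. -/
def supBound (c : Times n) : ℕ := c.support.sup (fun i => i.2 + 1)

theorem lt_supBound {c : Times n} {i : Fin n × ℕ} (h : c i ≠ 0) : i.2 < supBound c := by
  have : i ∈ c.support := Finsupp.mem_support_iff.2 h
  exact Nat.lt_of_succ_le (Finset.le_sup (f := fun i : Fin n × ℕ => i.2 + 1) this)

/-- The index set `{(α, p) : p < K}`. -/
abbrev box (n K : ℕ) : Finset (Fin n × ℕ) := (Finset.univ : Finset (Fin n)) ×ˢ Finset.range K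

theorem sum_eq_sum_box {F : Type*} [AddCommMonoid F] {t : Times n} {K : ℕ}
    (hK : ∀ i, t i ≠ 0 → i.2 < K) {g : Fin n × ℕ → ℂ → F} (hg : ∀ i, g i 0 = 0) :
    t.sum g = ∑ i ∈ box n K, g i (t i) := by
  refine Finsupp.sum_of_support_subset _ (fun i hi => ?_) _ fun i _ => hg i
  simpa using hK i (Finsupp.mem_support_iff.1 hi)

theorem emb_sub_support (c : Times n) {N : ℕ} (hN : supBound c ≤ N) (y : Fin n × Fin N → ℂ)
    (i : Fin n × ℕ) (h : (emb N y - c) i ≠ 0) : i.2 < N := by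
  by_contra hi
  apply h
  rw [Finsupp.sub_apply]
  have h1 : emb N y i = 0 := by
    have := emb_apply N y i.1 i.2
    rw [dif_neg hi] at this; exact this
  have h2 : c i = 0 := by
    by_contra hc
    exact hi (lt_of_lt_of_le (lt_supBound hc) hN)
  rw [h1, h2, sub_zero]

/-- The linear combination `∑ (t - c)^i f_i(t)`. -/
def shiftSum (c : Times n) (f : Fin n × ℕ → Times n → ℂ) : Times n → ℂ :=
  fun t => (t - c).sum fun i x => x * f i t

theorem shiftSum_eq (c : Times n) (f : Fin n × ℕ → Times n → ℂ) {t : Times n} {K : ℕ}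
    (hK : ∀ i, (t - c) i ≠ 0 → i.2 < K) :
    shiftSum c f t = ∑ i ∈ box n K, (t - c) i * f i t :=
  sum_eq_sum_box hK fun _ => zero_mul _

theorem analyticGerm_sub_coord (c : Times n) (i : Fin n × ℕ) :
    AnalyticGerm fun t : Times n => (t - c) i :=
  (AnalyticGerm.coord i).sub (AnalyticGerm.const (c i))

theorem analyticGerm_shiftSum (c : Times n) {f : Fin n × ℕ → Times n → ℂ}
    (hf : ∀ i, AnalyticGerm (f i)) : AnalyticGerm (shiftSum c f) := by
  refine AnalyticGerm.of_large (supBound c) fun N hN => ?_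
  have h := AnalyticGerm.sum (box n N) (fun i _ => (analyticGerm_sub_coord c i).mul (hf i)) N
  refine h.congr (Filter.Eventually.of_forall fun y => ?_)
  exact (shiftSum_eq c f (emb_sub_support c hN y)).symm

theorem dt_shiftSum (c : Times n) {f : Fin n × ℕ → Times n → ℂ}
    (hf : ∀ i, AnalyticGerm (f i)) (i : Fin n × ℕ) :
    HoldsNear fun t => dt i (shiftSum c f) t =
      f i t + shiftSum c (fun j t => dt i (f j) t) t := by
  refine HoldsNear.of_large (max (supBound c) (i.2 + 1)) fun N hN => ?_
  have hN1 : supBound c ≤ N := le_trans (le_max_left _ _) hN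
  have hN2 : i.2 < N := lt_of_lt_of_le (Nat.lt_succ_self _) (le_trans (le_max_right _ _) hN)
  have h1 := AnalyticGerm.dt_sum (box n N) (fun i _ => (analyticGerm_sub_coord c i).mul (hf i)) i N
  have h2 := HoldsNear.forall_finset (box n N) (fun j _ =>
    AnalyticGerm.dt_mul (analyticGerm_sub_coord c j) (hf j) i) N
  filter_upwards [h1, h2] with y hy1 hy2
  -- The whole line in the direction `i` stays in the slice, so the sum over the varying support is
  -- a sum over one fixed box before differentiation.
  have e : dt i (shiftSum c f) (emb N y) =
      dt i (fun t => ∑ j ∈ box n N, (t - c) j * f j t) (emb N y) := by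
    simp only [dt]
    congr 1
    ext s
    have : emb N y + Finsupp.single i s = emb N (y + s • dir N i) := by
      rw [emb_add, emb_smul_dir hN2]
    rw [this]
    exact shiftSum_eq c f (emb_sub_support c hN1 _)
  rw [e, hy1, shiftSum_eq c _ (emb_sub_support c hN1 y), Finset.sum_congr rfl hy2]
  simp only [dt_sub_coord, Finset.sum_add_distrib, ite_mul, one_mul, zero_mul]
  rw [Finset.sum_ite_eq, if_pos (by simpa using hN2)]

end Germs

end

/-! ### Genus zero: the functions `Ω`, the Principal Hierarchy and the derivatives of `𝓕_0` -/

section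

open FrobeniusManifold

namespace LeveltSystem

variable {n : ℕ} [NeZero n] {S : FrobeniusManifold n} (L : LeveltSystem S) {v : Fin n → ℂ}

/-- The vector `∇θ_{α,p}(v)`. -/
def col (i : Fin n × ℕ) (v : Fin n → ℂ) : Fin n → ℂ := fun γ => L.Th i.2 v γ i.1

/-- The bilinear form `η`. -/
def bil (S : FrobeniusManifold n) (x y : Fin n → ℂ) : ℂ := dotProduct x (S.η.mulVec y)

theorem bil_comm (x y : Fin n → ℂ) : bil S x y = bil S y x := by
  rw [bil, bil, Matrix.dotProduct_mulVec, dotProduct_comm, ← Matrix.mulVec_transpose, η_transpose]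

theorem bil_mulMatrix (hv : v ∈ S.carrier) (w x y : Fin n → ℂ) :
    bil S ((S.mulMatrix v w).mulVec x) y = bil S x ((S.mulMatrix v w).mulVec y) := by
  rw [bil, bil, Matrix.mulVec_mulVec, η_mul_mulMatrix hv, ← Matrix.mulVec_mulVec,
    Matrix.dotProduct_mulVec x, Matrix.vecMul_transpose]

theorem bil_zero_right (x : Fin n → ℂ) : bil S x 0 = 0 := by simp [bil]

theorem pd_θ_eq (i : Fin n × ℕ) (γ : Fin n) :
    pd γ (L.θ i.1 i.2) v = (S.η.mulVec (L.col i v)) γ := by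
  have : L.col i v = (S.η⁻¹).mulVec (fun γ => pd γ (L.θ i.1 i.2) v) := by
    ext γ; rfl
  rw [this, Matrix.mulVec_mulVec, η_mul_inv, Matrix.one_mulVec]

theorem Ω_eq (i j : Fin n × ℕ) (v : Fin n → ℂ) : L.Ω i j v =
    ∑ s ∈ Finset.range (j.2 + 1), (-1 : ℂ) ^ s *
      bil S (L.col (i.1, i.2 + 1 + s) v) (L.col (j.1, j.2 - s) v) := by
  refine Finset.sum_congr rfl fun s _ => ?_
  congr 1
  have h1 := fun γ => L.pd_θ_eq (v := v) (i.1, i.2 + 1 + s) γ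
  have h2 := fun γ => L.pd_θ_eq (v := v) (j.1, j.2 - s) γ
  simp only at h1 h2
  simp only [h1, h2]
  have : bil S (L.col (i.1, i.2 + 1 + s) v) (L.col (j.1, j.2 - s) v) =
      dotProduct (S.η.mulVec (L.col (i.1, i.2 + 1 + s) v))
        (S.η⁻¹.mulVec (S.η.mulVec (L.col (j.1, j.2 - s) v))) := by
    rw [Matrix.mulVec_mulVec, η_inv_mul, Matrix.one_mulVec, dotProduct_comm, ← bil, bil_comm]
  rw [this]
  simp only [dotProduct, Matrix.mulVec, Finset.mul_sum, Finset.sum_mul, mul_assoc]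

theorem Ω_zero (i : Fin n × ℕ) (β : Fin n) (v : Fin n → ℂ) :
    L.Ω i (β, 0) v = bil S (L.col (i.1, i.2 + 1) v) (L.col (β, 0) v) := by
  simp [Ω_eq]

/-- This is multiplication of the generating function of `Ω` by `z + w`, coefficient by coefficient.
It drives the inductions on `q` below. -/
theorem Ω_succ (α β : Fin n) (p q : ℕ) (v : Fin n → ℂ) :
    L.Ω (α, p) (β, q + 1) v = bil S (L.col (α, p + 1) v) (L.col (β, q + 1) v) -
      L.Ω (α, p + 1) (β, q) v := by
  rw [Ω_eq, Finset.sum_range_succ', Ω_eq, add_comm, sub_eq_add_neg, ← Finset.sum_neg_distrib]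
  congr 1
  · simp
  · refine Finset.sum_congr rfl fun s _ => ?_
    rw [show p + 1 + (s + 1) = p + 1 + 1 + s by ring, show q + 1 - (s + 1) = q - s by omega]
    ring

theorem sum_bil_eq_zero (hv : v ∈ S.carrier) (α β : Fin n) (p : ℕ) :
    ∑ j ∈ Finset.range (p + 2), (-1 : ℂ) ^ j *
      bil S (L.col (β, j) v) (L.col (α, p + 1 - j) v) = 0 := by
  have h := L.orthogonal v hv (p + 1)
  rw [if_neg (by omega)] at h
  have h2 := congrArg (fun X => (S.η * X) β α) h
  simp only [Finset.mul_sum, Matrix.mul_smul, Matrix.mul_zero] at h2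
  rw [Matrix.sum_apply] at h2
  rw [Matrix.zero_apply] at h2
  rw [← h2]
  refine Finset.sum_congr rfl fun j _ => ?_
  rw [Matrix.smul_apply, smul_eq_mul, ← Matrix.mul_assoc, η_mul_adj, Matrix.mul_assoc,
    Matrix.mul_apply]
  rfl

theorem Ω_comm_zero (hv : v ∈ S.carrier) (α β : Fin n) (p : ℕ) :
    L.Ω (β, 0) (α, p) v = L.Ω (α, p) (β, 0) v := by
  have h := L.sum_bil_eq_zero hv α β p
  rw [Finset.sum_range_succ'] at h
  rw [Ω_zero, bil_comm, Ω_eq]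
  simp only [pow_zero, one_mul, Nat.sub_zero] at h
  have e : ∑ s ∈ Finset.range (p + 1), (-1 : ℂ) ^ (s + 1) *
      bil S (L.col (β, s + 1) v) (L.col (α, p + 1 - (s + 1)) v) =
      -∑ s ∈ Finset.range (p + 1), (-1 : ℂ) ^ s *
        bil S (L.col (β, 0 + 1 + s) v) (L.col (α, p - s) v) := by
    rw [← Finset.sum_neg_distrib]
    refine Finset.sum_congr rfl fun s _ => ?_
    rw [show p + 1 - (s + 1) = p - s by omega, show 0 + 1 + s = s + 1 by ring]
    ring
  rw [e] at h
  linear_combination -h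

/-- Induction on `q` by `Ω_succ`; the case `q = 0` is the orthogonality `Θ^*(-z) Θ(z) = 1`, read as
an alternating sum of pairings. -/
theorem Ω_comm (hv : v ∈ S.carrier) (i j : Fin n × ℕ) : L.Ω i j v = L.Ω j i v := by
  obtain ⟨α, p⟩ := i
  obtain ⟨β, q⟩ := j
  induction q generalizing p with
  | zero => exact (L.Ω_comm_zero hv α β p).symm
  | succ q ih =>
    rw [Ω_succ, ih (p + 1), Ω_succ, bil_comm]
    ring

theorem analyticAt_col (hv : v ∈ S.carrier) (i : Fin n × ℕ) (γ : Fin n) :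
    AnalyticAt ℂ (fun v => L.col i v γ) v := L.analyticAt_Th hv _ _ _

theorem hasFDerivAt_col (hv : v ∈ S.carrier) (i : Fin n × ℕ) (γ : Fin n) :
    HasFDerivAt (fun v => L.col i v γ) (fderiv ℂ (fun v => L.col i v γ) v) v :=
  (L.analyticAt_col hv i γ).differentiableAt.hasFDerivAt

theorem fderiv_col_zero (hv : v ∈ S.carrier) (α γ : Fin n) (w : Fin n → ℂ) :
    fderiv ℂ (fun v => L.col (α, 0) v γ) v w = 0 := L.fderiv_Th_zero hv _ _ w

theorem fderiv_col_succ (hv : v ∈ S.carrier) (α : Fin n) (p : ℕ) (γ : Fin n) (w : Fin n → ℂ) :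
    fderiv ℂ (fun v => L.col (α, p + 1) v γ) v w =
      ((S.mulMatrix v w).mulVec (L.col (α, p) v)) γ := L.fderiv_Th_succ hv p γ α w

theorem analyticAt_bil_col (hv : v ∈ S.carrier) (i j : Fin n × ℕ) :
    AnalyticAt ℂ (fun v => bil S (L.col i v) (L.col j v)) v := by
  unfold bil Matrix.mulVec dotProduct
  exact Finset.analyticAt_fun_sum _ fun γ _ => (L.analyticAt_col hv i γ).fun_mul
    (Finset.analyticAt_fun_sum _ fun δ _ => analyticAt_const.fun_mul (L.analyticAt_col hv j δ))

theorem analyticAt_Ω (hv : v ∈ S.carrier) (i j : Fin n × ℕ) : AnalyticAt ℂ (L.Ω i j) v := by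
  rw [show L.Ω i j = fun v => _ from funext fun v => L.Ω_eq i j v]
  exact Finset.analyticAt_fun_sum _ fun s _ =>
    analyticAt_const.fun_mul (L.analyticAt_bil_col hv _ _)

theorem fderiv_bil_col (hv : v ∈ S.carrier) (i j : Fin n × ℕ) (w : Fin n → ℂ) :
    fderiv ℂ (fun v => bil S (L.col i v) (L.col j v)) v w =
      bil S (fun γ => fderiv ℂ (fun v => L.col i v γ) v w) (L.col j v) +
      bil S (L.col i v) (fun γ => fderiv ℂ (fun v => L.col j v γ) v w) := by
  have h := HasFDerivAt.fun_sum (u := Finset.univ) fun γ _ => (L.hasFDerivAt_col hv i γ).fun_mul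
      (HasFDerivAt.fun_sum (u := Finset.univ)
        fun δ _ => (L.hasFDerivAt_col hv j δ).const_mul (S.η γ δ))
  have h' : fderiv ℂ (fun v => bil S (L.col i v) (L.col j v)) v = _ := h.fderiv
  rw [h']
  simp only [bil, Matrix.mulVec, dotProduct, sum_apply, add_apply, smul_apply, smul_eq_mul]
  rw [Finset.sum_add_distrib, add_comm]
  congr 1
  exact Finset.sum_congr rfl fun γ _ => mul_comm _ _

/-- In the inductive step the product rule gives two terms. The one that differentiates the second
factor cancels, by self-adjointness of multiplication, against the derivative of the subtracted `Ω`.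
-/
theorem fderiv_Ω (hv : v ∈ S.carrier) (i j : Fin n × ℕ) (w : Fin n → ℂ) :
    fderiv ℂ (L.Ω i j) v w = bil S ((S.mulMatrix v w).mulVec (L.col i v)) (L.col j v) := by
  obtain ⟨α, p⟩ := i
  obtain ⟨β, q⟩ := j
  induction q generalizing p with
  | zero =>
    rw [show L.Ω (α, p) (β, 0) = fun v => _ from funext fun v => L.Ω_zero (α, p) β v,
      fderiv_bil_col L hv]
    simp only [L.fderiv_col_zero hv, L.fderiv_col_succ hv]
    rw [show (fun _ : Fin n => (0 : ℂ)) = 0 from rfl, bil_zero_right, add_zero]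
  | succ q ih =>
    rw [show L.Ω (α, p) (β, q + 1) = fun v => _ from funext fun v => L.Ω_succ α β p q v,
      fderiv_fun_sub (L.analyticAt_bil_col hv _ _).differentiableAt
        (L.analyticAt_Ω hv _ _).differentiableAt, sub_apply, ih,
      fderiv_bil_col L hv]
    simp only [L.fderiv_col_succ hv]
    rw [← bil_mulMatrix hv]
    ring

/-- The vectors `∇θ_{α,p-q}(v)`, zero for `p < q`. -/
def shiftCol (q : ℕ) (i : Fin n × ℕ) (v : Fin n → ℂ) : Fin n → ℂ :=
  if q ≤ i.2 then L.col (i.1, i.2 - q) v else 0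

theorem shiftCol_zero (i : Fin n × ℕ) (v : Fin n → ℂ) : L.shiftCol 0 i v = L.col i v := by
  simp [shiftCol]

theorem analyticAt_shiftCol (hv : v ∈ S.carrier) (q : ℕ) (i : Fin n × ℕ) (γ : Fin n) :
    AnalyticAt ℂ (fun v => L.shiftCol q i v γ) v := by
  unfold shiftCol
  split_ifs
  · exact L.analyticAt_col hv _ γ
  · exact analyticAt_const

theorem fderiv_shiftCol (hv : v ∈ S.carrier) (q : ℕ) (i : Fin n × ℕ) (γ : Fin n)
    (w : Fin n → ℂ) : fderiv ℂ (fun v => L.shiftCol q i v γ) v w =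
      ((S.mulMatrix v w).mulVec (L.shiftCol (q + 1) i v)) γ := by
  unfold shiftCol
  split_ifs with h1 h2 h2
  · rw [show i.2 - q = (i.2 - (q + 1)) + 1 by omega]
    exact L.fderiv_col_succ hv _ _ _ w
  · rw [show i.2 - q = 0 by omega, L.fderiv_col_zero hv, Matrix.mulVec_zero]; rfl
  · omega
  · simp

end LeveltSystem

namespace Solution

open LeveltSystem

variable {n : ℕ} [NeZero n] {S : FrobeniusManifold n} {L : LeveltSystem S} (s : Solution L)

theorem analyticGerm_v : AnalyticGerm s.v := s.analytic

theorem near_mem : HoldsNear fun t => s.v t ∈ S.carrier :=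
  s.analyticGerm_v.eventually_mem S.isOpen_carrier s.mem

/-- The vector `∂v/∂t^i`. -/
def dv (i : Fin n × ℕ) (t : Times n) : Fin n → ℂ := fun γ => dt i (fun t => s.v t γ) t

theorem analyticGerm_comp {H : (Fin n → ℂ) → ℂ} (hH : ∀ v ∈ S.carrier, AnalyticAt ℂ H v) :
    AnalyticGerm fun t => H (s.v t) := s.analyticGerm_v.comp (hH _ s.mem)

theorem dt_comp_v {H : (Fin n → ℂ) → ℂ} (hH : ∀ v ∈ S.carrier, AnalyticAt ℂ H v)
    (i : Fin n × ℕ) :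
    HoldsNear fun t => dt i (fun t => H (s.v t)) t = fderiv ℂ H (s.v t) (s.dv i t) := by
  refine ((s.analyticGerm_v.dt_comp i (hH _ s.mem)).and
    (s.analyticGerm_v.differentiableAt_line i)).mono fun t ht => ?_
  rw [ht.1.2]
  congr 1
  ext γ
  rw [deriv_pi fun k => differentiableAt_pi.1 ht.2 k]; rfl

/-- The vectors `y_q = ∑ (t - c)^{α,p} ∇θ_{α,p-q}(v)`. -/
def y (q : ℕ) (t : Times n) : Fin n → ℂ :=
  fun γ => shiftSum s.c (fun i t => L.shiftCol q i (s.v t) γ) t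

theorem analyticGerm_shiftCol (q : ℕ) (i : Fin n × ℕ) (γ : Fin n) :
    AnalyticGerm fun t => L.shiftCol q i (s.v t) γ :=
  s.analyticGerm_comp (H := fun v => L.shiftCol q i v γ)
    fun _ hv => L.analyticAt_shiftCol hv q i γ

theorem analyticGerm_y (q : ℕ) (γ : Fin n) : AnalyticGerm fun t => s.y q t γ :=
  analyticGerm_shiftSum s.c fun i => s.analyticGerm_shiftCol q i γ

theorem near_y_zero : HoldsNear fun t => s.y 0 t = 0 := by
  refine s.tsarev.mono fun t ht => ?_
  ext γ
  rw [Pi.zero_apply, ← ht γ]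
  simp only [y, shiftSum, shiftCol_zero]
  rfl

/-- A bilinear expression in the times can be pulled through a matrix. -/
theorem y_mulVec (q : ℕ) (X : Matrix (Fin n) (Fin n) ℂ) (t : Times n) (γ : Fin n) :
    (X.mulVec (s.y q t)) γ =
      shiftSum s.c (fun i t' => (X.mulVec (L.shiftCol q i (s.v t'))) γ) t := by
  simp only [y, shiftSum, Matrix.mulVec, dotProduct, Finsupp.sum, Finset.mul_sum]
  rw [Finset.sum_comm]
  refine Finset.sum_congr rfl fun i _ => Finset.sum_congr rfl fun β _ => by ring

/-- `S` is the sum of the given values once these agree at `t`. -/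
theorem shiftSum_congr {c : Times n} {f g : Fin n × ℕ → Times n → ℂ} {t : Times n}
    (h : ∀ i ∈ (t - c).support, f i t = g i t) : shiftSum c f t = shiftSum c g t :=
  Finset.sum_congr rfl fun i hi => by simp only [h i hi]

/-- The explicit time `t^i` contributes `shiftCol q i`. Differentiating `∇θ_{α,p-q}(v)` multiplies
by `∂v/∂t^i` and lowers the second index by one, which replaces `q` by `q + 1`. -/
theorem dt_y (i : Fin n × ℕ) (q : ℕ) : HoldsNear fun t =>
    (fun γ => dt i (fun t => s.y q t γ) t) = L.shiftCol q i (s.v t) +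
      (S.mulMatrix (s.v t) (s.dv i t)).mulVec (s.y (q + 1) t) := by
  have h1 := HoldsNear.forall_fintype (ι := Fin n) fun γ =>
    dt_shiftSum s.c (fun j => s.analyticGerm_shiftCol q j γ) i
  have h2 : HoldsNear fun t => ∀ j ∈ (t - s.c).support, ∀ γ,
      dt i (fun t => L.shiftCol q j (s.v t) γ) t =
      ((S.mulMatrix (s.v t) (s.dv i t)).mulVec (L.shiftCol (q + 1) j (s.v t))) γ := by
    refine HoldsNear.of_large (supBound s.c) fun N hN => ?_
    have := HoldsNear.forall_finset (box n N) (fun j _ =>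
      HoldsNear.forall_fintype (ι := Fin n) fun γ => s.dt_comp_v (H := fun v => L.shiftCol q j v γ)
        (fun _ hv => L.analyticAt_shiftCol hv q j γ) i) N
    filter_upwards [this, s.near_mem N] with y hy hm j hj γ
    have hj' : j ∈ box n N := by
      simpa using emb_sub_support s.c hN y j (Finsupp.mem_support_iff.1 hj)
    rw [hy j hj' γ, L.fderiv_shiftCol hm]
  refine (h1.and h2).mono fun t ht => ?_
  ext γ
  rw [Pi.add_apply, y_mulVec]
  refine (ht.1 γ).trans ?_
  congr 1
  exact shiftSum_congr fun j hj => ht.2 j hj γ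

/-- Differentiates the equation `y_0 = 0` of the solution. -/
theorem near_mulMatrix_y_dv (i : Fin n × ℕ) : HoldsNear fun t =>
    (S.mulMatrix (s.v t) (s.dv i t)).mulVec (s.y 1 t) = -L.col i (s.v t) := by
  have h0 : HoldsNear fun t => ∀ γ, dt i (fun t => s.y 0 t γ) t = 0 :=
    HoldsNear.forall_fintype fun γ =>
      ((s.near_y_zero.mono fun t ht => show s.y 0 t γ = 0 by rw [ht]; rfl).dt_congr i).mono
        fun t ht => ht.trans (dt_const 0 i t)
  refine ((s.dt_y i 0).and h0).mono fun t ht => ?_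
  have h := ht.1
  rw [shiftCol_zero] at h
  have h' : (fun γ => dt i (fun t => s.y 0 t γ) t) = 0 := funext ht.2
  rw [h'] at h
  rw [eq_neg_iff_add_eq_zero, add_comm]; exact h.symm

theorem col_zero_zero {v : Fin n → ℂ} (hv : v ∈ S.carrier) : L.col (0, 0) v = unit n := by
  ext γ
  simp only [col, L.Th_zero hv, unit, Matrix.one_apply, Pi.single_apply]

/-- For `i = (0, 0)` the right side of `near_mulMatrix_y_dv` is minus the unity: thus `v_x` is
invertible and equals `-y_1⁻¹`. -/
theorem near_vx_mul_y : HoldsNear fun t =>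
    S.mulMatrix (s.v t) (s.dv (0, 0) t) * S.mulMatrix (s.v t) (s.y 1 t) = -1 := by
  refine ((s.near_mulMatrix_y_dv (0, 0)).and s.near_mem).mono fun t ht => ?_
  rw [← mulMatrix_mulMatrix ht.2, ht.1, col_zero_zero ht.2, mulMatrix_neg, mulMatrix_unit ht.2]

/-- The Principal Hierarchy, obtained on multiplying `∂_i v · y_1 = -∇θ_i` by `v_x`. -/
theorem near_dv (i : Fin n × ℕ) : HoldsNear fun t =>
    s.dv i t = (S.mulMatrix (s.v t) (s.dv (0, 0) t)).mulVec (L.col i (s.v t)) := by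
  refine ((s.near_mulMatrix_y_dv i).and (s.near_vx_mul_y.and s.near_mem)).mono fun t ht => ?_
  obtain ⟨h1, h2, h3⟩ := ht
  rw [← neg_neg (L.col i (s.v t)), ← h1, mulMatrix_mulVec_comm h3 (s.dv i t) (s.y 1 t), Matrix.mulVec_neg,
    Matrix.mulVec_mulVec, h2, Matrix.neg_mulVec, Matrix.one_mulVec, neg_neg]

theorem analyticGerm_Ω (i j : Fin n × ℕ) : AnalyticGerm fun t => L.Ω i j (s.v t) :=
  s.analyticGerm_comp fun _ hv => L.analyticAt_Ω hv i j

theorem dt_Ω (k i j : Fin n × ℕ) : HoldsNear fun t => dt k (fun t => L.Ω i j (s.v t)) t =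
    bil S ((S.mulMatrix (s.v t) (s.dv k t)).mulVec (L.col i (s.v t))) (L.col j (s.v t)) :=
  ((s.dt_comp_v (fun _ hv => L.analyticAt_Ω hv i j) k).and s.near_mem).mono fun t ht => by
    rw [ht.1, L.fderiv_Ω ht.2]

/-- The first derivatives of the genus zero free energy. -/
def dF0 (i : Fin n × ℕ) : Times n → ℂ := shiftSum s.c fun j t => L.Ω i j (s.v t)

theorem analyticGerm_dF0 (i : Fin n × ℕ) : AnalyticGerm (s.dF0 i) :=
  analyticGerm_shiftSum s.c fun j => s.analyticGerm_Ω i j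

theorem F0_eq (t : Times n) : s.F0 t = 1 / 2 * shiftSum s.c s.dF0 t := by
  simp only [F0, dF0, shiftSum]
  congr 1
  refine Finsupp.sum_congr fun i _ => ?_
  rw [Finsupp.mul_sum]
  exact Finsupp.sum_congr fun j _ => by ring

theorem analyticGerm_F0 : AnalyticGerm s.F0 := by
  rw [show s.F0 = fun t => _ from funext s.F0_eq]
  exact (AnalyticGerm.const _).mul (analyticGerm_shiftSum s.c fun i => s.analyticGerm_dF0 i)

/-- When the derivative falls on `v`, the sum over the times turns `∇θ_j` into `y_0`, which
vanishes. Only the explicit time remains. -/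
theorem dt_dF0 (k i : Fin n × ℕ) : HoldsNear fun t => dt k (s.dF0 i) t = L.Ω i k (s.v t) := by
  have h1 := dt_shiftSum s.c (fun j => s.analyticGerm_Ω i j) k
  have h2 : HoldsNear fun t => ∀ j ∈ (t - s.c).support, dt k (fun t => L.Ω i j (s.v t)) t =
      bil S ((S.mulMatrix (s.v t) (s.dv k t)).mulVec (L.col i (s.v t))) (L.col j (s.v t)) := by
    refine HoldsNear.of_large (supBound s.c) fun N hN => ?_
    filter_upwards [HoldsNear.forall_finset (box n N) (fun j _ => s.dt_Ω k i j) N] with y hy j hj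
    exact hy j (by simpa using emb_sub_support s.c hN y j (Finsupp.mem_support_iff.1 hj))
  refine (h1.and (h2.and s.near_y_zero)).mono fun t ht => ?_
  obtain ⟨e1, e2, e3⟩ := ht
  refine e1.trans ?_
  rw [shiftSum_congr (g := fun j t' => bil S ((S.mulMatrix (s.v t) (s.dv k t)).mulVec
    (L.col i (s.v t))) (L.col j (s.v t'))) e2]
  have e4 : bil S ((S.mulMatrix (s.v t) (s.dv k t)).mulVec (L.col i (s.v t))) (s.y 0 t) =
      shiftSum s.c (fun j t' => bil S ((S.mulMatrix (s.v t) (s.dv k t)).mulVec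
    (L.col i (s.v t))) (L.col j (s.v t'))) t := by
    generalize (S.mulMatrix (s.v t) (s.dv k t)).mulVec (L.col i (s.v t)) = x
    have := fun γ => s.y_mulVec 0 S.η t γ
    simp only [bil, dotProduct, this, shiftSum, shiftCol_zero, Finsupp.sum, Finset.mul_sum]
    rw [Finset.sum_comm]
    exact Finset.sum_congr rfl fun j _ => Finset.sum_congr rfl fun γ _ => by ring
  rw [← e4, e3, bil_zero_right, add_zero]

/-- The two factors `t̃` of the quadratic expression contribute equally, because `Ω` is symmetric,
and this absorbs the factor `1/2`. -/
theorem dt_F0 (k : Fin n × ℕ) : HoldsNear fun t => dt k s.F0 t = s.dF0 k t := by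
  have h1 := dt_shiftSum s.c s.analyticGerm_dF0 k
  have h2 : HoldsNear fun t => ∀ j ∈ (t - s.c).support, dt k (s.dF0 j) t =
      L.Ω j k (s.v t) := by
    refine HoldsNear.of_large (supBound s.c) fun N hN => ?_
    filter_upwards [HoldsNear.forall_finset (box n N) (fun j _ => s.dt_dF0 k j) N] with y hy j hj
    exact hy j (by simpa using emb_sub_support s.c hN y j (Finsupp.mem_support_iff.1 hj))
  refine (h1.and (h2.and s.near_mem)).mono fun t ht => ?_
  obtain ⟨e1, e2, e3⟩ := ht
  rw [show s.F0 = fun t => _ from funext s.F0_eq, dt_const_mul, e1,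
    shiftSum_congr (g := fun j t => L.Ω k j (s.v t)) (fun j hj => (e2 j hj).trans (L.Ω_comm e3 j k))]
  change 1 / 2 * (s.dF0 k t + s.dF0 k t) = _
  ring

theorem dt_dt_F0 (i j : Fin n × ℕ) : HoldsNear fun t => dt i (dt j s.F0) t = L.Ω j i (s.v t) :=
  (((s.dt_F0 j).dt_congr i).and (s.dt_dF0 i j)).mono fun _ ht => ht.1.trans ht.2

end Solution

end

section

/-! ### Laurent series -/

namespace Laurent

/-- Formal Laurent series in `z`. -/
abbrev LS := LaurentSeries ℂ

theorem exists_lower (f : LS) : ∃ d : ℤ, ∀ j < d, f.coeff j = 0 :=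
  ⟨f.order, fun _ hj => HahnSeries.coeff_eq_zero_of_lt_order hj⟩

theorem coeff_mul_Icc {f g : LS} {a b : ℤ} (hf : ∀ j < a, f.coeff j = 0)
    (hg : ∀ j < b, g.coeff j = 0) (s : ℤ) :
    (f * g).coeff s = ∑ k ∈ Finset.Icc a (s - b), f.coeff k * g.coeff (s - k) := by
  rw [HahnSeries.coeff_mul]
  refine Finset.sum_of_injOn Prod.fst ?_ ?_ ?_ ?_
  · rintro ⟨i, j⟩ h ⟨i', j'⟩ h' hh
    simp only [Finset.mem_coe, Finset.mem_antidiagonal] at h h'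
    simp only at hh
    ext
    · exact hh
    · simp only; omega
  · rintro ⟨i, j⟩ h
    simp only [Finset.mem_coe, Finset.mem_antidiagonal, HahnSeries.mem_support] at h
    simp only [Finset.coe_Icc, Set.mem_Icc]
    have h1 : a ≤ i := by by_contra hh; exact h.1 (hf i (by omega))
    have h2 : b ≤ j := by by_contra hh; exact h.2.1 (hg j (by omega))
    omega
  · intro k _ hk
    by_contra hne
    apply hk
    refine ⟨(k, s - k), ?_, rfl⟩
    simp only [Finset.mem_coe, Finset.mem_antidiagonal, HahnSeries.mem_support]
    exact ⟨left_ne_zero_of_mul hne, right_ne_zero_of_mul hne, by ring⟩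
  · rintro ⟨i, j⟩ h
    simp only [Finset.mem_antidiagonal] at h
    simp only
    rw [show s - i = j by omega]

/-- Multiplication of the coefficients by a function of the exponent. -/
def scale (w : ℤ → ℂ) (f : LS) : LS :=
  ⟨fun s => w s * f.coeff s, f.isPWO_support.mono fun s hs => by
    simp only [Function.mem_support] at hs
    exact right_ne_zero_of_mul hs⟩

@[simp] theorem scale_coeff (w : ℤ → ℂ) (f : LS) (s : ℤ) :
    (scale w f).coeff s = w s * f.coeff s := rfl

/-- `z d/dz`. -/
def euler (f : LS) : LS := scale (fun s => (s : ℂ)) f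

/-- `f(z) ↦ f(-z)`. -/
def refl (f : LS) : LS := scale (fun s => (-1 : ℂ) ^ s) f

theorem euler_coeff (f : LS) (s : ℤ) : (euler f).coeff s = s * f.coeff s := rfl

theorem refl_coeff (f : LS) (s : ℤ) : (refl f).coeff s = (-1 : ℂ) ^ s * f.coeff s := rfl

theorem euler_add (f g : LS) : euler (f + g) = euler f + euler g := by
  ext s; simp [euler, mul_add]

theorem euler_sum {ι : Type*} (t : Finset ι) (f : ι → LS) :
    euler (∑ i ∈ t, f i) = ∑ i ∈ t, euler (f i) := by
  classical
  induction t using Finset.induction_on with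
  | empty => ext s; simp [euler]
  | insert i t hi ih => rw [Finset.sum_insert hi, Finset.sum_insert hi, euler_add, ih]

theorem refl_add (f g : LS) : refl (f + g) = refl f + refl g := by
  ext s; simp [refl, mul_add]

theorem refl_sub (f g : LS) : refl (f - g) = refl f - refl g := by
  ext s; simp [refl, mul_sub]

theorem refl_zero : refl 0 = 0 := by ext s; simp [refl]

theorem refl_sum {ι : Type*} (t : Finset ι) (f : ι → LS) :
    refl (∑ i ∈ t, f i) = ∑ i ∈ t, refl (f i) := by
  classical
  induction t using Finset.induction_on with
  | empty => simp [refl_zero]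
  | insert i t hi ih => rw [Finset.sum_insert hi, Finset.sum_insert hi, refl_add, ih]

theorem euler_mul (f g : LS) : euler (f * g) = euler f * g + f * euler g := by
  obtain ⟨a, ha⟩ := exists_lower f
  obtain ⟨b, hb⟩ := exists_lower g
  ext s
  have ha' : ∀ j < a, (euler f).coeff j = 0 := fun j hj => by rw [euler_coeff, ha j hj, mul_zero]
  have hb' : ∀ j < b, (euler g).coeff j = 0 := fun j hj => by rw [euler_coeff, hb j hj, mul_zero]
  rw [HahnSeries.coeff_add, euler_coeff, coeff_mul_Icc ha hb, coeff_mul_Icc ha' hb,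
    coeff_mul_Icc ha hb', ← Finset.sum_add_distrib, Finset.mul_sum]
  refine Finset.sum_congr rfl fun k _ => ?_
  rw [euler_coeff, euler_coeff]; push_cast; ring

theorem refl_mul (f g : LS) : refl (f * g) = refl f * refl g := by
  obtain ⟨a, ha⟩ := exists_lower f
  obtain ⟨b, hb⟩ := exists_lower g
  ext s
  have ha' : ∀ j < a, (refl f).coeff j = 0 := fun j hj => by rw [refl_coeff, ha j hj, mul_zero]
  have hb' : ∀ j < b, (refl g).coeff j = 0 := fun j hj => by rw [refl_coeff, hb j hj, mul_zero]
  rw [refl_coeff, coeff_mul_Icc ha hb, coeff_mul_Icc ha' hb', Finset.mul_sum]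
  refine Finset.sum_congr rfl fun k _ => ?_
  rw [refl_coeff, refl_coeff]
  have : (-1 : ℂ) ^ s = (-1 : ℂ) ^ k * (-1 : ℂ) ^ (s - k) := by
    rw [← zpow_add₀ (by norm_num)]; congr 1; ring
  rw [this]; ring

theorem refl_euler (f : LS) : refl (euler f) = euler (refl f) := by
  ext s; simp only [refl_coeff, euler_coeff]; ring

theorem refl_refl (f : LS) : refl (refl f) = f := by
  ext s
  rw [refl_coeff, refl_coeff, ← mul_assoc, ← mul_zpow]; simp

/-- The constant series. -/
def con (c : ℂ) : LS := HahnSeries.C c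

theorem con_mul_coeff (c : ℂ) (f : LS) (s : ℤ) : (con c * f).coeff s = c * f.coeff s := by
  simp [con]

theorem refl_con (c : ℂ) : refl (con c) = con c := by
  ext s
  rw [refl_coeff]
  by_cases h : s = 0
  · subst h; simp
  · simp [con, HahnSeries.coeff_single_of_ne h]

theorem euler_con (c : ℂ) : euler (con c) = 0 := by
  ext s
  rw [euler_coeff]
  by_cases h : s = 0
  · subst h; simp
  · simp [con, HahnSeries.coeff_single_of_ne h]

/-- The variable `z` and its powers. -/
def zpw (s : ℤ) : LS := HahnSeries.single s 1

theorem zpw_mul_coeff (s : ℤ) (f : LS) (j : ℤ) : (zpw s * f).coeff j = f.coeff (j - s) := by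
  have := HahnSeries.coeff_single_mul_add (r := (1 : ℂ)) (x := f) (a := j - s) (b := s)
  simpa [zpw] using this

theorem refl_zpw (s : ℤ) : refl (zpw s) = con ((-1) ^ s) * zpw s := by
  ext j
  rw [con_mul_coeff, refl_coeff]
  by_cases h : j = s
  · subst h; rfl
  · simp [zpw, HahnSeries.coeff_single_of_ne h]

/-- A power series as a Laurent series. -/
def ofPS (g : PowerSeries ℂ) : LS := HahnSeries.ofPowerSeries ℤ ℂ g

theorem ofPS_coeff (g : PowerSeries ℂ) (s : ℤ) :
    (ofPS g).coeff s = if s < 0 then 0 else PowerSeries.coeff s.natAbs g := by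
  rw [ofPS]; exact PowerSeries.coeff_coe g s

variable {n : ℕ}

/-! ### Vectors and matrices of Laurent series -/

/-- Vectors of Laurent series. -/
abbrev W (n : ℕ) := Fin n → LS

/-- The coefficient of `z^s`. -/
def cf (s : ℤ) : W n →ₗ[ℂ] (Fin n → ℂ) where
  toFun f := fun i => (f i).coeff s
  map_add' _ _ := rfl
  map_smul' _ _ := rfl

theorem cf_apply (s : ℤ) (f : W n) (i : Fin n) : cf s f i = (f i).coeff s := rfl

/-- The vector `x z^s`. -/
def mono (s : ℤ) : (Fin n → ℂ) →ₗ[ℂ] W n where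
  toFun x := fun i => HahnSeries.single s (x i)
  map_add' _ _ := by ext i; simp
  map_smul' c x := by
    ext i j
    change (HahnSeries.single s (c * x i)).coeff j = c * (HahnSeries.single s (x i)).coeff j
    rw [HahnSeries.coeff_single, HahnSeries.coeff_single]; split_ifs <;> simp

theorem mono_apply (s : ℤ) (x : Fin n → ℂ) (i : Fin n) : mono s x i = HahnSeries.single s (x i) := rfl

theorem cf_mono (s j : ℤ) (x : Fin n → ℂ) : cf j (mono s x) = if j = s then x else 0 := by
  ext i
  rw [cf_apply, mono_apply, HahnSeries.coeff_single]
  split_ifs <;> rfl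

/-- Matrices of power series in `z` with given coefficients. -/
def PM (f : ℕ → Matrix (Fin n) (Fin n) ℂ) : Matrix (Fin n) (Fin n) (PowerSeries ℂ) :=
  fun i j => PowerSeries.mk fun p => f p i j

theorem PM_mul (f g : ℕ → Matrix (Fin n) (Fin n) ℂ) :
    PM f * PM g = PM fun p => ∑ k ∈ Finset.range (p + 1), f k * g (p - k) := by
  ext i j p
  simp only [Matrix.mul_apply, PM, map_sum, PowerSeries.coeff_mul, PowerSeries.coeff_mk]
  rw [Finset.sum_comm, Finset.Nat.sum_antidiagonal_eq_sum_range_succ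
    (fun a b => ∑ x, f a i x * g b x j)]
  rw [Matrix.sum_apply]
  rfl

/-- The same as Laurent series. -/
def LM (f : ℕ → Matrix (Fin n) (Fin n) ℂ) : Matrix (Fin n) (Fin n) LS :=
  fun i j => ofPS (PowerSeries.mk fun p => f p i j)

theorem LM_mul (f g : ℕ → Matrix (Fin n) (Fin n) ℂ) :
    LM f * LM g = LM fun p => ∑ k ∈ Finset.range (p + 1), f k * g (p - k) := by
  have h : ∀ f : ℕ → Matrix (Fin n) (Fin n) ℂ, LM f = (PM f).map (HahnSeries.ofPowerSeries ℤ ℂ) :=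
    fun f => rfl
  rw [h, h, h, ← Matrix.map_mul, PM_mul]

theorem LM_coeff (f : ℕ → Matrix (Fin n) (Fin n) ℂ) (i j : Fin n) (s : ℤ) :
    (LM f i j).coeff s = if s < 0 then 0 else f s.natAbs i j := by
  rw [LM, ofPS_coeff, PowerSeries.coeff_mk]

theorem LM_add (f g : ℕ → Matrix (Fin n) (Fin n) ℂ) :
    LM f + LM g = LM fun p => f p + g p := by
  ext i j s
  rw [Matrix.add_apply, HahnSeries.coeff_add, LM_coeff, LM_coeff, LM_coeff]
  split_ifs <;> simp

theorem LM_one : LM (fun p => if p = 0 then (1 : Matrix (Fin n) (Fin n) ℂ) else 0) = 1 := by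
  ext i j s
  rw [LM_coeff, Matrix.one_apply]
  by_cases h1 : s = 0
  · subst h1
    by_cases h2 : i = j <;> simp [h2, Matrix.one_apply]
  · have h3 : s.natAbs ≠ 0 := by omega
    by_cases h2 : i = j <;> simp [h2, h3, HahnSeries.coeff_one, h1]

theorem euler_LM (f : ℕ → Matrix (Fin n) (Fin n) ℂ) (i j : Fin n) :
    euler (LM f i j) = LM (fun p => (p : ℂ) • f p) i j := by
  ext s
  rw [euler_coeff, LM_coeff, LM_coeff]
  split_ifs with h
  · simp
  · have : ((s.natAbs : ℕ) : ℂ) = (s : ℂ) := by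
      conv_rhs => rw [show s = ((s.natAbs : ℕ) : ℤ) by omega]
      rw [Int.cast_natCast]
    rw [Matrix.smul_apply, this]; rfl

theorem refl_LM (f : ℕ → Matrix (Fin n) (Fin n) ℂ) (i j : Fin n) :
    refl (LM f i j) = LM (fun p => (-1 : ℂ) ^ p • f p) i j := by
  ext s
  rw [refl_coeff, LM_coeff, LM_coeff]
  split_ifs with h
  · simp
  · rw [Matrix.smul_apply, smul_eq_mul]
    congr 1
    rw [← zpow_natCast]; congr 1; omega

/-- `f` has no powers `z^j`, `j < d`. -/
def Ge (d : ℤ) (f : W n) : Prop := ∀ j < d, cf j f = 0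

theorem Ge.mono' {d e : ℤ} (h : e ≤ d) {f : W n} (hf : Ge d f) : Ge e f :=
  fun j hj => hf j (by omega)

theorem Ge.add {d : ℤ} {f g : W n} (hf : Ge d f) (hg : Ge d g) : Ge d (f + g) :=
  fun j hj => by rw [map_add, hf j hj, hg j hj, add_zero]

theorem Ge.sum {ι : Type*} {d : ℤ} {t : Finset ι} {f : ι → W n} (hf : ∀ i ∈ t, Ge d (f i)) :
    Ge d (∑ i ∈ t, f i) :=
  fun j hj => by rw [map_sum]; exact Finset.sum_eq_zero fun i hi => hf i hi j hj

theorem ge_mono (s : ℤ) (x : Fin n → ℂ) : Ge s (mono s x) :=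
  fun j hj => by rw [cf_mono, if_neg (by omega)]

theorem exists_ge (f : W n) : ∃ d, Ge d f := by
  choose d hd using fun i => exists_lower (f i)
  obtain ⟨m, hm⟩ := (Set.finite_range d).bddBelow
  refine ⟨m, fun j hj => ?_⟩
  ext i
  exact hd i j (lt_of_lt_of_le hj (hm ⟨i, rfl⟩))

theorem cf_LM_mulVec (f : ℕ → Matrix (Fin n) (Fin n) ℂ) {g : W n} {d : ℤ} (hg : Ge d g) (s : ℤ)
    (K : ℕ) (hK : s - K < d) :
    cf s ((LM f).mulVec g) = ∑ k ∈ Finset.range K, (f k).mulVec (cf (s - k) g) := by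
  ext i
  simp only [cf_apply, Matrix.mulVec, dotProduct, Finset.sum_apply, HahnSeries.coeff_sum]
  rw [Finset.sum_comm]
  refine Finset.sum_congr rfl fun j _ => ?_
  have h1 : ∀ m < (0 : ℤ), (LM f i j).coeff m = 0 := fun m hm => by rw [LM_coeff, if_pos hm]
  rw [coeff_mul_Icc h1 fun m hm => congrFun (hg m hm) j]
  refine Finset.sum_of_injOn Int.toNat ?_ ?_ ?_ ?_
  · intro a ha b hb h
    simp only [Finset.coe_Icc, Set.mem_Icc] at ha hb
    omega
  · intro a ha
    simp only [Finset.coe_Icc, Set.mem_Icc] at ha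
    simp only [Finset.coe_range, Set.mem_Iio]
    omega
  · intro k _ hk
    have : cf (s - k) g = 0 := by
      by_contra hne
      apply hk
      refine ⟨(k : ℤ), ?_, by simp⟩
      simp only [Finset.coe_Icc, Set.mem_Icc]
      by_contra hlt
      exact hne (hg _ (by omega))
    rw [← cf_apply (s - k) g j, this, Pi.zero_apply, mul_zero]
  · intro k hk
    simp only [Finset.mem_Icc] at hk
    rw [LM_coeff, if_neg (by omega), show k.natAbs = k.toNat by omega,
      show ((k.toNat : ℕ) : ℤ) = k by omega]

end Laurent

end

/-! ### The operator `J` and its self-adjointness for a residue pairing -/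

section

namespace Laurent

variable {n : ℕ}

theorem Ge.LM_mulVec (f : ℕ → Matrix (Fin n) (Fin n) ℂ) {g : W n} {d : ℤ} (hg : Ge d g) :
    Ge d ((LM f).mulVec g) := by
  intro j hj
  rw [cf_LM_mulVec f hg j 0 (by simpa using hj)]; simp

theorem smul_eq_con (c : ℂ) (f : LS) : c • f = con c * f := by
  ext s; rw [con_mul_coeff, HahnSeries.coeff_smul, smul_eq_mul]

theorem mulVec_smul_LS (X : Matrix (Fin n) (Fin n) LS) (c : ℂ) (f : W n) :
    X.mulVec (c • f) = c • X.mulVec f := by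
  ext1 i
  simp only [Matrix.mulVec, dotProduct, Pi.smul_apply, smul_eq_con, Finset.mul_sum]
  exact Finset.sum_congr rfl fun j _ => mul_left_comm _ _ _

/-- Multiplication by a matrix of Laurent series. -/
def mulL (X : Matrix (Fin n) (Fin n) LS) : W n →ₗ[ℂ] W n where
  toFun f := X.mulVec f
  map_add' := Matrix.mulVec_add X
  map_smul' := fun c f => mulVec_smul_LS X c f

/-- The operator `z⁻¹ (X(z) - 1/2 - z d/dz)`. -/
def J (X : Matrix (Fin n) (Fin n) LS) : W n →ₗ[ℂ] W n where
  toFun f := fun i => zpw (-1) * (X.mulVec f i - con (1 / 2) * f i - euler (f i))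
  map_add' f g := by
    ext i j
    simp only [Matrix.mulVec_add, Pi.add_apply, euler_add]
    congr 1
    ring
  map_smul' c f := by
    ext i j
    simp only [mulVec_smul_LS, Pi.smul_apply, RingHom.id_apply, HahnSeries.coeff_smul,
      zpw_mul_coeff, HahnSeries.coeff_sub, con_mul_coeff, euler_coeff, smul_eq_mul]
    ring

theorem J_apply (X : Matrix (Fin n) (Fin n) LS) (f : W n) (i : Fin n) :
    J X f i = zpw (-1) * (X.mulVec f i - con (1 / 2) * f i - euler (f i)) := rfl

theorem cf_J (X : Matrix (Fin n) (Fin n) LS) (f : W n) (s : ℤ) :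
    cf s (J X f) = cf (s + 1) (X.mulVec f) - ((1 / 2 : ℂ) + ((s : ℂ) + 1)) • cf (s + 1) f := by
  ext i
  rw [cf_apply, J_apply, zpw_mul_coeff, HahnSeries.coeff_sub, HahnSeries.coeff_sub, con_mul_coeff,
    euler_coeff]
  simp only [Pi.sub_apply, Pi.smul_apply, cf_apply, smul_eq_mul, sub_neg_eq_add]
  push_cast; ring

theorem Ge.J (f : ℕ → Matrix (Fin n) (Fin n) ℂ) {g : W n} {d : ℤ} (hg : Ge d g) :
    Ge (d - 1) (J (LM f) g) := by
  intro j hj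
  rw [cf_J, hg.LM_mulVec f _ (by omega), hg _ (by omega)]; simp

theorem Ge.J_pow (f : ℕ → Matrix (Fin n) (Fin n) ℂ) {g : W n} {d : ℤ} (hg : Ge d g) (M : ℕ) :
    Ge (d - M) ((Laurent.J (LM f) ^ M) g) := by
  induction M with
  | zero => simpa using hg
  | succ M ih =>
    rw [pow_succ', Module.End.mul_apply]
    exact (ih.J f).mono' (by push_cast; omega)

/-- The gauge transformation of `J`. -/
theorem mulL_J {X Y T : Matrix (Fin n) (Fin n) LS} (h : T.map euler + T * X = Y * T) (f : W n) :
    mulL T (J X f) = J Y (mulL T f) := by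
  ext1 i
  have h1 := fun j => congrFun (congrFun h i) j
  simp only [Matrix.add_apply, Matrix.map_apply] at h1
  have e1 : mulL T (J X f) i =
      zpw (-1) * ((T * X).mulVec f i - con (1 / 2) * T.mulVec f i - ∑ j, T i j * euler (f j)) := by
    change ∑ j, T i j * (zpw (-1) * (X.mulVec f j - con (1 / 2) * f j - euler (f j))) = _
    rw [← Matrix.mulVec_mulVec]
    simp only [Matrix.mulVec, dotProduct, Finset.mul_sum, mul_sub, Finset.sum_sub_distrib]
    refine congrArg₂ _ (congrArg₂ _ ?_ ?_) ?_
    · exact Finset.sum_congr rfl fun j _ => Finset.sum_congr rfl fun k _ => by ring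
    · exact Finset.sum_congr rfl fun j _ => by ring
    · exact Finset.sum_congr rfl fun j _ => by ring
  have e2 : euler (T.mulVec f i) = ∑ j, euler (T i j) * f j + ∑ j, T i j * euler (f j) := by
    simp only [Matrix.mulVec, dotProduct, euler_sum, euler_mul, Finset.sum_add_distrib]
  have e3 : Y.mulVec (T.mulVec f) i = ∑ j, euler (T i j) * f j + (T * X).mulVec f i := by
    rw [Matrix.mulVec_mulVec, ← h, Matrix.add_mulVec]; rfl
  rw [e1, J_apply]
  change _ = zpw (-1) * (Y.mulVec (T.mulVec f) i - con (1 / 2) * T.mulVec f i -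
    euler (T.mulVec f i))
  rw [e2, e3]
  ring

theorem mulL_J_pow {X Y T : Matrix (Fin n) (Fin n) LS} (h : T.map euler + T * X = Y * T) (M : ℕ)
    (f : W n) : mulL T ((J X ^ M) f) = (J Y ^ M) (mulL T f) := by
  induction M with
  | zero => rfl
  | succ M ih => rw [pow_succ', pow_succ', Module.End.mul_apply, Module.End.mul_apply, mulL_J h, ih]

/-! ### The residue pairing -/

/-- The Laurent series `f(-z)ᵀ η g(z)`. -/
def pairS (η : Matrix (Fin n) (Fin n) ℂ) (f g : W n) : LS :=
  ∑ i, ∑ j, refl (f i) * (con (η i j) * g j)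

/-- The coefficient of `z⁻²` in `f(-z)ᵀ η g(z)`. -/
def pair (η : Matrix (Fin n) (Fin n) ℂ) (f g : W n) : ℂ := (pairS η f g).coeff (-2)

variable (η : Matrix (Fin n) (Fin n) ℂ)

theorem pair_add_left (f f' g : W n) : pair η (f + f') g = pair η f g + pair η f' g := by
  simp only [pair, pairS, Pi.add_apply, refl_add, add_mul, Finset.sum_add_distrib,
    HahnSeries.coeff_add]

theorem pair_add_right (f g g' : W n) : pair η f (g + g') = pair η f g + pair η f g' := by
  simp only [pair, pairS, Pi.add_apply, mul_add, Finset.sum_add_distrib,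
    HahnSeries.coeff_add]

theorem pair_smul_left (c : ℂ) (f g : W n) : pair η (c • f) g = c * pair η f g := by
  have : pairS η (c • f) g = con c * pairS η f g := by
    simp only [pairS, Pi.smul_apply, smul_eq_con, refl_mul, refl_con, Finset.mul_sum]
    exact Finset.sum_congr rfl fun i _ => Finset.sum_congr rfl fun j _ => by ring
  rw [pair, this, con_mul_coeff, pair]

theorem pair_smul_right (c : ℂ) (f g : W n) : pair η f (c • g) = c * pair η f g := by
  have : pairS η f (c • g) = con c * pairS η f g := by
    simp only [pairS, Pi.smul_apply, smul_eq_con, Finset.mul_sum]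
    exact Finset.sum_congr rfl fun i _ => Finset.sum_congr rfl fun j _ => by ring
  rw [pair, this, con_mul_coeff, pair]

theorem pair_zero_left (g : W n) : pair η 0 g = 0 := by
  have := pair_smul_left η 0 0 g
  simpa using this

theorem pair_zero_right (f : W n) : pair η f 0 = 0 := by
  have := pair_smul_right η 0 f 0
  simpa using this

theorem pair_sum_left {ι : Type*} (t : Finset ι) (f : ι → W n) (g : W n) :
    pair η (∑ i ∈ t, f i) g = ∑ i ∈ t, pair η (f i) g := by
  classical
  induction t using Finset.induction_on with
  | empty => simp [pair_zero_left]
  | insert i t hi ih => rw [Finset.sum_insert hi, Finset.sum_insert hi, pair_add_left, ih]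

theorem pair_sum_right {ι : Type*} (t : Finset ι) (f : W n) (g : ι → W n) :
    pair η f (∑ i ∈ t, g i) = ∑ i ∈ t, pair η f (g i) := by
  classical
  induction t using Finset.induction_on with
  | empty => simp [pair_zero_right]
  | insert i t hi ih => rw [Finset.sum_insert hi, Finset.sum_insert hi, pair_add_right, ih]

theorem pair_sub_left (f f' g : W n) : pair η (f - f') g = pair η f g - pair η f' g := by
  rw [sub_eq_add_neg, pair_add_left, ← neg_one_smul ℂ, pair_smul_left]; ring

theorem pair_sub_right (f g g' : W n) : pair η f (g - g') = pair η f g - pair η f g' := by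
  rw [sub_eq_add_neg, pair_add_right, ← neg_one_smul ℂ, pair_smul_right]; ring

/-- The substitution `z ↦ -z` exchanges the arguments of `pairS` and fixes the coefficient of the
even power `z⁻²`. -/
theorem pair_comm (hη : η.IsSymm) (f g : W n) : pair η f g = pair η g f := by
  have h : refl (pairS η f g) = pairS η g f := by
    simp only [pairS, refl_sum, refl_mul, refl_refl, refl_con]
    rw [Finset.sum_comm]
    refine Finset.sum_congr rfl fun i _ => Finset.sum_congr rfl fun j _ => ?_
    rw [hη.apply i j]; ring
  rw [pair, pair, ← h, refl_coeff]; norm_num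

theorem pair_eq_zero_of_ge {f g : W n} {d e : ℤ} (hf : Ge d f) (hg : Ge e g) (h : -2 < d + e) :
    pair η f g = 0 := by
  simp only [pair, pairS, HahnSeries.coeff_sum]
  refine Finset.sum_eq_zero fun i _ => Finset.sum_eq_zero fun j _ => ?_
  have h1 : ∀ k < d, (refl (f i)).coeff k = 0 := fun k hk => by
    rw [refl_coeff, ← cf_apply k f i, hf k hk]; simp
  have h2 : ∀ k < e, (con (η i j) * g j).coeff k = 0 := fun k hk => by
    rw [con_mul_coeff, ← cf_apply k g j, hg k hk]; simp
  rw [coeff_mul_Icc h1 h2, Finset.Icc_eq_empty (by omega), Finset.sum_empty]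

theorem pair_mono_left (a : ℤ) (x : Fin n → ℂ) (g : W n) :
    pair η (mono a x) g = (-1) ^ a * dotProduct x (η.mulVec (cf (-2 - a) g)) := by
  simp only [pair, pairS, HahnSeries.coeff_sum, dotProduct, Matrix.mulVec, Finset.mul_sum]
  refine Finset.sum_congr rfl fun i _ => Finset.sum_congr rfl fun j _ => ?_
  have : refl (mono a x i) = con ((-1) ^ a * x i) * zpw a := by
    ext s
    rw [refl_coeff, con_mul_coeff, mono_apply, zpw, HahnSeries.coeff_single,
      HahnSeries.coeff_single]
    split_ifs with h
    · rw [h]; ring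
    · simp
  rw [this, mul_assoc, con_mul_coeff, zpw_mul_coeff, con_mul_coeff, cf_apply]; ring

/-- `J` is self-adjoint. -/
theorem pair_J {X : Matrix (Fin n) (Fin n) LS}
    (hX : (X.map refl).transpose * η.map con = -(η.map con * X)) (f g : W n) :
    pair η f (J X g) = pair η (J X f) g := by
  have hA : ∑ i, ∑ j, refl (X.mulVec f i) * (con (η i j) * g j) =
      -∑ i, ∑ j, refl (f i) * (con (η i j) * X.mulVec g j) := by
    have e1 : ∑ i, ∑ j, refl (X.mulVec f i) * (con (η i j) * g j) =
        dotProduct (fun k => refl (f k)) (((X.map refl).transpose * η.map con).mulVec g) := by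
      rw [← Matrix.mulVec_mulVec, Matrix.dotProduct_mulVec, Matrix.vecMul_transpose]
      simp only [dotProduct, Matrix.mulVec, refl_sum, refl_mul, Finset.mul_sum, Matrix.map_apply]
    have e2 : ∑ i, ∑ j, refl (f i) * (con (η i j) * X.mulVec g j) =
        dotProduct (fun k => refl (f k)) ((η.map con * X).mulVec g) := by
      rw [← Matrix.mulVec_mulVec]
      simp only [dotProduct, Matrix.mulVec, Finset.mul_sum, Matrix.map_apply]
    rw [e1, e2, hX, Matrix.neg_mulVec, dotProduct_neg]
  have hE : euler (pairS η f g) = ∑ i, ∑ j, euler (refl (f i)) * (con (η i j) * g j) +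
      ∑ i, ∑ j, refl (f i) * (con (η i j) * euler (g j)) := by
    simp only [pairS, euler_sum, euler_mul, euler_con, zero_mul, zero_add, Finset.sum_add_distrib]
  have r1 : pairS η f (J X g) = zpw (-1) *
      (∑ i, ∑ j, refl (f i) * (con (η i j) * X.mulVec g j) - con (1 / 2) * pairS η f g -
        ∑ i, ∑ j, refl (f i) * (con (η i j) * euler (g j))) := by
    simp only [pairS, J_apply, Finset.mul_sum, mul_sub, Finset.sum_sub_distrib]
    refine congrArg₂ _ (congrArg₂ _ ?_ ?_) ?_ <;>
      exact Finset.sum_congr rfl fun i _ => Finset.sum_congr rfl fun j _ => by ring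
  have r2 : pairS η (J X f) g = zpw (-1) *
      (-(∑ i, ∑ j, refl (X.mulVec f i) * (con (η i j) * g j)) + con (1 / 2) * pairS η f g +
        ∑ i, ∑ j, euler (refl (f i)) * (con (η i j) * g j)) := by
    have hz : refl (zpw (-1)) = - zpw (-1) := by
      rw [refl_zpw]; ext s; rw [con_mul_coeff]; norm_num
    simp only [pairS, J_apply, refl_mul, refl_sub, refl_con, refl_euler, hz, Finset.mul_sum, mul_add,
      ← Finset.sum_neg_distrib, ← Finset.sum_add_distrib]
    exact Finset.sum_congr rfl fun i _ => Finset.sum_congr rfl fun j _ => by ring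
  -- With `P = pairS η f g`, the two halves `1/2` add up and the difference is `-z⁻¹ (zP)'`. Its
  -- coefficient of `z⁻²` is the residue of a derivative, hence zero.
  have r3 : pairS η f (J X g) - pairS η (J X f) g =
      zpw (-1) * (-(con 1 * pairS η f g) - euler (pairS η f g)) := by
    have hc : con (1 : ℂ) = con (1 / 2) + con (1 / 2) := by
      rw [con, con, ← map_add]; norm_num
    rw [r1, r2, hE, hA, hc]; ring
  have := congrArg (fun x : LS => x.coeff (-2)) r3
  simp only [HahnSeries.coeff_sub, zpw_mul_coeff, HahnSeries.coeff_neg, con_mul_coeff,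
    euler_coeff] at this
  rw [pair, pair, ← sub_eq_zero, this]
  push_cast; ring

theorem pair_J_pow {X : Matrix (Fin n) (Fin n) LS}
    (hX : (X.map refl).transpose * η.map con = -(η.map con * X)) (M : ℕ) (f g : W n) :
    pair η f ((J X ^ M) g) = pair η ((J X ^ M) f) g := by
  induction M generalizing f with
  | zero => rfl
  | succ M ih =>
    rw [pow_succ', Module.End.mul_apply, pair_J η hX, ih, ← Module.End.mul_apply, ← pow_succ,
      pow_succ']

theorem pair_mulL {T : Matrix (Fin n) (Fin n) LS}
    (hT : (T.map refl).transpose * η.map con * T = η.map con) (f g : W n) :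
    pair η (mulL T f) (mulL T g) = pair η f g := by
  have e : ∀ f g : W n, pairS η f g = dotProduct (fun k => refl (f k)) ((η.map con).mulVec g) := by
    intro f g
    simp only [pairS, dotProduct, Matrix.mulVec, Finset.mul_sum, Matrix.map_apply]
  have e2 : (fun k => refl (mulL T f k)) = (T.map refl).mulVec fun k => refl (f k) := by
    ext1 k
    change refl (∑ j, T k j * f j) = ∑ j, refl (T k j) * refl (f j)
    rw [refl_sum]; exact Finset.sum_congr rfl fun j _ => refl_mul _ _
  rw [pair, pair, e, e, e2]
  congr 1
  rw [← Matrix.vecMul_transpose, ← Matrix.dotProduct_mulVec]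
  change dotProduct _ (Matrix.mulVec _ (Matrix.mulVec _ (Matrix.mulVec T g))) = _
  rw [Matrix.mulVec_mulVec, Matrix.mulVec_mulVec, hT]

end Laurent

end

/-! ### The Virasoro coefficients as matrix elements of powers of `J` -/

section

open FrobeniusManifold Laurent

namespace LeveltSystem

variable {n : ℕ} [NeZero n] {S : FrobeniusManifold n} (L : LeveltSystem S) {v : Fin n → ℂ}

/-! ### The recursion for the coefficients of the Virasoro operators -/

theorem hasseDeriv_succ_mul_X_add_C (g : Polynomial ℂ) (c : ℂ) (j : ℕ) :
    Polynomial.hasseDeriv (j + 1) (g * (Polynomial.X + Polynomial.C c)) =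
      Polynomial.hasseDeriv (j + 1) g * (Polynomial.X + Polynomial.C c) +
        Polynomial.hasseDeriv j g := by
  rw [Polynomial.hasseDeriv_mul]
  rw [Finset.Nat.sum_antidiagonal_eq_sum_range_succ
    (fun a b => Polynomial.hasseDeriv a g * Polynomial.hasseDeriv b (Polynomial.X + Polynomial.C c)),
    Finset.sum_range_succ, Finset.sum_range_succ]
  have h0 : ∀ k ∈ Finset.range j, Polynomial.hasseDeriv k g *
      Polynomial.hasseDeriv (j + 1 - k) (Polynomial.X + Polynomial.C c) = 0 := by
    intro k hk
    rw [Finset.mem_range] at hk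
    rw [Polynomial.hasseDeriv_eq_zero_of_lt_natDegree (Polynomial.X + Polynomial.C c) (j + 1 - k)
      (by rw [Polynomial.natDegree_X_add_C]; omega), mul_zero]
  rw [Finset.sum_eq_zero h0, Nat.sub_self, Polynomial.hasseDeriv_zero', zero_add,
    show j + 1 - j = 1 by omega, Polynomial.hasseDeriv_one]
  simp [add_comm]

/-- By `[μ, R_k] = k R_k`, a product of `R`'s of total degree `r` passes through `μ` at the price of
a shift of `μ` by `r`. -/
theorem coeff_R_pow_mul_μ (j r : ℕ) :
    PowerSeries.coeff r (PowerSeries.mk L.R ^ j) * L.μ =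
      (L.μ - (r : ℂ) • 1) * PowerSeries.coeff r (PowerSeries.mk L.R ^ j) := by
  induction j generalizing r with
  | zero =>
    rw [pow_zero, PowerSeries.coeff_one]
    split_ifs with h
    · subst h; simp
    · simp
  | succ j ih =>
    rw [pow_succ', PowerSeries.coeff_mul, Finset.sum_mul, Finset.mul_sum]
    refine Finset.sum_congr rfl fun ab hab => ?_
    rw [Finset.HasAntidiagonal.mem_antidiagonal] at hab
    rw [PowerSeries.coeff_mk, Matrix.mul_assoc, ih, ← Matrix.mul_assoc, ← Matrix.mul_assoc]
    congr 1
    have h := L.comm_R ab.1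
    rw [Matrix.mul_sub, Matrix.sub_mul, Matrix.mul_smul, Matrix.smul_mul, Matrix.mul_one,
      Matrix.one_mul, sub_eq_iff_eq_add.1 h, ← hab]
    push_cast
    rw [add_smul]; abel

theorem expR_zero (x : ℂ) (r : ℕ) : L.expR 0 x r = if r = 0 then 1 else 0 := by
  simp [expR, PowerSeries.coeff_one]

/-- By the Leibniz rule the new factor `X + x + M` either survives, and is moved to the left through
the `R`'s with the shift by `r`, or is differentiated, which frees one more `R`. The result has the
shape of one application of `J`. -/
theorem expR_succ (M : ℕ) (x : ℂ) (r : ℕ) :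
    L.expR (M + 1) x r = (L.μ + (x + M - r) • 1) * L.expR M x r +
      ∑ k ∈ Finset.range (r + 1), L.R k * L.expR M x (r - k) := by
  set g : Polynomial ℂ := ∏ i ∈ Finset.range M, (Polynomial.X + Polynomial.C (x + (i : ℂ))) with hg
  have hdeg : g.natDegree = M := by
    rw [hg, Polynomial.natDegree_prod_of_monic _ _ fun i _ => Polynomial.monic_X_add_C _,
      Finset.sum_congr rfl fun (i : ℕ) _ => Polynomial.natDegree_X_add_C (x + (i : ℂ))]
    simp
  have hco : ∀ j, PowerSeries.coeff r (PowerSeries.mk L.R ^ (j + 1)) =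
      ∑ k ∈ Finset.range (r + 1), L.R k * PowerSeries.coeff (r - k) (PowerSeries.mk L.R ^ j) := by
    intro j
    rw [pow_succ', PowerSeries.coeff_mul, Finset.Nat.sum_antidiagonal_eq_sum_range_succ
      (fun a b => PowerSeries.coeff a (PowerSeries.mk L.R) *
        PowerSeries.coeff b (PowerSeries.mk L.R ^ j))]
    simp
  have hfirst : ∀ j, PowerSeries.coeff r (PowerSeries.mk L.R ^ j) *
      Polynomial.aeval L.μ (Polynomial.hasseDeriv j g * (Polynomial.X + Polynomial.C (x + (M : ℂ)))) =
      (L.μ + (x + M - r) • 1) * (PowerSeries.coeff r (PowerSeries.mk L.R ^ j) *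
        Polynomial.aeval L.μ (Polynomial.hasseDeriv j g)) := by
    intro j
    rw [mul_comm (Polynomial.hasseDeriv j g), map_mul, ← Matrix.mul_assoc, ← Matrix.mul_assoc]
    congr 1
    rw [map_add, Polynomial.aeval_X, Polynomial.aeval_C, Matrix.mul_add, coeff_R_pow_mul_μ,
      Algebra.algebraMap_eq_smul_one, Matrix.mul_smul, Matrix.mul_one, Matrix.sub_mul,
      Matrix.add_mul, Matrix.smul_mul, Matrix.smul_mul, Matrix.one_mul, sub_smul]
    abel
  have hexp : L.expR (M + 1) x r = ∑ j ∈ Finset.range (M + 2),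
      PowerSeries.coeff r (PowerSeries.mk L.R ^ j) * Polynomial.aeval L.μ
        (Polynomial.hasseDeriv j (g * (Polynomial.X + Polynomial.C (x + (M : ℂ))))) := by
    rw [expR, hg]
    simp only [Finset.prod_range_succ]
  rw [hexp, Finset.sum_range_succ', Polynomial.hasseDeriv_zero']
  have hstep : ∀ j ∈ Finset.range (M + 1), PowerSeries.coeff r (PowerSeries.mk L.R ^ (j + 1)) *
      Polynomial.aeval L.μ (Polynomial.hasseDeriv (j + 1)
        (g * (Polynomial.X + Polynomial.C (x + (M : ℂ))))) =
      (L.μ + (x + M - r) • 1) * (PowerSeries.coeff r (PowerSeries.mk L.R ^ (j + 1)) *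
        Polynomial.aeval L.μ (Polynomial.hasseDeriv (j + 1) g)) +
      ∑ k ∈ Finset.range (r + 1), L.R k * (PowerSeries.coeff (r - k) (PowerSeries.mk L.R ^ j) *
        Polynomial.aeval L.μ (Polynomial.hasseDeriv j g)) := by
    intro j _
    rw [hasseDeriv_succ_mul_X_add_C, map_add, Matrix.mul_add, hfirst, hco j]
    congr 1
    rw [Finset.sum_mul]
    exact Finset.sum_congr rfl fun k _ => Matrix.mul_assoc _ _ _
  rw [Finset.sum_congr rfl hstep, Finset.sum_add_distrib]
  have h0 := hfirst 0
  rw [Polynomial.hasseDeriv_zero'] at h0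
  rw [h0, ← Finset.mul_sum]
  have hlast : Polynomial.hasseDeriv (M + 1) g = 0 :=
    Polynomial.hasseDeriv_eq_zero_of_lt_natDegree _ _ (by omega)
  have e1 : L.expR M x r = ∑ j ∈ Finset.range (M + 1),
      PowerSeries.coeff r (PowerSeries.mk L.R ^ (j + 1)) *
        Polynomial.aeval L.μ (Polynomial.hasseDeriv (j + 1) g) +
      PowerSeries.coeff r (PowerSeries.mk L.R ^ 0) * Polynomial.aeval L.μ g := by
    rw [Finset.sum_range_succ, hlast, map_zero, Matrix.mul_zero, add_zero, expR,
      Finset.sum_range_succ', Polynomial.hasseDeriv_zero']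
  have e2 : ∑ k ∈ Finset.range (r + 1), L.R k * L.expR M x (r - k) =
      ∑ j ∈ Finset.range (M + 1), ∑ k ∈ Finset.range (r + 1), L.R k *
        (PowerSeries.coeff (r - k) (PowerSeries.mk L.R ^ j) *
          Polynomial.aeval L.μ (Polynomial.hasseDeriv j g)) := by
    rw [Finset.sum_comm]
    exact Finset.sum_congr rfl fun k _ => by rw [expR, Finset.mul_sum]
  rw [e2, e1, Matrix.mul_add]
  abel

/-! ### The operators `J` and the gauge transformation `Θ` -/

/-- `Θ(v; z)`. -/
def ThZ (v : Fin n → ℂ) : Matrix (Fin n) (Fin n) LS := LM fun p => L.Th p v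

/-- `Θ(v; z)⁻¹ = Θ^*(v; -z)`. -/
def ThInv (v : Fin n → ℂ) : Matrix (Fin n) (Fin n) LS :=
  LM fun p => (-1 : ℂ) ^ p • S.adj (L.Th p v)

/-- The coefficients of `μ + R(z)`. -/
def Acoef (k : ℕ) : Matrix (Fin n) (Fin n) ℂ := if k = 0 then L.μ + L.R 0 else L.R k

/-- The coefficients of `𝒱 + z 𝒰`. -/
def Bcoef (S : FrobeniusManifold n) (v : Fin n → ℂ) (k : ℕ) : Matrix (Fin n) (Fin n) ℂ :=
  if k = 0 then S.V else if k = 1 then S.U v else 0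

/-- The coefficient of `z^{p+1}` is the Levelt recursion, and that of `z^0` is `Θ_0 = 1` with `𝒱 = μ
+ R_0`. Consequently `Θ` conjugates `J` into `𝒰 + z⁻¹ (𝒱 - 1/2 - z d/dz)`, whose coefficients are
known. -/
theorem gauge (hv : v ∈ S.carrier) :
    (L.ThZ v).map euler + L.ThZ v * LM L.Acoef = LM (Bcoef S v) * L.ThZ v := by
  have h1 : (L.ThZ v).map euler = LM fun p => (p : ℂ) • L.Th p v := by
    ext1 i j; exact euler_LM _ i j
  rw [h1, ThZ, LM_mul, LM_mul, LM_add]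
  congr 1
  ext1 p
  cases p with
  | zero =>
    simp [L.Th_zero hv, Acoef, Bcoef, L.V_eq]
  | succ p =>
    have h := L.levelt v hv p
    have e1 : ∑ k ∈ Finset.range (p + 1 + 1), L.Th k v * L.Acoef (p + 1 - k) =
        ∑ k ∈ Finset.range (p + 1), L.Th (p - k) v * L.R (k + 1) + L.Th (p + 1) v * S.V := by
      rw [Finset.sum_range_succ, ← Finset.sum_range_reflect]
      congr 1
      · refine Finset.sum_congr rfl fun k hk => ?_
        rw [Finset.mem_range] at hk
        rw [Acoef, if_neg (by omega), show p + 1 - 1 - k = p - k by omega,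
          show p + 1 - (p - k) = k + 1 by omega]
      · simp [Acoef, L.V_eq]
    have e2 : ∑ k ∈ Finset.range (p + 1 + 1), Bcoef S v k * L.Th (p + 1 - k) v =
        S.V * L.Th (p + 1) v + S.U v * L.Th p v := by
      rw [Finset.sum_range_succ', Finset.sum_range_succ']
      rw [Finset.sum_eq_zero]
      · simp [Bcoef, add_comm]
      · intro k _; simp [Bcoef]
    rw [e1, e2]
    push_cast
    change ((p : ℂ) + 1) • L.Th (p + 1) v + (L.Th (p + 1) v * S.V - S.V * L.Th (p + 1) v) = _ at h
    rw [eq_sub_iff_add_eq] at h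
    rw [← h]
    abel

theorem ThInv_mul_ThZ (hv : v ∈ S.carrier) : L.ThInv v * L.ThZ v = 1 := by
  rw [ThInv, ThZ, LM_mul, ← LM_one]
  congr 1
  ext1 p
  rw [← L.orthogonal v hv p]
  exact Finset.sum_congr rfl fun k _ => Matrix.smul_mul _ _ _

theorem ThZ_mul_ThInv (hv : v ∈ S.carrier) : L.ThZ v * L.ThInv v = 1 :=
  mul_eq_one_comm.1 (L.ThInv_mul_ThZ hv)

theorem LM_mul_con (f : ℕ → Matrix (Fin n) (Fin n) ℂ) (X : Matrix (Fin n) (Fin n) ℂ) :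
    LM f * X.map con = LM fun p => f p * X := by
  ext i j s
  simp only [Matrix.mul_apply, HahnSeries.coeff_sum, Matrix.map_apply, LM_coeff]
  rw [Finset.sum_congr rfl fun k _ => by rw [mul_comm, con_mul_coeff, LM_coeff]]
  split_ifs with h
  · simp
  · exact Finset.sum_congr rfl fun k _ => mul_comm _ _

theorem con_mul_LM (f : ℕ → Matrix (Fin n) (Fin n) ℂ) (X : Matrix (Fin n) (Fin n) ℂ) :
    X.map con * LM f = LM fun p => X * f p := by
  ext i j s
  simp only [Matrix.mul_apply, HahnSeries.coeff_sum, Matrix.map_apply, LM_coeff]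
  rw [Finset.sum_congr rfl fun k _ => by rw [con_mul_coeff, LM_coeff]]
  split_ifs with h
  · simp
  · rfl

theorem refl_transpose_LM (f : ℕ → Matrix (Fin n) (Fin n) ℂ) :
    ((LM f).map refl).transpose = LM fun p => (-1 : ℂ) ^ p • (f p).transpose := by
  ext1 i j
  exact refl_LM f j i

theorem ThZ_isometry (hv : v ∈ S.carrier) :
    ((L.ThZ v).map refl).transpose * S.η.map con * L.ThZ v = S.η.map con := by
  have : ((L.ThZ v).map refl).transpose * S.η.map con = S.η.map con * L.ThInv v := by
    rw [ThZ, refl_transpose_LM, LM_mul_con, ThInv, con_mul_LM]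
    congr 1
    ext1 p
    rw [Matrix.smul_mul, Matrix.mul_smul, η_mul_adj]
  rw [this, Matrix.mul_assoc, L.ThInv_mul_ThZ hv, Matrix.mul_one]

/-- `μ` and the `R_k` with `k` even are antisymmetric, the others symmetric; the reflection of `z`
gives all of them a common sign. -/
theorem Acoef_selfAdj :
    ((LM L.Acoef).map refl).transpose * S.η.map con = -(S.η.map con * LM L.Acoef) := by
  rw [refl_transpose_LM, LM_mul_con, con_mul_LM]
  have : -(LM fun p => S.η * L.Acoef p) = LM fun p => -(S.η * L.Acoef p) := by
    ext i j s
    rw [Matrix.neg_apply, HahnSeries.coeff_neg, LM_coeff, LM_coeff]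
    split_ifs <;> simp
  rw [this]
  congr 1
  ext1 p
  by_cases hp : p = 0
  · subst hp
    have := L.R_transpose_η 0
    simp only [Acoef, if_true, pow_zero, one_smul, Matrix.transpose_add, Matrix.add_mul,
      L.μ_transpose_η, this, Matrix.mul_add]
    simp [add_comm]
  · simp only [Acoef, if_neg hp, Matrix.smul_mul, L.R_transpose_η, smul_smul]
    rw [← pow_add, show p + (p + 1) = 2 * p + 1 by ring, pow_succ, pow_mul]
    simp

/-- The operator `J = z⁻¹ (μ + R(z) - 1/2 - z d/dz)`. -/
abbrev JA : W n →ₗ[ℂ] W n := J (LM L.Acoef)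

/-- The operator `z⁻¹ (𝒱 + z 𝒰 - 1/2 - z d/dz)`. -/
abbrev JB (S : FrobeniusManifold n) (v : Fin n → ℂ) : W n →ₗ[ℂ] W n := J (LM (Bcoef S v))

theorem mulL_ThInv_ThZ (hv : v ∈ S.carrier) (f : W n) : mulL (L.ThInv v) (mulL (L.ThZ v) f) = f := by
  change (L.ThInv v).mulVec ((L.ThZ v).mulVec f) = f
  rw [Matrix.mulVec_mulVec, L.ThInv_mul_ThZ hv, Matrix.one_mulVec]

theorem mulL_ThZ_ThInv (hv : v ∈ S.carrier) (f : W n) : mulL (L.ThZ v) (mulL (L.ThInv v) f) = f := by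
  change (L.ThZ v).mulVec ((L.ThInv v).mulVec f) = f
  rw [Matrix.mulVec_mulVec, L.ThZ_mul_ThInv hv, Matrix.one_mulVec]

/-- `Θ` is an isometry of the residue pairing and intertwines the two operators, so matrix elements
of `J^M` can be computed in the gauge attached to `v`. -/
theorem pair_ThInv_JA (hv : v ∈ S.carrier) (M : ℕ) (f g : W n) :
    pair S.η (mulL (L.ThInv v) f) ((L.JA ^ M) (mulL (L.ThInv v) g)) =
      pair S.η f ((JB S v ^ M) g) := by
  rw [← pair_mulL S.η (L.ThZ_isometry hv), mulL_J_pow (L.gauge hv), L.mulL_ThZ_ThInv hv,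
    L.mulL_ThZ_ThInv hv]

/-- Both sides obey the same recursion in `M`, given by `cf_J` and by `expR_succ`. The argument `-s
- 1/2` is the eigenvalue of `-z d/dz - 1/2` on `z^s`. -/
theorem cf_JA_pow_mono (M : ℕ) (s : ℤ) (x : Fin n → ℂ) (r : ℕ) :
    cf (s + r - M) ((L.JA ^ M) (mono s x)) = (L.expR M (-(s : ℂ) - 1 / 2) r).mulVec x := by
  induction M generalizing r with
  | zero =>
    rw [pow_zero, Module.End.one_apply, cf_mono, expR_zero]
    by_cases hr : r = 0
    · subst hr; simp
    · rw [if_neg (by simpa using hr), if_neg hr, Matrix.zero_mulVec]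
  | succ M ih =>
    have hge := (ge_mono s x).J_pow L.Acoef M
    rw [pow_succ', Module.End.mul_apply, cf_J]
    have e0 : s + r - ((M + 1 : ℕ) : ℤ) + 1 = s + r - M := by push_cast; ring
    rw [e0, cf_LM_mulVec L.Acoef hge _ (r + 1) (by push_cast; omega), ih, Finset.sum_range_succ']
    have e1 : ∀ k ∈ Finset.range r, (L.Acoef (k + 1)).mulVec
        (cf (s + r - M - ((k + 1 : ℕ) : ℤ)) ((L.JA ^ M) (mono s x))) =
        (L.R (k + 1) * L.expR M (-(s : ℂ) - 1 / 2) (r - (k + 1))).mulVec x := by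
      intro k hk
      rw [Finset.mem_range] at hk
      have : s + (r : ℤ) - M - ((k + 1 : ℕ) : ℤ) = s + ((r - (k + 1) : ℕ) : ℤ) - M := by
        push_cast [Nat.cast_sub (show k + 1 ≤ r by omega)]; ring
      rw [this, ih, Matrix.mulVec_mulVec, Acoef, if_neg (by omega)]
    rw [Finset.sum_congr rfl e1]
    have e2 : s + (r : ℤ) - M - ((0 : ℕ) : ℤ) = s + r - M := by simp
    rw [e2, ih, Acoef, if_pos rfl, expR_succ, Finset.sum_range_succ', Nat.sub_zero]
    simp only [Matrix.add_mulVec, Matrix.mulVec_mulVec, Matrix.add_mul, Matrix.smul_mul,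
      Matrix.one_mul, Matrix.smul_mulVec, Matrix.sum_mulVec]
    push_cast
    rw [show -(s : ℂ) - 1 / 2 + (M : ℂ) - (r : ℂ) = -(1 / 2 + ((s : ℂ) + r - (M + 1) + 1)) by ring,
      neg_smul]
    abel

/-- The vectors dual to the derivatives of the free energy. -/
def hvec (S : FrobeniusManifold n) (j : Fin n × ℕ) : W n :=
  mono (j.2 : ℤ) ((-1 : ℂ) ^ (j.2 + 1) • (S.η⁻¹).mulVec (Pi.single j.1 1))

/-- The vectors dual to the times. -/
def tvec (j : Fin n × ℕ) : W n := mono (-(j.2 : ℤ) - 1) (Pi.single j.1 1)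

theorem dot_η_inv (α : Fin n) (x : Fin n → ℂ) :
    dotProduct ((S.η⁻¹).mulVec (Pi.single α 1)) (S.η.mulVec x) = x α := by
  rw [Matrix.dotProduct_mulVec, ← Matrix.mulVec_transpose, η_transpose, Matrix.mulVec_mulVec,
    η_mul_inv, Matrix.one_mulVec, single_one_dotProduct]

theorem pair_hvec (i : Fin n × ℕ) (g : W n) :
    pair S.η (hvec S i) g = -cf (-2 - (i.2 : ℤ)) g i.1 := by
  rw [hvec, pair_mono_left, smul_dotProduct, dot_η_inv, zpow_natCast, smul_eq_mul, ← mul_assoc,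
    ← pow_add, show i.2 + (i.2 + 1) = 2 * i.2 + 1 by ring, pow_succ, pow_mul]
  simp

theorem pair_tvec (i : Fin n × ℕ) (g : W n) :
    pair S.η (tvec i) g = (-1) ^ (i.2 + 1) * (S.η.mulVec (cf ((i.2 : ℤ) - 1) g)) i.1 := by
  rw [tvec, pair_mono_left, single_one_dotProduct, show -2 - (-(i.2 : ℤ) - 1) = i.2 - 1 by ring]
  congr 1
  rw [show -(i.2 : ℤ) - 1 = -((i.2 + 1 : ℕ) : ℤ) by push_cast; ring, zpow_neg, zpow_natCast]
  rw [← inv_pow]; norm_num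

/-- Together with `b_eq` and `c_eq` this shows that the three families are blocks of one quadratic
form, for the splitting into nonnegative powers of `z` (derivatives) and negative ones (times). The
cases excluded by the `if` are those where the degree forces the matrix element to vanish. -/
theorem a_eq (M : ℕ) (i j : Fin n × ℕ) :
    L.a M i j = -(1 / 2) * pair S.η (hvec S i) ((L.JA ^ M) (hvec S j)) := by
  rw [pair_hvec]
  rw [a]
  split_ifs with h
  · rw [hvec, show -2 - (i.2 : ℤ) = (j.2 : ℤ) + ((M - (i.2 + j.2 + 2) : ℕ) : ℤ) - M by
      push_cast [Nat.cast_sub h]; ring, cf_JA_pow_mono, Matrix.mulVec_smul, Matrix.mulVec_mulVec,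
      Matrix.mulVec_single_one]
    simp only [Pi.smul_apply, smul_eq_mul, Matrix.col_apply]
    push_cast; ring
  · rw [hvec, (ge_mono _ _).J_pow L.Acoef M _ (by omega)]; simp

theorem b_eq (M : ℕ) (i j : Fin n × ℕ) :
    L.b M i j = -pair S.η (hvec S i) ((L.JA ^ M) (tvec j)) := by
  rw [pair_hvec, b]
  split_ifs with h
  · rw [tvec, show -2 - (i.2 : ℤ) = (-(j.2 : ℤ) - 1) + ((M + j.2 - (i.2 + 1) : ℕ) : ℤ) - M by
      push_cast [Nat.cast_sub h]; ring, cf_JA_pow_mono, Matrix.mulVec_single_one, neg_neg]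
    simp only [Matrix.col_apply]
    congr 2
    push_cast; ring
  · rw [tvec, (ge_mono _ _).J_pow L.Acoef M _ (by omega)]; simp

theorem c_eq (M : ℕ) (i j : Fin n × ℕ) :
    L.c M i j = -(1 / 2) * pair S.η (tvec i) ((L.JA ^ M) (tvec j)) := by
  rw [pair_tvec, c, tvec, show (i.2 : ℤ) - 1 = (-(j.2 : ℤ) - 1) + ((M + i.2 + j.2 : ℕ) : ℤ) - M by
    push_cast; ring, cf_JA_pow_mono, Matrix.mulVec_mulVec, Matrix.mulVec_single_one,
    Matrix.col_apply]
  push_cast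
  rw [show -(-(j.2 : ℂ) - 1) - 1 / 2 = (j.2 : ℂ) + 1 / 2 by ring]
  ring

theorem a_symm (M : ℕ) (i j : Fin n × ℕ) : L.a M i j = L.a M j i := by
  rw [a_eq, a_eq, pair_J_pow S.η L.Acoef_selfAdj, pair_comm S.η S.η_symm]

theorem pair_JA_symm (M : ℕ) (f g : W n) :
    pair S.η f ((L.JA ^ M) g) = pair S.η g ((L.JA ^ M) f) := by
  rw [pair_J_pow S.η L.Acoef_selfAdj, pair_comm S.η S.η_symm]

end LeveltSystem

end

/-! ### The generating series in the gauge at `v`, and the constraints of genus zero -/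

section

open FrobeniusManifold Laurent

/-! ### Coefficients of the powers of `𝒰 + z⁻¹ (𝒱 - 1/2 - z d/dz)` -/

namespace Laurent

variable {n : ℕ}

/-- The coefficients of `z^j` vanish for `j > d`. -/
def Le (d : ℤ) (f : W n) : Prop := ∀ j, d < j → cf j f = 0

theorem Le.mono_le {d e : ℤ} {f : W n} (hf : Le d f) (h : d ≤ e) : Le e f :=
  fun j hj => hf j (by omega)

theorem Le.add {d : ℤ} {f g : W n} (hf : Le d f) (hg : Le d g) : Le d (f + g) :=
  fun j hj => by rw [map_add, hf j hj, hg j hj, add_zero]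

theorem Le.smul {d : ℤ} {f : W n} (hf : Le d f) (c : ℂ) : Le d (c • f) :=
  fun j hj => by rw [map_smul, hf j hj, smul_zero]

theorem Le.sum {ι : Type*} {d : ℤ} {t : Finset ι} {f : ι → W n} (hf : ∀ i ∈ t, Le d (f i)) :
    Le d (∑ i ∈ t, f i) :=
  fun j hj => by rw [map_sum]; exact Finset.sum_eq_zero fun i hi => hf i hi j hj

theorem le_mono (s : ℤ) (x : Fin n → ℂ) : Le s (mono s x) :=
  fun j hj => by rw [cf_mono, if_neg (by omega)]

end Laurent

section

variable {n : ℕ} [NeZero n] {S : FrobeniusManifold n} {v : Fin n → ℂ}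

open LeveltSystem

/-- The matrix `𝒱 - 1/2 - s`. -/
def Kmat (S : FrobeniusManifold n) (s : ℤ) : Matrix (Fin n) (Fin n) ℂ :=
  S.V - (1 / 2 + (s : ℂ)) • 1

theorem cf_JB (v : Fin n → ℂ) (f : W n) (s : ℤ) :
    cf s (JB S v f) = (S.U v).mulVec (cf s f) + (Kmat S (s + 1)).mulVec (cf (s + 1) f) := by
  obtain ⟨d, hd⟩ := exists_ge f
  rw [cf_J, cf_LM_mulVec _ hd (s + 1) ((s + 1 - d).toNat + 2) (by omega), Finset.sum_range_succ',
    Finset.sum_range_succ', Finset.sum_eq_zero, Kmat, Matrix.sub_mulVec, Matrix.smul_mulVec,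
    Matrix.one_mulVec]
  · simp [Bcoef]
    abel
  · intro k _; simp [Bcoef]

theorem Laurent.Le.JB {d : ℤ} {f : W n} (hf : Le d f) (v : Fin n → ℂ) :
    Le d (LeveltSystem.JB S v f) := fun j hj => by
  rw [cf_JB, hf j hj, hf (j + 1) (by omega)]; simp

theorem Laurent.Le.JB_pow {d : ℤ} {f : W n} (hf : Le d f) (v : Fin n → ℂ) (M : ℕ) :
    Le d ((LeveltSystem.JB S v ^ M) f) := by
  induction M with
  | zero => exact hf
  | succ M ih => rw [pow_succ', Module.End.mul_apply]; exact ih.JB v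

/-- The coefficient of `z^{s-l}` in `(𝒰 + z⁻¹ (𝒱 - 1/2 - z d/dz))^M z^s`. -/
def Nm (S : FrobeniusManifold n) (v : Fin n → ℂ) : ℕ → ℤ → ℕ → Matrix (Fin n) (Fin n) ℂ
  | 0, _, l => if l = 0 then 1 else 0
  | M + 1, s, 0 => S.U v * Nm S v M s 0
  | M + 1, s, l + 1 => S.U v * Nm S v M s (l + 1) + Kmat S (s - l) * Nm S v M s l

theorem cf_JB_pow_mono (v : Fin n → ℂ) (M : ℕ) (s : ℤ) (l : ℕ) (x : Fin n → ℂ) :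
    cf (s - l) ((LeveltSystem.JB S v ^ M) (mono s x)) = (Nm S v M s l).mulVec x := by
  induction M generalizing l with
  | zero =>
    rw [pow_zero, Module.End.one_apply, cf_mono]
    by_cases h : l = 0
    · subst h; simp [Nm]
    · rw [if_neg (by omega), Nm, if_neg h, Matrix.zero_mulVec]
  | succ M ih =>
    rw [pow_succ', Module.End.mul_apply, cf_JB, ih]
    cases l with
    | zero =>
      rw [((le_mono s x).JB_pow v M) _ (by push_cast; omega), Nm, Matrix.mulVec_zero, add_zero,
        Matrix.mulVec_mulVec]
    | succ l =>
      rw [show s - ((l + 1 : ℕ) : ℤ) + 1 = s - l by push_cast; ring, ih, Nm, Matrix.add_mulVec,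
        Matrix.mulVec_mulVec, Matrix.mulVec_mulVec]

end

namespace LeveltSystem

variable {n : ℕ} [NeZero n] {S : FrobeniusManifold n} (L : LeveltSystem S) {v : Fin n → ℂ}

/-! ### The generating series of the times and of the derivatives of the free energy -/

theorem sum_box {F : Type*} [AddCommMonoid F] (K : ℕ) (f : Fin n × ℕ → F) :
    ∑ i ∈ box n K, f i = ∑ q ∈ Finset.range K, ∑ α, f (α, q) := by
  rw [Finset.sum_product, Finset.sum_comm]

theorem sum_smul_single (x : Fin n → ℂ) : ∑ α, x α • (Pi.single α 1 : Fin n → ℂ) = x := by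
  ext γ; simp [Finset.sum_apply, Pi.single_apply]

theorem sum_smul_hvec (K : ℕ) (x : Fin n × ℕ → ℂ) :
    ∑ j ∈ box n K, x j • hvec S j = ∑ q ∈ Finset.range K,
      mono (q : ℤ) ((-1 : ℂ) ^ (q + 1) • (S.η⁻¹).mulVec fun α => x (α, q)) := by
  rw [sum_box]
  refine Finset.sum_congr rfl fun q _ => ?_
  have h : (fun α => x (α, q)) = ∑ α, x (α, q) • (Pi.single α 1 : Fin n → ℂ) :=
    (sum_smul_single _).symm
  rw [h, Matrix.mulVec_sum, Finset.smul_sum, map_sum]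
  refine Finset.sum_congr rfl fun α _ => ?_
  rw [Matrix.mulVec_smul, hvec, ← map_smul, smul_comm]

theorem sum_smul_tvec (K : ℕ) (x : Fin n × ℕ → ℂ) :
    ∑ j ∈ box n K, x j • tvec j = ∑ q ∈ Finset.range K,
      mono (-(q : ℤ) - 1) (fun α => x (α, q)) := by
  rw [sum_box]
  refine Finset.sum_congr rfl fun q _ => ?_
  rw [← sum_smul_single fun α => x (α, q), map_sum]
  refine Finset.sum_congr rfl fun α _ => ?_
  rw [map_smul]; rfl

theorem cf_sum_mono (K : ℕ) (e : ℕ → ℤ) (he : Function.Injective e) (x : ℕ → Fin n → ℂ) (q : ℕ) :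
    cf (e q) (∑ p ∈ Finset.range K, mono (e p) (x p)) = if q < K then x q else 0 := by
  rw [map_sum]
  simp only [cf_mono, he.eq_iff]
  rw [Finset.sum_ite_eq]
  simp

theorem cf_sum_mono_of_ne (K : ℕ) (e : ℕ → ℤ) (x : ℕ → Fin n → ℂ) (s : ℤ)
    (h : ∀ p < K, s ≠ e p) : cf s (∑ p ∈ Finset.range K, mono (e p) (x p)) = 0 := by
  rw [map_sum]
  refine Finset.sum_eq_zero fun p hp => ?_
  rw [cf_mono, if_neg (h p (Finset.mem_range.1 hp))]

/-- The vectors `y_q = ∑_k Θ_k(v) t̃_{q+k}`. -/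
def tY (v : Fin n → ℂ) (T : Times n) (q : ℕ) : Fin n → ℂ := T.sum fun i x => x • L.shiftCol q i v

/-- The derivatives of the free energy of genus zero. -/
def tF (v : Fin n → ℂ) (T : Times n) (i : Fin n × ℕ) : ℂ := T.sum fun j x => x * L.Ω i j v

variable {T : Times n} {K : ℕ}

theorem tY_eq (hK : ∀ i, T i ≠ 0 → i.2 < K) (q : ℕ) :
    L.tY v T q = ∑ i ∈ box n K, T i • L.shiftCol q i v :=
  sum_eq_sum_box hK fun _ => zero_smul _ _

theorem tY_eq_zero (hK : ∀ i, T i ≠ 0 → i.2 < K) {q : ℕ} (hq : K ≤ q) : L.tY v T q = 0 := by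
  rw [L.tY_eq hK]
  refine Finset.sum_eq_zero fun i hi => ?_
  simp only [Finset.mem_product, Finset.mem_range] at hi
  rw [shiftCol, if_neg (by omega), smul_zero]

/-- The series `∑_{q ≥ 1} y_q z^{-q-1}`. -/
def serY (v : Fin n → ℂ) (T : Times n) (K : ℕ) : W n :=
  ∑ q ∈ Finset.range K, mono (-(q : ℤ) - 2) (L.tY v T (q + 1))

/-- The series `∑ t̃_q z^{-q-1}`. -/
def serT (T : Times n) (K : ℕ) : W n := ∑ j ∈ box n K, T j • tvec j

theorem cf_serT (hK : ∀ i, T i ≠ 0 → i.2 < K) (q : ℕ) :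
    cf (-(q : ℤ) - 1) (serT T K) = fun α => T (α, q) := by
  rw [serT, sum_smul_tvec, cf_sum_mono K (fun q : ℕ => -(q : ℤ) - 1) (fun a b h => by simpa using h)
    (fun q α => T (α, q))]
  split_ifs with h
  · rfl
  · ext α
    by_contra hne
    exact h (hK (α, q) (fun h0 => hne h0.symm))

theorem cf_serT_nonneg {s : ℤ} (hs : 0 ≤ s) : cf s (serT T K) = 0 := by
  rw [serT, sum_smul_tvec]
  exact cf_sum_mono_of_ne _ _ _ _ fun p _ => by omega

theorem ge_serT : Ge (-(K : ℤ)) (serT T K) := by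
  rw [serT, sum_smul_tvec]
  refine Ge.sum fun q hq => (ge_mono _ _).mono' ?_
  rw [Finset.mem_range] at hq; omega

theorem ge_serY : Ge (-(K : ℤ) - 1) (L.serY v T K) := by
  refine Ge.sum fun q hq => (ge_mono _ _).mono' ?_
  rw [Finset.mem_range] at hq; omega

theorem le_serY : Le (-2) (L.serY v T K) :=
  Le.sum fun q _ => (le_mono _ _).mono_le (by omega)

theorem Th_mulVec (p : ℕ) (x : Fin n → ℂ) :
    (L.Th p v).mulVec x = ∑ α, x α • L.col (α, p) v := by
  ext γ
  simp only [Matrix.mulVec, dotProduct, Finset.sum_apply, Pi.smul_apply, smul_eq_mul, col]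
  exact Finset.sum_congr rfl fun α _ => mul_comm _ _

theorem sum_range_shift {F : Type*} [AddCommMonoid F] (K q : ℕ) (hq : q ≤ K) (f : ℕ → F) :
    ∑ p ∈ Finset.range K, (if q ≤ p then f (p - q) else 0) = ∑ k ∈ Finset.range (K - q), f k := by
  obtain ⟨m, rfl⟩ := Nat.exists_eq_add_of_le hq
  rw [Finset.sum_range_add]
  rw [Finset.sum_eq_zero (fun p hp => if_neg (by rw [Finset.mem_range] at hp; omega)), zero_add]
  simp

/-- The sums defining the `y_q` are the convolution of the times with the coefficients of `Θ`, so
all of them are packed into one product of series. -/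
theorem cf_ThZ_serT (hK : ∀ i, T i ≠ 0 → i.2 < K) (q : ℕ) :
    cf (-(q : ℤ) - 1) ((L.ThZ v).mulVec (serT T K)) = L.tY v T q := by
  rw [ThZ, cf_LM_mulVec _ ge_serT _ K (by omega), L.tY_eq hK, sum_box]
  by_cases hq : q ≤ K
  · have h1 : ∀ p ∈ Finset.range K, ∑ α, T (α, p) • L.shiftCol q (α, p) v =
        if q ≤ p then (fun k => (L.Th k v).mulVec fun α => T (α, q + k)) (p - q) else 0 := by
      intro p _
      split_ifs with h
      · simp only [shiftCol, if_pos h, Th_mulVec, Nat.add_sub_cancel' h]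
      · simp [shiftCol, if_neg h]
    rw [Finset.sum_congr rfl h1, sum_range_shift K q hq
      (fun k => (L.Th k v).mulVec fun α => T (α, q + k))]
    have h2 : ∀ k ∈ Finset.range K, (L.Th k v).mulVec (cf (-(q : ℤ) - 1 - k) (serT T K)) =
        (L.Th k v).mulVec fun α => T (α, q + k) := by
      intro k _
      rw [show -(q : ℤ) - 1 - k = -((q + k : ℕ) : ℤ) - 1 by push_cast; ring, cf_serT hK]
    rw [Finset.sum_congr rfl h2]
    symm
    refine Finset.sum_subset (Finset.range_mono (Nat.sub_le _ _)) fun k _ hk => ?_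
    rw [Finset.mem_range] at hk
    have : (fun α => T (α, q + k)) = 0 := by
      ext α
      by_contra hne
      have := hK _ hne
      simp at this; omega
    rw [this, Matrix.mulVec_zero]
  · rw [Finset.sum_eq_zero, Finset.sum_eq_zero]
    · intro p hp
      rw [Finset.mem_range] at hp
      refine Finset.sum_eq_zero fun α _ => ?_
      simp only [shiftCol]
      rw [if_neg (by omega), smul_zero]
    · intro k _
      rw [show -(q : ℤ) - 1 - k = -((q + k : ℕ) : ℤ) - 1 by push_cast; ring, cf_serT hK]
      have : (fun α => T (α, q + k)) = 0 := by
        ext α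
        by_contra hne
        have := hK _ hne
        simp at this; omega
      rw [this, Matrix.mulVec_zero]

/-- The series `Θ(v; z)⁻¹ ∑_{q ≥ 1} y_q z^{-q-1}`. -/
def serJ (v : Fin n → ℂ) (T : Times n) (K : ℕ) : W n := mulL (L.ThInv v) (L.serY v T K)

theorem cf_serY (hK : ∀ i, T i ≠ 0 → i.2 < K) (q : ℕ) :
    cf (-(q : ℤ) - 2) (L.serY v T K) = L.tY v T (q + 1) := by
  rw [serY, cf_sum_mono K (fun q : ℕ => -(q : ℤ) - 2) (fun a b h => by simpa using h)
    (fun q => L.tY v T (q + 1))]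
  split_ifs with h
  · rfl
  · rw [L.tY_eq_zero hK (by omega)]

theorem ge_serJ : Ge (-(K : ℤ) - 1) (L.serJ v T K) := L.ge_serY.LM_mulVec _

/-- Since `y_0 = 0`, the series `Θ · serT` and `serY` have the same negative powers; multiplication
by `Θ⁻¹`, a power series in `z`, preserves this. -/
theorem cf_serJ_neg (hv : v ∈ S.carrier) (hK : ∀ i, T i ≠ 0 → i.2 < K) (h0 : L.tY v T 0 = 0)
    {s : ℤ} (hs : s < 0) : cf s (L.serJ v T K) = cf s (serT T K) := by
  have hP : Ge 0 (mulL (L.ThZ v) (serT T K) - L.serY v T K) := by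
    intro j hj
    rw [map_sub, sub_eq_zero]
    obtain ⟨q, rfl⟩ : ∃ q : ℕ, j = -(q : ℤ) - 1 := ⟨(-j - 1).toNat, by omega⟩
    refine (L.cf_ThZ_serT hK q).trans ?_
    cases q with
    | zero =>
      rw [h0, serY, cf_sum_mono_of_ne]
      intro p _; omega
    | succ q =>
      rw [show -((q + 1 : ℕ) : ℤ) - 1 = -(q : ℤ) - 2 by push_cast; ring, L.cf_serY hK]
  have h1 : Ge 0 (mulL (L.ThInv v) (mulL (L.ThZ v) (serT T K) - L.serY v T K)) := hP.LM_mulVec _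
  rw [map_sub, L.mulL_ThInv_ThZ hv] at h1
  have h2 := h1 s hs
  rw [map_sub, sub_eq_zero] at h2
  exact h2.symm

theorem η_mul_adj_mulVec (k : ℕ) (x : Fin n → ℂ) (β : Fin n) :
    (S.η.mulVec ((S.adj (L.Th k v)).mulVec x)) β = bil S (L.col (β, k) v) x := by
  rw [Matrix.mulVec_mulVec, η_mul_adj, ← Matrix.mulVec_mulVec]; rfl

theorem bil_sum_smul_right {ι : Type*} (t : Finset ι) (x : Fin n → ℂ) (c : ι → ℂ)
    (f : ι → Fin n → ℂ) : bil S x (∑ i ∈ t, c i • f i) = ∑ i ∈ t, c i * bil S x (f i) := by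
  simp only [bil, Matrix.mulVec_sum, dotProduct_sum, Matrix.mulVec_smul, dotProduct_smul,
    smul_eq_mul]

/-- Expanding `Θ⁻¹ = Θ^*(-z)`, the coefficient of `z^q` is an alternating sum of pairings of
`∇θ_{β,q+1+k}` with `y_k`. This is the expansion `Ω_eq` contracted with the times, that is, a
derivative of `𝓕_0`. The terms before index `q + 1` meet nonnegative powers, which `serY` lacks. -/
theorem cf_serJ_nonneg (hK : ∀ i, T i ≠ 0 → i.2 < K) (h0 : L.tY v T 0 = 0) (q : ℕ) :
    cf (q : ℤ) (L.serJ v T K) = (-1 : ℂ) ^ (q + 1) • (S.η⁻¹).mulVec fun β => L.tF v T (β, q) := by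
  have key : S.η.mulVec (cf (q : ℤ) (L.serJ v T K)) =
      (-1 : ℂ) ^ (q + 1) • fun β => L.tF v T (β, q) := by
    change S.η.mulVec (cf (q : ℤ) ((LM _).mulVec (L.serY v T K))) = _
    rw [cf_LM_mulVec _ L.ge_serY _ (q + 1 + K + 1) (by push_cast; omega), Matrix.mulVec_sum]
    ext β
    rw [Finset.sum_apply, add_assoc, Finset.sum_range_add, Finset.sum_eq_zero, zero_add]
    · have h1 : ∀ k ∈ Finset.range (K + 1), (S.η.mulVec (((-1 : ℂ) ^ (q + 1 + k) •
          S.adj (L.Th (q + 1 + k) v)).mulVec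
            (cf ((q : ℤ) - ((q + 1 + k : ℕ) : ℤ)) (L.serY v T K)))) β =
          (-1 : ℂ) ^ (q + 1) * ((-1) ^ k * bil S (L.col (β, q + 1 + k) v) (L.tY v T k)) := by
        intro k _
        rw [Matrix.smul_mulVec, Matrix.mulVec_smul, Pi.smul_apply, L.η_mul_adj_mulVec, smul_eq_mul,
          pow_add, mul_assoc]
        congr 3
        cases k with
        | zero =>
          rw [h0, serY, cf_sum_mono_of_ne]
          intro p _; push_cast; omega
        | succ k =>
          rw [show (q : ℤ) - ((q + 1 + (k + 1) : ℕ) : ℤ) = -(k : ℤ) - 2 by push_cast; ring,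
            L.cf_serY hK]
      rw [Finset.sum_congr rfl h1, ← Finset.mul_sum, Pi.smul_apply, smul_eq_mul, tF,
        sum_eq_sum_box hK (g := fun j x => x * L.Ω (β, q) j v) (fun _ => zero_mul _)]
      congr 1
      simp only [L.tY_eq hK, bil_sum_smul_right, Finset.mul_sum]
      rw [Finset.sum_comm]
      refine Finset.sum_congr rfl fun i hi => ?_
      simp only [Finset.mem_product, Finset.mem_range] at hi
      rw [Ω_eq, Finset.mul_sum]
      symm
      rw [← Finset.sum_subset (Finset.range_mono (show i.2 + 1 ≤ K + 1 by omega))]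
      · refine Finset.sum_congr rfl fun k hk => ?_
        rw [Finset.mem_range] at hk
        rw [shiftCol, if_pos (by omega)]
        ring
      · intro k _ hk
        rw [Finset.mem_range] at hk
        rw [shiftCol, if_neg (by omega), bil_zero_right]; ring
    · intro k hk
      rw [Finset.mem_range] at hk
      rw [serY, cf_sum_mono_of_ne, Matrix.mulVec_zero, Matrix.mulVec_zero]
      · rfl
      · intro p _; omega
  rw [← Matrix.one_mulVec (cf (q : ℤ) (L.serJ v T K)), ← η_inv_mul (S := S), ← Matrix.mulVec_mulVec, key,
    Matrix.mulVec_smul]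

/-- The series whose coefficients are the derivatives of the free energy, truncated. -/
def serF (v : Fin n → ℂ) (T : Times n) (K' : ℕ) : W n := ∑ j ∈ box n K', L.tF v T j • hvec S j

theorem ge_serJ_sub (hv : v ∈ S.carrier) (hK : ∀ i, T i ≠ 0 → i.2 < K) (h0 : L.tY v T 0 = 0)
    (K' : ℕ) : Ge (K' : ℤ) (L.serJ v T K - (serT T K + L.serF v T K')) := by
  intro s hs
  rw [map_sub, map_add, serF, sum_smul_hvec]
  by_cases hn : s < 0
  · rw [L.cf_serJ_neg hv hK h0 hn, cf_sum_mono_of_ne _ _ _ _ (fun p _ => by omega)]; simp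
  · obtain ⟨q, rfl⟩ : ∃ q : ℕ, s = q := ⟨s.toNat, by omega⟩
    rw [L.cf_serJ_nonneg hK h0, cf_serT_nonneg (by omega),
      cf_sum_mono K' (fun q : ℕ => (q : ℤ)) Nat.cast_injective
        (fun q => (-1 : ℂ) ^ (q + 1) • (S.η⁻¹).mulVec fun α => L.tF v T (α, q)),
      if_pos (by omega)]
    simp

/-- `J^M` lowers the order in `z` by at most `M`, so the pairing does not reach `z⁻²`. This
justifies cutting off the infinite sequence of derivatives of `𝓕_0`. -/
theorem pair_J_tail (M : ℕ) {f g : W n} {d e : ℤ} (hf : Ge d f) (hg : Ge e g) (h : (M : ℤ) - 2 < d + e) :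
    pair S.η f ((L.JA ^ M) g) = 0 :=
  pair_eq_zero_of_ge S.η hf (hg.J_pow _ M) (by omega)

theorem ge_hvec (i : Fin n × ℕ) : Ge (i.2 : ℤ) (hvec S i) := ge_mono _ _

theorem a_eq_zero {M : ℕ} {i j : Fin n × ℕ} (h : M < i.2 + j.2 + 2) : L.a M i j = 0 := by
  rw [a, if_neg (by omega)]

theorem b_eq_zero {M : ℕ} {i j : Fin n × ℕ} (h : M + j.2 ≤ i.2) : L.b M i j = 0 := by
  rw [b, if_neg (by omega)]

/-- The genus zero vector field of the constraint: `2 a^{ij} ∂_jF_0 + b^i_j t̃^j`. -/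
theorem sum_a_add_sum_b (hv : v ∈ S.carrier) (hK : ∀ i, T i ≠ 0 → i.2 < K) (h0 : L.tY v T 0 = 0)
    (M : ℕ) (i : Fin n × ℕ) :
    ∑ j ∈ box n M, 2 * L.a M i j * L.tF v T j + ∑ j ∈ box n K, L.b M i j * T j =
      -pair S.η (hvec S i) ((L.JA ^ M) (L.serJ v T K)) := by
  have h1 := L.ge_serJ_sub hv hK h0 M
  have h2 := L.pair_J_tail M (ge_hvec (S := S) i) h1 (by omega)
  rw [map_sub, pair_sub_right, sub_eq_zero] at h2
  rw [h2, serT, serF, map_add, pair_add_right, map_sum, map_sum, pair_sum_right, pair_sum_right,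
    neg_add, add_comm, ← Finset.sum_neg_distrib, ← Finset.sum_neg_distrib]
  congr 1
  · refine Finset.sum_congr rfl fun j _ => ?_
    rw [b_eq, map_smul, pair_smul_right]; ring
  · refine Finset.sum_congr rfl fun j _ => ?_
    rw [a_eq, map_smul, pair_smul_right]; ring

theorem box_mono {K K' : ℕ} (h : K ≤ K') : box n K ⊆ box n K' :=
  Finset.product_subset_product_right (Finset.range_mono h)

theorem sum_box_of_zero {K K' : ℕ} (h : K ≤ K') {f : Fin n × ℕ → ℂ} (hf : ∀ i, K ≤ i.2 → f i = 0) :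
    ∑ i ∈ box n K, f i = ∑ i ∈ box n K', f i := by
  refine Finset.sum_subset (box_mono h) fun i _ hi => hf i ?_
  simpa using hi

/-- The constraint of genus zero. -/
theorem genus_zero (hv : v ∈ S.carrier) (hK : ∀ i, T i ≠ 0 → i.2 < K) (h0 : L.tY v T 0 = 0)
    (M : ℕ) :
    ∑ i ∈ box n M, ∑ j ∈ box n M, L.a M i j * L.tF v T i * L.tF v T j +
      ∑ j ∈ box n K, ∑ i ∈ box n (M + j.2), L.b M i j * T j * L.tF v T i +
      ∑ i ∈ box n K, ∑ j ∈ box n K, L.c M i j * T i * T j = 0 := by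
  set K' := M + K + 1 with hK'
  have e1 : ∑ i ∈ box n M, ∑ j ∈ box n M, L.a M i j * L.tF v T i * L.tF v T j =
      ∑ i ∈ box n K', ∑ j ∈ box n K', L.a M i j * L.tF v T i * L.tF v T j := by
    rw [sum_box_of_zero (K' := K') (by omega)]
    · refine Finset.sum_congr rfl fun i _ => sum_box_of_zero (by omega) fun j hj => ?_
      rw [L.a_eq_zero (by omega)]; ring
    · intro i hi
      refine Finset.sum_eq_zero fun j _ => ?_
      rw [L.a_eq_zero (by omega)]; ring
  have e2 : ∑ j ∈ box n K, ∑ i ∈ box n (M + j.2), L.b M i j * T j * L.tF v T i =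
      ∑ j ∈ box n K, ∑ i ∈ box n K', L.b M i j * T j * L.tF v T i := by
    refine Finset.sum_congr rfl fun j hj => ?_
    simp only [Finset.mem_product, Finset.mem_range] at hj
    refine sum_box_of_zero (by omega) fun i hi => ?_
    rw [L.b_eq_zero (by omega)]; ring
  have hA : pair S.η (L.serF v T K') ((L.JA ^ M) (L.serF v T K')) =
      -2 * ∑ i ∈ box n K', ∑ j ∈ box n K', L.a M i j * L.tF v T i * L.tF v T j := by
    rw [serF, map_sum, pair_sum_left, Finset.mul_sum]
    refine Finset.sum_congr rfl fun i _ => ?_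
    rw [pair_sum_right, Finset.mul_sum]
    refine Finset.sum_congr rfl fun j _ => ?_
    rw [map_smul, pair_smul_right, pair_smul_left, a_eq]; ring
  have hB : pair S.η (L.serF v T K') ((L.JA ^ M) (serT T K)) =
      -∑ j ∈ box n K, ∑ i ∈ box n K', L.b M i j * T j * L.tF v T i := by
    rw [serF, serT, map_sum, pair_sum_left, Finset.sum_comm, ← Finset.sum_neg_distrib]
    refine Finset.sum_congr rfl fun i _ => ?_
    rw [pair_sum_right, ← Finset.sum_neg_distrib]
    refine Finset.sum_congr rfl fun j _ => ?_
    rw [map_smul, pair_smul_right, pair_smul_left, b_eq]; ring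
  have hC : pair S.η (serT T K) ((L.JA ^ M) (serT T K)) =
      -2 * ∑ i ∈ box n K, ∑ j ∈ box n K, L.c M i j * T i * T j := by
    rw [serT, map_sum, pair_sum_left, Finset.mul_sum]
    refine Finset.sum_congr rfl fun i _ => ?_
    rw [pair_sum_right, Finset.mul_sum]
    refine Finset.sum_congr rfl fun j _ => ?_
    rw [map_smul, pair_smul_right, pair_smul_left, c_eq]; ring
  -- `serJ` differs from times plus truncated derivatives only from `z^{K'}` on, and `K' = M + K +
  -- 1` puts these powers out of reach of the pairing.
  have hs : pair S.η (L.serJ v T K) ((L.JA ^ M) (L.serJ v T K)) =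
      pair S.η (serT T K + L.serF v T K') ((L.JA ^ M) (serT T K + L.serF v T K')) := by
    have h1 := L.ge_serJ_sub hv hK h0 K'
    have hT : Ge (-(K : ℤ)) (serT T K + L.serF v T K') := by
      refine ge_serT.add (Ge.sum fun j _ => ?_)
      intro s hs
      rw [map_smul, ge_hvec j s (by omega), smul_zero]
    have h2 := L.pair_J_tail M h1 hT (by omega)
    have h3 := L.pair_J_tail M (L.ge_serJ (v := v) (T := T) (K := K)) h1 (by omega)
    rw [map_sub, pair_sub_right, sub_eq_zero] at h3
    rw [pair_sub_left, sub_eq_zero] at h2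
    rw [h3, h2]
  -- In the gauge at `v` the series has only powers up to `z⁻²` and the operator does not raise
  -- degrees. Both arguments stay at or below `z⁻²`, their product at or below `z⁻⁴`, so nothing is
  -- left at `z⁻²`.
  have hz : pair S.η (L.serJ v T K) ((L.JA ^ M) (L.serJ v T K)) = 0 := by
    rw [serJ, L.pair_ThInv_JA hv]
    nth_rewrite 1 [serY]
    rw [pair_sum_left]
    refine Finset.sum_eq_zero fun q _ => ?_
    rw [pair_mono_left]
    have : cf (-2 - (-(q : ℤ) - 2)) ((JB S v ^ M) (L.serY v T K)) = 0 :=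
      (L.le_serY.JB_pow v M) _ (by omega)
    rw [this, Matrix.mulVec_zero, dotProduct_zero, mul_zero]
  rw [e1, e2]
  rw [hz, map_add, pair_add_left, pair_add_right, pair_add_right, hA, hC, hB,
    L.pair_JA_symm M (serT T K), hB] at hs
  linear_combination (1/2) * hs

/-- Contraction of the constraint vector field with `x_i = ℓ · Θ_{p-a}`. -/
theorem sum_hvec_shiftCol (l : Fin n → ℂ) (a K' : ℕ) :
    Ge (K' : ℤ) (∑ i ∈ box n K', dotProduct l (L.shiftCol a i v) • hvec S i -
      (-1 : ℂ) ^ (a + 1) • mulL (L.ThInv v) (mono (a : ℤ) ((S.η⁻¹).mulVec l))) := by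
  intro s hs
  rw [sum_smul_hvec, map_sub, map_smul, sub_eq_zero]
  change _ = _ • cf s ((LM _).mulVec _)
  by_cases hn : s < a
  · rw [(ge_mono (a : ℤ) ((S.η⁻¹).mulVec l)).LM_mulVec _ _ hn, smul_zero]
    by_cases h0 : s < 0
    · exact cf_sum_mono_of_ne _ _ _ _ fun p _ => by omega
    · obtain ⟨q, rfl⟩ : ∃ q : ℕ, s = q := ⟨s.toNat, by omega⟩
      rw [cf_sum_mono K' (fun q : ℕ => (q : ℤ)) Nat.cast_injective
        (fun q => (-1 : ℂ) ^ (q + 1) • (S.η⁻¹).mulVec fun α => dotProduct l (L.shiftCol a (α, q) v)),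
        if_pos (by omega)]
      have : (fun α => dotProduct l (L.shiftCol a (α, q) v)) = 0 := by
        ext α
        rw [shiftCol, if_neg (by simp; omega), dotProduct_zero]; rfl
      rw [this, Matrix.mulVec_zero, smul_zero]
  · obtain ⟨k, rfl⟩ : ∃ k : ℕ, s = ((a + k : ℕ) : ℤ) := ⟨(s - a).toNat, by push_cast; omega⟩
    rw [cf_sum_mono K' (fun q : ℕ => (q : ℤ)) Nat.cast_injective
        (fun q => (-1 : ℂ) ^ (q + 1) • (S.η⁻¹).mulVec fun α => dotProduct l (L.shiftCol a (α, q) v)),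
        if_pos (by omega), cf_LM_mulVec _ (ge_mono _ _) _ (k + 1) (by push_cast; omega),
        Finset.sum_eq_single_of_mem k (by simp)]
    · rw [cf_mono, if_pos (by push_cast; ring), Matrix.smul_mulVec, smul_smul, ← pow_add,
        show a + 1 + k = a + k + 1 by ring, adj, Matrix.mulVec_mulVec, Matrix.mul_assoc, η_mul_inv,
        Matrix.mul_one, ← Matrix.mulVec_mulVec]
      congr 2
      ext α
      rw [shiftCol, if_pos (by simp), Matrix.mulVec, dotProduct_comm]
      simp only [Nat.add_sub_cancel_left]
      rfl
    · intro j _ hj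
      rw [cf_mono, if_neg (by push_cast; omega), Matrix.mulVec_zero]

/-- The vector field of the constraint, applied to `x_i = ℓ · Θ_{p-a}`. -/
theorem constraint_lin (hv : v ∈ S.carrier) (l : Fin n → ℂ) (a M K' : ℕ) (hK' : M + K ≤ K') :
    ∑ i ∈ box n K', -pair S.η (hvec S i) ((L.JA ^ M) (L.serJ v T K)) *
      dotProduct l (L.shiftCol a i v) =
      dotProduct l (cf (-2 - (a : ℤ)) ((JB S v ^ M) (L.serY v T K))) := by
  have h := L.pair_J_tail M (L.sum_hvec_shiftCol (v := v) l a K')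
    (L.ge_serJ (v := v) (T := T) (K := K)) (by omega)
  rw [pair_sub_left, sub_eq_zero, pair_smul_left, serJ, L.pair_ThInv_JA hv, pair_mono_left,
    pair_sum_left] at h
  have e : ∀ x y : Fin n → ℂ, dotProduct ((S.η⁻¹).mulVec x) (S.η.mulVec y) = dotProduct x y := by
    intro x y
    rw [Matrix.dotProduct_mulVec, ← Matrix.mulVec_transpose, η_transpose, Matrix.mulVec_mulVec,
      η_mul_inv, Matrix.one_mulVec]
  rw [e, zpow_natCast, ← mul_assoc, ← pow_add, show a + 1 + a = 2 * a + 1 by ring, pow_succ,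
    pow_mul] at h
  rw [← neg_inj, ← Finset.sum_neg_distrib]
  refine Eq.trans (Finset.sum_congr rfl fun i _ => ?_) (h.trans (by norm_num))
  rw [pair_smul_left, serJ]; ring

/-- The quadratic part of the constraint, applied to `x_i = ℓ · Θ_{p-a}`, `x'_j = ℓ' · Θ_{q-b}`. -/
theorem constraint_quad (hv : v ∈ S.carrier) (l l' : Fin n → ℂ) (a b M : ℕ) :
    ∑ i ∈ box n M, ∑ j ∈ box n M, L.a M i j * dotProduct l (L.shiftCol a i v) *
      dotProduct l' (L.shiftCol b j v) =
      -(1 / 2) * (-1) ^ b * dotProduct l ((Nm S v M b (a + b + 2)).mulVec ((S.η⁻¹).mulVec l')) := by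
  have e : ∀ x y : Fin n → ℂ, dotProduct ((S.η⁻¹).mulVec x) (S.η.mulVec y) = dotProduct x y := by
    intro x y
    rw [Matrix.dotProduct_mulVec, ← Matrix.mulVec_transpose, η_transpose, Matrix.mulVec_mulVec,
      η_mul_inv, Matrix.one_mulVec]
  have g : ∀ (l : Fin n → ℂ) (a : ℕ),
      Ge 0 (∑ i ∈ box n M, dotProduct l (L.shiftCol a i v) • hvec S i) := by
    intro l a
    refine Ge.sum fun i _ s hs => ?_
    rw [map_smul, ge_hvec i s (by omega), smul_zero]
  have g' : Ge 0 ((-1 : ℂ) ^ (a + 1) • mulL (L.ThInv v) (mono (a : ℤ) ((S.η⁻¹).mulVec l))) := by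
    intro s hs
    rw [map_smul]
    change _ • cf s ((LM _).mulVec _) = 0
    rw [(ge_mono (a : ℤ) ((S.η⁻¹).mulVec l)).LM_mulVec _ s (by omega), smul_zero]
  have h1 := L.pair_J_tail M (L.sum_hvec_shiftCol (v := v) l a M) (g l' b) (by omega)
  have h2 := L.pair_J_tail M g' (L.sum_hvec_shiftCol (v := v) l' b M) (by omega)
  rw [pair_sub_left, sub_eq_zero] at h1
  rw [map_sub, pair_sub_right, sub_eq_zero, ← h1, map_smul, pair_smul_left, pair_smul_right,
    L.pair_ThInv_JA hv, pair_mono_left, e, zpow_natCast,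
    show -2 - (a : ℤ) = (b : ℤ) - ((a + b + 2 : ℕ) : ℤ) by push_cast; ring, cf_JB_pow_mono,
    pair_sum_left] at h2
  have h3 : ∑ i ∈ box n M, ∑ j ∈ box n M, L.a M i j * dotProduct l (L.shiftCol a i v) *
      dotProduct l' (L.shiftCol b j v) = -(1 / 2) * ∑ i ∈ box n M,
        pair S.η (dotProduct l (L.shiftCol a i v) • hvec S i)
          ((L.JA ^ M) (∑ i ∈ box n M, dotProduct l' (L.shiftCol b i v) • hvec S i)) := by
    rw [Finset.mul_sum]
    refine Finset.sum_congr rfl fun i _ => ?_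
    rw [map_sum, pair_sum_right, Finset.mul_sum]
    refine Finset.sum_congr rfl fun j _ => ?_
    rw [map_smul, pair_smul_left, pair_smul_right, a_eq]; ring
  rw [h3, h2]
  have ha : ((-1 : ℂ)) ^ (a + 1) * (-1) ^ a = -1 := by
    rw [← pow_add, show a + 1 + a = 2 * a + 1 by ring, pow_succ, pow_mul]; norm_num
  have hb : ((-1 : ℂ)) ^ (b + 1) = -(-1) ^ b := by rw [pow_succ]; ring
  rw [hb]
  linear_combination (1 / 2) * (-1) ^ b *
    dotProduct l ((Nm S v M b (a + b + 2)).mulVec ((S.η⁻¹).mulVec l')) * ha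

end LeveltSystem

end

section

open FrobeniusManifold Laurent

/-! ### The coordinates `v, y_1, …, y_N` -/

section Analytic

variable {n : ℕ} {E : Type*} [NormedAddCommGroup E] [NormedSpace ℂ E] {x : E}

theorem analyticAt_matrix_mul {A B : E → Matrix (Fin n) (Fin n) ℂ}
    (hA : ∀ i j, AnalyticAt ℂ (fun x => A x i j) x) (hB : ∀ i j, AnalyticAt ℂ (fun x => B x i j) x)
    (i j : Fin n) : AnalyticAt ℂ (fun x => (A x * B x) i j) x := by
  simp only [Matrix.mul_apply]
  exact Finset.analyticAt_fun_sum _ fun k _ => (hA i k).fun_mul (hB k j)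

theorem analyticAt_mulVec {A : E → Matrix (Fin n) (Fin n) ℂ} {w : E → Fin n → ℂ}
    (hA : ∀ i j, AnalyticAt ℂ (fun x => A x i j) x) (hw : ∀ i, AnalyticAt ℂ (fun x => w x i) x)
    (i : Fin n) : AnalyticAt ℂ (fun x => ((A x).mulVec (w x)) i) x := by
  simp only [Matrix.mulVec, dotProduct]
  exact Finset.analyticAt_fun_sum _ fun k _ => (hA i k).fun_mul (hw k)

theorem analyticAt_det {A : E → Matrix (Fin n) (Fin n) ℂ}
    (hA : ∀ i j, AnalyticAt ℂ (fun x => A x i j) x) : AnalyticAt ℂ (fun x => (A x).det) x := by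
  simp only [Matrix.det_apply', ]
  exact Finset.analyticAt_fun_sum _ fun σ _ => analyticAt_const.fun_mul
    (Finset.analyticAt_fun_prod _ fun i _ => hA _ _)

theorem analyticAt_matrix_inv {A : E → Matrix (Fin n) (Fin n) ℂ}
    (hA : ∀ i j, AnalyticAt ℂ (fun x => A x i j) x) (hd : IsUnit (A x).det) (i j : Fin n) :
    AnalyticAt ℂ (fun x => (A x)⁻¹ i j) x := by
  simp only [Matrix.inv_def, Matrix.smul_apply, smul_eq_mul, Ring.inverse_eq_inv',
    Matrix.adjugate_apply]
  refine ((analyticAt_det hA).fun_inv hd.ne_zero).fun_mul (analyticAt_det fun k l => ?_)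
  by_cases h : k = j
  · subst h; simp only [Matrix.updateRow_self]; exact analyticAt_const
  · simp only [Matrix.updateRow_ne h]; exact hA k l

theorem analyticAt_mulMatrix_comp [NeZero n] {S : FrobeniusManifold n} {f g : E → Fin n → ℂ}
    (hf : ∀ γ, AnalyticAt ℂ (fun x => f x γ) x) (hg : ∀ γ, AnalyticAt ℂ (fun x => g x γ) x)
    (hx : f x ∈ S.carrier) (γ β : Fin n) :
    AnalyticAt ℂ (fun x => S.mulMatrix (f x) (g x) γ β) x := by
  have h : ∀ x, S.mulMatrix (f x) (g x) γ β =
      ∑ α, g x α * S.mulMatrix (f x) (Pi.single α 1) γ β := by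
    intro x
    conv_lhs => rw [← LeveltSystem.sum_smul_single (g x), mulMatrix_sum]
    simp [mulMatrix_smul, Matrix.sum_apply]
  simp only [h]
  refine Finset.analyticAt_fun_sum _ fun α _ => (hg α).fun_mul ?_
  exact AnalyticAt.fun_comp (g := fun v => S.mulMatrix v (Pi.single α 1) γ β)
    (analyticAt_mulMatrix hx _ _ _) (AnalyticAt.pi hf)

theorem analyticAt_comp_vec {f : E → Fin n → ℂ} {H : (Fin n → ℂ) → ℂ}
    (hf : ∀ γ, AnalyticAt ℂ (fun x => f x γ) x) (hH : AnalyticAt ℂ H (f x)) :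
    AnalyticAt ℂ (fun x => H (f x)) x :=
  AnalyticAt.fun_comp (g := H) hH (AnalyticAt.pi hf)

/-- The derivative of `x ↦ df(x)(Z(x))`. -/
theorem fderiv_fderiv_vectorField {H : E → ℂ} {Z : E → E} (hH : AnalyticAt ℂ H x)
    (hZ : DifferentiableAt ℂ Z x) (w : E) :
    fderiv ℂ (fun x => fderiv ℂ H x (Z x)) x w =
      fderiv ℂ (fun y => fderiv ℂ H y w) x (Z x) + fderiv ℂ H x (fderiv ℂ Z x w) := by
  have hd : DifferentiableAt ℂ (fderiv ℂ H) x := hH.fderiv.differentiableAt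
  rw [(hd.hasFDerivAt.clm_apply hZ.hasFDerivAt).fderiv, fderiv_fderiv_comm hH w (Z x),
    (hd.hasFDerivAt.clm_apply (hasFDerivAt_const (Z x) x)).fderiv]
  simp [add_comm]

theorem analyticAt_fderiv_vectorField {H : E → ℂ} {Z : E → E} (hH : AnalyticAt ℂ H x)
    (hZ : AnalyticAt ℂ Z x) : AnalyticAt ℂ (fun x => fderiv ℂ H x (Z x)) x :=
  AnalyticAt.fun_comp (g := fun p : (E →L[ℂ] ℂ) × E => p.1 p.2)
    ((ContinuousLinearMap.id ℂ (E →L[ℂ] ℂ)).analyticAt_bilinear _) (hH.fderiv.prod hZ)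

end Analytic

/-- The space of the coordinates `v, y_1, …, y_N`. -/
abbrev Chart (n N : ℕ) := Fin (N + 1) → Fin n → ℂ

section Chart

variable {n N : ℕ}

variable (N) in
/-- The coordinate `y_q`, which is `0` for `q > N`. -/
def cY (q : ℕ) : Chart n N →L[ℂ] (Fin n → ℂ) :=
  if h : q < N + 1 then ContinuousLinearMap.proj (R := ℂ) (φ := fun _ : Fin (N + 1) => Fin n → ℂ) ⟨q, h⟩
  else 0

variable (N) in
/-- The inclusion of the vectors along `y_q`, which is `0` for `q > N`. -/
def inc (q : ℕ) : (Fin n → ℂ) →L[ℂ] Chart n N :=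
  if h : q < N + 1 then ContinuousLinearMap.single ℂ (fun _ : Fin (N + 1) => Fin n → ℂ) ⟨q, h⟩
  else 0

variable (N) in
/-- The point with coordinates `f 0, …, f N`. -/
def ofSeq (f : ℕ → Fin n → ℂ) : Chart n N := fun q => f q

theorem cY_apply {q : ℕ} (h : q ≤ N) (Y : Chart n N) : cY N q Y = Y ⟨q, by omega⟩ := by
  rw [cY, dif_pos (by omega)]; rfl

theorem cY_of_lt {q : ℕ} (h : N < q) : (cY N q : Chart n N →L[ℂ] _) = 0 := by
  rw [cY, dif_neg (by omega)]

theorem inc_of_lt {q : ℕ} (h : N < q) : (inc N q : (Fin n → ℂ) →L[ℂ] _) = 0 := by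
  rw [inc, dif_neg (by omega)]

theorem inc_apply {q : ℕ} (h : q ≤ N) (w : Fin n → ℂ) :
    inc N q w = Pi.single ⟨q, by omega⟩ w := by
  rw [inc, dif_pos (by omega)]; rfl

theorem cY_inc_self {q : ℕ} (h : q ≤ N) (w : Fin n → ℂ) : cY N q (inc N q w) = w := by
  rw [cY_apply h, inc_apply h, Pi.single_eq_same]

theorem cY_inc_ne {q q' : ℕ} (h : q ≠ q') (w : Fin n → ℂ) : cY N q (inc N q' w) = 0 := by
  by_cases h1 : q ≤ N
  · by_cases h2 : q' ≤ N
    · rw [cY_apply h1, inc_apply h2, Pi.single_eq_of_ne]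
      simpa [Fin.ext_iff] using h
    · rw [inc_of_lt (by omega)]; simp
  · rw [cY_of_lt (by omega)]; rfl

theorem cY_ofSeq {q : ℕ} (h : q ≤ N) (f : ℕ → Fin n → ℂ) : cY N q (ofSeq N f) = f q := by
  rw [cY_apply h]; rfl

theorem ofSeq_cY (Y : Chart n N) : ofSeq N (fun q => cY N q Y) = Y := by
  ext q γ
  rw [ofSeq, cY_apply (by omega)]

theorem ofSeq_eq_sum (f : ℕ → Fin n → ℂ) :
    ofSeq N f = ∑ q ∈ Finset.range (N + 1), inc N q (f q) := by
  ext q γ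
  rw [Finset.sum_apply, Finset.sum_apply, Finset.sum_eq_single (q : ℕ)]
  · rw [inc_apply (by omega), Pi.single_eq_same]; rfl
  · intro r hr hne
    rw [Finset.mem_range] at hr
    rw [inc_apply (by omega), Pi.single_eq_of_ne]
    · rfl
    · intro h; apply hne; rw [h]
  · intro h; exact absurd (Finset.mem_range.2 q.2) h

theorem chart_ext {Y Y' : Chart n N} (h : ∀ q ≤ N, cY N q Y = cY N q Y') : Y = Y' := by
  ext q γ
  have := h q (by omega)
  rw [cY_apply (by omega), cY_apply (by omega)] at this
  exact congrFun this γ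

theorem clm_eq_zero {l : Chart n N →L[ℂ] ℂ} (h : ∀ q ≤ N, ∀ w, l (inc N q w) = 0) : l = 0 := by
  ext Y
  rw [← ofSeq_cY Y, ofSeq_eq_sum, map_sum]
  refine Finset.sum_eq_zero fun q hq => h q ?_ _
  rw [Finset.mem_range] at hq; omega

theorem analyticAt_cY (q : ℕ) (γ : Fin n) (Y : Chart n N) : AnalyticAt ℂ (fun Y => cY N q Y γ) Y :=
  ((ContinuousLinearMap.proj (R := ℂ) (φ := fun _ : Fin n => ℂ) γ).comp (cY N q)).analyticAt Y

theorem fderiv_cY (q : ℕ) (γ : Fin n) (Y w : Chart n N) :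
    fderiv ℂ (fun Y => cY N q Y γ) Y w = cY N q w γ := by
  have := ((ContinuousLinearMap.proj (R := ℂ) (φ := fun _ : Fin n => ℂ) γ).comp (cY N q)).fderiv
    (x := Y)
  exact congrArg (fun l => l w) this

theorem analyticAt_ofSeq {E : Type*} [NormedAddCommGroup E] [NormedSpace ℂ E] {x : E}
    {f : E → ℕ → Fin n → ℂ} (hf : ∀ q γ, q ≤ N → AnalyticAt ℂ (fun x => f x q γ) x) :
    AnalyticAt ℂ (fun x => ofSeq N (f x)) x :=
  AnalyticAt.pi fun q => AnalyticAt.pi fun γ => hf q γ (by omega)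

end Chart

namespace LeveltSystem

variable {n N : ℕ} [NeZero n] {S : FrobeniusManifold n} (L : LeveltSystem S)

/-- The points where `v ∈ M` and `y_1` is invertible. -/
def dom0 (S : FrobeniusManifold n) (N : ℕ) : Set (Chart n N) :=
  {Y | cY N 0 Y ∈ S.carrier ∧ IsUnit (S.mulMatrix (cY N 0 Y) (cY N 1 Y)).det}

/-- The vector `v_x = -y_1⁻¹`. -/
def vx (S : FrobeniusManifold n) (Y : Chart n N) : Fin n → ℂ :=
  -((S.mulMatrix (cY N 0 Y) (cY N 1 Y))⁻¹).mulVec (unit n)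

/-- The matrix of multiplication by `v_x`. -/
def Cx (S : FrobeniusManifold n) (Y : Chart n N) : Matrix (Fin n) (Fin n) ℂ :=
  S.mulMatrix (cY N 0 Y) (vx S Y)

variable {Y : Chart n N}

theorem one_le_of_mem (hY : Y ∈ dom0 S N) : 1 ≤ N := by
  by_contra h
  have h1 := hY.2
  rw [cY_of_lt (show N < 1 by omega), zero_apply, mulMatrix_zero,
    Matrix.det_zero] at h1
  exact not_isUnit_zero h1

theorem Cx_mul (hY : Y ∈ dom0 S N) : Cx S Y * S.mulMatrix (cY N 0 Y) (cY N 1 Y) = -1 := by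
  rw [Cx, mulMatrix_comm hY.1, ← mulMatrix_mulMatrix hY.1, vx, Matrix.mulVec_neg,
    Matrix.mulVec_mulVec, Matrix.mul_nonsing_inv _ hY.2, Matrix.one_mulVec, mulMatrix_neg,
    mulMatrix_unit hY.1]

theorem vx_eq_of_mul (hY : cY N 0 Y ∈ S.carrier) {x : Fin n → ℂ}
    (h : S.mulMatrix (cY N 0 Y) x * S.mulMatrix (cY N 0 Y) (cY N 1 Y) = -1) :
    Y ∈ dom0 S N ∧ vx S Y = x := by
  have h1 : -S.mulMatrix (cY N 0 Y) x * S.mulMatrix (cY N 0 Y) (cY N 1 Y) = 1 := by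
    rw [Matrix.neg_mul, h, neg_neg]
  refine ⟨⟨hY, Matrix.isUnit_det_of_left_inverse h1⟩, ?_⟩
  rw [vx, Matrix.inv_eq_left_inv h1, Matrix.neg_mulVec, neg_neg, mulMatrix_mulVec_unit hY]

theorem analyticAt_C1 (hY : cY N 0 Y ∈ S.carrier) (q : ℕ) (i j : Fin n) :
    AnalyticAt ℂ (fun Y => S.mulMatrix (cY N 0 Y) (cY N q Y) i j) Y :=
  analyticAt_mulMatrix_comp (fun γ => analyticAt_cY 0 γ Y) (fun γ => analyticAt_cY q γ Y) hY i j

theorem analyticAt_vx (hY : Y ∈ dom0 S N) (γ : Fin n) : AnalyticAt ℂ (fun Y => vx S Y γ) Y := by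
  simp only [vx, Pi.neg_apply]
  have h := analyticAt_mulVec (A := fun Y => (S.mulMatrix (cY N 0 Y) (cY N 1 Y))⁻¹)
    (w := fun _ => unit n) (analyticAt_matrix_inv (analyticAt_C1 hY.1 1) hY.2)
    (fun _ => analyticAt_const) γ
  exact h.fun_neg

theorem analyticAt_Cx (hY : Y ∈ dom0 S N) (i j : Fin n) : AnalyticAt ℂ (fun Y => Cx S Y i j) Y :=
  analyticAt_mulMatrix_comp (fun γ => analyticAt_cY 0 γ Y) (analyticAt_vx hY) hY.1 i j

theorem isOpen_dom0 : IsOpen (dom0 S N) := by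
  rw [isOpen_iff_mem_nhds]
  intro Y hY
  have h1 : ∀ᶠ Y' in 𝓝 Y, cY N 0 Y' ∈ S.carrier :=
    (cY N 0).continuous.continuousAt.eventually_mem (S.isOpen_carrier.mem_nhds hY.1)
  have h2 := (analyticAt_det (analyticAt_C1 hY.1 1)).continuousAt.eventually_ne hY.2.ne_zero
  filter_upwards [h1, h2] with Y' ha hb
  exact ⟨ha, isUnit_iff_ne_zero.2 hb⟩

/-- The vector field `∂/∂t^i` in the coordinates `v, y_1, …, y_N`. -/
def Z (i : Fin n × ℕ) (Y : Chart n N) : Chart n N := ofSeq N fun q =>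
  if q = 0 then (Cx S Y).mulVec (L.col i (cY N 0 Y))
  else L.shiftCol q i (cY N 0 Y) +
    (S.mulMatrix (cY N 0 Y) (cY N (q + 1) Y)).mulVec ((Cx S Y).mulVec (L.col i (cY N 0 Y)))

theorem analyticAt_Z (hY : Y ∈ dom0 S N) (i : Fin n × ℕ) : AnalyticAt ℂ (L.Z i) Y := by
  have h0 : ∀ γ, AnalyticAt ℂ (fun Y => ((Cx S Y).mulVec (L.col i (cY N 0 Y))) γ) Y :=
    analyticAt_mulVec (analyticAt_Cx hY) fun γ =>
      analyticAt_comp_vec (H := fun v => L.col i v γ) (fun γ => analyticAt_cY 0 γ Y)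
        (L.analyticAt_col hY.1 i γ)
  refine analyticAt_ofSeq fun q γ _ => ?_
  split_ifs with h
  · exact h0 γ
  · simp only [Pi.add_apply]
    exact (analyticAt_comp_vec (H := fun v => L.shiftCol q i v γ) (fun γ => analyticAt_cY 0 γ Y)
      (L.analyticAt_shiftCol hY.1 q i γ)).fun_add
        (analyticAt_mulVec (analyticAt_C1 hY.1 (q + 1)) h0 γ)

theorem vx_add_inc {q : ℕ} (hq : 2 ≤ q) (Y : Chart n N) (w : Fin n → ℂ) :
    vx S (Y + inc N q w) = vx S Y := by
  simp only [vx, map_add, cY_inc_ne (show 0 ≠ q by omega), cY_inc_ne (show 1 ≠ q by omega), add_zero]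

theorem Cx_add_inc {q : ℕ} (hq : 2 ≤ q) (Y : Chart n N) (w : Fin n → ℂ) :
    Cx S (Y + inc N q w) = Cx S Y := by
  simp only [Cx, vx_add_inc hq, map_add, cY_inc_ne (show 0 ≠ q by omega), add_zero]

/-- `v_x` involves only `v` and `y_1`, so a coordinate `y_{q+1}` with `q ≥ 1` enters the vector
field linearly and only in its component along `y_q`. This is the triangular structure behind all
order counts. -/
theorem Z_add_inc {q : ℕ} (hq : 1 ≤ q) (hN : q + 1 ≤ N) (i : Fin n × ℕ) (Y : Chart n N)
    (w : Fin n → ℂ) : L.Z i (Y + inc N (q + 1) w) = L.Z i Y +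
      inc N q ((S.mulMatrix (cY N 0 Y) w).mulVec ((Cx S Y).mulVec (L.col i (cY N 0 Y)))) := by
  refine chart_ext fun r hr => ?_
  rw [map_add, Z, Z, cY_ofSeq hr, cY_ofSeq hr, Cx_add_inc (by omega), map_add,
    cY_inc_ne (show 0 ≠ q + 1 by omega), add_zero, map_add]
  by_cases h0 : r = 0
  · rw [if_pos h0, if_pos h0, cY_inc_ne (by omega), add_zero]
  · rw [if_neg h0, if_neg h0]
    by_cases h1 : r = q
    · subst h1
      rw [cY_inc_self hr, cY_inc_self hN, mulMatrix_add, Matrix.add_mulVec, add_assoc]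
    · rw [cY_inc_ne (by omega), cY_inc_ne h1, add_zero, add_zero]

theorem fderiv_Z_inc {q : ℕ} (hq : 1 ≤ q) (hN : q + 1 ≤ N) (i : Fin n × ℕ) (hY : Y ∈ dom0 S N)
    (w : Fin n → ℂ) : fderiv ℂ (L.Z i) Y (inc N (q + 1) w) =
      inc N q ((S.mulMatrix (cY N 0 Y) w).mulVec ((Cx S Y).mulVec (L.col i (cY N 0 Y)))) := by
  have h1 := (L.analyticAt_Z hY i).differentiableAt.hasFDerivAt.hasLineDerivAt (inc N (q + 1) w)
  have h2 : HasDerivAt (fun s : ℂ => L.Z i Y + s • inc N q ((S.mulMatrix (cY N 0 Y) w).mulVec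
      ((Cx S Y).mulVec (L.col i (cY N 0 Y))))) (inc N q ((S.mulMatrix (cY N 0 Y) w).mulVec
      ((Cx S Y).mulVec (L.col i (cY N 0 Y))))) 0 := by
    simpa using ((hasDerivAt_id (0 : ℂ)).smul_const _).const_add (L.Z i Y)
  refine HasDerivAt.unique h1 (h2.congr_of_eventuallyEq (Filter.Eventually.of_forall fun s => ?_))
  simp only [← map_smul]
  rw [L.Z_add_inc hq hN, mulMatrix_smul, Matrix.smul_mulVec]

/-- `H` is analytic on `Ω` and depends only on `v, y_1, …, y_r`. -/
def Ord (Ω : Set (Chart n N)) (r : ℕ) (H : Chart n N → ℂ) : Prop :=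
  (∀ Y ∈ Ω, AnalyticAt ℂ H Y) ∧ ∀ Y ∈ Ω, ∀ q, r < q → ∀ w, fderiv ℂ H Y (inc N q w) = 0

variable {Ω : Set (Chart n N)} {H : Chart n N → ℂ}

theorem fderiv_eq_zero_of_eqOn (hΩ : IsOpen Ω) {f : Chart n N → ℂ} (hf : ∀ Y ∈ Ω, f Y = 0)
    (hY : Y ∈ Ω) (w : Chart n N) : fderiv ℂ f Y w = 0 := by
  have : f =ᶠ[𝓝 Y] fun _ => 0 := Filter.mem_of_superset (hΩ.mem_nhds hY) hf
  rw [this.fderiv_eq]; simp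

/-- Differentiate `dH(Z)` along `y_q`, `q > r + 1`: the term with the derivative of `H` along `y_q`
vanishes, and by `fderiv_Z_inc` the derivative of `Z` points along `y_{q-1}`, where `dH` vanishes
too. -/
theorem Ord.Z {r : ℕ} (hΩ : IsOpen Ω) (hsub : Ω ⊆ dom0 S N) (h : Ord Ω r H) (i : Fin n × ℕ) :
    Ord Ω (r + 1) (fun Y => fderiv ℂ H Y (L.Z i Y)) := by
  refine ⟨fun Y hY => analyticAt_fderiv_vectorField (h.1 Y hY) (L.analyticAt_Z (hsub hY) i), ?_⟩
  intro Y hY q hq w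
  rw [fderiv_fderiv_vectorField (h.1 Y hY) (L.analyticAt_Z (hsub hY) i).differentiableAt,
    fderiv_eq_zero_of_eqOn hΩ (fun Y hY => h.2 Y hY q (by omega) w) hY, zero_add]
  by_cases hN : q ≤ N
  · obtain ⟨p, rfl⟩ : ∃ p, q = p + 1 := ⟨q - 1, by omega⟩
    rw [L.fderiv_Z_inc (by omega) hN i (hsub hY)]
    exact h.2 Y hY p (by omega) _
  · rw [inc_of_lt (by omega)]; simp

/-- The jet coordinate `v^{γ,r}` as a function of `v, y_1, …, y_N`. -/
def Phi : ℕ → Fin n → Chart n N → ℂ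
  | 0, γ => fun Y => cY N 0 Y γ
  | r + 1, γ => fun Y => fderiv ℂ (Phi r γ) Y (L.Z (0, 0) Y)

theorem ord_Phi (r : ℕ) (γ : Fin n) : Ord (dom0 S N) r (L.Phi r γ) := by
  induction r with
  | zero =>
    refine ⟨fun Y _ => analyticAt_cY 0 γ Y, fun Y _ q hq w => ?_⟩
    change fderiv ℂ (fun Y => cY N 0 Y γ) Y _ = 0
    rw [fderiv_cY, cY_inc_ne (by omega)]; rfl
  | succ r ih => exact ih.Z L isOpen_dom0 subset_rfl (0, 0)

theorem Phi_one (hY : Y ∈ dom0 S N) (γ : Fin n) : L.Phi 1 γ Y = vx S Y γ := by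
  change fderiv ℂ (fun Y => cY N 0 Y γ) Y _ = _
  rw [fderiv_cY, Z, cY_ofSeq (Nat.zero_le _), if_pos rfl, Solution.col_zero_zero hY.1, Cx,
    mulMatrix_mulVec_unit hY.1]

/-- Implicit differentiation of `y_1 · v_x = -e` along `y_1`, followed by multiplication with `v_x`.
-/
theorem fderiv_vx_inc_one (hY : Y ∈ dom0 S N) (w : Fin n → ℂ) (γ : Fin n) :
    fderiv ℂ (fun Y => vx S Y γ) Y (inc N 1 w) = ((Cx S Y ^ 2).mulVec w) γ := by
  have hN := one_le_of_mem hY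
  set A := S.mulMatrix (cY N 0 Y) (cY N 1 Y) with hA
  let p : ℂ → Chart n N := fun s => Y + s • inc N 1 w
  have hp0 : p 0 = Y := by simp [p]
  have hline : ∀ γ, HasDerivAt (fun s : ℂ => vx S (p s) γ)
      (fderiv ℂ (fun Y => vx S Y γ) Y (inc N 1 w)) 0 := fun γ =>
    (analyticAt_vx hY γ).differentiableAt.hasFDerivAt.hasLineDerivAt (inc N 1 w)
  have hev : ∀ᶠ s in 𝓝 (0 : ℂ), p s ∈ dom0 S N := by
    have hc : ContinuousAt p 0 := by fun_prop
    exact hc.eventually_mem (by rw [hp0]; exact isOpen_dom0.mem_nhds hY)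
  have hid : ∀ᶠ s in 𝓝 (0 : ℂ), A.mulVec (vx S (p s)) +
      s • (S.mulMatrix (cY N 0 Y) w).mulVec (vx S (p s)) = -unit n := by
    filter_upwards [hev] with s hs
    have h1 := Cx_mul hs
    have h2 : S.mulMatrix (cY N 0 (p s)) (cY N 1 (p s)) = A + s • S.mulMatrix (cY N 0 Y) w := by
      simp only [p, map_add, map_smul, cY_inc_ne (show 0 ≠ 1 by omega), cY_inc_self hN, smul_zero,
        add_zero, mulMatrix_add, mulMatrix_smul, hA]
    rw [Cx, mulMatrix_comm hs.1, h2] at h1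
    rw [← Matrix.smul_mulVec, ← Matrix.add_mulVec, ← mulMatrix_mulVec_unit hs.1 (vx S (p s)),
      Matrix.mulVec_mulVec, h1, Matrix.neg_mulVec, Matrix.one_mulVec]
  set x : Fin n → ℂ := fun γ => fderiv ℂ (fun Y => vx S Y γ) Y (inc N 1 w) with hx
  have hvec : HasDerivAt (fun s : ℂ => vx S (p s)) x 0 := hasDerivAt_pi.2 hline
  have hm : ∀ B : Matrix (Fin n) (Fin n) ℂ, HasDerivAt (fun s : ℂ => B.mulVec (vx S (p s)))
      (B.mulVec x) 0 := fun B =>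
    (LinearMap.toContinuousLinearMap (Matrix.mulVecLin B)).hasFDerivAt.comp_hasDerivAt 0 hvec
  have hd := (hm A).add ((hasDerivAt_id (0 : ℂ)).smul (hm (S.mulMatrix (cY N 0 Y) w)))
  have hz := (hasDerivAt_const (0 : ℂ) (-unit n)).congr_of_eventuallyEq hid
  have heq := hd.unique hz
  simp only [id_eq, zero_smul, one_smul, zero_add, hp0] at heq
  have h4 : A.mulVec x = -(Cx S Y).mulVec w := by
    rw [Cx, mulMatrix_mulVec_comm hY.1 (vx S Y) w, ← add_eq_zero_iff_eq_neg]; exact heq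
  have h5 := congrArg (fun z => (Cx S Y).mulVec z) h4
  simp only [Matrix.mulVec_mulVec, hA, Cx_mul hY, Matrix.mulVec_neg, Matrix.neg_mulVec,
    Matrix.one_mulVec] at h5
  rw [neg_inj] at h5
  rw [pow_two, ← h5]

/-- Each `∂_x` converts a derivative along `y_{r+1}` into one along `y_r` with a factor `v_x`,
starting from `v_x²` at `r = 1`. As `v_x` is invertible, the passage from `y`'s to jets is
triangular and invertible. -/
theorem fderiv_Phi_top {r : ℕ} (hr : 1 ≤ r) (hN : r ≤ N) (hY : Y ∈ dom0 S N) (w : Fin n → ℂ)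
    (γ : Fin n) : fderiv ℂ (L.Phi r γ) Y (inc N r w) = ((Cx S Y ^ (r + 1)).mulVec w) γ := by
  induction r, hr using Nat.le_induction generalizing w γ with
  | base =>
    rw [← fderiv_vx_inc_one hY]
    have : L.Phi 1 γ =ᶠ[𝓝 Y] fun Y => vx S Y γ :=
      Filter.mem_of_superset (isOpen_dom0.mem_nhds hY) fun Y hY => L.Phi_one hY γ
    rw [this.fderiv_eq]
  | succ r hr ih =>
    have h := L.ord_Phi (N := N) r γ
    change fderiv ℂ (fun Y => fderiv ℂ (L.Phi r γ) Y (L.Z (0, 0) Y)) Y _ = _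
    rw [fderiv_fderiv_vectorField (h.1 Y hY) (L.analyticAt_Z hY _).differentiableAt,
      fderiv_eq_zero_of_eqOn isOpen_dom0 (fun Y hY => h.2 Y hY (r + 1) (by omega) w) hY, zero_add,
      L.fderiv_Z_inc hr hN _ hY, ih (by omega), Solution.col_zero_zero hY.1]
    rw [Cx, mulMatrix_mulVec_unit hY.1, mulMatrix_mulVec_comm hY.1, Matrix.mulVec_mulVec,
      ← pow_succ]

end LeveltSystem

end

/-! ### The linearized constraints as vector fields on the chart -/

section

open FrobeniusManifold Laurent LeveltSystem

variable {n N : ℕ} [NeZero n] {S : FrobeniusManifold n} {L : LeveltSystem S}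

/-! ### Jet functions in the coordinates `v, y_1, …, y_N` -/

namespace LeveltSystem

variable (L) (G : JetFunction S)

/-- The jet of order `r` as a function of `v, y_1, …, y_N`. -/
def jetOf (r : ℕ) (Y : Chart n N) : Fin (r + 1) → Fin n → ℂ := fun q γ => L.Phi q γ Y

/-- A jet function in the coordinates `v, y_1, …, y_N`. -/
def hat (Y : Chart n N) : ℂ := G.toFun (L.jetOf G.order Y)

/-- The domain of a jet function in the coordinates `v, y_1, …, y_N`. -/
def domOf (N : ℕ) : Set (Chart n N) := {Y | Y ∈ dom0 S N ∧ L.jetOf G.order Y ∈ G.dom}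

variable {Y : Chart n N}

theorem analyticAt_jetOf (r : ℕ) (hY : Y ∈ dom0 S N) : AnalyticAt ℂ (L.jetOf r) Y :=
  AnalyticAt.pi fun q => AnalyticAt.pi fun γ => (L.ord_Phi q γ).1 Y hY

theorem isOpen_domOf : IsOpen (L.domOf G N) := by
  rw [isOpen_iff_mem_nhds]
  intro Y hY
  filter_upwards [isOpen_dom0.mem_nhds hY.1,
    (L.analyticAt_jetOf G.order hY.1).continuousAt.eventually_mem (G.isOpen_dom.mem_nhds hY.2)]
    with Y' h1 h2
  exact ⟨h1, h2⟩

theorem fderiv_jetOf (r : ℕ) (hY : Y ∈ dom0 S N) (w : Chart n N) (q : Fin (r + 1)) (γ : Fin n) :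
    fderiv ℂ (L.jetOf r) Y w q γ = fderiv ℂ (L.Phi q γ) Y w := by
  have h : HasFDerivAt (L.jetOf r) (ContinuousLinearMap.pi fun q => ContinuousLinearMap.pi fun γ =>
      fderiv ℂ (L.Phi (q : ℕ) γ) Y) Y :=
    hasFDerivAt_pi.2 fun q => hasFDerivAt_pi.2 fun γ =>
      ((L.ord_Phi q γ).1 Y hY).differentiableAt.hasFDerivAt
  rw [h.fderiv]; rfl

theorem fderiv_hat (hY : Y ∈ L.domOf G N) (w : Chart n N) :
    fderiv ℂ (L.hat G) Y w = fderiv ℂ G.toFun (L.jetOf G.order Y)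
      (fun q γ => fderiv ℂ (L.Phi q γ) Y w) := by
  have h1 := (G.analytic _ hY.2).differentiableAt.hasFDerivAt
  have h2 := (L.analyticAt_jetOf G.order hY.1).differentiableAt.hasFDerivAt
  have h3 : HasFDerivAt (L.hat G) _ Y := h1.comp Y h2
  rw [h3.fderiv, ContinuousLinearMap.comp_apply]
  congr 1
  ext q γ
  exact L.fderiv_jetOf _ hY.1 w q γ

theorem ord_hat : Ord (L.domOf G N) G.order (L.hat G) := by
  refine ⟨fun Y hY => AnalyticAt.fun_comp (g := G.toFun) (G.analytic _ hY.2)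
    (L.analyticAt_jetOf _ hY.1), fun Y hY q hq w => ?_⟩
  rw [L.fderiv_hat G hY]
  have : (fun (p : Fin (G.order + 1)) γ => fderiv ℂ (L.Phi p γ) Y (inc N q w)) = 0 := by
    ext p γ
    exact (L.ord_Phi p γ).2 Y hY.1 q (by omega) w
  rw [this, map_zero]

/-- The series `∑_{q ≥ 1} y_q z^{-q-1}`. -/
def serC (Y : Chart n N) : W n := ∑ q ∈ Finset.range N, mono (-(q : ℤ) - 2) (cY N (q + 1) Y)

theorem cf_serC (Y : Chart n N) (q : ℕ) : cf (-(q : ℤ) - 2) (serC Y) = cY N (q + 1) Y := by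
  rw [serC, cf_sum_mono N (fun q : ℕ => -(q : ℤ) - 2) (fun a b h => by simpa using h)
    (fun q => cY N (q + 1) Y)]
  split_ifs with h
  · rfl
  · rw [cY_of_lt (by omega)]; rfl

theorem le_serC (Y : Chart n N) : Le (-2) (serC Y) :=
  Le.sum fun q _ => (le_mono _ _).mono_le (by omega)

/-- The coefficients of `p(𝒰 + z⁻¹ (𝒱 - 1/2 - z d/dz)) ∑ y_q z^{-q-1}`. -/
def Ev (S : FrobeniusManifold n) (Y : Chart n N) (p : Polynomial ℂ) (a : ℕ) : Fin n → ℂ :=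
  cf (-2 - (a : ℤ)) (Polynomial.aeval (JB S (cY N 0 Y)) p (serC Y))

/-- The vector field of the constraint in the coordinates `v, y_1, …, y_N`. -/
def DM (S : FrobeniusManifold n) (Y : Chart n N) (p : Polynomial ℂ) : Chart n N := ofSeq N fun q =>
  if q = 0 then (Cx S Y).mulVec (Ev S Y p 0)
  else Ev S Y p q + (S.mulMatrix (cY N 0 Y) (cY N (q + 1) Y)).mulVec ((Cx S Y).mulVec (Ev S Y p 0))

end LeveltSystem

namespace Solution

variable (s : Solution L)

/-! ### The solution in the coordinates `v, y_1, …, y_N` -/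

/-- The coordinates `v, y_1, …, y_N` on the solution. -/
def Ych (N : ℕ) (t : Times n) : Chart n N := ofSeq N fun q => if q = 0 then s.v t else s.y q t

theorem cY_zero_Ych (t : Times n) : cY N 0 (s.Ych N t) = s.v t := by
  rw [Ych, cY_ofSeq (Nat.zero_le _), if_pos rfl]

theorem cY_Ych {q : ℕ} (hq : 1 ≤ q) (hN : q ≤ N) (t : Times n) : cY N q (s.Ych N t) = s.y q t := by
  rw [Ych, cY_ofSeq hN, if_neg (by omega)]

theorem analyticGerm_Ych_apply (q : Fin (N + 1)) (γ : Fin n) :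
    AnalyticGerm fun t => s.Ych N t q γ := by
  by_cases h : (q : ℕ) = 0
  · have : (fun t => s.Ych N t q γ) = fun t => s.v t γ := by ext t; simp [Ych, ofSeq, h]
    rw [this]; exact s.analyticGerm_v.apply γ
  · have : (fun t => s.Ych N t q γ) = fun t => s.y q t γ := by ext t; simp [Ych, ofSeq, h]
    rw [this]; exact s.analyticGerm_y q γ

theorem analyticGerm_Ych : AnalyticGerm (s.Ych N) :=
  AnalyticGerm.pi fun q => AnalyticGerm.pi fun γ => s.analyticGerm_Ych_apply q γ

theorem near_Ych (hN : 1 ≤ N) : HoldsNear fun t =>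
    s.Ych N t ∈ dom0 S N ∧ vx S (s.Ych N t) = s.dv (0, 0) t := by
  refine (s.near_mem.and s.near_vx_mul_y).mono fun t ht => ?_
  have h0 := s.cY_zero_Ych (N := N) t
  have h1 := s.cY_Ych le_rfl hN t
  exact vx_eq_of_mul (by rw [h0]; exact ht.1) (by rw [h0, h1]; exact ht.2)

/-- The derivative of `y_N` involves `y_{N+1}`, which the chart replaces by zero. The resulting
error lies in the last slot only and is invisible to functions of order less than `N`. -/
theorem deriv_Ych (hN : 1 ≤ N) (i : Fin n × ℕ) : HoldsNear fun t =>
    deriv (fun x : ℂ => s.Ych N (t + Finsupp.single i x)) 0 = L.Z i (s.Ych N t) +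
      inc N N ((S.mulMatrix (s.v t) (s.y (N + 1) t)).mulVec (s.dv i t)) := by
  have hy : HoldsNear fun t => ∀ q : Fin (N + 2), (fun γ => dt i (fun t => s.y q t γ) t) =
      L.shiftCol q i (s.v t) + (S.mulMatrix (s.v t) (s.dv i t)).mulVec (s.y (q + 1) t) :=
    HoldsNear.forall_fintype fun q => s.dt_y i q
  refine ((((s.analyticGerm_Ych (N := N)).differentiableAt_line i).and (s.near_Ych hN)).and
    ((hy.and s.near_mem).and (s.near_dv i))).mono fun t ht => ?_
  obtain ⟨⟨hd, hdom, hvx⟩, ⟨hq, hm⟩, hdv⟩ := ht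
  have hCx : Cx S (s.Ych N t) = S.mulMatrix (s.v t) (s.dv (0, 0) t) := by
    rw [Cx, hvx, cY_zero_Ych]
  have hcomp : ∀ q : Fin (N + 1), (deriv (fun x : ℂ => s.Ych N (t + Finsupp.single i x)) 0) q =
      fun γ => dt i (fun t => s.Ych N t q γ) t := by
    intro q
    have h1 := differentiableAt_pi.1 hd
    rw [deriv_pi h1]
    simp only
    rw [deriv_pi (differentiableAt_pi.1 (h1 q))]
    rfl
  refine chart_ext fun q hqN => ?_
  rw [cY_apply hqN, hcomp, map_add, Z, cY_ofSeq hqN]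
  by_cases h0 : q = 0
  · subst h0
    rw [if_pos rfl, cY_inc_ne (by omega), add_zero, hCx, cY_zero_Ych, ← hdv]
    rfl
  · have e1 : (fun γ => dt i (fun t => s.Ych N t ⟨q, by omega⟩ γ) t) =
        fun γ => dt i (fun t => s.y q t γ) t := by
      simp [Ych, ofSeq, h0]
    have e2 := hq ⟨q, by omega⟩
    simp only at e2
    rw [e1, e2, if_neg h0, cY_zero_Ych, hCx, ← hdv, mulMatrix_mulVec_comm hm, add_assoc]
    congr 1
    by_cases h1 : q = N
    · subst h1
      rw [cY_of_lt (by omega), zero_apply, mulMatrix_zero, Matrix.zero_mulVec, zero_add,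
        cY_inc_self le_rfl]
    · rw [cY_inc_ne h1, add_zero, s.cY_Ych (by omega) (by omega)]

theorem dt_comp_Ych {Ω : Set (Chart n N)} {H : Chart n N → ℂ} {r : ℕ} (hΩ : IsOpen Ω)
    (hH : Ord Ω r H) (hr : r < N) (h0 : s.Ych N 0 ∈ Ω) (i : Fin n × ℕ) :
    AnalyticGerm (fun t => H (s.Ych N t)) ∧ HoldsNear fun t =>
      dt i (fun t => H (s.Ych N t)) t = fderiv ℂ H (s.Ych N t) (L.Z i (s.Ych N t)) := by
  have ha := hH.1 _ h0
  refine ⟨s.analyticGerm_Ych.comp ha, ?_⟩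
  refine (((s.analyticGerm_Ych (N := N)).dt_comp i ha).and ((s.deriv_Ych (N := N) (by omega) i).and
    ((s.analyticGerm_Ych (N := N)).eventually_mem hΩ h0))).mono fun t ht => ?_
  rw [ht.1.2, ht.2.1, map_add, hH.2 _ ht.2.2 N hr, add_zero]

theorem near_jet (hN : 1 ≤ N) {r : ℕ} (hr : r ≤ N) (γ : Fin n) :
    HoldsNear fun t => s.jet t r γ = L.Phi r γ (s.Ych N t) := by
  induction r with
  | zero =>
    refine HoldsNear.mono (P := fun _ => True) (fun N => Filter.Eventually.of_forall fun _ => trivial)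
      fun t _ => ?_
    change s.v t γ = cY N 0 (s.Ych N t) γ
    rw [cY_zero_Ych]
  | succ r ih =>
    have h1 := (ih (by omega)).dt_congr (0, 0)
    have h2 := (s.dt_comp_Ych isOpen_dom0 (L.ord_Phi r γ) (by omega) (s.near_Ych hN).at_zero.1
      (0, 0)).2
    refine (h1.and h2).mono fun t ht => ?_
    change (dt (0, 0))^[r + 1] (fun t => s.v t γ) t = _
    rw [Function.iterate_succ_apply']
    exact ht.1.trans ht.2

theorem near_jetOf (hN : 1 ≤ N) {r : ℕ} (hr : r ≤ N) :
    HoldsNear fun t => (fun q : Fin (r + 1) => s.jet t q) = L.jetOf r (s.Ych N t) := by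
  refine (HoldsNear.forall_fintype (ι := Fin (r + 1) × Fin n) fun q =>
    s.near_jet hN (show (q.1 : ℕ) ≤ N by omega) q.2).mono fun t ht => ?_
  ext q γ
  exact ht (q, γ)

variable {G : JetFunction S}

theorem Ych_mem (hN : 1 ≤ N) (hr : G.order ≤ N) (hG : G.trunc (s.jet 0) ∈ G.dom) :
    s.Ych N 0 ∈ L.domOf G N := by
  refine ⟨(s.near_Ych hN).at_zero.1, ?_⟩
  rw [← (s.near_jetOf hN hr).at_zero]
  exact hG

theorem near_eval (hN : 1 ≤ N) (hr : G.order ≤ N) :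
    HoldsNear fun t => s.eval G t = L.hat G (s.Ych N t) :=
  (s.near_jetOf hN hr).mono fun t ht => by
    rw [hat, ← ht]; rfl

theorem near_dt_eval (hr : G.order < N) (hG : G.trunc (s.jet 0) ∈ G.dom) (i : Fin n × ℕ) :
    HoldsNear fun t => dt i (s.eval G) t =
      fderiv ℂ (L.hat G) (s.Ych N t) (L.Z i (s.Ych N t)) :=
  (((s.near_eval (G := G) (N := N) (by omega) (by omega)).dt_congr i).and
    (s.dt_comp_Ych (L.isOpen_domOf G) (L.ord_hat G) hr (s.Ych_mem (by omega) (by omega) hG) i).2).mono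
      fun _ ht => ht.1.trans ht.2

theorem near_dt_dt_eval (hr : G.order + 1 < N) (hG : G.trunc (s.jet 0) ∈ G.dom)
    (i j : Fin n × ℕ) : HoldsNear fun t => dt i (dt j (s.eval G)) t =
      fderiv ℂ (fun Y => fderiv ℂ (L.hat G) Y (L.Z j Y)) (s.Ych N t) (L.Z i (s.Ych N t)) :=
  (((s.near_dt_eval (G := G) (N := N) (by omega) hG j).dt_congr i).and
    (s.dt_comp_Ych (L.isOpen_domOf G)
      ((L.ord_hat G).Z L (L.isOpen_domOf G) (fun _ hY => hY.1) j) hr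
      (s.Ych_mem (by omega) (by omega) hG) i).2).mono fun _ ht => ht.1.trans ht.2

/-! ### The linearized constraint -/

theorem y_eq_tY (q : ℕ) (t : Times n) : s.y q t = L.tY (s.v t) (t - s.c) q := by
  ext γ
  simp only [y, shiftSum, tY, Finsupp.sum, Finset.sum_apply, Pi.smul_apply, smul_eq_mul]

end Solution

namespace LeveltSystem

variable (L)

/-- Collects the two parts of the linearized constraint into one first-order operator. Both index
ranges are enlarged to a common box, where the extra coefficients `a` and `b` vanish. -/
theorem sum_constraint {v : Fin n → ℂ} {T : Times n} {K : ℕ} (hv : v ∈ S.carrier)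
    (hK : ∀ i, T i ≠ 0 → i.2 < K) (h0 : L.tY v T 0 = 0) (M K' : ℕ) (hK' : M + K ≤ K')
    (x : Fin n × ℕ → ℂ) :
    (∑ i ∈ box n M, ∑ j ∈ box n M, 2 * L.a M i j * L.tF v T i * x j) +
      (T.sum fun j τ => ∑ i ∈ box n (M + j.2), L.b M i j * τ * x i) =
    ∑ i ∈ box n K', -pair S.η (hvec S i) ((L.JA ^ M) (L.serJ v T K)) * x i := by
  have e1 : ∑ i ∈ box n M, ∑ j ∈ box n M, 2 * L.a M i j * L.tF v T i * x j =
      ∑ i ∈ box n K', (∑ j ∈ box n M, 2 * L.a M i j * L.tF v T j) * x i := by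
    rw [Finset.sum_comm, sum_box_of_zero (show M ≤ K' by omega)]
    · refine Finset.sum_congr rfl fun i _ => ?_
      rw [Finset.sum_mul]
      exact Finset.sum_congr rfl fun j _ => by rw [L.a_symm M j i]
    · intro i hi
      refine Finset.sum_eq_zero fun j _ => ?_
      rw [L.a_eq_zero (by omega)]; ring
  have e2 : (T.sum fun j τ => ∑ i ∈ box n (M + j.2), L.b M i j * τ * x i) =
      ∑ i ∈ box n K', (∑ j ∈ box n K, L.b M i j * T j) * x i := by
    rw [sum_eq_sum_box hK (fun j => by simp)]
    simp only [Finset.sum_mul]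
    rw [Finset.sum_comm (s := box n K')]
    refine Finset.sum_congr rfl fun j hj => ?_
    simp only [Finset.mem_product, Finset.mem_range] at hj
    refine sum_box_of_zero (by omega) fun i hi => ?_
    rw [L.b_eq_zero (by omega)]; ring
  rw [e1, e2, ← Finset.sum_add_distrib]
  refine Finset.sum_congr rfl fun i _ => ?_
  rw [← L.sum_a_add_sum_b hv hK h0 M i]; ring

theorem sum_constraint_shiftCol {v : Fin n → ℂ} {T : Times n} {K : ℕ} (hv : v ∈ S.carrier)
    (a M K' : ℕ) (hK' : M + K ≤ K') :
    ∑ i ∈ box n K', -pair S.η (hvec S i) ((L.JA ^ M) (L.serJ v T K)) • L.shiftCol a i v =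
      cf (-2 - (a : ℤ)) ((JB S v ^ M) (L.serY v T K)) := by
  ext γ
  have h := L.constraint_lin (T := T) (K := K) hv (Pi.single γ 1) a M K' hK'
  simp only [single_one_dotProduct] at h
  rw [← h, Finset.sum_apply]
  rfl

/-- The gauged operator does not raise degrees, so a coefficient of the result depends only on
coefficients of the argument of the same or higher degree. -/
theorem cf_JB_congr {v : Fin n → ℂ} {f g : W n} {s : ℤ} (h : ∀ j, s ≤ j → cf j f = cf j g)
    (M : ℕ) : cf s ((JB S v ^ M) f) = cf s ((JB S v ^ M) g) := by
  have h1 : Le (s - 1) (f - g) := fun j hj => by rw [map_sub, h j (by omega), sub_self]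
  have h2 := (h1.JB_pow (S := S) v M) s (by omega)
  rw [map_sub, map_sub, sub_eq_zero] at h2
  exact h2

end LeveltSystem

namespace Solution

variable (s : Solution L) {G : JetFunction S}

/-- Writing `∂/∂t^i` as `Z i`, the sum over `i` against the constraint coefficients can be evaluated
by `sum_constraint_shiftCol`. What remains depends on the solution only through its point of the
chart. -/
theorem linearized_zero (hr : G.order < N) (hG : G.trunc (s.jet 0) ∈ G.dom) (M : ℕ) :
    s.linearized M G 0 =
      fderiv ℂ (L.hat G) (s.Ych N 0) (DM S (s.Ych N 0) (Polynomial.X ^ M)) := by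
  set Y := s.Ych N 0 with hYdef
  have hN : 1 ≤ N := by omega
  have hY : Y ∈ L.domOf G N := s.Ych_mem hN (by omega) hG
  have hv : cY N 0 Y = s.v 0 := s.cY_zero_Ych 0
  set T : Times n := 0 - s.c with hT
  obtain ⟨K, hK⟩ : ∃ K, ∀ i, T i ≠ 0 → i.2 < K := ⟨supBound T, fun i hi => lt_supBound hi⟩
  have h0 : L.tY (s.v 0) T 0 = 0 := by rw [hT, ← s.y_eq_tY]; exact s.near_y_zero.at_zero
  have hF : ∀ i, dt i s.F0 0 = L.tF (s.v 0) T i := fun i => (s.dt_F0 i).at_zero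
  have hE : ∀ i, dt i (s.eval G) 0 = fderiv ℂ (L.hat G) Y (L.Z i Y) := fun i =>
    (s.near_dt_eval hr hG i).at_zero
  rw [linearized]
  simp only [hF, hE]
  rw [L.sum_constraint s.mem hK h0 M (M + K) le_rfl]
  have hser : ∀ a, a < N → cf (-2 - (a : ℤ)) ((JB S (s.v 0) ^ M) (L.serY (s.v 0) T K)) =
      Ev S Y (Polynomial.X ^ M) a := by
    intro a ha
    rw [Ev, map_pow, Polynomial.aeval_X, hv]
    refine cf_JB_congr (fun j hj => ?_) M
    by_cases hj2 : -2 < j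
    · rw [L.le_serY j hj2, le_serC Y j hj2]
    · obtain ⟨q, rfl⟩ : ∃ q : ℕ, j = -(q : ℤ) - 2 := ⟨(-2 - j).toNat, by omega⟩
      rw [L.cf_serY hK, cf_serC, hYdef, s.cY_Ych (by omega) (by omega), s.y_eq_tY]
  have hsum : ∀ q, q < N → cY N q (∑ i ∈ box n (M + K),
      -pair S.η (hvec S i) ((L.JA ^ M) (L.serJ (s.v 0) T K)) • L.Z i Y) =
      cY N q (DM S Y (Polynomial.X ^ M)) := by
    intro q hq
    have hs0 : ∑ i ∈ box n (M + K), -pair S.η (hvec S i) ((L.JA ^ M) (L.serJ (s.v 0) T K)) •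
        (Cx S Y).mulVec (L.col i (s.v 0)) = (Cx S Y).mulVec (Ev S Y (Polynomial.X ^ M) 0) := by
      rw [← hser 0 (by omega), ← L.sum_constraint_shiftCol s.mem 0 M (M + K) le_rfl,
        Matrix.mulVec_sum]
      exact Finset.sum_congr rfl fun i _ => by rw [Matrix.mulVec_smul, shiftCol_zero]
    rw [map_sum, DM, cY_ofSeq hq.le]
    simp only [map_smul, Z, cY_ofSeq hq.le, hv]
    by_cases hq0 : q = 0
    · simp only [if_pos hq0]; exact hs0
    · simp only [if_neg hq0, smul_add, Finset.sum_add_distrib]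
      rw [L.sum_constraint_shiftCol s.mem q M (M + K) le_rfl, hser q hq, ← hs0, Matrix.mulVec_sum]
      congr 1
      exact Finset.sum_congr rfl fun i _ => by rw [Matrix.mulVec_smul]
  -- The two vectors need not agree along `y_N`, since `serC` stops at `y_N` and has lost `y_{N+1}`;
  -- but `G` has order less than `N`.
  have hfin : ∀ w w' : Chart n N, (∀ q < N, cY N q w = cY N q w') →
      fderiv ℂ (L.hat G) Y w = fderiv ℂ (L.hat G) Y w' := by
    intro w w' h
    have : w - w' = inc N N (cY N N (w - w')) := by
      refine chart_ext fun q hq => ?_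
      by_cases hqN : q = N
      · subst hqN; rw [cY_inc_self le_rfl]
      · rw [cY_inc_ne hqN, map_sub, h q (by omega), sub_self]
    rw [← sub_eq_zero, ← map_sub, this]
    exact (L.ord_hat G).2 Y hY N hr _
  rw [← hfin _ _ hsum, map_sum]
  exact Finset.sum_congr rfl fun i _ => by rw [map_smul, smul_eq_mul]

end Solution

end

/-! ### The pole constants and the nondegeneracy of the constraints -/

section

open FrobeniusManifold Laurent LeveltSystem

/-! ### The constants -/

/-- The rising factorial `x (x + 1) ⋯ (x + N - 1)`. -/
def rising (x : ℂ) (N : ℕ) : ℂ := ∏ j ∈ Finset.range N, (x + j)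

theorem rising_succ (x : ℂ) (N : ℕ) : rising x (N + 1) = rising x N * (x + N) :=
  Finset.prod_range_succ _ _

theorem rising_add (x y : ℂ) (N : ℕ) :
    rising (x + y) N = ∑ ij ∈ Finset.HasAntidiagonal.antidiagonal N,
      (N.choose ij.1 : ℂ) * (rising x ij.1 * rising y ij.2) := by
  induction N with
  | zero => simp [rising]
  | succ N ih =>
    rw [Finset.sum_antidiagonal_choose_succ_mul (fun i j => rising x i * rising y j), rising_succ,
      ih, Finset.sum_mul, ← Finset.sum_add_distrib]
    refine Finset.sum_congr rfl fun ij hij => ?_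
    rw [Finset.HasAntidiagonal.mem_antidiagonal] at hij
    have h : (N.choose ij.2 : ℂ) = N.choose ij.1 := by
      rw [← hij, Nat.choose_symm_add]
    rw [rising_succ, rising_succ, h, ← hij]
    push_cast; ring

theorem rising_three_halves (N : ℕ) :
    rising (3 / 2) N = ((2 : ℂ) ^ N)⁻¹ * ((2 * N + 1).doubleFactorial : ℂ) := by
  induction N with
  | zero => simp [rising]
  | succ N ih =>
    rw [rising_succ, ih, show 2 * (N + 1) + 1 = (2 * N + 1) + 2 by ring, Nat.doubleFactorial_add_two,
      pow_succ, mul_inv]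
    push_cast; ring

theorem rising_neg_half (k : ℕ) :
    rising (-1 / 2) (k + 1) = -(((2 : ℂ) ^ (k + 1))⁻¹ * ((2 * (k + 1) - 3).doubleFactorial : ℂ)) := by
  induction k with
  | zero => simp [rising]; norm_num
  | succ k ih =>
    rw [rising_succ, ih, pow_succ _ (k + 1), mul_inv]
    cases k with
    | zero => norm_num
    | succ k =>
      rw [show 2 * (k + 1 + 1 + 1) - 3 = (2 * (k + 1 + 1) - 3) + 2 by omega,
        Nat.doubleFactorial_add_two, show 2 * (k + 1 + 1) - 3 + 2 = 2 * k + 3 by omega]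
      push_cast; ring

theorem rising_one (N : ℕ) : rising 1 N = N.factorial := by
  induction N with
  | zero => simp [rising]
  | succ N ih => rw [rising_succ, ih, Nat.factorial_succ]; push_cast; ring

/-- Apply the Vandermonde identity for rising factorials to `1 = -1/2 + 3/2`. The left side is `N!`,
the term `k = 0` is the right side here, and the terms `k ≥ 1`, which are negative, cancel the sum
of double factorials. -/
theorem poleConst_eq (N : ℕ) : poleConst N = rising (3 / 2) N := by
  have h := rising_add (-1 / 2) (3 / 2) N
  rw [show (-1 / 2 + 3 / 2 : ℂ) = 1 by norm_num, rising_one,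
    Finset.Nat.sum_antidiagonal_eq_sum_range_succ
      (fun i j => (N.choose i : ℂ) * (rising (-1 / 2) i * rising (3 / 2) j)),
    Finset.sum_range_succ'] at h
  have hIcc : ∀ (f : ℕ → ℂ) (N : ℕ), ∑ k ∈ Finset.Icc 1 N, f k = ∑ i ∈ Finset.range N, f (i + 1) := by
    intro f N
    induction N with
    | zero => simp
    | succ N ih => rw [Finset.sum_Icc_succ_top (by omega), ih, Finset.sum_range_succ]
  rw [poleConst, h, hIcc, Finset.mul_sum, add_right_comm, ← Finset.sum_add_distrib,
    Finset.sum_eq_zero]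
  · simp [rising]
  · intro i hi
    rw [Finset.mem_range] at hi
    have e : ((2 : ℂ) ^ N)⁻¹ = ((2 : ℂ) ^ (i + 1))⁻¹ * ((2 : ℂ) ^ (N - (i + 1)))⁻¹ := by
      rw [← mul_inv, ← pow_add, Nat.add_sub_cancel' (by omega : i + 1 ≤ N)]
    rw [rising_neg_half, rising_three_halves, e,
      show 2 * N - 2 * (i + 1) + 1 = 2 * (N - (i + 1)) + 1 by omega]
    ring

theorem rising_three_halves_ne (N : ℕ) : rising (3 / 2) N ≠ 0 := by
  rw [rising_three_halves]
  have : 0 < (2 * N + 1).doubleFactorial := Nat.doubleFactorial_pos _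
  exact mul_ne_zero (inv_ne_zero (pow_ne_zero _ two_ne_zero)) (by exact_mod_cast this.ne')

variable {n N : ℕ} [NeZero n] {S : FrobeniusManifold n} {L : LeveltSystem S} {v : Fin n → ℂ}

/-! ### Polynomials in `𝒰 + z⁻¹ (𝒱 - 1/2 - z d/dz)` -/

section

variable {d : ℤ} {f : W n}

theorem le_aeval_JB (hf : Le d f) (v : Fin n → ℂ) (p : Polynomial ℂ) :
    Le d (Polynomial.aeval (JB S v) p f) ∧
      cf d (Polynomial.aeval (JB S v) p f) = (Polynomial.aeval (S.U v) p).mulVec (cf d f) := by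
  have hpow : ∀ M : ℕ, cf d ((JB S v ^ M) f) = (S.U v ^ M).mulVec (cf d f) := by
    intro M
    induction M with
    | zero => simp
    | succ M ih =>
      rw [pow_succ', Module.End.mul_apply, cf_JB, ih, (hf.JB_pow v M) (d + 1) (by omega),
        Matrix.mulVec_zero, add_zero, Matrix.mulVec_mulVec, ← pow_succ']
  induction p using Polynomial.induction_on' with
  | add p q hp hq =>
    simp only [map_add, LinearMap.add_apply, Matrix.add_mulVec]
    exact ⟨hp.1.add hq.1, by rw [hp.2, hq.2]⟩
  | monomial M c =>
    rw [Polynomial.aeval_monomial, Polynomial.aeval_monomial, ← Algebra.smul_def,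
      ← Algebra.smul_def, LinearMap.smul_apply, map_smul, Matrix.smul_mulVec, hpow]
    exact ⟨(hf.JB_pow v M).smul c, rfl⟩

/-- The derivative of the matrix polynomial `p(𝒰)` in the direction `X`. -/
def polyDer (A : Matrix (Fin n) (Fin n) ℂ) (p : Polynomial ℂ) (X : Matrix (Fin n) (Fin n) ℂ) :
    Matrix (Fin n) (Fin n) ℂ :=
  p.sum fun M c => c • ∑ i ∈ Finset.range M, A ^ i * X * A ^ (M - 1 - i)

theorem polyDer_add (A : Matrix (Fin n) (Fin n) ℂ) (p q : Polynomial ℂ)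
    (X : Matrix (Fin n) (Fin n) ℂ) : polyDer A (p + q) X = polyDer A p X + polyDer A q X :=
  Polynomial.sum_add_index _ _ _ (fun _ => zero_smul _ _) fun _ _ _ => add_smul _ _ _

theorem polyDer_monomial (A : Matrix (Fin n) (Fin n) ℂ) (M : ℕ) (c : ℂ)
    (X : Matrix (Fin n) (Fin n) ℂ) : polyDer A (Polynomial.monomial M c) X =
      c • ∑ i ∈ Finset.range M, A ^ i * X * A ^ (M - 1 - i) :=
  Polynomial.sum_monomial_index _ _ (zero_smul _ _)

/-- To drop one degree below the top, exactly one factor of a monomial must act by `z⁻¹ (𝒱 - 1/2 - z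
d/dz)` and all others by `𝒰`. The sum over its position is the noncommutative derivative `polyDer`.
-/
theorem cf_aeval_JB_sub_one (hf : Le d f) (v : Fin n → ℂ) (p : Polynomial ℂ) :
    cf (d - 1) (Polynomial.aeval (JB S v) p f) =
      (Polynomial.aeval (S.U v) p).mulVec (cf (d - 1) f) +
        (polyDer (S.U v) p (Kmat S d)).mulVec (cf d f) := by
  have hpow : ∀ M : ℕ, cf (d - 1) ((JB S v ^ M) f) = (S.U v ^ M).mulVec (cf (d - 1) f) +
      (∑ i ∈ Finset.range M, S.U v ^ i * Kmat S d * S.U v ^ (M - 1 - i)).mulVec (cf d f) := by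
    intro M
    induction M with
    | zero => simp
    | succ M ih =>
      have h1 := (le_aeval_JB (S := S) hf v (Polynomial.X ^ M)).2
      simp only [map_pow, Polynomial.aeval_X] at h1
      rw [pow_succ', Module.End.mul_apply, cf_JB, ih, sub_add_cancel, h1, Finset.sum_range_succ',
        Matrix.mulVec_add, Matrix.mulVec_mulVec, Matrix.mulVec_mulVec, Matrix.mulVec_mulVec,
        ← pow_succ', Matrix.add_mulVec, add_assoc, Finset.mul_sum]
      congr 3
      · refine Finset.sum_congr rfl fun i _ => ?_
        rw [pow_succ', Matrix.mul_assoc, Matrix.mul_assoc, Matrix.mul_assoc,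
          show M + 1 - 1 - (i + 1) = M - 1 - i by omega]
      · simp
  induction p using Polynomial.induction_on' with
  | add p q hp hq =>
    simp only [map_add, LinearMap.add_apply, Matrix.add_mulVec, polyDer_add]
    rw [hp, hq]; abel
  | monomial M c =>
    rw [Polynomial.aeval_monomial, Polynomial.aeval_monomial, ← Algebra.smul_def,
      ← Algebra.smul_def, LinearMap.smul_apply, map_smul, Matrix.smul_mulVec, hpow, polyDer_monomial,
      Matrix.smul_mulVec, smul_add]

theorem polyDer_sub_smul (A : Matrix (Fin n) (Fin n) ℂ) (p : Polynomial ℂ)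
    (X : Matrix (Fin n) (Fin n) ℂ) (c : ℂ) :
    polyDer A p (X - c • 1) = polyDer A p X - c • Polynomial.aeval A p.derivative := by
  induction p using Polynomial.induction_on' with
  | add p q hp hq =>
    rw [polyDer_add, polyDer_add, hp, hq, Polynomial.derivative_add, map_add, smul_add]; abel
  | monomial M b =>
    rw [polyDer_monomial, polyDer_monomial, Polynomial.derivative_monomial,
      Polynomial.aeval_monomial, ← Algebra.smul_def]
    have h : ∀ i ∈ Finset.range M, A ^ i * (X - c • 1) * A ^ (M - 1 - i) =
        A ^ i * X * A ^ (M - 1 - i) - c • A ^ (M - 1) := by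
      intro i hi
      rw [Finset.mem_range] at hi
      rw [Matrix.mul_sub, Matrix.sub_mul, Matrix.mul_smul, Matrix.smul_mul, Matrix.mul_one,
        ← pow_add, show i + (M - 1 - i) = M - 1 by omega]
    rw [Finset.sum_congr rfl h, Finset.sum_sub_distrib, Finset.sum_const, Finset.card_range,
      smul_sub, ← Nat.cast_smul_eq_nsmul ℂ, smul_smul, smul_smul, smul_smul]
    congr 2
    ring

/-- Between two different idempotents `polyDer` is the divided difference of the polynomial at
`u_i`, `u_j` times the block of `𝒱`, and it vanishes for `χ` as both are roots. The diagonal blocks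
vanish by the antisymmetry of `𝒱`. -/
theorem polyDer_charpoly_V (F : Frame S v) (hv : v ∈ S.carrier) :
    polyDer (S.U v) (S.U v).charpoly S.V = 0 := by
  set P : Fin n → Matrix (Fin n) (Fin n) ℂ := fun i => S.mulMatrix v (F.π i) with hP
  have hpowl : ∀ i (k : ℕ), P i * S.U v ^ k = F.u i ^ k • P i := by
    intro i k
    induction k with
    | zero => simp
    | succ k ih =>
      rw [pow_succ, ← Matrix.mul_assoc, ih, Matrix.smul_mul, hP]
      simp only [F.mulMatrix_π_mul_U hv, smul_smul, pow_succ]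
  have hpowr : ∀ i (k : ℕ), S.U v ^ k * P i = F.u i ^ k • P i := by
    intro i k
    induction k with
    | zero => simp
    | succ k ih =>
      rw [pow_succ', Matrix.mul_assoc, ih, Matrix.mul_smul, hP]
      simp only [F.U_mul_mulMatrix_π hv, smul_smul, pow_succ]
  have hij : ∀ i j, i ≠ j → ∀ p : Polynomial ℂ, P i * polyDer (S.U v) p S.V * P j =
      ((p.eval (F.u i) - p.eval (F.u j)) / (F.u i - F.u j)) • (P i * S.V * P j) := by
    intro i j hne p
    have hne' : F.u i - F.u j ≠ 0 := sub_ne_zero.2 fun h => hne (F.inj h)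
    induction p using Polynomial.induction_on' with
    | add p q hp hq =>
      rw [polyDer_add, Matrix.mul_add, Matrix.add_mul, hp, hq, ← add_smul, Polynomial.eval_add,
        Polynomial.eval_add]
      congr 1; ring
    | monomial M c =>
      rw [polyDer_monomial, Matrix.mul_smul, Matrix.smul_mul, Finset.mul_sum, Finset.sum_mul]
      have h : ∀ k ∈ Finset.range M, P i * (S.U v ^ k * S.V * S.U v ^ (M - 1 - k)) * P j =
          (F.u i ^ k * F.u j ^ (M - 1 - k)) • (P i * S.V * P j) := by
        intro k _
        rw [← Matrix.mul_assoc, ← Matrix.mul_assoc, hpowl, Matrix.mul_assoc, hpowr, Matrix.smul_mul,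
          Matrix.smul_mul, Matrix.mul_smul, smul_smul]
      rw [Finset.sum_congr rfl h, ← Finset.sum_smul, smul_smul, Polynomial.eval_monomial,
        Polynomial.eval_monomial]
      congr 1
      rw [eq_div_iff hne', mul_assoc, geom_sum₂_mul]; ring
  have hii : ∀ i, ∀ p : Polynomial ℂ, P i * polyDer (S.U v) p S.V * P i = 0 := by
    intro i p
    induction p using Polynomial.induction_on' with
    | add p q hp hq => rw [polyDer_add, Matrix.mul_add, Matrix.add_mul, hp, hq, add_zero]
    | monomial M c =>
      rw [polyDer_monomial, Matrix.mul_smul, Matrix.smul_mul, Finset.mul_sum, Finset.sum_mul,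
        Finset.sum_eq_zero, smul_zero]
      intro k _
      rw [← Matrix.mul_assoc, ← Matrix.mul_assoc, hpowl, Matrix.mul_assoc, hpowr, Matrix.smul_mul,
        Matrix.smul_mul, Matrix.mul_smul, hP]
      simp only [F.π_V_π hv, smul_zero]
  have hroot : ∀ i, (S.U v).charpoly.eval (F.u i) = 0 := by
    intro i
    rw [F.charpoly_eq, Polynomial.eval_prod]
    exact Finset.prod_eq_zero (Finset.mem_univ i) (by simp)
  rw [← Matrix.one_mul (polyDer _ _ _), ← Matrix.mul_one (1 * _), ← F.sum_mulMatrix_π hv,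
    Finset.sum_mul, Finset.sum_mul]
  refine Finset.sum_eq_zero fun i _ => ?_
  rw [Finset.mul_sum]
  refine Finset.sum_eq_zero fun j _ => ?_
  by_cases h : i = j
  · subst h; exact hii i _
  · refine (hij i j h _).trans ?_
    rw [hroot, hroot, sub_self, zero_div, zero_smul]

theorem le_charpoly (hf : Le d f) (v : Fin n → ℂ) :
    Le (d - 1) (Polynomial.aeval (JB S v) (S.U v).charpoly f) := by
  intro j hj
  obtain ⟨h1, h2⟩ := le_aeval_JB (S := S) hf v (S.U v).charpoly
  by_cases h : j = d
  · rw [h, h2, Matrix.aeval_self_charpoly, Matrix.zero_mulVec]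
  · exact h1 j (by omega)

/-- Cayley-Hamilton kills the top coefficient and the contribution of the old subleading one, and
`𝒱` does not contribute by `polyDer_charpoly_V`. Only the scalar part `-(1/2 + d)` of `Kmat`
survives, and it gives the ordinary derivative `χ'`. -/
theorem cf_charpoly (F : Frame S v) (hv : v ∈ S.carrier) (hf : Le d f) :
    cf (d - 1) (Polynomial.aeval (JB S v) (S.U v).charpoly f) =
      (-1 / 2 - (d : ℂ)) • (Polynomial.aeval (S.U v) (S.U v).charpoly.derivative).mulVec (cf d f) := by
  rw [cf_aeval_JB_sub_one hf, Matrix.aeval_self_charpoly, Matrix.zero_mulVec, zero_add, Kmat,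
    polyDer_sub_smul, polyDer_charpoly_V F hv, zero_sub, ← neg_smul, Matrix.smul_mulVec]
  congr 1
  ring

theorem le_charpoly_pow (hf : Le d f) (v : Fin n → ℂ) (r : ℕ) :
    Le (d - r) (Polynomial.aeval (JB S v) ((S.U v).charpoly ^ r) f) := by
  induction r with
  | zero => simpa using hf
  | succ r ih =>
    rw [pow_succ', map_mul, Module.End.mul_apply]
    exact (le_charpoly ih v).mono_le (by push_cast; omega)

/-- The `r`-th application starts at degree `d = -2 - r` (counting from zero), so its factor `-1/2 -
d` is `3/2 + r`. -/
theorem cf_charpoly_pow (F : Frame S v) (hv : v ∈ S.carrier) (hf : Le (-2) f) (r : ℕ) :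
    cf (-2 - (r : ℤ)) (Polynomial.aeval (JB S v) ((S.U v).charpoly ^ r) f) =
      rising (3 / 2) r •
        (Polynomial.aeval (S.U v) ((S.U v).charpoly.derivative ^ r)).mulVec (cf (-2) f) := by
  induction r with
  | zero => simp [rising]
  | succ r ih =>
    rw [pow_succ', map_mul, Module.End.mul_apply,
      show -2 - ((r + 1 : ℕ) : ℤ) = -2 - (r : ℤ) - 1 by push_cast; ring,
      cf_charpoly F hv (le_charpoly_pow hf v r), ih, Matrix.mulVec_smul, smul_smul,
      Matrix.mulVec_mulVec, ← map_mul, ← pow_succ', rising_succ]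
    congr 1
    push_cast; ring

end

/-! ### The constraint vector field at test polynomials -/

namespace LeveltSystem

variable {Y : Chart n N}

theorem Ev_add (p q : Polynomial ℂ) (a : ℕ) : Ev S Y (p + q) a = Ev S Y p a + Ev S Y q a := by
  simp only [Ev, map_add, LinearMap.add_apply]

theorem Ev_smul (c : ℂ) (p : Polynomial ℂ) (a : ℕ) : Ev S Y (c • p) a = c • Ev S Y p a := by
  simp only [Ev, map_smul, LinearMap.smul_apply]

theorem DM_add (p q : Polynomial ℂ) : DM S Y (p + q) = DM S Y p + DM S Y q := by
  refine chart_ext fun r hr => ?_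
  rw [map_add, DM, DM, DM, cY_ofSeq hr, cY_ofSeq hr, cY_ofSeq hr]
  simp only [Ev_add, Matrix.mulVec_add]
  split_ifs <;> abel

theorem DM_smul (c : ℂ) (p : Polynomial ℂ) : DM S Y (c • p) = c • DM S Y p := by
  refine chart_ext fun r hr => ?_
  rw [map_smul, DM, DM, cY_ofSeq hr, cY_ofSeq hr]
  simp only [Ev_smul, Matrix.mulVec_smul]
  split_ifs <;> simp

variable (S Y) in
/-- The vector field of the constraint, as a linear map. -/
def DMlin : Polynomial ℂ →ₗ[ℂ] Chart n N where
  toFun := DM S Y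
  map_add' := DM_add
  map_smul' := DM_smul

theorem Ev_charpoly_lt {r a : ℕ} (h : a < r) (g : Polynomial ℂ) :
    Ev S Y ((S.U (cY N 0 Y)).charpoly ^ r * g) a = 0 := by
  rw [Ev, map_mul, Module.End.mul_apply]
  exact le_charpoly_pow (le_aeval_JB (le_serC Y) _ g).1 _ r _ (by omega)

theorem Ev_charpoly_self (F : Frame S (cY N 0 Y)) (hv : cY N 0 Y ∈ S.carrier) (r : ℕ)
    (g : Polynomial ℂ) : Ev S Y ((S.U (cY N 0 Y)).charpoly ^ r * g) r = rising (3 / 2) r •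
      (Polynomial.aeval (S.U (cY N 0 Y)) ((S.U (cY N 0 Y)).charpoly.derivative ^ r * g)).mulVec
        (cY N 1 Y) := by
  have h := le_aeval_JB (S := S) (le_serC Y) (cY N 0 Y) g
  rw [Ev, map_mul, Module.End.mul_apply, cf_charpoly_pow F hv h.1, h.2, Matrix.mulVec_mulVec,
    ← map_mul]
  have := cf_serC Y 0
  simp only [Nat.cast_zero, neg_zero, zero_sub, zero_add] at this
  rw [this]

/-- The leading component of the constraint vector field at `χ^r g`. -/
def topVec (S : FrobeniusManifold n) (Y : Chart n N) (r : ℕ) (g : Polynomial ℂ) : Fin n → ℂ :=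
  if r = 0 then -(Polynomial.aeval (S.U (cY N 0 Y)) g).mulVec (unit n)
  else rising (3 / 2) r •
    (Polynomial.aeval (S.U (cY N 0 Y)) ((S.U (cY N 0 Y)).charpoly.derivative ^ r * g)).mulVec
      (cY N 1 Y)

theorem Cx_mulVec_aeval (hY : Y ∈ dom0 S N) (g : Polynomial ℂ) :
    (Cx S Y).mulVec ((Polynomial.aeval (S.U (cY N 0 Y)) g).mulVec (cY N 1 Y)) =
      -(Polynomial.aeval (S.U (cY N 0 Y)) g).mulVec (unit n) := by
  rw [← mulMatrix_mulVec_unit hY.1 (cY N 1 Y), ← mulMatrix_aeval_U hY.1 g, Matrix.mulVec_mulVec,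
    Matrix.mulVec_mulVec, Matrix.mul_assoc, mulMatrix_comm hY.1 _ (cY N 1 Y), ← Matrix.mul_assoc, Cx_mul hY,
    Matrix.neg_mul, Matrix.one_mul, Matrix.neg_mulVec]

theorem cY_DM_lt {r q : ℕ} (h : q < r) (hq : q ≤ N) (g : Polynomial ℂ) :
    cY N q (DM S Y ((S.U (cY N 0 Y)).charpoly ^ r * g)) = 0 := by
  rw [DM, cY_ofSeq hq, Ev_charpoly_lt (show 0 < r by omega), Matrix.mulVec_zero, Matrix.mulVec_zero,
    add_zero, Ev_charpoly_lt h, ite_self]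

/-- For `r > 0` the terms that pass through the `v`-component vanish. The case `r = 0` looks
different because that component carries a factor `v_x`, which cancels `y_1` up to sign. -/
theorem cY_DM_self (F : Frame S (cY N 0 Y)) (hY : Y ∈ dom0 S N) {r : ℕ} (hr : r ≤ N)
    (g : Polynomial ℂ) :
    cY N r (DM S Y ((S.U (cY N 0 Y)).charpoly ^ r * g)) = topVec S Y r g := by
  rw [DM, cY_ofSeq hr, topVec]
  by_cases h : r = 0
  · subst h
    rw [if_pos rfl, if_pos rfl, Ev_charpoly_self F hY.1, ← Cx_mulVec_aeval hY]
    simp [rising]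
  · rw [if_neg h, if_neg h, Ev_charpoly_lt (show 0 < r by omega), Matrix.mulVec_zero,
      Matrix.mulVec_zero, add_zero, Ev_charpoly_self F hY.1]

variable {l : Chart n N →L[ℂ] ℂ}

theorem clm_apply_eq_sum (l : Chart n N →L[ℂ] ℂ) (w : Chart n N) :
    l w = ∑ q ∈ Finset.range (N + 1), l (inc N q (cY N q w)) := by
  conv_lhs => rw [← ofSeq_cY w, ofSeq_eq_sum, map_sum]

theorem apply_DM_top (F : Frame S (cY N 0 Y)) (hY : Y ∈ dom0 S N) {r : ℕ} (hr : r ≤ N)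
    (hl : ∀ q, r < q → ∀ w, l (inc N q w) = 0) (g : Polynomial ℂ) :
    l (DM S Y ((S.U (cY N 0 Y)).charpoly ^ r * g)) = l (inc N r (topVec S Y r g)) := by
  rw [clm_apply_eq_sum, Finset.sum_eq_single r, cY_DM_self F hY hr]
  · intro q hq hne
    rw [Finset.mem_range] at hq
    rcases lt_or_gt_of_ne hne with h | h
    · rw [cY_DM_lt h (by omega), map_zero, map_zero]
    · exact hl q h _
  · intro h; exact absurd (Finset.mem_range.2 (by omega)) h

theorem apply_DM_eq_zero {r : ℕ} (hl : ∀ q, r < q → ∀ w, l (inc N q w) = 0)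
    (g : Polynomial ℂ) : l (DM S Y ((S.U (cY N 0 Y)).charpoly ^ (r + 1) * g)) = 0 := by
  rw [clm_apply_eq_sum]
  refine Finset.sum_eq_zero fun q hq => ?_
  rw [Finset.mem_range] at hq
  by_cases h : q ≤ r
  · rw [cY_DM_lt (by omega) (by omega), map_zero, map_zero]
  · exact hl q (by omega) _

theorem eq_zero_of_topVec (F : Frame S (cY N 0 Y)) (hY : Y ∈ dom0 S N) (r : ℕ) {x : Fin n → ℂ}
    (h : ∀ m : ℕ, dotProduct x (topVec S Y r (Polynomial.X ^ m)) = 0) : x = 0 := by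
  by_cases hr : r = 0
  · subst hr
    refine Frame.eq_zero_of_forall_pow F hY.1 (w := unit n) ?_ 0 x fun m => ?_
    · rw [mulMatrix_unit hY.1]; simp
    · have := h m
      rw [topVec, if_pos rfl, dotProduct_neg, neg_eq_zero] at this
      simpa using this
  · refine Frame.eq_zero_of_forall_pow F hY.1 hY.2 r x fun m => ?_
    have := h m
    rw [topVec, if_neg hr, dotProduct_smul, smul_eq_mul] at this
    exact (mul_eq_zero.1 this).resolve_left (rising_three_halves_ne r)

theorem clm_eq_dotProduct (m : (Fin n → ℂ) →L[ℂ] ℂ) (w : Fin n → ℂ) :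
    m w = dotProduct (fun γ => m (Pi.single γ 1)) w := by
  conv_lhs => rw [← sum_smul_single w, map_sum]
  simp only [map_smul, smul_eq_mul, dotProduct]
  exact Finset.sum_congr rfl fun γ _ => mul_comm _ _

theorem apply_inc_eq_zero (F : Frame S (cY N 0 Y)) (hY : Y ∈ dom0 S N) (r : ℕ)
    (h : ∀ m : ℕ, l (inc N r (topVec S Y r (Polynomial.X ^ m))) = 0) (w : Fin n → ℂ) :
    l (inc N r w) = 0 := by
  have h1 := eq_zero_of_topVec F hY r (x := fun γ => l.comp (inc N r) (Pi.single γ 1)) fun m => by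
    rw [← clm_eq_dotProduct]; exact h m
  have h2 := clm_eq_dotProduct (l.comp (inc N r)) w
  rw [h1, zero_dotProduct] at h2
  exact h2

theorem apply_DM_poly {κ : ℂ}
    (h : ∀ M : ℕ, l (DM S Y (Polynomial.X ^ M)) + (if M = 1 then κ else 0) = 0)
    (p : Polynomial ℂ) : l (DM S Y p) + κ * p.coeff 1 = 0 := by
  induction p using Polynomial.induction_on' with
  | add p q hp hq => rw [DM_add, map_add, Polynomial.coeff_add]; linear_combination hp + hq
  | monomial M c =>
    rw [← Polynomial.C_mul_X_pow_eq_monomial, ← Polynomial.smul_eq_C_mul, DM_smul, map_smul,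
      Polynomial.coeff_smul, Polynomial.coeff_X_pow, smul_eq_mul, smul_eq_mul]
    have := h M
    by_cases hM : M = 1
    · rw [if_pos hM] at this; rw [if_pos hM.symm]; linear_combination c * this
    · rw [if_neg hM] at this; rw [if_neg (Ne.symm hM)]; linear_combination c * this

/-- A covector annihilated by the linearized constraints vanishes. -/
theorem constraint_nondegenerate (hY : Y ∈ dom0 S N) (hss : cY N 0 Y ∈ S.Mss) {κ : ℂ}
    (h : ∀ M : ℕ, l (DM S Y (Polynomial.X ^ M)) + (if M = 1 then κ else 0) = 0) :
    ((S.U (cY N 0 Y)).charpoly.eval 0 ≠ 0 → κ = 0) ∧ (κ = 0 → l = 0) := by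
  obtain ⟨F⟩ := exists_frame hss
  have hp := apply_DM_poly h
  have hbig : ∀ q, N < q → ∀ w, l (inc N q w) = 0 := fun q hq w => by
    rw [inc_of_lt hq]; simp
  constructor
  · intro h0
    -- The power `χ^{N+1}` removes all components of the chart, and the factor `X` exposes the
    -- constant: what is left is `κ χ(0)^{N+1} = 0`.
    have h1 := hp ((S.U (cY N 0 Y)).charpoly ^ (N + 1) * Polynomial.X)
    rw [apply_DM_eq_zero hbig, zero_add, Polynomial.coeff_mul_X, Polynomial.coeff_zero_eq_eval_zero,
      Polynomial.eval_pow] at h1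
    exact (mul_eq_zero.1 h1).resolve_right (pow_ne_zero _ h0)
  · intro hκ
    -- Downward induction on the coordinate: once `l` is zero along `y_{q'}` for `q' > q`, the test
    -- polynomials `χ^q X^m` see only its component along `y_q`.
    have key : ∀ k r, r + k = N + 1 → ∀ q, r ≤ q → ∀ w, l (inc N q w) = 0 := by
      intro k
      induction k with
      | zero => intro r hr q hq w; exact hbig q (by omega) w
      | succ k ih =>
        intro r hr q hq w
        by_cases hqr : q = r
        · subst hqr
          refine apply_inc_eq_zero F hY q (fun m => ?_) w
          rw [← apply_DM_top F hY (by omega) fun q' hq' w => ih (q + 1) (by omega) q' hq' w]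
          have := hp ((S.U (cY N 0 Y)).charpoly ^ q * Polynomial.X ^ m)
          rwa [hκ, zero_mul, add_zero] at this
        · exact ih (r + 1) (by omega) q (by omega) w
    exact clm_eq_zero fun q _ w => key (N + 1) 0 (by omega) q (by omega) w

end LeveltSystem

end

section

open FrobeniusManifold Laurent LeveltSystem

variable {n N : ℕ} [NeZero n] {S : FrobeniusManifold n}

/-! ### Existence of solutions -/

namespace LeveltSystem

variable (L : LeveltSystem S) {v₀ : Fin n → ℂ} {T : Times n}

/-- The left hand side of the equation for the solution, on the slice `{t^{α,p} = 0, p ≥ N}`. -/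
def eqn (T : Times n) (N : ℕ) (p : (Fin n × Fin N → ℂ) × (Fin n → ℂ)) : Fin n → ℂ :=
  fun γ => ∑ i ∈ box n (max N (supBound T)), (emb N p.1 i + T i) * L.shiftCol 0 i p.2 γ

theorem emb_add_support (T : Times n) (N : ℕ) (y : Fin n × Fin N → ℂ) (i : Fin n × ℕ)
    (h : (emb N y + T) i ≠ 0) : i.2 < max N (supBound T) := by
  by_contra hi
  apply h
  have h1 : emb N y i = 0 := by
    rw [show i = (i.1, i.2) from rfl, emb_apply, dif_neg (by omega)]
  have h2 : T i = 0 := by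
    by_contra h0
    have := lt_supBound h0
    omega
  rw [Finsupp.add_apply, h1, h2, add_zero]

theorem eqn_eq (T : Times n) (N : ℕ) (y : Fin n × Fin N → ℂ) (w : Fin n → ℂ) :
    L.eqn T N (y, w) = L.tY w (emb N y + T) 0 := by
  rw [L.tY_eq (emb_add_support T N y)]
  ext γ
  simp only [eqn, Finset.sum_apply, Pi.smul_apply, smul_eq_mul, Finsupp.add_apply]

theorem analyticAt_emb (i : Fin n × ℕ) (y : Fin n × Fin N → ℂ) :
    AnalyticAt ℂ (fun y : Fin n × Fin N → ℂ => emb N y i) y := by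
  have h : ∀ y : Fin n × Fin N → ℂ, emb N y i = if h : i.2 < N then y (i.1, ⟨i.2, h⟩) else 0 :=
    fun y => emb_apply N y i.1 i.2
  simp only [h]
  split_ifs with hi
  · exact (ContinuousLinearMap.proj (R := ℂ) (φ := fun _ : Fin n × Fin N => ℂ) _).analyticAt _
  · exact analyticAt_const

theorem analyticAt_eqn (hv : v₀ ∈ S.carrier) (y : Fin n × Fin N → ℂ) :
    AnalyticAt ℂ (L.eqn T N) (y, v₀) := by
  refine AnalyticAt.pi fun γ => Finset.analyticAt_fun_sum _ fun i _ => ?_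
  refine AnalyticAt.fun_mul (AnalyticAt.fun_add ?_ analyticAt_const) ?_
  · exact AnalyticAt.fun_comp (g := fun y : Fin n × Fin N → ℂ => emb N y i)
      (analyticAt_emb i _) analyticAt_fst
  · exact AnalyticAt.fun_comp (g := fun w => L.shiftCol 0 i w γ)
      (L.analyticAt_shiftCol hv 0 i γ) analyticAt_snd

/-- Differentiating `y_0` in `v` yields multiplication by `y_1`, whose invertibility is therefore
the hypothesis of the implicit function theorem. -/
theorem eqn_inr_apply (hv : v₀ ∈ S.carrier) (w : Fin n → ℂ) :
    (fderiv ℂ (L.eqn T N) (0, v₀)) (0, w) = (S.mulMatrix v₀ (L.tY v₀ T 1)).mulVec w := by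
  have h1 := (L.analyticAt_eqn (T := T) hv (0 : Fin n × Fin N → ℂ)).differentiableAt.hasFDerivAt
  have h2 : HasFDerivAt (fun w : Fin n → ℂ => ((0 : Fin n × Fin N → ℂ), w))
      (ContinuousLinearMap.inr ℂ _ _) v₀ := hasFDerivAt_prodMk_right _ _
  have h3 : HasFDerivAt (fun w => L.eqn T N (0, w)) _ v₀ := h1.comp v₀ h2
  have h4 := hasFDerivAt_pi'.1 h3
  ext γ
  have h5 := HasFDerivAt.fun_sum (u := box n (max N (supBound T))) fun i _ =>
    ((L.analyticAt_shiftCol hv 0 i γ).differentiableAt.hasFDerivAt).const_mul (emb N 0 i + T i)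
  have h6 := congrArg (fun l => l w) ((h4 γ).unique h5)
  have h7 : (fderiv ℂ (L.eqn T N) (0, v₀)) (0, w) γ = ∑ i ∈ box n (max N (supBound T)),
      (emb N 0 i + T i) * fderiv ℂ (fun w => L.shiftCol 0 i w γ) v₀ w := by
    refine Eq.trans h6 ?_
    simp [sum_apply, smul_apply]
  have hK : ∀ i, T i ≠ 0 → i.2 < max N (supBound T) := fun i hi =>
    lt_of_lt_of_le (lt_supBound hi) (le_max_right _ _)
  rw [h7, mulMatrix_mulVec_comm hv, L.tY_eq hK, Matrix.mulVec_sum, Finset.sum_apply]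
  refine Finset.sum_congr rfl fun i _ => ?_
  rw [L.fderiv_shiftCol hv, emb_zero, Finsupp.zero_apply, zero_add, Matrix.mulVec_smul,
    Pi.smul_apply, smul_eq_mul]

theorem isInvertible_mulVec {A : Matrix (Fin n) (Fin n) ℂ} (hA : IsUnit A.det) :
    (LinearMap.toContinuousLinearMap (Matrix.mulVecLin A)).IsInvertible := by
  refine ContinuousLinearMap.IsInvertible.of_inverse
    (g := LinearMap.toContinuousLinearMap (Matrix.mulVecLin A⁻¹)) ?_ ?_
  · ext1 x
    change A.mulVec (A⁻¹.mulVec x) = x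
    rw [Matrix.mulVec_mulVec, Matrix.mul_nonsing_inv _ hA, Matrix.one_mulVec]
  · ext1 x
    change A⁻¹.mulVec (A.mulVec x) = x
    rw [Matrix.mulVec_mulVec, Matrix.nonsing_inv_mul _ hA, Matrix.one_mulVec]

theorem eqn_inr (hv : v₀ ∈ S.carrier) (hu : IsUnit (S.mulMatrix v₀ (L.tY v₀ T 1)).det) :
    (fderiv ℂ (L.eqn T N) (0, v₀) ∘L .inr ℂ (Fin n × Fin N → ℂ) (Fin n → ℂ)).IsInvertible := by
  have : fderiv ℂ (L.eqn T N) (0, v₀) ∘L .inr ℂ (Fin n × Fin N → ℂ) (Fin n → ℂ) =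
      LinearMap.toContinuousLinearMap (Matrix.mulVecLin (S.mulMatrix v₀ (L.tY v₀ T 1))) := by
    ext1 w
    exact L.eqn_inr_apply hv w
  rw [this]
  exact isInvertible_mulVec hu

theorem contDiffAt_eqn (hv : v₀ ∈ S.carrier) :
    ContDiffAt ℂ ⊤ (L.eqn T N) (0, v₀) := (L.analyticAt_eqn hv 0).contDiffAt

/-- The solution on the slice `{t^{α,p} = 0, p ≥ N}`. -/
def sliceSol (hv : v₀ ∈ S.carrier) (hu : IsUnit (S.mulMatrix v₀ (L.tY v₀ T 1)).det) (N : ℕ) :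
    (Fin n × Fin N → ℂ) → Fin n → ℂ :=
  (L.contDiffAt_eqn (T := T) (N := N) hv).implicitFunction (by simp) (L.eqn_inr hv hu)

variable (hv : v₀ ∈ S.carrier) (hu : IsUnit (S.mulMatrix v₀ (L.tY v₀ T 1)).det)

theorem sliceSol_zero : L.sliceSol hv hu N 0 = v₀ :=
  (L.contDiffAt_eqn (T := T) (N := N) hv).implicitFunction_apply_self (by simp) (L.eqn_inr hv hu)

theorem analyticAt_sliceSol : AnalyticAt ℂ (L.sliceSol hv hu N) 0 := by
  have h := (L.contDiffAt_eqn (T := T) (N := N) hv).contDiffAt_implicitFunction (by simp)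
    (L.eqn_inr hv hu)
  exact h.analyticAt

theorem eqn_base (h0 : L.tY v₀ T 0 = 0) : L.eqn T N (0, v₀) = 0 := by
  rw [eqn_eq, emb_zero, zero_add, h0]

theorem eventually_eqn (h0 : L.tY v₀ T 0 = 0) :
    ∀ᶠ y in 𝓝 (0 : Fin n × Fin N → ℂ), L.eqn T N (y, L.sliceSol hv hu N y) = 0 := by
  have h := (L.contDiffAt_eqn (T := T) (N := N) hv).eventually_apply_implicitFunction (by simp)
    (L.eqn_inr hv hu)
  rw [L.eqn_base h0] at h
  exact h

theorem eventually_unique (h0 : L.tY v₀ T 0 = 0) :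
    ∀ᶠ p in 𝓝 ((0 : Fin n × Fin N → ℂ), v₀), L.eqn T N p = 0 ↔ L.sliceSol hv hu N p.1 = p.2 := by
  have h := (L.contDiffAt_eqn (T := T) (N := N) hv).eventually_apply_eq_iff_implicitFunction
    (by simp) (L.eqn_inr hv hu)
  rw [L.eqn_base h0] at h
  exact h

/-- The restriction of the larger solution solves the smaller equation and stays near `v₀`, so the
local uniqueness of the implicit function identifies the two. -/
theorem eventually_sliceSol_extend (h0 : L.tY v₀ T 0 = 0) {N N' : ℕ} (h : N ≤ N') :
    ∀ᶠ y in 𝓝 (0 : Fin n × Fin N → ℂ),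
      L.sliceSol hv hu N' (extend N N' y) = L.sliceSol hv hu N y := by
  have hc : Filter.Tendsto (extend (n := n) N N') (𝓝 0) (𝓝 0) := by
    simpa using (extend (n := n) N N').continuous.tendsto 0
  have h1 := hc.eventually (L.eventually_eqn hv hu h0)
  have h2 : Filter.Tendsto (fun y => (y, L.sliceSol hv hu N' (extend N N' y))) (𝓝 0)
      (𝓝 ((0 : Fin n × Fin N → ℂ), v₀)) := by
    refine Filter.Tendsto.prodMk_nhds Filter.tendsto_id ?_
    have h3 := (L.analyticAt_sliceSol hv hu (N := N')).continuousAt.tendsto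
    rw [L.sliceSol_zero] at h3
    exact h3.comp hc
  filter_upwards [h1, h2.eventually (L.eventually_unique hv hu h0)] with y ha hb
  refine (hb.1 ?_).symm
  rw [eqn_eq] at ha ⊢
  rwa [emb_extend h] at ha

/-- The coordinates of a point of the slice. -/
def restr (N : ℕ) (t : Times n) : Fin n × Fin N → ℂ := fun i => t (i.1, i.2)

/-- The solution as a function of all the times. -/
def glueSol (t : Times n) : Fin n → ℂ := L.sliceSol hv hu (supBound t) (restr (supBound t) t)

/-- `glueSol` uses the smallest slice containing the point, which varies with the point. Inside the
slice `N` only finitely many slices `m ≤ N` occur, so compatibility with all of them holds on one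
neighbourhood. -/
theorem eventually_glueSol (h0 : L.tY v₀ T 0 = 0) (N : ℕ) :
    ∀ᶠ y in 𝓝 (0 : Fin n × Fin N → ℂ), L.glueSol hv hu (emb N y) = L.sliceSol hv hu N y := by
  have h : ∀ᶠ y in 𝓝 (0 : Fin n × Fin N → ℂ), ∀ m ∈ Finset.range (N + 1),
      L.sliceSol hv hu N (extend m N (extend N m y)) = L.sliceSol hv hu m (extend N m y) := by
    refine (Filter.eventually_all_finset _).2 fun m hm => ?_
    rw [Finset.mem_range] at hm
    have hc : Filter.Tendsto (extend (n := n) N m) (𝓝 0) (𝓝 0) := by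
      simpa using (extend (n := n) N m).continuous.tendsto 0
    exact hc.eventually (L.eventually_sliceSol_extend hv hu h0 (by omega))
  filter_upwards [h] with y hy
  set m := supBound (emb N y) with hm
  have hmN : m ≤ N := by
    refine Finset.sup_le fun i hi => ?_
    rw [Finsupp.mem_support_iff] at hi
    by_contra hlt
    apply hi
    rw [show i = (i.1, i.2) from rfl, emb_apply, dif_neg (by omega)]
  have h1 := hy m (Finset.mem_range.2 (by omega))
  have h2 : restr m (emb N y) = extend N m y := by
    ext i
    rw [restr, emb_apply, extend_apply]
  have h3 : extend m N (extend N m y) = y := by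
    ext i
    rw [extend_apply]
    split_ifs with hi
    · rw [extend_apply, dif_pos i.2.2]
    · have : emb N y (i.1, (i.2 : ℕ)) = 0 := by
        by_contra hne
        exact hi (lt_supBound hne)
      rw [emb_apply, dif_pos i.2.2] at this
      exact this.symm
  rw [glueSol, ← hm, h2, ← h1, h3]

theorem isUnit_vx (h0 : L.tY v₀ T 0 = 0) : IsUnit (S.mulMatrix v₀ fun γ =>
    dt (0, 0) (fun t => L.glueSol hv hu t γ) 0).det := by
  have hφ := (L.contDiffAt_eqn (T := T) (N := 1) hv).hasStrictFDerivAt_implicitFunction (by simp)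
    (L.eqn_inr hv hu)
  have hline : HasDerivAt (fun s : ℂ => s • dir (n := n) 1 (0, 0)) (dir 1 (0, 0)) 0 := by
    simpa using (hasDerivAt_id (0 : ℂ)).smul_const (dir (n := n) 1 (0, 0))
  set A := fderiv ℂ (L.eqn T 1) (0, v₀) ∘L .inr ℂ (Fin n × Fin 1 → ℂ) (Fin n → ℂ) with hA
  set B := fderiv ℂ (L.eqn T 1) (0, v₀) ∘L .inl ℂ (Fin n × Fin 1 → ℂ) (Fin n → ℂ) with hB
  have hd : HasDerivAt (fun s : ℂ => L.sliceSol hv hu 1 (s • dir 1 (0, 0)))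
      ((-A.inverse ∘L B) (dir 1 (0, 0))) 0 :=
    HasFDerivAt.comp_hasDerivAt (0 : ℂ) (by rw [zero_smul]; exact hφ.hasFDerivAt) hline
  have hev : (fun s : ℂ => L.glueSol hv hu (0 + Finsupp.single (0, 0) s)) =ᶠ[𝓝 0]
      fun s => L.sliceSol hv hu 1 (s • dir 1 (0, 0)) := by
    have hc : Filter.Tendsto (fun s : ℂ => s • dir (n := n) 1 (0, 0)) (𝓝 0) (𝓝 0) := by
      have := hline.continuousAt.tendsto
      rwa [zero_smul] at this
    filter_upwards [hc.eventually (L.eventually_glueSol hv hu h0 1)] with s hs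
    rw [zero_add, ← emb_smul_dir (N := 1) (i := (0, 0)) (by simp) s, hs]
  have hd2 := hd.congr_of_eventuallyEq hev
  have hx : (fun γ => dt (0, 0) (fun t => L.glueSol hv hu t γ) 0) =
      (-A.inverse ∘L B) (dir 1 (0, 0)) := by
    ext γ
    exact (hasDerivAt_pi.1 hd2 γ).deriv
  have hBe : B (dir 1 (0, 0)) = unit n := by
    have h1 := (L.analyticAt_eqn (T := T) hv (0 : Fin n × Fin 1 → ℂ)).differentiableAt.hasFDerivAt
    have h2 : HasDerivAt (fun s : ℂ => (s • dir (n := n) 1 (0, 0), v₀))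
        (dir (n := n) 1 (0, 0), 0) 0 := hline.prodMk (hasDerivAt_const _ _)
    have h3 : HasDerivAt (fun s : ℂ => L.eqn T 1 (s • dir 1 (0, 0), v₀))
        (fderiv ℂ (L.eqn T 1) (0, v₀) (dir (n := n) 1 (0, 0), 0)) 0 := by
      have h1' : HasFDerivAt (L.eqn T 1) (fderiv ℂ (L.eqn T 1) (0, v₀))
          ((0 : ℂ) • dir (n := n) 1 (0, 0), v₀) := by rw [zero_smul]; exact h1
      exact h1'.comp_hasDerivAt (0 : ℂ) h2
    have h4 : ∀ s : ℂ, L.eqn T 1 (s • dir 1 (0, 0), v₀) = s • unit n := by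
      intro s
      rw [eqn_eq, emb_smul_dir (by simp), tY, Finsupp.sum_add_index', Finsupp.sum_single_index]
      · rw [shiftCol_zero, Solution.col_zero_zero hv]
        change _ + L.tY v₀ T 0 = _
        rw [h0, add_zero]
      · simp
      · simp
      · intro i a b; rw [add_smul]
    simp only [h4] at h3
    have h5 : HasDerivAt (fun s : ℂ => s • unit n) (unit n) 0 := by
      simpa using (hasDerivAt_id (0 : ℂ)).smul_const (unit n)
    exact h3.unique h5
  have hAx : (S.mulMatrix v₀ (L.tY v₀ T 1)).mulVec
      ((-A.inverse ∘L B) (dir 1 (0, 0))) = -unit n := by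
    have h1 : ∀ w, A w = (S.mulMatrix v₀ (L.tY v₀ T 1)).mulVec w := fun w => L.eqn_inr_apply hv w
    rw [← h1]
    change A (-(A.inverse (B (dir 1 (0, 0))))) = _
    rw [map_neg, (L.eqn_inr (T := T) (N := 1) hv hu).self_apply_inverse, hBe]
  rw [hx]
  have h2 : -S.mulMatrix v₀ (L.tY v₀ T 1) * S.mulMatrix v₀ ((-A.inverse ∘L B) (dir 1 (0, 0))) = 1 := by
    rw [Matrix.neg_mul, ← mulMatrix_mulMatrix hv, hAx, mulMatrix_neg, mulMatrix_unit hv, neg_neg]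
  exact Matrix.isUnit_det_of_left_inverse h2

theorem exists_solution (hv : v₀ ∈ S.carrier) (h0 : L.tY v₀ T 0 = 0) (hu : IsUnit (S.mulMatrix v₀ (L.tY v₀ T 1)).det) :
    ∃ s : Solution L, s.c = -T ∧ s.v 0 = v₀ := by
  have hz : L.glueSol hv hu 0 = v₀ := by
    have h := (L.eventually_glueSol hv hu h0 0).self_of_nhds
    rw [emb_zero] at h
    rw [h, L.sliceSol_zero]
  refine ⟨⟨-T, L.glueSol hv hu, fun N => ?_, ?_, fun N => ?_, ?_⟩, rfl, hz⟩
  · exact (L.analyticAt_sliceSol hv hu).congr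
      ((L.eventually_glueSol hv hu h0 N).mono fun y hy => hy.symm)
  · rw [hz]; exact hv
  · filter_upwards [L.eventually_glueSol hv hu h0 N, L.eventually_eqn hv hu h0] with y h1 h2 γ
    rw [← h1, eqn_eq] at h2
    have h3 := congrFun h2 γ
    rw [tY, Finsupp.sum, Finset.sum_apply] at h3
    rw [sub_neg_eq_add, Finsupp.sum]
    refine Eq.trans (Finset.sum_congr rfl fun i _ => ?_) h3
    rw [shiftCol_zero]; rfl
  · rw [hz]; exact L.isUnit_vx hv hu h0

/-- The times at which the coordinates `y_q` take given values. -/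
def timesOf (Y : Chart n N) : Times n :=
  Finsupp.onFinset (box n (N + 1))
    (fun i => cf (-(i.2 : ℤ) - 1) (mulL (L.ThInv (cY N 0 Y)) (serC Y)) i.1) fun i hi => by
      by_contra hn
      apply hi
      have hge : Ge (-(N : ℤ) - 1) (serC Y) := Ge.sum fun q hq => (ge_mono _ _).mono' (by
        rw [Finset.mem_range] at hq; omega)
      have h2 : N + 1 ≤ i.2 := by simpa using hn
      have h3 : Ge (-(N : ℤ) - 1) (mulL (L.ThInv (cY N 0 Y)) (serC Y)) := hge.LM_mulVec _
      rw [h3 _ (by omega)]; rfl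

theorem timesOf_support (Y : Chart n N) (i : Fin n × ℕ) (h : L.timesOf Y i ≠ 0) : i.2 < N + 1 := by
  have h1 : i ∈ (L.timesOf Y).support := Finsupp.mem_support_iff.2 h
  have h2 := Finsupp.support_onFinset_subset h1
  simpa using h2

/-- The times are the negative part of `Θ⁻¹ · serC`. The discarded nonnegative powers stay
nonnegative under `Θ`, so the negative powers of `serC` are recovered; the absence of `z⁻¹` in
`serC` is the equation `y_0 = 0`. -/
theorem tY_timesOf {Y : Chart n N} (hY : cY N 0 Y ∈ S.carrier) (q : ℕ) :
    L.tY (cY N 0 Y) (L.timesOf Y) q = if q = 0 then 0 else cY N q Y := by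
  rw [← L.cf_ThZ_serT (L.timesOf_support Y)]
  have hP : Ge 0 (mulL (L.ThInv (cY N 0 Y)) (serC Y) - serT (L.timesOf Y) (N + 1)) := by
    intro j hj
    obtain ⟨q, rfl⟩ : ∃ q : ℕ, j = -(q : ℤ) - 1 := ⟨(-j - 1).toNat, by omega⟩
    rw [map_sub, cf_serT (L.timesOf_support Y), sub_eq_zero]
    rfl
  have h1 : Ge 0 (mulL (L.ThZ (cY N 0 Y)) (mulL (L.ThInv (cY N 0 Y)) (serC Y) -
      serT (L.timesOf Y) (N + 1))) := hP.LM_mulVec _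
  rw [map_sub, L.mulL_ThZ_ThInv hY] at h1
  have h2 := h1 (-(q : ℤ) - 1) (by omega)
  rw [map_sub, sub_eq_zero] at h2
  refine Eq.trans h2.symm ?_
  cases q with
  | zero => rw [if_pos rfl]; exact le_serC Y _ (by simp)
  | succ q =>
    rw [if_neg (by omega), show -((q + 1 : ℕ) : ℤ) - 1 = -(q : ℤ) - 2 by push_cast; ring, cf_serC]

/-- Every point of the chart is taken by a solution. -/
theorem exists_solution_Ych {Y : Chart n N} (hY : Y ∈ dom0 S N) :
    ∃ s : Solution L, s.Ych N 0 = Y := by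
  have h0 := L.tY_timesOf hY.1 0
  have h1 := L.tY_timesOf hY.1 1
  rw [if_pos rfl] at h0
  rw [if_neg one_ne_zero] at h1
  obtain ⟨s, hc, hv⟩ := L.exists_solution hY.1 h0 (by rw [h1]; exact hY.2)
  refine ⟨s, chart_ext fun q hq => ?_⟩
  by_cases hq0 : q = 0
  · subst hq0; rw [s.cY_zero_Ych, hv]
  · rw [s.cY_Ych (by omega) hq, s.y_eq_tY, hc, hv, zero_sub, neg_neg, L.tY_timesOf hY.1, if_neg hq0]

/-! ### Every jet is taken by a solution -/

theorem add_smul_inc_mem {Y : Chart n N} (hY : Y ∈ dom0 S N) {r : ℕ} (hr : 2 ≤ r) (x : ℂ)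
    (w : Fin n → ℂ) : Y + x • inc N r w ∈ dom0 S N := by
  rw [← map_smul]
  simpa only [dom0, Set.mem_ofPred_eq, map_add, cY_inc_ne (show 0 ≠ r by omega),
    cY_inc_ne (show 1 ≠ r by omega), add_zero] using hY

/-- A function with constant derivative along a line is affine on it. For `r ≥ 2` the whole complex
line lies in `dom0`, since `v` and `y_1` do not move. -/
theorem Phi_add_inc {Y : Chart n N} (hY : Y ∈ dom0 S N) {r : ℕ} (hr : 2 ≤ r) {H : Chart n N → ℂ}
    (hH : ∀ Y ∈ dom0 S N, AnalyticAt ℂ H Y) (w : Fin n → ℂ) (c : ℂ)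
    (hc : ∀ x : ℂ, fderiv ℂ H (Y + x • inc N r w) (inc N r w) = c) :
    H (Y + inc N r w) = H Y + c := by
  have hd : ∀ x : ℂ, HasDerivAt (fun x : ℂ => H (Y + x • inc N r w) - x * c) 0 x := by
    intro x
    have h1 := (hH _ (add_smul_inc_mem hY hr x w)).differentiableAt.hasFDerivAt
    have h2 : HasDerivAt (fun x : ℂ => Y + x • inc N r w) (inc N r w) x := by
      simpa using ((hasDerivAt_id x).smul_const (inc N r w)).const_add Y
    have h3 : HasDerivAt (fun x : ℂ => H (Y + x • inc N r w)) _ x := h1.comp_hasDerivAt x h2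
    rw [hc x] at h3
    have h4 := h3.fun_sub ((hasDerivAt_id x).mul_const c)
    rw [one_mul, sub_self] at h4
    exact h4
  have := is_const_of_deriv_eq_zero (fun x => (hd x).differentiableAt) (fun x => (hd x).deriv) 1 0
  simp only [one_smul, zero_smul, one_mul, zero_mul, add_zero, sub_zero] at this
  rw [← this]; ring

theorem isUnit_Cx {Y : Chart n N} (hY : Y ∈ dom0 S N) : IsUnit (Cx S Y).det := by
  have h := Cx_mul hY
  refine Matrix.isUnit_det_of_right_inverse (B := -S.mulMatrix (cY N 0 Y) (cY N 1 Y)) ?_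
  rw [Matrix.mul_neg, h, neg_neg]

/-- Solve for the coordinates one at a time: `y_1 = -v_x⁻¹`, and afterwards `y_{r+1}` enters
`v^{(r+1)}` affinely with the invertible coefficient `v_x^{r+2}`, without disturbing the lower jets.
-/
theorem exists_chart (hN : 1 ≤ N) (j : ℕ → Fin n → ℂ) (h0 : j 0 ∈ S.carrier)
    (h1 : IsUnit (S.mulMatrix (j 0) (j 1)).det) :
    ∃ Y ∈ dom0 S N, ∀ r ≤ N, ∀ γ, L.Phi r γ Y = j r γ := by
  suffices h : ∀ r, 1 ≤ r → r ≤ N → ∃ Y ∈ dom0 S N, ∀ q ≤ r, ∀ γ, L.Phi q γ Y = j q γ from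
    h N hN le_rfl
  intro r hr
  induction r, hr using Nat.le_induction with
  | base =>
    intro _
    set A := S.mulMatrix (j 0) (j 1) with hA
    set y : Fin n → ℂ := -(A⁻¹).mulVec (unit n) with hy
    let Y : Chart n N := ofSeq N fun q => if q = 0 then j 0 else y
    have e0 : cY N 0 Y = j 0 := by simp [Y, cY_ofSeq]
    have e1 : cY N 1 Y = y := by simp [Y, cY_ofSeq hN]
    have hmul : S.mulMatrix (cY N 0 Y) (j 1) * S.mulMatrix (cY N 0 Y) (cY N 1 Y) = -1 := by
      rw [e0, e1, ← mulMatrix_mulMatrix h0, hy, Matrix.mulVec_neg, ← hA, Matrix.mulVec_mulVec,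
        Matrix.mul_nonsing_inv _ h1, Matrix.one_mulVec, mulMatrix_neg, mulMatrix_unit h0]
    obtain ⟨hY, hvx⟩ := vx_eq_of_mul (by rw [e0]; exact h0) hmul
    refine ⟨Y, hY, fun q hq γ => ?_⟩
    interval_cases q
    · change cY N 0 Y γ = _
      rw [e0]
    · rw [L.Phi_one hY, hvx]
  | succ r hr ih =>
    intro hrN
    obtain ⟨Y, hY, hj⟩ := ih (by omega)
    have hu : IsUnit (Cx S Y ^ (r + 2)).det := by rw [Matrix.det_pow]; exact (isUnit_Cx hY).pow _
    set w := ((Cx S Y ^ (r + 2))⁻¹).mulVec (fun γ => j (r + 1) γ - L.Phi (r + 1) γ Y) with hw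
    refine ⟨Y + inc N (r + 1) w, by simpa using add_smul_inc_mem hY (by omega) 1 w, fun q hq γ => ?_⟩
    by_cases hq' : q ≤ r
    · rw [Phi_add_inc hY (by omega) (L.ord_Phi q γ).1 w 0 fun x =>
        (L.ord_Phi q γ).2 _ (add_smul_inc_mem hY (by omega) x w) (r + 1) (by omega) w, add_zero,
        hj q hq']
    · obtain rfl : q = r + 1 := by omega
      rw [Phi_add_inc hY (by omega) (L.ord_Phi (r + 1) γ).1 w (((Cx S Y ^ (r + 2)).mulVec w) γ)]
      · rw [hw, Matrix.mulVec_mulVec, Matrix.mul_nonsing_inv _ hu, Matrix.one_mulVec]; ring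
      · intro x
        rw [L.fderiv_Phi_top (by omega) hrN (add_smul_inc_mem hY (by omega) x w), ← map_smul,
          Cx_add_inc (by omega)]

end LeveltSystem

end

/-! ### Generic jets, the comparison of the two coordinate systems, and the order-by-order
constraints -/

section

open FrobeniusManifold Laurent LeveltSystem

variable {n N : ℕ} [NeZero n] {S : FrobeniusManifold n} {L : LeveltSystem S}

/-! ### Density of the good jets -/

/-- The jets with `v ∈ M_ss`, invertible `E` and invertible `v_x`. -/
def goodJets (S : FrobeniusManifold n) : Set (ℕ → Fin n → ℂ) :=
  {j | j 0 ∈ S.Mss ∧ (S.U (j 0)).charpoly.eval 0 ≠ 0 ∧ IsUnit (S.mulMatrix (j 0) (j 1)).det}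

theorem charpoly_add_smul_one (A : Matrix (Fin n) (Fin n) ℂ) (c : ℂ) :
    (A + c • 1).charpoly = A.charpoly.comp (Polynomial.X - Polynomial.C c) := by
  have h := Matrix.charpoly_sub_scalar A (-c)
  rw [map_neg, sub_neg_eq_add, map_neg, ← sub_eq_add_neg] at h
  rw [← h]
  congr 2
  ext i j
  simp [Matrix.scalar_apply, Matrix.diagonal_apply, Matrix.one_apply]

theorem nodup_roots_comp {p : Polynomial ℂ} (hp : p.roots.Nodup) (c : ℂ) :
    (p.comp (Polynomial.X - Polynomial.C c)).roots.Nodup := by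
  have h := Polynomial.roots_comp_C_mul_X_add_C p 1 (-c) isUnit_one
  rw [map_one, one_mul, map_neg, ← sub_eq_add_neg] at h
  rw [h]
  refine hp.map fun x y hxy => ?_
  simpa using hxy

theorem dense_eval_ne {p : Polynomial ℂ} (hp : p ≠ 0) : Dense {x : ℂ | p.eval x ≠ 0} := by
  have hf : {x : ℂ | p.eval x = 0}.Finite := by
    refine (Polynomial.finite_setOfPred_isRoot hp).subset fun x hx => hx
  exact hf.countable.dense_compl ℂ

theorem exists_small {p : Polynomial ℂ} (hp : p ≠ 0) {P : ℂ → Prop} (hP : ∀ᶠ x in 𝓝 0, P x) :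
    ∃ x, p.eval x ≠ 0 ∧ P x := by
  obtain ⟨x, hx, hx'⟩ := (dense_eval_ne hp).inter_nhds_nonempty hP
  exact ⟨x, hx, hx'⟩

/-- Three successive small perturbations: move `v` into `M_ss`; shift it along the unity, which
translates the eigenvalues of `𝒰` and makes them nonzero; add a multiple of the unity to `v_x`,
avoiding the finitely many values where it is not invertible. -/
theorem mem_closure_goodJets (hS : S.IsSemisimple) {j : ℕ → Fin n → ℂ} (hj : j 0 ∈ S.carrier) :
    j ∈ closure (goodJets S) := by
  rw [mem_closure_iff]
  intro O hO hjO
  obtain ⟨v₁, hv₁, hv₁ss⟩ : ∃ v₁, Function.update j 0 v₁ ∈ O ∧ v₁ ∈ S.Mss := by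
    have hc : Continuous fun w : Fin n → ℂ => Function.update j 0 w := by fun_prop
    have h1 := mem_closure_iff.1 (hS hj) _ (hO.preimage hc) (by simpa using hjO)
    exact h1
  obtain ⟨c, hc0, hcO, hcU, hcm⟩ : ∃ c : ℂ, (S.U v₁).charpoly.eval (-c) ≠ 0 ∧
      Function.update j 0 (v₁ + c • unit n) ∈ O ∧ S.U (v₁ + c • unit n) = S.U v₁ + c • 1 ∧
      v₁ + c • unit n ∈ S.carrier := by
    have hc : Continuous fun c : ℂ => Function.update j 0 (v₁ + c • unit n) := by fun_prop
    have h1 : ∀ᶠ c in 𝓝 (0 : ℂ), Function.update j 0 (v₁ + c • unit n) ∈ O :=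
      hc.continuousAt.eventually_mem (hO.mem_nhds (by simpa using hv₁))
    have hne : (S.U v₁).charpoly.comp (-Polynomial.X) ≠ 0 := by
      intro h
      have h2 := congrArg (fun p : Polynomial ℂ => p.comp (-Polynomial.X)) h
      simp only [Polynomial.comp_assoc, Polynomial.neg_comp, Polynomial.X_comp, neg_neg,
        Polynomial.comp_X, Polynomial.zero_comp] at h2
      exact (Matrix.charpoly_monic _).ne_zero h2
    obtain ⟨c, h2, h3⟩ := exists_small hne
      (h1.and ((eventually_U_shift hv₁ss.1).and (eventually_shift_mem hv₁ss.1)))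
    refine ⟨c, ?_, h3.1, h3.2.1, h3.2.2⟩
    simpa [Polynomial.eval_comp] using h2
  set v₂ := v₁ + c • unit n with hv₂
  set j₂ := Function.update j 0 v₂ with hj₂
  obtain ⟨b, hb, hbO⟩ : ∃ b : ℂ, (-S.mulMatrix v₂ (j 1)).charpoly.eval b ≠ 0 ∧
      Function.update j₂ 1 (j 1 + b • unit n) ∈ O := by
    have hc : Continuous fun b : ℂ => Function.update j₂ 1 (j 1 + b • unit n) := by fun_prop
    refine exists_small (Matrix.charpoly_monic _).ne_zero
      (hc.continuousAt.eventually_mem (hO.mem_nhds ?_))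
    have : Function.update j₂ 1 (j 1 + (0 : ℂ) • unit n) = j₂ := by
      rw [zero_smul, add_zero, Function.update_eq_self_iff, hj₂, Function.update_of_ne (by omega)]
    rw [this]; exact hcO
  have e0 : Function.update j₂ 1 (j 1 + b • unit n) 0 = v₂ := by
    rw [Function.update_of_ne (by omega), hj₂, Function.update_self]
  refine ⟨_, hbO, ?_, ?_, ?_⟩
  · rw [e0]
    refine ⟨hcm, ?_⟩
    rw [hcU, charpoly_add_smul_one]
    exact nodup_roots_comp hv₁ss.2 c
  · rw [e0, hcU, charpoly_add_smul_one]
    simpa [Polynomial.eval_comp] using hc0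
  · rw [e0, Function.update_self, mulMatrix_add, mulMatrix_smul, mulMatrix_unit hcm,
      isUnit_iff_ne_zero]
    rw [Matrix.eval_charpoly] at hb
    convert hb using 2
    ext x y
    simp [Matrix.scalar_apply, Matrix.diagonal_apply, Matrix.one_apply, add_comm]

/-! ### Partial derivatives of jet functions in the two coordinate systems -/

namespace LeveltSystem

variable (L) {G : JetFunction S} {Y : Chart n N}

theorem fderiv_hat_eq_sum (hY : Y ∈ L.domOf G N) {j : ℕ → Fin n → ℂ}
    (hj : G.trunc j = L.jetOf G.order Y) {R : ℕ} (hR : G.order ≤ R) (w : Chart n N) :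
    fderiv ℂ (L.hat G) Y w = ∑ r ∈ Finset.range (R + 1), ∑ γ,
      G.partialDeriv γ r j * fderiv ℂ (L.Phi r γ) Y w := by
  rw [L.fderiv_hat G hY]
  set z : Fin (G.order + 1) → Fin n → ℂ := fun q γ => fderiv ℂ (L.Phi q γ) Y w with hz
  have h1 : z = ∑ q, ∑ γ, z q γ • (Pi.single q (Pi.single γ 1) : Fin (G.order + 1) → Fin n → ℂ) := by
    ext q γ
    rw [Finset.sum_apply, Finset.sum_apply, Finset.sum_eq_single q]
    · rw [Finset.sum_apply, Finset.sum_apply, Finset.sum_eq_single γ]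
      · simp
      · intro b _ hb; simp [hb.symm]
      · simp
    · intro b _ hb
      rw [Finset.sum_apply, Finset.sum_apply]
      exact Finset.sum_eq_zero fun c _ => by simp [hb.symm]
    · simp
  have h2 : ∑ r ∈ Finset.range (R + 1), ∑ γ, G.partialDeriv γ r j * fderiv ℂ (L.Phi r γ) Y w =
      ∑ r ∈ Finset.range (G.order + 1), ∑ γ, G.partialDeriv γ r j * fderiv ℂ (L.Phi r γ) Y w := by
    symm
    refine Finset.sum_subset (Finset.range_mono (by omega)) fun r _ hr => ?_
    refine Finset.sum_eq_zero fun γ _ => ?_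
    rw [JetFunction.partialDeriv, dif_neg (by simpa using hr), zero_mul]
  rw [h2, Finset.sum_range]
  conv_lhs => rw [h1]
  simp only [map_sum, map_smul, smul_eq_mul]
  refine Finset.sum_congr rfl fun q _ => Finset.sum_congr rfl fun γ _ => ?_
  rw [JetFunction.partialDeriv, dif_pos q.2, hj, mul_comm]

/-- Downward induction on the order: along `y_q` the jets of order below `q` do not change, those
above `q` have zero coefficient already, and the jet of order `q` changes by an invertible matrix.
The bound `m` lets the result be applied to the top orders alone. -/
theorem coeff_eq_zero (hY : Y ∈ dom0 S N) {R m : ℕ} (hR : R ≤ N) {c : ℕ → Fin n → ℂ}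
    (h : ∀ q, m ≤ q → q ≤ R → ∀ w, ∑ r ∈ Finset.range (R + 1), ∑ γ,
      c r γ * fderiv ℂ (L.Phi r γ) Y (inc N q w) = 0) :
    ∀ r, m ≤ r → r ≤ R → c r = 0 := by
  suffices key : ∀ k r, r + k = R + 1 → ∀ q, m ≤ q → r ≤ q → q ≤ R → c q = 0 from
    fun r hm hr => key (R + 1) 0 (by omega) r hm (by omega) hr
  intro k
  induction k with
  | zero => intro r hr q _ hq hqR; omega
  | succ k ih =>
    intro r hr q hm hq hqR
    by_cases hne : q = r
    · subst hne
      have h1 : ∀ w, ∑ γ, c q γ * fderiv ℂ (L.Phi q γ) Y (inc N q w) = 0 := by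
        intro w
        rw [← h q hm hqR w]
        symm
        refine Finset.sum_eq_single q (fun r' hr' hne => ?_) fun hn =>
          absurd (Finset.mem_range.2 (by omega)) hn
        rw [Finset.mem_range] at hr'
        refine Finset.sum_eq_zero fun γ _ => ?_
        rcases lt_or_gt_of_ne hne with hlt | hgt
        · rw [(L.ord_Phi r' γ).2 Y hY q hlt, mul_zero]
        · rw [ih (q + 1) (by omega) r' (by omega) (by omega) (by omega), Pi.zero_apply, zero_mul]
      by_cases hq0 : q = 0
      · subst hq0
        ext γ
        have h2 := h1 (Pi.single γ 1)
        have h3 : ∀ β, fderiv ℂ (L.Phi (N := N) 0 β) Y (inc N 0 (Pi.single γ 1)) =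
            (Pi.single γ 1 : Fin n → ℂ) β := by
          intro β
          change fderiv ℂ (fun Y => cY N 0 Y β) Y _ = _
          rw [fderiv_cY, cY_inc_self (Nat.zero_le _)]
        simp only [h3, Pi.single_apply, mul_ite, mul_one, mul_zero] at h2
        simpa using h2
      · have hu : IsUnit (Cx S Y ^ (q + 1)).det := by
          rw [Matrix.det_pow]; exact (isUnit_Cx hY).pow _
        ext γ
        have h2 := h1 (((Cx S Y ^ (q + 1))⁻¹).mulVec (Pi.single γ 1))
        simp only [L.fderiv_Phi_top (show 1 ≤ q by omega) (show q ≤ N by omega) hY,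
          Matrix.mulVec_mulVec, Matrix.mul_nonsing_inv _ hu, Matrix.one_mulVec, Pi.single_apply,
          mul_ite, mul_one, mul_zero] at h2
        simpa using h2
    · exact ih (r + 1) (by omega) q hm (by omega) hqR

/-- A good jet is taken by a solution. -/
theorem exists_solution_jet (hN : 1 ≤ N) {j : ℕ → Fin n → ℂ} (hj : j ∈ goodJets S) :
    ∃ s : Solution L, (∀ r ≤ N, s.jet 0 r = j r) ∧ s.v 0 = j 0 := by
  obtain ⟨Y, hY, hP⟩ := L.exists_chart hN j hj.1.1 hj.2.2
  obtain ⟨s, hs⟩ := L.exists_solution_Ych hY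
  have h : ∀ r ≤ N, s.jet 0 r = j r := by
    intro r hr
    ext γ
    rw [(s.near_jet hN hr γ).at_zero, hs, hP r hr]
  exact ⟨s, h, h 0 (Nat.zero_le _)⟩

end LeveltSystem

/-! ### The constraints, order by order -/

namespace Solution

variable (s : Solution L)

/-- The part of the constraint of order `m + 1` that involves lower orders only. -/
def inhom (F : ℕ → JetFunction S) (M m : ℕ) (t : Times n) : ℂ :=
  (∑ l ∈ Finset.range m, ∑ i ∈ box n M, ∑ j ∈ box n M,
    L.a M i j * dt i (s.eval (F (l + 1))) t * dt j (s.eval (F (m - l))) t) +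
  if 1 ≤ m then ∑ i ∈ box n M, ∑ j ∈ box n M, L.a M i j * dt i (dt j (s.logTau F (m - 1))) t else 0

/-- The two extreme terms of the quadratic sum pair `𝓕_0` with the new unknown, and the symmetry of
`a` merges them into the factor `2` of the linearized constraint. All else is of lower order. -/
theorem virasoroCoeff_eq (F : ℕ → JetFunction S) (κ : ℂ) (M m : ℕ) (t' t : Times n) :
    s.virasoroCoeff F κ M (m + 1) t' t =
      ((∑ i ∈ box n M, ∑ j ∈ box n M, 2 * L.a M i j * dt i s.F0 t * dt j (s.eval (F (m + 1))) t) +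
        (t'.sum fun j x => ∑ i ∈ box n (M + j.2), L.b M i j * x * dt i (s.eval (F (m + 1))) t)) +
      s.inhom F M m t + if M = 1 ∧ m = 1 then κ else 0 := by
  rw [virasoroCoeff, Finset.sum_range_succ, Finset.sum_range_succ', inhom]
  have e0 : s.logTau F 0 = s.F0 := if_pos rfl
  have e1 : s.logTau F (m + 1) = s.eval (F (m + 1)) := if_neg (by omega)
  have e2 : ∀ l ∈ Finset.range m, ∑ i ∈ box n M, ∑ j ∈ box n M,
      L.a M i j * dt i (s.logTau F (l + 1)) t * dt j (s.logTau F (m + 1 - (l + 1))) t =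
      ∑ i ∈ box n M, ∑ j ∈ box n M,
      L.a M i j * dt i (s.eval (F (l + 1))) t * dt j (s.eval (F (m - l))) t := by
    intro l hl
    rw [Finset.mem_range] at hl
    rw [show s.logTau F (l + 1) = s.eval (F (l + 1)) from if_neg (by omega),
      show m + 1 - (l + 1) = m - l by omega,
      show s.logTau F (m - l) = s.eval (F (m - l)) from if_neg (by omega)]
  have e3 : ∑ i ∈ box n M, ∑ j ∈ box n M,
      2 * L.a M i j * dt i s.F0 t * dt j (s.eval (F (m + 1))) t =
      ∑ i ∈ box n M, ∑ j ∈ box n M, L.a M i j * dt i s.F0 t * dt j (s.eval (F (m + 1))) t +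
      ∑ i ∈ box n M, ∑ j ∈ box n M, L.a M i j * dt i (s.eval (F (m + 1))) t * dt j s.F0 t := by
    rw [Finset.sum_comm (f := fun i j => L.a M i j * dt i (s.eval (F (m + 1))) t * dt j s.F0 t),
      ← Finset.sum_add_distrib]
    refine Finset.sum_congr rfl fun i _ => ?_
    rw [← Finset.sum_add_distrib]
    refine Finset.sum_congr rfl fun j _ => ?_
    rw [L.a_symm M j i]; ring
  rw [Finset.sum_congr rfl e2, Nat.sub_self, Nat.sub_zero, e0, e1, e3,
    if_neg (show ¬ m + 1 = 0 by omega), show m + 1 - 2 = m - 1 by omega]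
  have e4 : (if 2 ≤ m + 1 then ∑ i ∈ box n M, ∑ j ∈ box n M,
      L.a M i j * dt i (dt j (s.logTau F (m - 1))) t else 0) = if 1 ≤ m then ∑ i ∈ box n M,
      ∑ j ∈ box n M, L.a M i j * dt i (dt j (s.logTau F (m - 1))) t else 0 := by
    by_cases h : 1 ≤ m
    · rw [if_pos h, if_pos (by omega)]
    · rw [if_neg h, if_neg (by omega)]
  have e5 : (if M = 1 ∧ m + 1 = 2 then κ else 0) = if M = 1 ∧ m = 1 then κ else 0 := by
    by_cases h : M = 1 ∧ m = 1
    · rw [if_pos h, if_pos ⟨h.1, by omega⟩]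
    · rw [if_neg h, if_neg fun h' => h ⟨h'.1, by omega⟩]
  rw [e4, e5]
  ring

theorem virasoroCoeff_sub (F : ℕ → JetFunction S) (κ : ℂ) (M m : ℕ) (t : Times n) :
    s.virasoroCoeff F κ M (m + 1) (t - s.c) t =
      s.linearized M (F (m + 1)) t + s.inhom F M m t + if M = 1 ∧ m = 1 then κ else 0 :=
  s.virasoroCoeff_eq F κ M m (t - s.c) t

end Solution

end

/-! ### Uniqueness, and the parity in `ε` -/

section

open FrobeniusManifold Laurent LeveltSystem

variable {n N : ℕ} [NeZero n] {S : FrobeniusManifold n} {L : LeveltSystem S}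

/-! ### Uniqueness -/

theorem JetFunction.partialDeriv_congr (G : JetFunction S) {j j' : ℕ → Fin n → ℂ}
    (h : G.trunc j = G.trunc j') (γ : Fin n) (r : ℕ) :
    G.partialDeriv γ r j = G.partialDeriv γ r j' := by
  simp only [JetFunction.partialDeriv, h]

theorem JetFunction.continuous_trunc (G : JetFunction S) : Continuous G.trunc :=
  continuous_pi fun r => continuous_apply (r : ℕ)

theorem JetFunction.continuousAt_partialDeriv (G : JetFunction S) {j : ℕ → Fin n → ℂ}
    (hj : G.trunc j ∈ G.dom) (γ : Fin n) (r : ℕ) : ContinuousAt (G.partialDeriv γ r) j := by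
  unfold JetFunction.partialDeriv
  by_cases h : r < G.order + 1
  · simp only [dif_pos h]
    have h1 : ContinuousAt (fderiv ℂ G.toFun) (G.trunc j) := (G.analytic _ hj).fderiv.continuousAt
    have h2 : ContinuousAt (fun j => fderiv ℂ G.toFun (G.trunc j)) j :=
      h1.comp G.continuous_trunc.continuousAt
    exact h2.clm_apply continuousAt_const
  · simp only [dif_neg h]; exact continuousAt_const

theorem isOpen_inDom (F : ℕ → JetFunction S) (k : ℕ) : IsOpen {j | InDom F k j} := by
  have : {j | InDom F k j} = ⋂ l ∈ Finset.Icc 1 k, (F l).trunc ⁻¹' (F l).dom := by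
    ext j
    simp only [InDom, Set.mem_ofPred_eq, Set.mem_iInter, Finset.mem_Icc, Set.mem_preimage, and_imp]
  rw [this]
  exact isOpen_biInter_finset fun l _ => (F l).isOpen_dom.preimage (F l).continuous_trunc

theorem inDom_congr {F : ℕ → JetFunction S} {k K : ℕ} (hK : ∀ l ≤ k, (F l).order ≤ K)
    {j j' : ℕ → Fin n → ℂ} (h : ∀ r ≤ K, j' r = j r) (hj : InDom F k j) : InDom F k j' := by
  intro l h1 h2
  have : (F l).trunc j' = (F l).trunc j := by
    funext r
    have := hK l h2
    exact h r (by omega)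
  rw [this]; exact hj l h1 h2

/-- If an open set of jets contains a jet, it contains a good one. -/
theorem exists_goodJet (hS : S.IsSemisimple) {O : Set (ℕ → Fin n → ℂ)} (hO : IsOpen O)
    {j : ℕ → Fin n → ℂ} (hj : j ∈ O) (h0 : j 0 ∈ S.carrier) : ∃ j' ∈ O, j' ∈ goodJets S :=
  mem_closure_iff.1 (mem_closure_goodJets hS h0) O hO hj

namespace Solution

variable (s : Solution L)

theorem near_trunc_mem {G : JetFunction S} (hG : G.trunc (s.jet 0) ∈ G.dom) :
    HoldsNear fun t => G.trunc (s.jet t) ∈ G.dom := by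
  refine ((s.near_jetOf (N := G.order + 1) (r := G.order) (by omega) (by omega)).and
    ((s.analyticGerm_Ych (N := G.order + 1)).eventually_mem (L.isOpen_domOf G)
      (s.Ych_mem (by omega) (by omega) hG))).mono fun t ht => ?_
  change (fun q : Fin (G.order + 1) => s.jet t q) ∈ G.dom
  rw [ht.1]; exact ht.2.2

theorem near_inDom {F : ℕ → JetFunction S} {k : ℕ} (h : InDom F k (s.jet 0)) :
    HoldsNear fun t => InDom F k (s.jet t) := by
  have h1 := HoldsNear.forall_finset (Finset.Icc 1 k)
    (P := fun l t => (F l).trunc (s.jet t) ∈ (F l).dom)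
    (fun l hl => s.near_trunc_mem (h l (Finset.mem_Icc.1 hl).1 (Finset.mem_Icc.1 hl).2))
  exact h1.mono fun t ht l h1 h2 => ht l (Finset.mem_Icc.2 ⟨h1, h2⟩)

theorem near_dt_eval_eq_sum {G : JetFunction S} {R : ℕ} (hR : G.order ≤ R) (hN : R < N)
    (hG : G.trunc (s.jet 0) ∈ G.dom) (i : Fin n × ℕ) :
    HoldsNear fun t => dt i (s.eval G) t = ∑ r ∈ Finset.range (R + 1), ∑ γ,
      G.partialDeriv γ r (s.jet t) * fderiv ℂ (L.Phi r γ) (s.Ych N t) (L.Z i (s.Ych N t)) := by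
  refine (((s.near_dt_eval (G := G) (N := N) (by omega) hG i).and
    (s.near_jetOf (N := N) (r := G.order) (by omega) (by omega))).and
    ((s.analyticGerm_Ych (N := N)).eventually_mem (L.isOpen_domOf G)
      (s.Ych_mem (by omega) (by omega) hG))).mono fun t ht => ?_
  rw [ht.1.1]
  exact L.fderiv_hat_eq_sum (j := s.jet t) ht.2 ht.1.2 hR _

theorem near_dt_eval_congr {G G' : JetFunction S} (hG : G.trunc (s.jet 0) ∈ G.dom)
    (hG' : G'.trunc (s.jet 0) ∈ G'.dom)
    (h : HoldsNear fun t => ∀ γ r, G.partialDeriv γ r (s.jet t) = G'.partialDeriv γ r (s.jet t))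
    (i : Fin n × ℕ) : HoldsNear fun t => dt i (s.eval G) t = dt i (s.eval G') t := by
  set R := max G.order G'.order
  refine (h.and ((s.near_dt_eval_eq_sum (R := R) (le_max_left _ _) R.lt_succ_self hG i).and
    (s.near_dt_eval_eq_sum (R := R) (le_max_right _ _) R.lt_succ_self hG' i))).mono fun t ht => ?_
  rw [ht.2.1, ht.2.2]
  simp only [ht.1]

/-- The linearized constraints determine the differential of a jet function. -/
theorem partialDeriv_eq_of_linearized (hss : s.v 0 ∈ S.Mss) {G G' : JetFunction S} {δ : ℂ}
    (hG : G.trunc (s.jet 0) ∈ G.dom) (hG' : G'.trunc (s.jet 0) ∈ G'.dom)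
    (h : ∀ M, s.linearized M G 0 - s.linearized M G' 0 + (if M = 1 then δ else 0) = 0) :
    ((S.U (s.v 0)).charpoly.eval 0 ≠ 0 → δ = 0) ∧
      (δ = 0 → ∀ γ r, G.partialDeriv γ r (s.jet 0) = G'.partialDeriv γ r (s.jet 0)) := by
  set R := max G.order G'.order with hR
  have hr : G.order ≤ R := le_max_left _ _
  have hr' : G'.order ≤ R := le_max_right _ _
  set Y := s.Ych (R + 1) 0 with hYd
  have hY : Y ∈ L.domOf G (R + 1) := s.Ych_mem (by omega) (by omega) hG
  have hY' : Y ∈ L.domOf G' (R + 1) := s.Ych_mem (by omega) (by omega) hG'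
  have hv : cY (R + 1) 0 Y = s.v 0 := s.cY_zero_Ych 0
  have key := constraint_nondegenerate (l := fderiv ℂ (L.hat G) Y - fderiv ℂ (L.hat G') Y) (κ := δ)
    hY.1 (by rw [hv]; exact hss) (fun M => by
      have hM := h M
      rw [s.linearized_zero (N := R + 1) (by omega) hG M,
        s.linearized_zero (N := R + 1) (by omega) hG' M] at hM
      exact hM)
  rw [hv] at key
  refine ⟨key.1, fun hδ => ?_⟩
  have hl := key.2 hδ
  have hz := L.coeff_eq_zero hY.1 (R := R) (m := 0) (by omega)
    (c := fun r γ => G.partialDeriv γ r (s.jet 0) - G'.partialDeriv γ r (s.jet 0)) (by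
      intro q _ _ w
      have e1 := L.fderiv_hat_eq_sum (j := s.jet 0) hY
        (s.near_jetOf (N := R + 1) (r := G.order) (by omega) (by omega)).at_zero hr (inc (R + 1) q w)
      have e2 := L.fderiv_hat_eq_sum (j := s.jet 0) hY'
        (s.near_jetOf (N := R + 1) (r := G'.order) (by omega) (by omega)).at_zero hr'
          (inc (R + 1) q w)
      have e3 := DFunLike.congr_fun hl (inc (R + 1) q w)
      rw [sub_apply, e1, e2, zero_apply, ← Finset.sum_sub_distrib] at e3
      rw [← e3]
      refine Finset.sum_congr rfl fun r _ => ?_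
      rw [← Finset.sum_sub_distrib]
      exact Finset.sum_congr rfl fun γ _ => by ring)
  intro γ r
  by_cases hrR : r ≤ R
  · have := congrFun (hz r (Nat.zero_le _) hrR) γ
    exact sub_eq_zero.1 this
  · rw [JetFunction.partialDeriv, JetFunction.partialDeriv, dif_neg (by omega), dif_neg (by omega)]

/-- Only derivatives of the lower orders enter, so additive constants do not matter. Because second
derivatives occur, the first ones have to be compared near `t = 0` and not just there. -/
theorem inhom_congr {F F' : ℕ → JetFunction S} {m : ℕ} (h : InDom F (m + 1) (s.jet 0))
    (h' : InDom F' (m + 1) (s.jet 0))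
    (ih : ∀ k, 1 ≤ k → k ≤ m → ∀ j, InDom F k j → InDom F' k j →
      ∀ γ r, (F k).partialDeriv γ r j = (F' k).partialDeriv γ r j) (M : ℕ) :
    s.inhom F M m 0 = s.inhom F' M m 0 := by
  have hdt : ∀ k, 1 ≤ k → k ≤ m → ∀ i, HoldsNear fun t =>
      dt i (s.eval (F k)) t = dt i (s.eval (F' k)) t := by
    intro k h1 hk i
    refine s.near_dt_eval_congr (h k h1 (by omega)) (h' k h1 (by omega)) ?_ i
    refine ((s.near_inDom (k := k) fun l hl1 hl2 => h l hl1 (by omega)).and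
      (s.near_inDom (k := k) fun l hl1 hl2 => h' l hl1 (by omega))).mono fun t ht => ?_
    exact ih k h1 hk _ ht.1 ht.2
  rw [inhom, inhom]
  congr 1
  · refine Finset.sum_congr rfl fun l hl => Finset.sum_congr rfl fun i _ =>
      Finset.sum_congr rfl fun j _ => ?_
    rw [Finset.mem_range] at hl
    rw [(hdt (l + 1) (by omega) (by omega) i).at_zero, (hdt (m - l) (by omega) (by omega) j).at_zero]
  · by_cases hm : 1 ≤ m
    · rw [if_pos hm, if_pos hm]
      refine Finset.sum_congr rfl fun i _ => Finset.sum_congr rfl fun j _ => ?_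
      by_cases h0 : m - 1 = 0
      · simp only [logTau, if_pos h0]
      · simp only [logTau, if_neg h0]
        rw [((hdt (m - 1) (by omega) (by omega) j).dt_congr i).at_zero]
    · rw [if_neg hm, if_neg hm]

end Solution

/-- The zero jet function. -/
def zeroJet (S : FrobeniusManifold n) : JetFunction S where
  order := 0
  dom := {y | y 0 ∈ S.carrier}
  isOpen_dom := S.isOpen_carrier.preimage (continuous_apply 0)
  dom_sub _ h := h
  toFun _ := 0
  analytic _ _ := analyticAt_const

/-- A good jet lies on a solution, where the nondegeneracy of the constraints applies to `G`
compared with the zero function. Density of good jets and continuity of the derivatives cover the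
rest of the domain. -/
theorem fderiv_eq_zero_of_linearized (hS : S.IsSemisimple) {G : JetFunction S}
    (h : ∀ s : Solution L, G.trunc (s.jet 0) ∈ G.dom →
      ∀ M : ℕ, HoldsNear fun t => s.linearized M G t = 0) :
    ∀ y ∈ G.dom, fderiv ℂ G.toFun y = 0 := by
  have hgood : ∀ j ∈ goodJets S, G.trunc j ∈ G.dom → ∀ γ r, G.partialDeriv γ r j = 0 := by
    intro j hj hd γ r
    obtain ⟨s, hs, hs0⟩ := L.exists_solution_jet (N := G.order + 1) (by omega) hj
    have htr : G.trunc (s.jet 0) = G.trunc j := funext fun q => hs q (by omega)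
    have hlin0 : ∀ M, s.linearized M (zeroJet S) 0 = 0 := by
      intro M
      have : ∀ i, dt i (s.eval (zeroJet S)) 0 = 0 := fun i => by
        simp [dt, Solution.eval, zeroJet]
      simp [Solution.linearized, this]
    have key := (s.partialDeriv_eq_of_linearized (G := G) (G' := zeroJet S) (δ := 0)
      (by rw [hs0]; exact hj.1) (by rw [htr]; exact hd) s.mem (fun M => by
        rw [(h s (by rw [htr]; exact hd) M).at_zero, hlin0 M]; simp)).2 rfl γ r
    rw [G.partialDeriv_congr htr] at key
    rw [key, JetFunction.partialDeriv]
    split_ifs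
    · change fderiv ℂ (fun _ => (0 : ℂ)) _ _ = 0
      simp
    · rfl
  have hall : ∀ j, G.trunc j ∈ G.dom → ∀ γ r, G.partialDeriv γ r j = 0 := by
    intro j hj γ r
    by_contra hne
    have hev := (G.continuousAt_partialDeriv hj γ r).eventually_ne hne
    obtain ⟨O, hO, hOo, hjO⟩ := eventually_nhds_iff.1 (hev.and
      ((G.isOpen_dom.preimage G.continuous_trunc).mem_nhds hj))
    obtain ⟨j', hj'O, hj'⟩ := exists_goodJet hS hOo hjO (G.dom_sub _ hj)
    exact (hO j' hj'O).1 (hgood j' hj' (hO j' hj'O).2 γ r)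
  intro y hy
  set j : ℕ → Fin n → ℂ := fun r => if h : r < G.order + 1 then y ⟨r, h⟩ else 0 with hj
  have htr : G.trunc j = y := by
    funext q
    exact dif_pos q.2
  have hlin : (fderiv ℂ G.toFun y : (Fin (G.order + 1) → Fin n → ℂ) →ₗ[ℂ] ℂ) = 0 := by
    refine LinearMap.pi_ext' fun q => LinearMap.pi_ext' fun γ => LinearMap.ext_ring ?_
    have := hall j (by rw [htr]; exact hy) γ q
    rw [JetFunction.partialDeriv, dif_pos q.2, htr] at this
    exact this
  exact ContinuousLinearMap.coe_injective hlin

/-- If the lower orders agree, the inhomogeneous terms agree, and the difference of the next orders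
satisfies the homogeneous linearized constraints up to `κ - κ'`. This is settled on good jets and
extended by density. -/
theorem virasoro_unique (hS : S.IsSemisimple) {F F' : ℕ → JetFunction S} {κ κ' : ℂ}
    (h : VirasoroConstraints L F κ) (h' : VirasoroConstraints L F' κ') :
    (∀ k, 1 ≤ k → ∀ j, InDom F k j → InDom F' k j →
        ∀ γ r, (F k).partialDeriv γ r j = (F' k).partialDeriv γ r j) ∧
      ((∃ j, InDom F 2 j ∧ InDom F' 2 j) → κ = κ') := by
  have step : ∀ m, (∀ k, 1 ≤ k → k ≤ m → ∀ j, InDom F k j → InDom F' k j →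
      ∀ γ r, (F k).partialDeriv γ r j = (F' k).partialDeriv γ r j) →
      ∀ j ∈ goodJets S, InDom F (m + 1) j → InDom F' (m + 1) j →
      (∀ γ r, (F (m + 1)).partialDeriv γ r j = (F' (m + 1)).partialDeriv γ r j) ∧
        (m = 1 → κ = κ') := by
    intro m ih j hj hd hd'
    obtain ⟨K, hK, hK'⟩ : ∃ K, (∀ l ≤ m + 1, (F l).order ≤ K) ∧ ∀ l ≤ m + 1, (F' l).order ≤ K := by
      refine ⟨∑ l ∈ Finset.range (m + 2), ((F l).order + (F' l).order), fun l hl => ?_, fun l hl => ?_⟩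
      · exact (Nat.le_add_right _ _).trans (Finset.single_le_sum
          (f := fun l => (F l).order + (F' l).order) (fun _ _ => Nat.zero_le _)
          (Finset.mem_range.2 (by omega)))
      · exact (Nat.le_add_left _ _).trans (Finset.single_le_sum
          (f := fun l => (F l).order + (F' l).order) (fun _ _ => Nat.zero_le _)
          (Finset.mem_range.2 (by omega)))
    obtain ⟨s, hs, hs0⟩ := L.exists_solution_jet (N := K + 1) (by omega) hj
    have hsj : ∀ r ≤ K, s.jet 0 r = j r := fun r hr => hs r (by omega)
    have hsd := inDom_congr hK hsj hd
    have hsd' := inDom_congr hK' hsj hd'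
    have key := s.partialDeriv_eq_of_linearized (G := F (m + 1)) (G' := F' (m + 1))
      -- The constants enter only the constraint of order `k = 2`, that is `m = 1`. Good jets have
      -- `E` invertible, which forces this discrepancy to vanish.
      (δ := if m = 1 then κ - κ' else 0)
      (by rw [hs0]; exact hj.1) (hsd _ (by omega) le_rfl) (hsd' _ (by omega) le_rfl) (fun M => by
        have e1 := (h s (m + 1) hsd M).at_zero
        have e2 := (h' s (m + 1) hsd' M).at_zero
        rw [s.virasoroCoeff_sub] at e1 e2
        rw [s.inhom_congr hsd hsd' ih M] at e1
        by_cases hM : M = 1 <;> by_cases hm : m = 1 <;> simp [hM, hm] at e1 e2 ⊢ <;>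
          linear_combination e1 - e2)
    have hδ := key.1 (by rw [hs0]; exact hj.2.1)
    refine ⟨fun γ r => ?_, fun hm => ?_⟩
    · have := key.2 hδ γ r
      rwa [(F (m + 1)).partialDeriv_congr (j := s.jet 0) (j' := j) (funext fun q => hsj q (by
          have := hK _ le_rfl; omega)),
        (F' (m + 1)).partialDeriv_congr (j := s.jet 0) (j' := j) (funext fun q => hsj q (by
          have := hK' _ le_rfl; omega))] at this
    · rw [if_pos hm] at hδ
      exact sub_eq_zero.1 hδ
  have hall : ∀ k, 1 ≤ k → ∀ j, InDom F k j → InDom F' k j →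
      ∀ γ r, (F k).partialDeriv γ r j = (F' k).partialDeriv γ r j := by
    intro k
    induction k using Nat.strong_induction_on with
    | _ k ih =>
    intro hk j hj hj' γ r
    obtain ⟨m, rfl⟩ : ∃ m, k = m + 1 := ⟨k - 1, by omega⟩
    by_contra hne
    have hm := hj (m + 1) hk le_rfl
    have hm' := hj' (m + 1) hk le_rfl
    have hev := (((F (m + 1)).continuousAt_partialDeriv hm γ r).sub
      ((F' (m + 1)).continuousAt_partialDeriv hm' γ r)).eventually_ne (sub_ne_zero.2 hne)
    obtain ⟨O, hO, hOo, hjO⟩ := eventually_nhds_iff.1 (hev.and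
      (Filter.inter_mem ((isOpen_inDom F (m + 1)).mem_nhds hj)
        ((isOpen_inDom F' (m + 1)).mem_nhds hj')))
    obtain ⟨j', hj'O, hjg⟩ := exists_goodJet hS hOo hjO ((F (m + 1)).dom_sub _ hm)
    obtain ⟨a1, a2, a3⟩ := hO j' hj'O
    refine a1 (sub_eq_zero.2 ((step m (fun k h1 h2 => ih k (by omega) h1) j' hjg a2 a3).1 γ r))
  refine ⟨hall, fun ⟨j, hj, hj'⟩ => ?_⟩
  obtain ⟨j', hj'O, hjg⟩ := exists_goodJet hS ((isOpen_inDom F 2).inter (isOpen_inDom F' 2))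
    ⟨hj, hj'⟩ ((F 2).dom_sub _ (hj 2 (by omega) le_rfl))
  exact (step 1 (fun k h1 _ => hall k h1) j' hjg hj'O.1 hj'O.2).2 rfl

/-! ### Only even orders -/

/-- Multiplication of a jet function by a constant. -/
def JetFunction.scale (c : ℂ) (G : JetFunction S) : JetFunction S where
  order := G.order
  dom := G.dom
  isOpen_dom := G.isOpen_dom
  dom_sub := G.dom_sub
  toFun y := c * G.toFun y
  analytic y hy := analyticAt_const.mul (G.analytic y hy)

/-- The symmetry `ε ↦ -ε`: each term of order `k` in the constraint acquires the sign `(-1)^k`, and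
`κ` keeps its sign because it sits at the even order `2`. -/
theorem virasoroConstraints_flip {F : ℕ → JetFunction S} {κ : ℂ} (h : VirasoroConstraints L F κ) :
    VirasoroConstraints L (fun k => (F k).scale ((-1) ^ k)) κ := by
  intro s k hk M
  have hlog : ∀ l, s.logTau (fun k => (F k).scale ((-1) ^ k)) l =
      fun t => (-1) ^ l * s.logTau F l t := by
    intro l
    by_cases hl : l = 0
    · subst hl; simp [Solution.logTau]
    · simp only [Solution.logTau, if_neg hl]; rfl
  have hd : ∀ l i, dt i (s.logTau (fun k => (F k).scale ((-1) ^ k)) l) =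
      fun t => (-1) ^ l * dt i (s.logTau F l) t := fun l i => by
    rw [hlog]; funext t; exact deriv_const_mul_field _
  have hdd : ∀ l i j, dt i (dt j (s.logTau (fun k => (F k).scale ((-1) ^ k)) l)) =
      fun t => (-1) ^ l * dt i (dt j (s.logTau F l)) t := fun l i j => by
    rw [hd]; funext t; exact deriv_const_mul_field _
  refine (h s k hk M).mono fun t ht => ?_
  rw [← mul_zero ((-1 : ℂ) ^ k), ← ht, Solution.virasoroCoeff, Solution.virasoroCoeff]
  simp only [hdd]
  simp only [hd, mul_add]
  congr 1
  congr 1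
  congr 1
  congr 1
  · rw [Finset.mul_sum]
    refine Finset.sum_congr rfl fun l hl => ?_
    rw [Finset.mem_range] at hl
    rw [Finset.mul_sum]
    refine Finset.sum_congr rfl fun i _ => ?_
    rw [Finset.mul_sum]
    refine Finset.sum_congr rfl fun j _ => ?_
    rw [show (-1 : ℂ) ^ k = (-1) ^ l * (-1) ^ (k - l) by rw [← pow_add]; congr 1; omega]
    ring
  · split_ifs with h2
    · rw [Finset.mul_sum]
      refine Finset.sum_congr rfl fun i _ => ?_
      rw [Finset.mul_sum]
      refine Finset.sum_congr rfl fun j _ => ?_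
      rw [show (-1 : ℂ) ^ k = (-1) ^ (k - 2) * (-1) ^ 2 by rw [← pow_add]; congr 1; omega]
      ring
    · rw [mul_zero]
  · rw [Finsupp.mul_sum]
    refine Finsupp.sum_congr fun j _ => ?_
    rw [Finset.mul_sum]
    exact Finset.sum_congr rfl fun i _ => by ring
  · split_ifs with h0
    · rw [h0, pow_zero, one_mul]
    · rw [mul_zero]
  · split_ifs with h0
    · rw [h0.2]; ring
    · rw [mul_zero]

/-- By uniqueness the solution and its image under `ε ↦ -ε` have the same differentials; at odd
order these are opposite. -/
theorem partialDeriv_odd (hS : S.IsSemisimple) {F : ℕ → JetFunction S} {κ : ℂ}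
    (h : VirasoroConstraints L F κ) {k : ℕ} (hk : Odd k) {j : ℕ → Fin n → ℂ} (hj : InDom F k j)
    (γ : Fin n) (r : ℕ) : (F k).partialDeriv γ r j = 0 := by
  have h1 := (virasoro_unique hS h (virasoroConstraints_flip h)).1 k hk.pos j hj hj γ r
  have h2 : ((F k).scale ((-1) ^ k)).partialDeriv γ r j = -(F k).partialDeriv γ r j := by
    rw [JetFunction.partialDeriv, JetFunction.partialDeriv]
    by_cases hr : r < (F k).order + 1
    · rw [dif_pos hr, dif_pos (show r < ((F k).scale ((-1) ^ k)).order + 1 from hr)]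
      change fderiv ℂ (fun y => (-1) ^ k * (F k).toFun y) ((F k).trunc j) _ = _
      rw [hk.neg_one_pow, fderiv_const_mul ((F k).analytic _ (hj k hk.pos le_rfl)).differentiableAt]
      exact neg_one_mul _
    · rw [dif_neg hr, dif_neg (show ¬ r < ((F k).scale ((-1) ^ k)).order + 1 from hr), neg_zero]
  rw [h2] at h1
  exact self_eq_neg.1 h1

theorem quasiMiura_odd (hS : S.IsSemisimple) {F : ℕ → JetFunction S} {κ : ℂ}
    (h : VirasoroConstraints L F κ) (s : Solution L) (hs : ∀ k, InDom F k (s.jet 0)) (α : Fin n)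
    {k : ℕ} (hk : Odd k) : PowerSeries.coeff k (s.quasiMiura F α) = 0 := by
  have hk0 : k ≠ 0 := hk.pos.ne'
  have h1 := s.near_dt_eval_eq_sum (G := F k) (N := (F k).order + 1) le_rfl (by omega)
    (hs k k hk.pos le_rfl) (α, 0)
  have h2 : HoldsNear fun t => dt (α, 0) (s.eval (F k)) t = (fun _ => 0 : Times n → ℂ) t :=
    (h1.and (s.near_inDom (hs k))).mono fun t ht => by
      rw [ht.1]
      refine Finset.sum_eq_zero fun r _ => Finset.sum_eq_zero fun γ _ => ?_
      rw [partialDeriv_odd hS h hk ht.2, zero_mul]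
  rw [Solution.quasiMiura, PowerSeries.coeff_mk, if_neg hk0, (h2.dt_congr (0, 0)).at_zero]
  simp [dt]

end

section

open FrobeniusManifold Laurent LeveltSystem

variable {n N : ℕ} [NeZero n] {S : FrobeniusManifold n} {L : LeveltSystem S}

/-! ### The generating function of the linearized constraints -/

theorem taylor_X_sub_C_pow_mul (u : ℂ) (k : ℕ) (h : Polynomial ℂ) :
    Polynomial.taylor u ((Polynomial.X - Polynomial.C u) ^ k * h) =
      Polynomial.X ^ k * Polynomial.taylor u h := by
  simp [Polynomial.taylor_apply]

theorem coeff_taylor_of_dvd {u : ℂ} {k r : ℕ} {p : Polynomial ℂ}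
    (h : (Polynomial.X - Polynomial.C u) ^ k ∣ p) (hr : r < k) :
    (Polynomial.taylor u p).coeff r = 0 := by
  obtain ⟨q, rfl⟩ := h
  rw [taylor_X_sub_C_pow_mul, Polynomial.coeff_X_pow_mul', if_neg (by omega)]

/-- A functional on polynomials that vanishes on the multiples of `∏ (X - u_i)^k` is a combination
of Taylor coefficients at the points `u_i`. -/
theorem exists_taylor_coeff {u : Fin n → ℂ} (hu : Function.Injective u) (k : ℕ)
    (Λ : Polynomial ℂ →ₗ[ℂ] ℂ)
    (h : ∀ g, Λ ((∏ i, (Polynomial.X - Polynomial.C (u i))) ^ k * g) = 0) :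
    ∃ A : Fin n → ℕ → ℂ, ∀ p,
      Λ p = ∑ i, ∑ r ∈ Finset.range k, A i r * (Polynomial.taylor (u i) p).coeff r := by
  let φ : Fin n × Fin k → Polynomial ℂ →ₗ[ℂ] ℂ := fun x =>
    (Polynomial.lcoeff ℂ x.2).comp (Polynomial.taylor (u x.1))
  -- If all these Taylor coefficients of `p` vanish, then `p` is divisible by the pairwise coprime
  -- powers `(X - u_i)^k`, hence by their product. A functional vanishing on the common kernel of
  -- finitely many functionals is a combination of them.
  have hk : ⨅ x, LinearMap.ker (φ x) ≤ LinearMap.ker Λ := by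
    intro p hp
    rw [Submodule.mem_iInf] at hp
    have hd : ∀ i, (Polynomial.X - Polynomial.C (u i)) ^ k ∣ p := by
      intro i
      rw [Polynomial.X_sub_C_pow_dvd_iff, ← Polynomial.taylor_apply, Polynomial.X_pow_dvd_iff]
      intro d hd
      exact hp (i, ⟨d, hd⟩)
    have hc : Pairwise (Function.onFun IsCoprime fun i => (Polynomial.X - Polynomial.C (u i)) ^ k) :=
      fun i j hij => (Polynomial.pairwise_coprime_X_sub_C hu hij).pow
    obtain ⟨q, hq⟩ := Fintype.prod_dvd_of_coprime hc hd
    rw [LinearMap.mem_ker, hq, Finset.prod_pow]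
    exact h q
  obtain ⟨c, hc⟩ := (Submodule.mem_span_range_iff_exists_fun ℂ).1
    (mem_span_of_iInf_ker_le_ker hk)
  refine ⟨fun i r => if hr : r < k then c (i, ⟨r, hr⟩) else 0, fun p => ?_⟩
  rw [← hc, LinearMap.sum_apply, Fintype.sum_prod_type]
  refine Finset.sum_congr rfl fun i _ => ?_
  rw [Finset.sum_range]
  refine Finset.sum_congr rfl fun r _ => ?_
  simp only [dif_pos r.2]
  rfl

/-- The Taylor coefficient is `M.choose r * u ^ (M - r)`, zero for `M < r`; the series is the
negative binomial expansion at infinity. -/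
theorem hasSum_taylor_coeff {u z : ℂ} (h : ‖u‖ < ‖z‖) (r : ℕ) :
    HasSum (fun M : ℕ => (Polynomial.taylor u (Polynomial.X ^ M)).coeff r / z ^ (M + 1))
      (1 / (z - u) ^ (r + 1)) := by
  have hz : z ≠ 0 := by
    rintro rfl
    rw [norm_zero] at h
    exact absurd h (not_lt.2 (norm_nonneg u))
  have hx : ‖u / z‖ < 1 := by rw [norm_div, div_lt_one (norm_pos_iff.2 hz)]; exact h
  have hc : ∀ M, (Polynomial.taylor u (Polynomial.X ^ M)).coeff r = u ^ (M - r) * (M.choose r : ℂ) := by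
    intro M
    rw [Polynomial.taylor_apply, Polynomial.X_pow_comp, Polynomial.coeff_X_add_C_pow]
  have hs := (hasSum_choose_mul_geometric_of_norm_lt_one r hx).mul_left (1 / z ^ (r + 1))
  rw [← (add_left_injective r).hasSum_iff]
  · have e1 : ((fun M : ℕ => (Polynomial.taylor u (Polynomial.X ^ M)).coeff r / z ^ (M + 1)) ∘
        fun x => x + r) = fun i => 1 / z ^ (r + 1) * (((i + r).choose r : ℂ) * (u / z) ^ i) := by
      funext M
      simp only [Function.comp, hc, Nat.add_sub_cancel, div_pow]
      rw [show M + r + 1 = M + (r + 1) by ring, pow_add]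
      field_simp
    have e2 : 1 / (z - u) ^ (r + 1) = 1 / z ^ (r + 1) * (1 / (1 - u / z) ^ (r + 1)) := by
      have : z - u ≠ 0 := fun h0 => by
        rw [sub_eq_zero.1 h0] at h; exact lt_irrefl _ h
      have h1 : 1 - u / z = (z - u) / z := by field_simp
      rw [h1, div_pow]
      field_simp
    rw [e1, e2]; exact hs
  · intro M hM
    have : M < r := by
      by_contra h'
      exact hM ⟨M - r, by simp; omega⟩
    rw [hc, Nat.choose_eq_zero_of_lt this]; simp

namespace LeveltSystem

variable {Y : Chart n N}

theorem aeval_mulVec_sum (F : Frame S (cY N 0 Y)) (c : Fin n → ℂ) (p : Polynomial ℂ) :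
    (Polynomial.aeval (S.U (cY N 0 Y)) p).mulVec (∑ k, c k • F.π k) =
      ∑ k, (c k * p.eval (F.u k)) • F.π k := by
  rw [Matrix.mulVec_sum]
  exact Finset.sum_congr rfl fun k _ => by
    rw [Matrix.mulVec_smul, aeval_mulVec_eigen (F.eigen k), smul_smul]

theorem eval_charpoly_derivative (F : Frame S (cY N 0 Y)) (i : Fin n) :
    (S.U (cY N 0 Y)).charpoly.derivative.eval (F.u i) =
      (∏ k ∈ Finset.univ.erase i, (Polynomial.X - Polynomial.C (F.u k))).eval (F.u i) := by
  rw [F.charpoly_eq, ← Finset.mul_prod_erase Finset.univ _ (Finset.mem_univ i)]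
  simp

variable (L) in
theorem fderiv_hat_inc_order {G : JetFunction S} (hY : Y ∈ L.domOf G N) {j : ℕ → Fin n → ℂ}
    (hj : G.trunc j = L.jetOf G.order Y) (hN : G.order ≤ N) (w : Fin n → ℂ) :
    fderiv ℂ (L.hat G) Y (inc N G.order w) = ∑ γ, G.partialDeriv γ G.order j *
      (if G.order = 0 then w else (Cx S Y ^ (G.order + 1)).mulVec w) γ := by
  rw [L.fderiv_hat_eq_sum hY hj le_rfl, Finset.sum_range_succ, Finset.sum_eq_zero, zero_add]
  · refine Finset.sum_congr rfl fun γ _ => ?_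
    congr 1
    split_ifs with h0
    · rw [h0]
      change fderiv ℂ (fun Y => cY N 0 Y γ) Y _ = _
      rw [fderiv_cY, cY_inc_self (Nat.zero_le _)]
    · exact L.fderiv_Phi_top (by omega) hN hY.1 w γ
  · intro r hr
    rw [Finset.mem_range] at hr
    refine Finset.sum_eq_zero fun γ _ => ?_
    rw [(L.ord_Phi r γ).2 Y hY.1 _ hr, mul_zero]

end LeveltSystem

/-- The constraints assemble into a functional on polynomials that kills the multiples of `χ^{N+1}`,
`N = G.order`, so it is a combination of Taylor coefficients at the `u_i`. Each Taylor functional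
sums to one power of `1/(z - u_i)`, and the leading coefficient is read off from one test polynomial
per eigenvalue. -/
theorem linearized_generating_function (G : JetFunction S) (s : Solution L) (hss : s.v 0 ∈ S.Mss)
    (hG : G.trunc (s.jet 0) ∈ G.dom) :
    ∃ (u : Fin n → ℂ) (π : Fin n → Fin n → ℂ) (u' : Fin n → ℂ) (A : Fin n → ℕ → ℂ),
      S.IsCanonicalFrame (s.v 0) u π ∧
      (s.jet 0 1 = ∑ i, u' i • π i) ∧
      (∀ z : ℂ, (∀ i, ‖u i‖ < ‖z‖) →
        HasSum (fun M : ℕ => s.linearized M G 0 / z ^ (M + 1))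
          (∑ i, ∑ r ∈ Finset.range (G.order + 1), A i r / (z - u i) ^ (r + 1))) ∧
      ∀ i, A i G.order = -(u' i ^ G.order * poleConst G.order) *
          ∑ γ, π i γ * G.partialDeriv γ G.order (s.jet 0) ∧
        u' i ^ G.order * poleConst G.order ≠ 0 := by
  set r₀ := G.order with hr₀
  set N := r₀ + 1 with hN
  set Y := s.Ych N 0 with hYd
  have hY : Y ∈ L.domOf G N := s.Ych_mem (by omega) (by omega) hG
  have hv : cY N 0 Y = s.v 0 := s.cY_zero_Ych 0
  obtain ⟨F⟩ := exists_frame (show cY N 0 Y ∈ S.Mss by rw [hv]; exact hss)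
  have hjet : G.trunc (s.jet 0) = L.jetOf G.order Y :=
    (s.near_jetOf (N := N) (r := G.order) (by omega) (by omega)).at_zero
  set l := fderiv ℂ (L.hat G) Y with hl
  have hl0 : ∀ q, r₀ < q → ∀ w, l (inc N q w) = 0 := fun q hq w => (L.ord_hat G).2 Y hY q hq w
  obtain ⟨A, hA⟩ := exists_taylor_coeff F.inj (r₀ + 1) ((l : Chart n N →ₗ[ℂ] ℂ).comp (DMlin S Y))
    (fun g => by
      rw [← F.charpoly_eq]
      exact apply_DM_eq_zero hl0 g)
  obtain ⟨u', hu'⟩ := F.span (vx S Y)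
  obtain ⟨y, hy⟩ := F.span (cY N 1 Y)
  have hCx : ∀ i, (Cx S Y).mulVec (F.π i) = u' i • F.π i := by
    intro i
    rw [Cx, mulMatrix_mulVec_comm hY.1.1, hu', F.mulMatrix_π_sum]
  -- The components of `v_x · y_1 = -e` in the frame of idempotents.
  have huy : ∀ i, u' i * y i = -1 := by
    intro i
    have h1 := Cx_mulVec_aeval hY.1 1
    rw [map_one, Matrix.one_mulVec, Matrix.one_mulVec, hy, Matrix.mulVec_sum] at h1
    simp only [Matrix.mulVec_smul, hCx, smul_smul] at h1
    have h2 := congrArg (S.mulMatrix (cY N 0 Y) (F.π i)).mulVec h1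
    rw [F.mulMatrix_π_sum, ← F.sum_π hY.1.1, Matrix.mulVec_neg] at h2
    have h3 := F.mulMatrix_π_sum (fun _ => 1) i
    simp only [one_smul] at h3
    rw [h3] at h2
    have h4 : (u' i * y i + 1) • F.π i = 0 := by
      rw [add_smul, one_smul, mul_comm, h2, neg_add_cancel]
    linear_combination (smul_eq_zero.1 h4).resolve_right (F.ne_zero i)
  have hu0 : ∀ i, u' i ≠ 0 := fun i h0 => by
    have := huy i
    rw [h0, zero_mul] at this
    exact neg_ne_zero.2 one_ne_zero this.symm
  have hCxp : ∀ i k, (Cx S Y ^ k).mulVec (F.π i) = u' i ^ k • F.π i := by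
    intro i k
    induction k with
    | zero => simp
    | succ k ih => rw [pow_succ, ← Matrix.mulVec_mulVec, hCx, Matrix.mulVec_smul, ih, smul_smul,
        ← pow_succ']
  refine ⟨F.u, F.π, u', A, hv ▸ F.isCanonicalFrame, ?_, ?_, fun i => ⟨?_, ?_⟩⟩
  · rw [← hu']
    ext γ
    rw [(s.near_jet (N := N) (r := 1) (by omega) (by omega) γ).at_zero]
    exact L.Phi_one hY.1 γ
  · intro z hz
    have hlin : ∀ M, s.linearized M G 0 / z ^ (M + 1) = ∑ i, ∑ r ∈ Finset.range (r₀ + 1),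
        A i r * ((Polynomial.taylor (F.u i) (Polynomial.X ^ M)).coeff r / z ^ (M + 1)) := by
      intro M
      rw [s.linearized_zero (N := N) (by omega) hG M]
      have := hA (Polynomial.X ^ M)
      change l (DM S Y (Polynomial.X ^ M)) = _ at this
      rw [← hYd, ← hl, this, Finset.sum_div]
      refine Finset.sum_congr rfl fun i _ => ?_
      rw [Finset.sum_div]
      exact Finset.sum_congr rfl fun r _ => by ring
    simp only [hlin]
    refine hasSum_sum fun i _ => hasSum_sum fun r _ => ?_
    have := (hasSum_taylor_coeff (hz i) r).mul_left (A i r)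
    rwa [mul_one_div] at this
  -- The test polynomial `χ^{r₀} g` vanishes to order `r₀ + 1` at the other eigenvalues and to order
  -- exactly `r₀` at `u_i`, which isolates `A i r₀`.
  · set g : Polynomial ℂ := ∏ k ∈ Finset.univ.erase i, (Polynomial.X - Polynomial.C (F.u k)) with hg
    have hgk : ∀ k, k ≠ i → g.eval (F.u k) = 0 := by
      intro k hk
      rw [hg, Polynomial.eval_prod]
      exact Finset.prod_eq_zero (Finset.mem_erase.2 ⟨hk, Finset.mem_univ k⟩) (by simp)
    have hχ : (S.U (cY N 0 Y)).charpoly = (Polynomial.X - Polynomial.C (F.u i)) * g := by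
      rw [F.charpoly_eq, hg, Finset.mul_prod_erase Finset.univ
        (fun k => Polynomial.X - Polynomial.C (F.u k)) (Finset.mem_univ i)]
    have hχ' : (S.U (cY N 0 Y)).charpoly.derivative.eval (F.u i) = g.eval (F.u i) :=
      eval_charpoly_derivative F i
    have hg0 : g.eval (F.u i) ≠ 0 := by rw [← hχ']; exact F.aeval_derivative_ne i
    have hp : (S.U (cY N 0 Y)).charpoly ^ r₀ * g =
        (Polynomial.X - Polynomial.C (F.u i)) ^ r₀ * g ^ (r₀ + 1) := by
      rw [hχ, mul_pow, pow_succ]; ring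
    have e1 := hA ((S.U (cY N 0 Y)).charpoly ^ r₀ * g)
    rw [Finset.sum_eq_single i, Finset.sum_eq_single r₀] at e1
    · rw [hp, taylor_X_sub_C_pow_mul, Polynomial.coeff_X_pow_mul', if_pos le_rfl, Nat.sub_self,
        Polynomial.taylor_coeff_zero, Polynomial.eval_pow, ← hp] at e1
      change l (DM S Y _) = _ at e1
      -- For `r₀ > 0` the vector `y_1` contributes `-1/u'_i`, and the passage from `y_{r₀}` to the
      -- jets contributes `u'_i^{r₀+1}`; together they give `-u'_i^{r₀}`. For `r₀ = 0` neither
      -- factor appears.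
      have e2 : topVec S Y r₀ g = (-(rising (3 / 2) r₀) * g.eval (F.u i) ^ (r₀ + 1) *
          (if r₀ = 0 then 1 else (u' i)⁻¹)) • F.π i := by
        rw [topVec]
        split_ifs with h0
        · rw [← F.sum_π hY.1.1]
          have := aeval_mulVec_sum F (fun _ => 1) g
          simp only [one_smul, one_mul] at this
          rw [this, Finset.sum_eq_single i]
          · simp [h0, rising]
          · intro k _ hk; rw [hgk k hk, zero_smul]
          · simp
        · rw [hy, aeval_mulVec_sum, Finset.sum_eq_single i]
          · rw [smul_smul, Polynomial.eval_mul, Polynomial.eval_pow, hχ', ← pow_succ]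
            have : y i = -(u' i)⁻¹ := by
              have := huy i
              have h' := hu0 i
              field_simp
              linear_combination this
            rw [this]
            congr 1
            ring
          · intro k _ hk; rw [Polynomial.eval_mul, hgk k hk, mul_zero, mul_zero, zero_smul]
          · simp
      rw [apply_DM_top F hY.1 (by omega) hl0, e2, map_smul, map_smul, hl,
        L.fderiv_hat_inc_order hY hjet (by omega), smul_eq_mul, ← hr₀] at e1
      have e3 : ∑ γ, G.partialDeriv γ r₀ (s.jet 0) *
          (if r₀ = 0 then F.π i else (Cx S Y ^ (r₀ + 1)).mulVec (F.π i)) γ =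
          (if r₀ = 0 then 1 else u' i ^ (r₀ + 1)) *
            ∑ γ, F.π i γ * G.partialDeriv γ r₀ (s.jet 0) := by
        rw [Finset.mul_sum]
        refine Finset.sum_congr rfl fun γ _ => ?_
        split_ifs
        · ring
        · rw [hCxp, Pi.smul_apply, smul_eq_mul]; ring
      rw [e3] at e1
      have h2 : g.eval (F.u i) ^ (r₀ + 1) ≠ 0 := pow_ne_zero _ hg0
      refine mul_right_cancel₀ h2 ?_
      rw [← e1, poleConst_eq]
      split_ifs with h0
      · rw [h0]; ring
      · have := hu0 i
        field_simp
        ring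
    · intro r hr hne
      rw [Finset.mem_range] at hr
      rw [hp, taylor_X_sub_C_pow_mul, Polynomial.coeff_X_pow_mul', if_neg (by omega), mul_zero]
    · simp
    · intro k _ hk
      refine Finset.sum_eq_zero fun r hr => ?_
      rw [Finset.mem_range] at hr
      rw [coeff_taylor_of_dvd (k := r₀ + 1) _ hr, mul_zero]
      rw [hp]
      refine Dvd.dvd.mul_left (pow_dvd_pow_of_dvd ?_ _) _
      exact Finset.dvd_prod_of_mem _ (Finset.mem_erase.2 ⟨hk, Finset.mem_univ k⟩)
    · simp
  · rw [poleConst_eq]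
    exact mul_ne_zero (pow_ne_zero _ (hu0 i)) (rising_three_halves_ne _)

end

section

open FrobeniusManifold Laurent LeveltSystem

variable {n N : ℕ} [NeZero n] {S : FrobeniusManifold n} {L : LeveltSystem S}

/-! ### Linearization of the Virasoro symmetries -/

variable (L) in
/-- The quadratic form of the Virasoro operators. -/
def cForm (M : ℕ) : Times n →ₗ[ℂ] Times n →ₗ[ℂ] ℂ :=
  Finsupp.linearCombination ℂ fun i => Finsupp.linearCombination ℂ fun j => L.c M i j

theorem cForm_apply (M : ℕ) (t t' : Times n) : cForm L M t t' =
    t.sum fun i x => t'.sum fun j y => L.c M i j * x * y := by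
  rw [cForm, Finsupp.linearCombination_apply, Finsupp.sum, LinearMap.sum_apply]
  refine Finset.sum_congr rfl fun i _ => ?_
  rw [LinearMap.smul_apply, Finsupp.linearCombination_apply, smul_eq_mul, Finsupp.mul_sum]
  exact Finset.sum_congr rfl fun j _ => by simp only [smul_eq_mul]; ring

namespace Solution

variable (s : Solution L)

theorem near_genus_zero (M : ℕ) : HoldsNear fun t =>
    (∑ i ∈ box n M, ∑ j ∈ box n M, L.a M i j * dt i s.F0 t * dt j s.F0 t) +
      ((t - s.c).sum fun j x => ∑ i ∈ box n (M + j.2), L.b M i j * x * dt i s.F0 t) +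
      cForm L M (t - s.c) (t - s.c) = 0 := by
  refine HoldsNear.of_large (supBound s.c) fun N hN => ?_
  filter_upwards [HoldsNear.forall_finset (box n (M + N)) (fun j _ => s.dt_F0 j) N, s.near_mem N,
    s.near_y_zero N] with y h1 h2 h3
  have hK := emb_sub_support s.c hN y
  have hF : ∀ i, i.2 < M + N → dt i s.F0 (emb N y) = L.tF (s.v (emb N y)) (emb N y - s.c) i :=
    fun i hi => h1 i (by simpa using hi)
  rw [s.y_eq_tY] at h3
  rw [← L.genus_zero h2 hK h3 M, cForm_apply, sum_eq_sum_box hK (fun j => by simp),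
    sum_eq_sum_box hK (fun j => by simp)]
  congr 1
  · congr 1
    · refine Finset.sum_congr rfl fun i hi => Finset.sum_congr rfl fun j hj => ?_
      simp only [Finset.mem_product, Finset.mem_range] at hi hj
      rw [hF i (by omega), hF j (by omega)]
    · refine Finset.sum_congr rfl fun j hj => Finset.sum_congr rfl fun i hi => ?_
      simp only [Finset.mem_product, Finset.mem_range] at hi hj
      rw [hF i (by omega)]
  · refine Finset.sum_congr rfl fun j _ => ?_
    rw [sum_eq_sum_box hK (fun j => by simp)]

/-- The derivative along `∑ b c^j ∂/∂t^i`. -/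
def bflow (M : ℕ) (f : Times n → ℂ) (t : Times n) : ℂ :=
  ∑ x ∈ s.c.support.sigma fun j => box n (M + j.2), L.b M x.2 x.1 * s.c x.1 * dt x.2 f t

theorem bflow_eq (M : ℕ) (f : Times n → ℂ) (t : Times n) : s.bflow M f t =
    s.c.sum fun j x => ∑ i ∈ box n (M + j.2), L.b M i j * x * dt i f t := by
  rw [bflow, Finset.sum_sigma]; rfl

theorem sum_b_sub (M : ℕ) (f : Times n → ℂ) (t : Times n) :
    ((t - s.c).sum fun j x => ∑ i ∈ box n (M + j.2), L.b M i j * x * dt i f t) =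
      (t.sum fun j x => ∑ i ∈ box n (M + j.2), L.b M i j * x * dt i f t) - s.bflow M f t := by
  rw [bflow_eq]
  refine Finsupp.sum_sub_index fun j x y => ?_
  rw [← Finset.sum_sub_distrib]
  exact Finset.sum_congr rfl fun i _ => by ring

theorem dt_bflow (M : ℕ) {f : Times n → ℂ} (hf : AnalyticGerm f) (i : Fin n × ℕ) :
    HoldsNear fun t => dt i (s.bflow M f) t = s.bflow M (dt i f) t := by
  have h1 := AnalyticGerm.dt_sum (s.c.support.sigma fun j => box n (M + j.2))
    (f := fun x t => L.b M x.2 x.1 * s.c x.1 * dt x.2 f t)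
    (fun x _ => (AnalyticGerm.const _).mul (hf.dt x.2)) i
  have h2 := HoldsNear.forall_finset (s.c.support.sigma fun j => box n (M + j.2))
    (fun x _ => hf.dt_comm i x.2)
  refine (h1.and h2).mono fun t ht => ?_
  rw [bflow]
  refine ht.1.trans (Finset.sum_congr rfl fun x hx => ?_)
  rw [dt_const_mul, ht.2 x hx]

theorem bflow_congr (M : ℕ) {f g : Times n → ℂ} (h : HoldsNear fun t => f t = g t) :
    HoldsNear fun t => s.bflow M f t = s.bflow M g t :=
  (HoldsNear.forall_finset (s.c.support.sigma fun j => box n (M + j.2))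
    (fun x _ => h.dt_congr x.2)).mono fun t ht =>
      Finset.sum_congr rfl fun x hx => by rw [ht x hx]

theorem analyticGerm_bflow (M : ℕ) {f : Times n → ℂ} (hf : AnalyticGerm f) :
    AnalyticGerm (s.bflow M f) :=
  AnalyticGerm.sum _ fun x _ => (AnalyticGerm.const _).mul (hf.dt x.2)

/-- Subtract the constraint of genus zero, which is the same expression in the shifted times: the
quadratic part in `∂𝓕_0` cancels, leaving the flow along `∑ b c ∂/∂t` and a difference of two
quadratic forms. -/
theorem near_symF0 (M : ℕ) : HoldsNear fun t => s.symF0 M t = s.bflow M s.F0 t +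
    (cForm L M t t - cForm L M (t - s.c) (t - s.c)) :=
  (s.near_genus_zero M).mono fun t ht => by
    rw [s.sum_b_sub] at ht
    rw [symF0, ← cForm_apply]
    linear_combination ht

theorem near_dt_symF0 (M : ℕ) (i : Fin n × ℕ) : HoldsNear fun t => dt i (s.symF0 M) t =
    s.bflow M (dt i s.F0) t +
      (cForm L M (Finsupp.single i 1) s.c + cForm L M s.c (Finsupp.single i 1)) := by
  have hB := s.analyticGerm_bflow M s.analyticGerm_F0
  refine (((s.near_symF0 M).dt_congr i).and ((s.dt_bflow M s.analyticGerm_F0 i).and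
    (hB.differentiableAt_line i))).mono fun t ht => ?_
  rw [ht.1, ← ht.2.1]
  set k := cForm L M (Finsupp.single i 1) s.c + cForm L M s.c (Finsupp.single i 1) with hk
  -- The two quadratic forms have the same leading part, so their difference is affine in `t`. One
  -- derivative makes it constant, and a second one removes it.
  have e : ∀ x : ℂ, cForm L M (t + Finsupp.single i x) (t + Finsupp.single i x) -
      cForm L M (t + Finsupp.single i x - s.c) (t + Finsupp.single i x - s.c) =
      (cForm L M t t - cForm L M (t - s.c) (t - s.c)) + x * k := by
    intro x
    have : (Finsupp.single i x : Times n) = x • Finsupp.single i 1 := by simp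
    rw [this, hk]
    simp only [map_add, map_sub, map_smul, LinearMap.add_apply, LinearMap.sub_apply,
      LinearMap.smul_apply, smul_eq_mul]
    ring
  have h2 : HasDerivAt (fun x : ℂ => (cForm L M t t - cForm L M (t - s.c) (t - s.c)) + x * k) k 0 := by
    simpa using ((hasDerivAt_id (0 : ℂ)).mul_const k).const_add
      (cForm L M t t - cForm L M (t - s.c) (t - s.c))
  have h3 := (ht.2.2.hasDerivAt.fun_add h2).deriv
  refine Eq.trans ?_ h3
  simp only [dt, e]

/-- `v` is built from second derivatives of `𝓕_0`, to which the affine correction of `near_symF0`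
does not contribute. Hence the symmetry acts on the solution by a linear flow with constant
coefficients. -/
theorem near_symV (M : ℕ) (γ : Fin n) :
    HoldsNear fun t => s.symV M γ t = s.bflow M (fun t => s.v t γ) t := by
  have h1 : ∀ α, HoldsNear fun t => dt (0, 0) (dt (α, 0) (s.symF0 M)) t =
      s.bflow M (fun t => L.Ω (α, 0) (0, 0) (s.v t)) t := by
    intro α
    refine (((s.near_dt_symF0 M (α, 0)).dt_congr (0, 0)).and
      ((s.dt_bflow M (s.analyticGerm_F0.dt (α, 0)) (0, 0)).and
        (s.bflow_congr M (s.dt_dt_F0 (0, 0) (α, 0))))).mono fun t ht => ?_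
    rw [ht.1, ← ht.2.2, ← ht.2.1]
    exact deriv_add_const _
  have h2 : ∀ i : Fin n × ℕ, HoldsNear fun t => ∑ α, S.η⁻¹ γ α *
      dt i (fun t => L.Ω (α, 0) (0, 0) (s.v t)) t = dt i (fun t => s.v t γ) t := by
    intro i
    refine ((HoldsNear.forall_fintype fun α => s.dt_Ω i (α, 0) (0, 0)).and s.near_mem).mono
      fun t ht => ?_
    have e1 : ∀ α, bil S ((S.mulMatrix (s.v t) (s.dv i t)).mulVec (L.col (α, 0) (s.v t)))
        (L.col (0, 0) (s.v t)) = (S.η.mulVec (s.dv i t)) α := by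
      intro α
      have : L.col (α, 0) (s.v t) = Pi.single α 1 := by
        ext γ
        simp [col, L.Th_zero ht.2, Matrix.one_apply, Pi.single_apply]
      rw [bil_mulMatrix ht.2, col_zero_zero ht.2, mulMatrix_mulVec_unit ht.2, this, bil,
        single_one_dotProduct]
    simp only [ht.1, e1]
    change ((S.η⁻¹).mulVec (S.η.mulVec (s.dv i t))) γ = _
    rw [Matrix.mulVec_mulVec, η_inv_mul, Matrix.one_mulVec]
    rfl
  refine ((HoldsNear.forall_fintype h1).and (HoldsNear.forall_finset
    (s.c.support.sigma fun j => box n (M + j.2)) (fun x _ => h2 x.2))).mono fun t ht => ?_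
  simp only [symV, ht.1, bflow, Finset.mul_sum]
  rw [Finset.sum_comm]
  refine Finset.sum_congr rfl fun x hx => ?_
  rw [← ht.2 x hx, Finset.mul_sum]
  exact Finset.sum_congr rfl fun α _ => by ring

theorem near_iterate_symV (M : ℕ) (γ : Fin n) (r : ℕ) : HoldsNear fun t =>
    (dt (0, 0))^[r] (s.symV M γ) t = s.bflow M (fun t => s.jet t r γ) t := by
  induction r with
  | zero => exact s.near_symV M γ
  | succ r ih =>
    have hj : AnalyticGerm fun t => s.jet t r γ := (s.analyticGerm_v.apply γ).iterate_dt (0, 0) r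
    refine ((ih.dt_congr (0, 0)).and (s.dt_bflow M hj (0, 0))).mono fun t ht => ?_
    rw [Function.iterate_succ_apply', ht.1, ht.2]
    congr 1
    funext t
    change _ = (dt (0, 0))^[r + 1] (fun t => s.v t γ) t
    rw [Function.iterate_succ_apply']
    rfl

theorem near_dt_jet (hN : 1 ≤ N) {r : ℕ} (hr : r < N) (γ : Fin n) (i : Fin n × ℕ) :
    HoldsNear fun t => dt i (fun t => s.jet t r γ) t =
      fderiv ℂ (L.Phi r γ) (s.Ych N t) (L.Z i (s.Ych N t)) :=
  (((s.near_jet hN hr.le γ).dt_congr i).and (s.dt_comp_Ych isOpen_dom0 (L.ord_Phi r γ) hr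
    (s.near_Ych hN).at_zero.1 i).2).mono fun _ ht => ht.1.trans ht.2

/-- The linear flow commutes with `∂_x`, so its prolongation to jets is again the flow, and the
chain rule applies. -/
theorem near_symLogTau {F : ℕ → JetFunction S} {k : ℕ} (hk : k ≠ 0)
    (hF : (F k).trunc (s.jet 0) ∈ (F k).dom) (M : ℕ) :
    HoldsNear fun t => s.symLogTau F M k t = s.bflow M (s.eval (F k)) t := by
  set R := (F k).order
  have h1 : HoldsNear fun t => ∀ x ∈ box n (R + 1), (dt (0, 0))^[x.2] (s.symV M x.1) t =
      s.bflow M (fun t => s.jet t x.2 x.1) t :=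
    HoldsNear.forall_finset _ fun x _ => s.near_iterate_symV M x.1 x.2
  have h2 := HoldsNear.forall_finset (s.c.support.sigma fun j => box n (M + j.2)) fun x _ =>
    HoldsNear.forall_finset (box n (R + 1)) fun y hy => s.near_dt_jet (N := R + 1) (r := y.2)
      (by omega) (by simpa using hy) y.1 x.2
  have h3 := HoldsNear.forall_finset (s.c.support.sigma fun j => box n (M + j.2)) fun x _ =>
    s.near_dt_eval_eq_sum (G := F k) (R := R) le_rfl R.lt_succ_self hF x.2
  refine (h1.and (h2.and h3)).mono fun t ht => ?_
  obtain ⟨a1, a2, a3⟩ := ht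
  rw [symLogTau, if_neg hk]
  have e1 : ∀ r ∈ Finset.range (R + 1), ∀ γ, (dt (0, 0))^[r] (s.symV M γ) t =
      ∑ x ∈ s.c.support.sigma fun j => box n (M + j.2), L.b M x.2 x.1 * s.c x.1 *
        fderiv ℂ (L.Phi r γ) (s.Ych (R + 1) t) (L.Z x.2 (s.Ych (R + 1) t)) := by
    intro r hr γ
    have hm : (γ, r) ∈ box n (R + 1) := by simpa using hr
    rw [a1 (γ, r) hm, bflow]
    exact Finset.sum_congr rfl fun x hx => by rw [a2 x hx (γ, r) hm]
  have e2 : s.bflow M (s.eval (F k)) t = ∑ x ∈ s.c.support.sigma fun j => box n (M + j.2),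
      ∑ r ∈ Finset.range (R + 1), L.b M x.2 x.1 * s.c x.1 * ∑ γ,
        (F k).partialDeriv γ r (s.jet t) *
          fderiv ℂ (L.Phi r γ) (s.Ych (R + 1) t) (L.Z x.2 (s.Ych (R + 1) t)) :=
    Finset.sum_congr rfl fun x hx => by rw [a3 x hx, Finset.mul_sum]
  refine Eq.symm (e2.trans ?_)
  rw [Finset.sum_comm]
  refine Finset.sum_congr rfl fun r hr => ?_
  simp only [Finset.mul_sum]
  rw [Finset.sum_comm]
  refine Finset.sum_congr rfl fun γ _ => ?_
  rw [e1 r hr γ, Finset.mul_sum]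
  exact Finset.sum_congr rfl fun x _ => by ring

end Solution

/-- Order zero is the constraint of genus zero. At higher order, replacing `t` by `t - c` in the
operator changes it only by `-bflow`, and `bflow` is exactly the action of the symmetry. -/
theorem virasoroConstraints_of_linearizes {F : ℕ → JetFunction S} {κ : ℂ}
    (h : LinearizesVirasoro L F κ) : VirasoroConstraints L F κ := by
  intro s k hk M
  obtain _ | m := k
  · refine (s.near_genus_zero M).mono fun t ht => ?_
    rw [cForm_apply] at ht
    rw [← ht]
    simp [Solution.virasoroCoeff, Solution.logTau]
  · refine ((h s (m + 1) hk M).and (s.near_symLogTau (F := F) (k := m + 1) (by omega)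
      (hk (m + 1) (by omega) le_rfl) M)).mono fun t ht => ?_
    have h1 := ht.1.trans ht.2
    rw [s.virasoroCoeff_eq] at h1 ⊢
    rw [s.sum_b_sub]
    linear_combination h1

end

section

open FrobeniusManifold Laurent LeveltSystem

variable {n N : ℕ} [NeZero n] {S : FrobeniusManifold n} {L : LeveltSystem S}

/-! ### The filtration by the weight `∑ (r - 1)` of the coordinates `y_r`, `r ≥ 2` -/

/-- The partial derivative along the component `γ` of `y_q`. -/
def dy (q : ℕ) (γ : Fin n) (f : Chart n N → ℂ) : Chart n N → ℂ :=
  fun Y => fderiv ℂ f Y (inc N q (Pi.single γ 1))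

/-- The functions annihilated by the products of derivatives along `y_{r_1}, …, y_{r_k}`, `r_i ≥ 2`,
with `∑ (r_i - 1) > w`. -/
inductive Filt (Ω : Set (Chart n N)) : ℤ → (Chart n N → ℂ) → Prop
  | zero {w : ℤ} {f : Chart n N → ℂ} : (∀ Y ∈ Ω, f Y = 0) → Filt Ω w f
  | step {w : ℤ} {f : Chart n N → ℂ} : 0 ≤ w → (∀ Y ∈ Ω, AnalyticAt ℂ f Y) →
      (∀ r : ℕ, 2 ≤ r → ∀ γ, Filt Ω (w - ((r : ℤ) - 1)) (dy r γ f)) → Filt Ω w f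

variable {Ω : Set (Chart n N)} {f g : Chart n N → ℂ} {w w' : ℤ}

theorem fderiv_congr_of_eqOn (hΩ : IsOpen Ω) (h : ∀ Y ∈ Ω, f Y = g Y) {Y : Chart n N} (hY : Y ∈ Ω) :
    fderiv ℂ f Y = fderiv ℂ g Y :=
  Filter.EventuallyEq.fderiv_eq (Filter.mem_of_superset (hΩ.mem_nhds hY) h)

theorem analyticAt_of_eqOn (hΩ : IsOpen Ω) (h : ∀ Y ∈ Ω, f Y = g Y) {Y : Chart n N} (hY : Y ∈ Ω)
    (hf : AnalyticAt ℂ f Y) : AnalyticAt ℂ g Y :=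
  hf.congr (Filter.mem_of_superset (hΩ.mem_nhds hY) h)

namespace Filt

theorem congr (hΩ : IsOpen Ω) (hf : Filt Ω w f) (h : ∀ Y ∈ Ω, f Y = g Y) : Filt Ω w g := by
  induction hf generalizing g with
  | zero h0 => exact .zero fun Y hY => by rw [← h Y hY, h0 Y hY]
  | step hw ha _ ih =>
    exact .step hw (fun Y hY => analyticAt_of_eqOn hΩ h hY (ha Y hY)) fun r hr γ =>
      ih r hr γ fun Y hY => by simp only [dy, fderiv_congr_of_eqOn hΩ h hY]

theorem analyticAt (hΩ : IsOpen Ω) (hf : Filt Ω w f) {Y : Chart n N} (hY : Y ∈ Ω) :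
    AnalyticAt ℂ f Y := by
  cases hf with
  | zero h => exact analyticAt_of_eqOn (f := fun _ => 0) hΩ (fun Y hY => (h Y hY).symm) hY
                  analyticAt_const
  | step _ ha _ => exact ha Y hY

theorem eq_zero (hf : Filt Ω w f) (hw : w < 0) {Y : Chart n N} (hY : Y ∈ Ω) : f Y = 0 := by
  cases hf with
  | zero h => exact h Y hY
  | step h _ _ => omega

theorem dy_of_two_le (hΩ : IsOpen Ω) (hf : Filt Ω w f) {r : ℕ} (hr : 2 ≤ r) (γ : Fin n) :
    Filt Ω (w - ((r : ℤ) - 1)) (dy r γ f) := by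
  cases hf with
  | zero h => exact .zero fun Y hY => fderiv_eq_zero_of_eqOn hΩ h hY _
  | step _ _ h => exact h r hr γ

theorem mono (hf : Filt Ω w f) (h : w ≤ w') : Filt Ω w' f := by
  induction hf generalizing w' with
  | zero h0 => exact .zero h0
  | step hw ha _ ih => exact .step (by omega) ha fun r hr γ => ih r hr γ (by omega)

theorem add (hΩ : IsOpen Ω) (hf : Filt Ω w f) (hg : Filt Ω w g) :
    Filt Ω w (fun Y => f Y + g Y) := by
  induction hf generalizing g with
  | zero h => exact hg.congr hΩ fun Y hY => by rw [h Y hY, zero_add]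
  | step hw ha h ih =>
    refine .step hw (fun Y hY => (ha Y hY).fun_add (hg.analyticAt hΩ hY)) fun r hr γ => ?_
    refine (ih r hr γ (hg.dy_of_two_le hΩ hr γ)).congr hΩ fun Y hY => ?_
    simp only [dy]
    rw [fderiv_fun_add (ha Y hY).differentiableAt (hg.analyticAt hΩ hY).differentiableAt]
    rfl

theorem sum (hΩ : IsOpen Ω) {ι : Type*} (s : Finset ι) {f : ι → Chart n N → ℂ}
    (hf : ∀ i ∈ s, Filt Ω w (f i)) : Filt Ω w (fun Y => ∑ i ∈ s, f i Y) := by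
  classical
  induction s using Finset.induction_on with
  | empty => exact .zero fun Y _ => by simp
  | insert a s ha ih =>
    simp only [Finset.sum_insert ha]
    exact (hf a (by simp)).add hΩ (ih fun i hi => hf i (by simp [hi]))

theorem mul (hΩ : IsOpen Ω) (hf : Filt Ω w f) (hg : Filt Ω w' g) :
    Filt Ω (w + w') (fun Y => f Y * g Y) := by
  -- Differentiating either factor along `y_r` with `r ≥ 2` lowers the total weight by at least one,
  -- so the induction runs over a bound for `w + w'`.
  suffices key : ∀ (k : ℕ) (w w' : ℤ) (f g : Chart n N → ℂ), w + w' < k → Filt Ω w f →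
      Filt Ω w' g → Filt Ω (w + w') (fun Y => f Y * g Y) from
    key ((w + w').toNat + 1) w w' f g (by omega) hf hg
  intro k
  induction k with
  | zero =>
    intro w w' f g hk hf hg
    by_cases hw : w < 0
    · exact .zero fun Y hY => by rw [hf.eq_zero hw hY, zero_mul]
    · exact .zero fun Y hY => by rw [hg.eq_zero (by push_cast at hk; omega) hY, mul_zero]
  | succ k ih =>
    intro w w' f g hk hf hg
    by_cases hw : w < 0
    · exact .zero fun Y hY => by rw [hf.eq_zero hw hY, zero_mul]
    by_cases hw' : w' < 0
    · exact .zero fun Y hY => by rw [hg.eq_zero hw' hY, mul_zero]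
    refine .step (by omega) (fun Y hY => (hf.analyticAt hΩ hY).fun_mul (hg.analyticAt hΩ hY))
      fun r hr γ => ?_
    have h1 := ih _ _ _ _ (by push_cast at hk; omega) (hf.dy_of_two_le hΩ hr γ) hg
    have h2 := ih _ _ _ _ (by push_cast at hk; omega) hf (hg.dy_of_two_le hΩ hr γ)
    refine ((h1.mono (w' := w + w' - ((r : ℤ) - 1)) (by omega)).add hΩ
      (h2.mono (by omega))).congr hΩ fun Y hY => ?_
    simp only [dy]
    rw [fderiv_fun_mul (hf.analyticAt hΩ hY).differentiableAt
      (hg.analyticAt hΩ hY).differentiableAt]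
    simp only [add_apply, smul_apply, smul_eq_mul]
    ring

theorem of_ord (hf : Ord Ω 1 f) : Filt Ω 0 f :=
  .step le_rfl hf.1 fun r hr γ => .zero fun Y hY => hf.2 Y hY r (by omega) _

theorem const (c : ℂ) : Filt Ω 0 (fun _ => c) :=
  of_ord ⟨fun _ _ => analyticAt_const, fun Y _ q _ w => by simp⟩

theorem const_mul (hΩ : IsOpen Ω) (c : ℂ) (hf : Filt Ω w f) : Filt Ω w (fun Y => c * f Y) :=
  ((const c).mul hΩ hf).mono (by omega)

theorem comp_v {h : (Fin n → ℂ) → ℂ} (hh : ∀ Y ∈ Ω, AnalyticAt ℂ h (cY N 0 Y)) :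
    Filt Ω 0 (fun Y => h (cY N 0 Y)) := by
  refine of_ord ⟨fun Y hY => AnalyticAt.fun_comp (g := h) (hh Y hY) ((cY N 0).analyticAt Y),
    fun Y hY q hq x => ?_⟩
  have h1 : HasFDerivAt (fun Y => h (cY N 0 Y)) _ Y :=
    (hh Y hY).differentiableAt.hasFDerivAt.comp Y (cY N 0).hasFDerivAt
  rw [h1.fderiv, ContinuousLinearMap.comp_apply, cY_inc_ne (by omega), map_zero]

theorem coord {q : ℕ} (hq : 1 ≤ q) (γ : Fin n) :
    Filt Ω ((q : ℤ) - 1) (fun Y => cY N q Y γ) := by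
  refine .step (by omega) (fun Y _ => analyticAt_cY q γ Y) fun r hr δ => ?_
  have e : dy r δ (fun Y => cY N q Y γ) = fun _ => cY N q (inc N r (Pi.single δ 1)) γ :=
    funext fun Y => fderiv_cY q γ Y _
  rw [e]
  by_cases h : q = r
  · subst h
    exact (const _).mono (by omega)
  · rw [cY_inc_ne h]; exact .zero fun _ _ => rfl

theorem dy_zero_one (hΩ : IsOpen Ω) (hf : Filt Ω w f) {q : ℕ} (γ : Fin n) :
    Filt Ω w (dy q γ f) := by
  induction hf with
  | zero h => exact .zero fun Y hY => fderiv_eq_zero_of_eqOn hΩ h hY _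
  | step hw ha _ ih =>
    refine .step hw (fun Y hY => analyticAt_fderiv_vectorField (ha Y hY) analyticAt_const)
      fun r hr δ => (ih r hr δ).congr hΩ fun Y hY => ?_
    unfold Dubrovin.dy
    rw [fderiv_fderiv_vectorField (ha Y hY) (differentiableAt_const _)]
    simp

/-- A uniform bound for all `q`: exact for `q ≥ 1`, and generous by one for `q = 0`, where the
derivative does not change the weight. -/
theorem dy (hΩ : IsOpen Ω) (hf : Filt Ω w f) (q : ℕ) (γ : Fin n) :
    Filt Ω (w + 1 - (q : ℤ)) (dy q γ f) := by
  by_cases hq : 2 ≤ q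
  · exact (hf.dy_of_two_le hΩ hq γ).mono (by omega)
  · exact (hf.dy_zero_one hΩ γ).mono (by omega)

/-- A linear system with nondegenerate coefficients of weight `0` can be inverted. -/
theorem of_sum_mul (hΩ : IsOpen Ω) {K : ℕ → Fin n → Chart n N → ℂ} (hK : ∀ m γ, Filt Ω 0 (K m γ))
    (hnd : ∀ Y ∈ Ω, ∀ x : Fin n → ℂ, (∀ m, ∑ γ, x γ * K m γ Y = 0) → x = 0)
    {f : Fin n → Chart n N → ℂ} (ha : ∀ γ, ∀ Y ∈ Ω, AnalyticAt ℂ (f γ) Y)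
    (hf : ∀ m, Filt Ω w (fun Y => ∑ γ, f γ Y * K m γ Y)) (γ : Fin n) : Filt Ω w (f γ) := by
  suffices key : ∀ (k : ℕ) (w : ℤ) (f : Fin n → Chart n N → ℂ), w < k →
      (∀ γ, ∀ Y ∈ Ω, AnalyticAt ℂ (f γ) Y) →
      (∀ m, Filt Ω w (fun Y => ∑ γ, f γ Y * K m γ Y)) → ∀ γ, Filt Ω w (f γ) from
    key (w.toNat + 1) w f (by omega) ha hf γ
  intro k
  induction k with
  | zero =>
    intro w f hw ha hf γ
    refine .zero fun Y hY => ?_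
    have := hnd Y hY (fun γ => f γ Y) fun m => (hf m).eq_zero (by simpa using hw) hY
    exact congrFun this γ
  | succ k ih =>
    intro w f hw ha hf γ
    by_cases hw0 : w < 0
    · refine .zero fun Y hY => ?_
      have := hnd Y hY (fun γ => f γ Y) fun m => (hf m).eq_zero hw0 hY
      exact congrFun this γ
    refine .step (by omega) (ha γ) fun r hr δ => ?_
    refine ih _ (fun γ => Dubrovin.dy r δ (f γ)) (by push_cast at hw; omega) (fun γ Y hY =>
      analyticAt_fderiv_vectorField (ha γ Y hY) analyticAt_const) (fun m => ?_) γ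
    refine ((hf m).dy_of_two_le hΩ hr δ).congr hΩ fun Y hY => ?_
    -- Coefficients of weight zero do not depend on `y_r`, `r ≥ 2`. The derivative of the system is
    -- therefore the same system for the derivatives of the unknowns, with smaller weight.
    have hKd : ∀ γ, fderiv ℂ (K m γ) Y (inc N r (Pi.single δ 1)) = 0 := fun γ =>
      ((hK m γ).dy_of_two_le hΩ hr δ).eq_zero (by omega) hY
    simp only [Dubrovin.dy]
    rw [fderiv_fun_sum fun γ _ => ((ha γ Y hY).fun_mul ((hK m γ).analyticAt hΩ hY)).differentiableAt,
      sum_apply]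
    refine Finset.sum_congr rfl fun γ _ => ?_
    rw [fderiv_fun_mul (ha γ Y hY).differentiableAt ((hK m γ).analyticAt hΩ hY).differentiableAt,
      add_apply, smul_apply, smul_apply, hKd, smul_zero, zero_add, smul_eq_mul, mul_comm]

end Filt

/-! ### Functions of weight zero -/

theorem mulMatrix_apply_eq_sum (v a : Fin n → ℂ) (γ β : Fin n) :
    S.mulMatrix v a γ β = ∑ α, a α * S.mulMatrix v (Pi.single α 1) γ β := by
  conv_lhs => rw [← LeveltSystem.sum_smul_single a, mulMatrix_sum]
  simp [mulMatrix_smul, Matrix.sum_apply]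

theorem filt_mulMatrix (hΩ : IsOpen Ω) (hsub : Ω ⊆ dom0 S N) {a : Chart n N → Fin n → ℂ}
    (ha : ∀ α, Filt Ω w (fun Y => a Y α)) (γ β : Fin n) :
    Filt Ω w (fun Y => S.mulMatrix (cY N 0 Y) (a Y) γ β) := by
  refine (Filt.sum hΩ Finset.univ (f := fun α Y => a Y α *
    S.mulMatrix (cY N 0 Y) (Pi.single α 1) γ β) fun α _ => ?_).congr hΩ fun Y _ =>
      (mulMatrix_apply_eq_sum _ _ _ _).symm
  exact ((ha α).mul hΩ (Filt.comp_v (h := fun v => S.mulMatrix v (Pi.single α 1) γ β)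
    fun Y hY => analyticAt_mulMatrix (hsub hY).1 _ _ _)).mono (by omega)

theorem filt_mulVec (hΩ : IsOpen Ω) {A : Chart n N → Matrix (Fin n) (Fin n) ℂ}
    {x : Chart n N → Fin n → ℂ} (hA : ∀ γ β, Filt Ω w (fun Y => A Y γ β))
    (hx : ∀ β, Filt Ω w' (fun Y => x Y β)) (γ : Fin n) :
    Filt Ω (w + w') (fun Y => ((A Y).mulVec (x Y)) γ) :=
  Filt.sum hΩ Finset.univ (f := fun β Y => A Y γ β * x Y β) fun β _ => (hA γ β).mul hΩ (hx β)

theorem filt_Cx (L : LeveltSystem S) (hΩ : IsOpen Ω) (hsub : Ω ⊆ dom0 S N) (γ β : Fin n) :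
    Filt Ω 0 (fun Y => Cx S Y γ β) := by
  refine filt_mulMatrix hΩ hsub (fun α => ?_) γ β
  have h : LeveltSystem.Ord Ω 1 (L.Phi (N := N) 1 α) := ⟨fun Y hY => (L.ord_Phi 1 α).1 Y (hsub hY),
    fun Y hY => (L.ord_Phi 1 α).2 Y (hsub hY)⟩
  exact (Filt.of_ord h).congr hΩ fun Y hY => L.Phi_one (hsub hY) α

end

/-! ### Weights of the constraint vector fields and of quadratic expressions -/

section

open FrobeniusManifold Laurent LeveltSystem

variable {n N : ℕ} [NeZero n] {S : FrobeniusManifold n} {L : LeveltSystem S}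

/-! ### Polynomial combinations of the constraints -/

/-- The functional `∑ p_M X^M ↦ ∑ p_M c_M`. -/
def polyT (c : ℕ → ℂ) : Polynomial ℂ →ₗ[ℂ] ℂ :=
  Polynomial.lsum fun M => (LinearMap.id : ℂ →ₗ[ℂ] ℂ).smulRight (c M)

theorem polyT_apply (c : ℕ → ℂ) {p : Polynomial ℂ} {K : ℕ} (hK : p.natDegree < K) :
    polyT c p = ∑ M ∈ Finset.range K, p.coeff M * c M := by
  rw [polyT, Polynomial.lsum_apply, Polynomial.sum_over_range' p (fun M => by simp) K hK]
  rfl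

theorem polyT_sum {ι : Type*} (s : Finset ι) (c : ι → ℕ → ℂ) (p : Polynomial ℂ) :
    polyT (fun M => ∑ k ∈ s, c k M) p = ∑ k ∈ s, polyT (c k) p := by
  simp only [polyT_apply _ p.natDegree.lt_succ_self, Finset.mul_sum]
  exact Finset.sum_comm

theorem polyT_add (c c' : ℕ → ℂ) (p : Polynomial ℂ) :
    polyT (fun M => c M + c' M) p = polyT c p + polyT c' p := by
  simp only [polyT_apply _ p.natDegree.lt_succ_self, mul_add, Finset.sum_add_distrib]

theorem polyT_mul (x : ℂ) (c : ℕ → ℂ) (p : Polynomial ℂ) :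
    polyT (fun M => x * c M) p = x * polyT c p := by
  simp only [polyT_apply _ p.natDegree.lt_succ_self, Finset.mul_sum]
  exact Finset.sum_congr rfl fun M _ => by ring

theorem apply_DM_polyT {Y : Chart n N} {l : Chart n N →L[ℂ] ℂ} {c : ℕ → ℂ}
    (h : ∀ M : ℕ, l (DM S Y (Polynomial.X ^ M)) + c M = 0) (p : Polynomial ℂ) :
    l (DM S Y p) + polyT c p = 0 := by
  induction p using Polynomial.induction_on' with
  | add p q hp hq => rw [DM_add, map_add, map_add]; linear_combination hp + hq
  | monomial M x =>
    rw [polyT, Polynomial.lsum_apply, Polynomial.sum_monomial_index _ _ (by simp),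
      ← Polynomial.C_mul_X_pow_eq_monomial, ← Polynomial.smul_eq_C_mul, DM_smul, map_smul]
    have := h M
    change x * _ + x * _ = _
    linear_combination x * this

section Coeff

variable {E : Type*} [NormedAddCommGroup E] [NormedSpace ℂ E] {x : E}

theorem analyticAt_coeff_mul {P Q : E → Polynomial ℂ}
    (hP : ∀ k, AnalyticAt ℂ (fun x => (P x).coeff k) x)
    (hQ : ∀ k, AnalyticAt ℂ (fun x => (Q x).coeff k) x) (k : ℕ) :
    AnalyticAt ℂ (fun x => (P x * Q x).coeff k) x := by
  simp only [Polynomial.coeff_mul]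
  exact Finset.analyticAt_fun_sum _ fun i _ => (hP _).fun_mul (hQ _)

theorem analyticAt_coeff_prod {ι : Type*} (s : Finset ι) {P : ι → E → Polynomial ℂ}
    (hP : ∀ i k, AnalyticAt ℂ (fun x => (P i x).coeff k) x) (k : ℕ) :
    AnalyticAt ℂ (fun x => (∏ i ∈ s, P i x).coeff k) x := by
  classical
  induction s using Finset.induction_on generalizing k with
  | empty => simp only [Finset.prod_empty]; exact analyticAt_const
  | insert a s ha ih =>
    simp only [Finset.prod_insert ha]
    exact analyticAt_coeff_mul (hP a) ih k

theorem analyticAt_coeff_charpoly {A : E → Matrix (Fin n) (Fin n) ℂ}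
    (hA : ∀ i j, AnalyticAt ℂ (fun x => A x i j) x) (k : ℕ) :
    AnalyticAt ℂ (fun x => (A x).charpoly.coeff k) x := by
  simp only [Matrix.charpoly, Matrix.det_apply', Polynomial.finsetSum_coeff]
  refine Finset.analyticAt_fun_sum _ fun σ _ => analyticAt_coeff_mul (fun _ => analyticAt_const)
    (analyticAt_coeff_prod _ fun i k => ?_) k
  simp only [Matrix.charmatrix_apply, Polynomial.coeff_sub, Polynomial.coeff_C]
  split_ifs
  · exact analyticAt_const.fun_sub (hA _ _)
  · exact analyticAt_const

theorem analyticAt_coeff_pow {P : E → Polynomial ℂ}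
    (hP : ∀ k, AnalyticAt ℂ (fun x => (P x).coeff k) x) (r k : ℕ) :
    AnalyticAt ℂ (fun x => (P x ^ r).coeff k) x := by
  simpa using analyticAt_coeff_prod (Finset.range r) (P := fun _ => P) (fun _ => hP) k

end Coeff

/-- The test polynomial `χ^r X^m`. -/
def testPoly (S : FrobeniusManifold n) (r m : ℕ) (v : Fin n → ℂ) : Polynomial ℂ :=
  (S.U v).charpoly ^ r * Polynomial.X ^ m

theorem natDegree_testPoly (r m : ℕ) (v : Fin n → ℂ) :
    (testPoly S r m v).natDegree < n * r + m + 1 := by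
  refine Nat.lt_succ_of_le (Polynomial.natDegree_mul_le.trans ?_)
  refine add_le_add (Polynomial.natDegree_pow_le.trans ?_) (Polynomial.natDegree_X_pow_le m)
  rw [Matrix.charpoly_natDegree_eq_dim, Fintype.card_fin, mul_comm]

theorem analyticAt_coeff_testPoly {v : Fin n → ℂ} (hv : v ∈ S.carrier) (r m k : ℕ) :
    AnalyticAt ℂ (fun v => (testPoly S r m v).coeff k) v :=
  analyticAt_coeff_mul (analyticAt_coeff_pow (analyticAt_coeff_charpoly (analyticAt_U hv)) r)
    (fun _ => analyticAt_const) k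

/-- The coefficient of `z^{s-l}` in `χ^r X^m (𝒰 + z⁻¹ (𝒱 - 1/2 - z d/dz)) z^s`. -/
def Np (S : FrobeniusManifold n) (r m : ℕ) (s : ℤ) (l : ℕ) (v : Fin n → ℂ) :
    Matrix (Fin n) (Fin n) ℂ :=
  ∑ M ∈ Finset.range (n * r + m + 1), (testPoly S r m v).coeff M • Nm S v M s l

theorem cf_testPoly (r m : ℕ) (s : ℤ) (l : ℕ) (v x : Fin n → ℂ) :
    cf (s - l) (Polynomial.aeval (JB S v) (testPoly S r m v) (mono s x)) =
      (Np S r m s l v).mulVec x := by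
  rw [Polynomial.aeval_eq_sum_range' (natDegree_testPoly r m v), LinearMap.sum_apply, map_sum, Np,
    Matrix.sum_mulVec]
  refine Finset.sum_congr rfl fun M _ => ?_
  rw [LinearMap.smul_apply, map_smul, cf_JB_pow_mono, Matrix.smul_mulVec]

/-- By Cayley-Hamilton each factor `χ` lowers the top degree by one, so nothing survives less than
`r` below the top. -/
theorem Np_eq_zero {r l : ℕ} (h : l < r) (m : ℕ) (s : ℤ) (v : Fin n → ℂ) : Np S r m s l v = 0 := by
  refine Matrix.ext_of_mulVec_single fun i => ?_
  rw [← cf_testPoly, testPoly, map_mul, Module.End.mul_apply, Matrix.zero_mulVec]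
  exact le_charpoly_pow (le_aeval_JB (le_mono _ _) _ _).1 _ r _ (by omega)

theorem analyticAt_Nm {v : Fin n → ℂ} (hv : v ∈ S.carrier) (M : ℕ) (s : ℤ) (l : ℕ) (i j : Fin n) :
    AnalyticAt ℂ (fun v => Nm S v M s l i j) v := by
  induction M generalizing l i j with
  | zero => simp only [Nm]; exact analyticAt_const
  | succ M ih =>
    cases l with
    | zero =>
      exact analyticAt_matrix_mul (A := S.U) (B := fun v => Nm S v M s 0) (analyticAt_U hv) (ih 0) i j
    | succ l =>
      exact (analyticAt_matrix_mul (A := S.U) (B := fun v => Nm S v M s (l + 1)) (analyticAt_U hv)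
        (ih (l + 1)) i j).fun_add (analyticAt_matrix_mul (A := fun _ => Kmat S (s - l))
          (B := fun v => Nm S v M s l) (fun _ _ => analyticAt_const) (ih l) i j)

variable {Ω : Set (Chart n N)} {w w' : ℤ}

theorem filt_Np (hsub : Ω ⊆ dom0 S N) (r m : ℕ) (s : ℤ) (l : ℕ) (i j : Fin n) :
    Filt Ω ((l : ℤ) - r) (fun Y => Np S r m s l (cY N 0 Y) i j) := by
  by_cases h : l < r
  · exact .zero fun Y _ => by rw [Np_eq_zero h]; rfl
  · refine (Filt.comp_v (h := fun v => Np S r m s l v i j) fun Y hY => ?_).mono (by omega)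
    simp only [Np, Matrix.sum_apply, Matrix.smul_apply, smul_eq_mul]
    exact Finset.analyticAt_fun_sum _ fun M _ =>
      (analyticAt_coeff_testPoly (hsub hY).1 r m M).fun_mul (analyticAt_Nm (hsub hY).1 M s l i j)

/-- The coordinate `y_{q+1}` has weight `q` and is multiplied by a coefficient lying `a - q` below
the top, of weight `a - q - r` by `filt_Np`. -/
theorem filt_Ev (hΩ : IsOpen Ω) (hsub : Ω ⊆ dom0 S N) (r m a : ℕ) (γ : Fin n) :
    Filt Ω ((a : ℤ) - r) (fun Y => Ev S Y (testPoly S r m (cY N 0 Y)) a γ) := by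
  have e : ∀ Y : Chart n N, Ev S Y (testPoly S r m (cY N 0 Y)) a γ = ∑ q ∈ Finset.range N,
      if q ≤ a then ((Np S r m (-(q : ℤ) - 2) (a - q) (cY N 0 Y)).mulVec (cY N (q + 1) Y)) γ
      else 0 := by
    intro Y
    rw [Ev, serC, map_sum, map_sum, Finset.sum_apply]
    refine Finset.sum_congr rfl fun q _ => ?_
    split_ifs with h
    · rw [show (-2 - (a : ℤ)) = -(q : ℤ) - 2 - ((a - q : ℕ) : ℤ) by omega, cf_testPoly]
    · rw [(le_aeval_JB (le_mono _ _) _ _).1 _ (by omega)]; rfl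
  simp only [e]
  refine Filt.sum hΩ _ fun q _ => ?_
  split_ifs with h
  · refine (filt_mulVec hΩ (filt_Np hsub r m _ _) (fun β => Filt.coord (q := q + 1) (by omega) β)
      γ).mono ?_
    omega
  · exact .zero fun _ _ => rfl

theorem filt_DM (L : LeveltSystem S) (hΩ : IsOpen Ω) (hsub : Ω ⊆ dom0 S N) (r m : ℕ) {q : ℕ}
    (hq : q ≤ N) (γ : Fin n) :
    Filt Ω ((q : ℤ) - r) (fun Y => cY N q (DM S Y (testPoly S r m (cY N 0 Y))) γ) := by
  have h0 := filt_mulVec hΩ (filt_Cx L hΩ hsub) (filt_Ev hΩ hsub r m 0)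
  simp only [DM, cY_ofSeq hq]
  by_cases hq0 : q = 0
  · subst hq0
    simp only [if_pos]
    exact (h0 γ).mono (by omega)
  · simp only [if_neg hq0, Pi.add_apply]
    refine (filt_Ev hΩ hsub r m q γ).add hΩ ((filt_mulVec hΩ (filt_mulMatrix hΩ hsub
      fun β => Filt.coord (q := q + 1) (by omega) β) h0 γ).mono ?_)
    push_cast; omega

/-! ### Quadratic expressions -/

variable (L) in
/-- A family of functions of weight `w`, the components of a series in `Θ(v; z)`. -/
def Fam (Ω : Set (Chart n N)) (w : ℤ) (x : Fin n × ℕ → Chart n N → ℂ) : Prop :=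
  ∃ (K : ℕ) (l : Fin n × ℕ → Chart n N → ℂ), (∀ z, Filt Ω (w - (z.2 : ℤ)) (l z)) ∧
    ∀ Y ∈ Ω, ∀ i, x i Y = ∑ z ∈ box n K, l z Y * L.shiftCol z.2 i (cY N 0 Y) z.1

variable (L) in
/-- A family of functions whose contraction with the coefficients `a` has weight `w + 2`. -/
def Fam2 (Ω : Set (Chart n N)) (w : ℤ) (G : Fin n × ℕ → Fin n × ℕ → Chart n N → ℂ) : Prop :=
  ∀ r m : ℕ, Filt Ω (w + 2 - (r : ℤ)) fun Y => polyT (fun M => ∑ i ∈ box n M, ∑ j ∈ box n M,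
    L.a M i j * G i j Y) (testPoly S r m (cY N 0 Y))

variable {G G' : Fin n × ℕ → Fin n × ℕ → Chart n N → ℂ}

theorem Fam2.congr (hΩ : IsOpen Ω) (h : Fam2 L Ω w G) (hG : ∀ Y ∈ Ω, ∀ i j, G i j Y = G' i j Y) :
    Fam2 L Ω w G' := fun r m => (h r m).congr hΩ fun Y hY => by simp only [hG Y hY]

theorem Fam2.mono (h : Fam2 L Ω w G) (hw : w ≤ w') : Fam2 L Ω w' G :=
  fun r m => (h r m).mono (by omega)

theorem Fam2.mul (hΩ : IsOpen Ω) {u : Chart n N → ℂ} (hu : Filt Ω w u) (h : Fam2 L Ω w' G) :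
    Fam2 L Ω (w + w') fun i j Y => u Y * G i j Y := fun r m => by
  refine ((hu.mul hΩ (h r m)).mono (w' := w + w' + 2 - (r : ℤ)) (by omega)).congr hΩ fun Y _ => ?_
  rw [← polyT_mul]
  congr 2
  funext M
  simp only [Finset.mul_sum]
  exact Finset.sum_congr rfl fun i _ => Finset.sum_congr rfl fun j _ => by ring

theorem Fam2.sum (hΩ : IsOpen Ω) {ι : Type*} (s : Finset ι)
    {G : ι → Fin n × ℕ → Fin n × ℕ → Chart n N → ℂ} (h : ∀ k ∈ s, Fam2 L Ω w (G k)) :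
    Fam2 L Ω w fun i j Y => ∑ k ∈ s, G k i j Y := fun r m => by
  refine (Filt.sum hΩ s fun k hk => h k hk r m).congr hΩ fun Y _ => ?_
  rw [← polyT_sum]
  congr 2
  funext M
  simp only [Finset.mul_sum]
  rw [Finset.sum_comm]
  refine Finset.sum_congr rfl fun i _ => ?_
  rw [Finset.sum_comm]

theorem Fam2.add (hΩ : IsOpen Ω) (h : Fam2 L Ω w G) (h' : Fam2 L Ω w G') :
    Fam2 L Ω w fun i j Y => G i j Y + G' i j Y := fun r m => by
  refine ((h r m).add hΩ (h' r m)).congr hΩ fun Y _ => ?_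
  rw [← polyT_add]
  congr 2
  funext M
  simp only [mul_add, Finset.sum_add_distrib]

theorem polyT_quad {v : Fin n → ℂ} (hv : v ∈ S.carrier) (r m : ℕ) (z z' : Fin n × ℕ) :
    polyT (fun M => ∑ i ∈ box n M, ∑ j ∈ box n M,
      L.a M i j * (L.shiftCol z.2 i v z.1 * L.shiftCol z'.2 j v z'.1)) (testPoly S r m v) =
    -(1 / 2) * (-1) ^ z'.2 * (Np S r m z'.2 (z.2 + z'.2 + 2) v * S.η⁻¹) z.1 z'.1 := by
  have h : ∀ M, ∑ i ∈ box n M, ∑ j ∈ box n M,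
      L.a M i j * (L.shiftCol z.2 i v z.1 * L.shiftCol z'.2 j v z'.1) =
      -(1 / 2) * (-1) ^ z'.2 * (Nm S v M z'.2 (z.2 + z'.2 + 2) * S.η⁻¹) z.1 z'.1 := by
    intro M
    have := L.constraint_quad hv (Pi.single z.1 1) (Pi.single z'.1 1) z.2 z'.2 M
    simp only [single_one_dotProduct, Matrix.mulVec_mulVec] at this
    simp only [← mul_assoc]
    rw [this]
    simp
  simp only [h]
  rw [polyT_mul, polyT_apply _ (natDegree_testPoly r m v), Np, Finset.sum_mul, Matrix.sum_apply]
  congr 1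
  refine Finset.sum_congr rfl fun M _ => ?_
  rw [Matrix.smul_mul, Matrix.smul_apply, smul_eq_mul]

variable (L) in
-- Contracting two columns with `a` extracts a coefficient lying `z.2 + z'.2 + 2` below the top.
-- This is the origin of the `+ 2` in `Fam2`.
theorem fam2_shiftCol (hΩ : IsOpen Ω) (hsub : Ω ⊆ dom0 S N) (z z' : Fin n × ℕ) :
    Fam2 L Ω ((z.2 : ℤ) + z'.2) fun i j Y =>
      L.shiftCol z.2 i (cY N 0 Y) z.1 * L.shiftCol z'.2 j (cY N 0 Y) z'.1 := fun r m => by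
  have h : Filt Ω ((z.2 : ℤ) + z'.2 + 2 - r) fun Y => -(1 / 2) * (-1) ^ z'.2 *
      ∑ k, Np S r m z'.2 (z.2 + z'.2 + 2) (cY N 0 Y) z.1 k * S.η⁻¹ k z'.1 := by
    refine Filt.const_mul hΩ _ (Filt.sum hΩ _ fun k _ => ?_)
    refine ((filt_Np hsub r m _ _ _ _).mul hΩ (Filt.const _)).mono ?_
    push_cast; omega
  exact h.congr hΩ fun Y hY => by rw [polyT_quad (hsub hY).1, Matrix.mul_apply]

variable {x x' : Fin n × ℕ → Chart n N → ℂ}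

theorem Fam.mul (hΩ : IsOpen Ω) (hsub : Ω ⊆ dom0 S N) (h : Fam L Ω w x) (h' : Fam L Ω w' x') :
    Fam2 L Ω (w + w') fun i j Y => x i Y * x' j Y := by
  obtain ⟨K, l, hl, hx⟩ := h
  obtain ⟨K', l', hl', hx'⟩ := h'
  have h : Fam2 L Ω (w + w') fun i j Y => ∑ z ∈ box n K, ∑ z' ∈ box n K', l z Y * l' z' Y *
      (L.shiftCol z.2 i (cY N 0 Y) z.1 * L.shiftCol z'.2 j (cY N 0 Y) z'.1) := by
    refine Fam2.sum hΩ _ fun z _ => Fam2.sum hΩ _ fun z' _ => ?_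
    exact (Fam2.mul hΩ ((hl z).mul hΩ (hl' z')) (fam2_shiftCol L hΩ hsub z z')).mono (by omega)
  refine h.congr hΩ fun Y hY i j => ?_
  rw [hx Y hY, hx' Y hY, Finset.sum_mul_sum]
  exact Finset.sum_congr rfl fun z _ => Finset.sum_congr rfl fun z' _ => by ring

end

section

open FrobeniusManifold Laurent LeveltSystem

variable {n N : ℕ} [NeZero n] {S : FrobeniusManifold n} {L : LeveltSystem S}
variable {Ω : Set (Chart n N)} {w w' : ℤ} {x x' : Fin n × ℕ → Chart n N → ℂ}

/-! ### Derivatives along the times -/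

theorem clm_apply_eq_sum_dy {H : Chart n N → ℂ} (Y v : Chart n N) : fderiv ℂ H Y v =
    ∑ q ∈ Finset.range (N + 1), ∑ δ, dy q δ H Y * cY N q v δ := by
  rw [clm_apply_eq_sum]
  exact Finset.sum_congr rfl fun q _ => clm_eq_dotProduct ((fderiv ℂ H Y).comp (inc N q)) _

variable (L) in
-- The component of `Z i` along `y_q` is `shiftCol q i`, absent for `q = 0`, plus a matrix of weight
-- `q` applied to `shiftCol 0 i`. A derivative of weight `w - q` along `y_q` thus contributes to the
-- columns `q` and `0` with the weights required by `Fam`.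
theorem fam_Z (hΩ : IsOpen Ω) (hsub : Ω ⊆ dom0 S N) {H : Chart n N → ℂ}
    (h : ∀ (q : ℕ) (γ : Fin n), Filt Ω (w - (q : ℤ)) (dy q γ H)) :
    Fam L Ω w fun i Y => fderiv ℂ H Y (L.Z i Y) := by
  let A : ℕ → Chart n N → Matrix (Fin n) (Fin n) ℂ := fun q Y =>
    if q = 0 then Cx S Y else S.mulMatrix (cY N 0 Y) (cY N (q + 1) Y) * Cx S Y
  have hA : ∀ (q : ℕ) (γ β : Fin n), Filt Ω (q : ℤ) (fun Y => A q Y γ β) := by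
    intro q γ β
    by_cases hq : q = 0
    · subst hq; simpa only [A, if_pos, Nat.cast_zero] using filt_Cx L hΩ hsub γ β
    · simp only [A, if_neg hq, Matrix.mul_apply]
      refine Filt.sum hΩ _ fun k _ => ((filt_mulMatrix hΩ hsub
        (fun β => Filt.coord (q := q + 1) (by omega) β) γ k).mul hΩ (filt_Cx L hΩ hsub k β)).mono ?_
      push_cast; omega
  have hZ : ∀ (i : Fin n × ℕ) (Y : Chart n N) (q : ℕ), q ≤ N → cY N q (L.Z i Y) =
      (if q = 0 then 0 else L.shiftCol q i (cY N 0 Y)) +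
        (A q Y).mulVec (L.shiftCol 0 i (cY N 0 Y)) := by
    intro i Y q hq
    rw [Z, cY_ofSeq hq, shiftCol_zero]
    by_cases h0 : q = 0
    · simp only [A, if_pos h0, zero_add]
    · simp only [A, if_neg h0, Matrix.mulVec_mulVec]
  refine ⟨N + 1, fun z Y => if z.2 = 0 then ∑ q ∈ Finset.range (N + 1), ∑ δ,
    dy q δ H Y * A q Y δ z.1 else dy z.2 z.1 H Y, fun z => ?_, fun Y hY i => ?_⟩
  · by_cases hz : z.2 = 0
    · simp only [if_pos hz]
      refine Filt.sum hΩ _ fun q _ => Filt.sum hΩ _ fun δ _ => ?_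
      exact ((h q δ).mul hΩ (hA q δ z.1)).mono (by omega)
    · simp only [if_neg hz]; exact h z.2 z.1
  · simp only []
    rw [clm_apply_eq_sum_dy, Finset.sum_product_right]
    have e1 : ∀ q ∈ Finset.range (N + 1), ∑ δ, dy q δ H Y * cY N q (L.Z i Y) δ =
        (if q = 0 then 0 else ∑ δ, dy q δ H Y * L.shiftCol q i (cY N 0 Y) δ) +
          ∑ γ, (∑ δ, dy q δ H Y * A q Y δ γ) * L.shiftCol 0 i (cY N 0 Y) γ := by
      intro q hq
      rw [Finset.mem_range] at hq
      rw [hZ i Y q (by omega)]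
      simp only [Pi.add_apply, mul_add, Finset.sum_add_distrib]
      congr 1
      · split_ifs <;> simp
      · simp only [Matrix.mulVec, dotProduct, Finset.mul_sum, Finset.sum_mul]
        rw [Finset.sum_comm]
        exact Finset.sum_congr rfl fun γ _ => Finset.sum_congr rfl fun δ _ => by ring
    rw [Finset.sum_congr rfl e1, Finset.sum_add_distrib, Finset.sum_range_succ',
      Finset.sum_range_succ' (n := N) (f := fun a => ∑ γ, (if a = 0 then _ else _) * _)]
    simp only [if_pos, add_zero, Nat.add_eq_zero_iff, one_ne_zero, and_false, if_false]
    congr 1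
    rw [Finset.sum_comm]
    exact Finset.sum_congr rfl fun γ _ => by rw [Finset.sum_mul]

theorem fam_of_eq_zero (h : ∀ Y ∈ Ω, ∀ i, x i Y = 0) : Fam L Ω w x :=
  ⟨0, fun _ _ => 0, fun _ => .zero fun _ _ => rfl, fun Y hY i => by simp [h Y hY i]⟩

theorem fam_shiftCol (z : Fin n × ℕ) :
    Fam L Ω z.2 fun i Y => L.shiftCol z.2 i (cY N 0 Y) z.1 := by
  refine ⟨z.2 + 1, fun z' _ => if z' = z then 1 else 0, fun z' => ?_, fun Y _ i => ?_⟩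
  · by_cases h : z' = z
    · subst h; exact (Filt.const _).mono (by omega)
    · simp only [if_neg h]; exact .zero fun _ _ => rfl
  · rw [Finset.sum_eq_single z]
    · simp
    · intro b _ hb; simp [hb]
    · intro h; exact absurd (by simp) h

/-- A time derivative falls either on a coefficient, where `Filt.dy` and `fam_Z` cost one unit of
weight, or on a column, which it moves from index `z.2` to `z.2 + 1`. Both raise the weight by one.
-/
theorem Fam.deriv (hΩ : IsOpen Ω) (hsub : Ω ⊆ dom0 S N) (h : Fam L Ω w x) :
    Fam2 L Ω (w + 1) fun i j Y => fderiv ℂ (x j) Y (L.Z i Y) := by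
  obtain ⟨K, l, hl, hx⟩ := h
  have h1 : ∀ z ∈ box n K, Fam2 L Ω (w + 1) fun i j Y =>
      fderiv ℂ (l z) Y (L.Z i Y) * L.shiftCol z.2 j (cY N 0 Y) z.1 := fun z _ =>
    ((fam_Z L hΩ hsub (w := w - z.2 + 1) fun q γ => ((hl z).dy hΩ q γ).mono (by omega)).mul hΩ hsub
      (fam_shiftCol z)).mono (by omega)
  have h2 : ∀ z ∈ box n K, Fam2 L Ω (w + 1) fun i j Y => l z Y * ∑ γ, ∑ ε,
      S.mulMatrix (cY N 0 Y) (fun α => Cx S Y α γ) z.1 ε *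
        (L.shiftCol 0 i (cY N 0 Y) γ * L.shiftCol (z.2 + 1) j (cY N 0 Y) ε) := fun z _ => by
    refine (Fam2.mul hΩ (hl z) (Fam2.sum hΩ _ fun γ _ => Fam2.sum hΩ _ fun ε _ =>
      Fam2.mul hΩ (filt_mulMatrix hΩ hsub (fun α => filt_Cx L hΩ hsub α γ) z.1 ε)
        (G := fun i j Y => L.shiftCol 0 i (cY N 0 Y) γ * L.shiftCol (z.2 + 1) j (cY N 0 Y) ε)
        (w' := z.2 + 1) (by simpa using fam2_shiftCol L hΩ hsub (γ, 0) (ε, z.2 + 1)))).mono ?_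
    omega
  refine ((Fam2.sum hΩ _ h1).add hΩ (Fam2.sum hΩ _ h2)).congr hΩ fun Y hY i j => ?_
  have hv := (hsub hY).1
  have hs : ∀ z : Fin n × ℕ, HasFDerivAt (fun Y => L.shiftCol z.2 j (cY N 0 Y) z.1)
      ((fderiv ℂ (fun v => L.shiftCol z.2 j v z.1) (cY N 0 Y)).comp (cY N 0)) Y := fun z =>
    (L.analyticAt_shiftCol hv z.2 j z.1).differentiableAt.hasFDerivAt.comp Y (cY N 0).hasFDerivAt
  rw [fderiv_congr_of_eqOn hΩ (fun Y hY => hx Y hY j) hY,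
    fderiv_fun_sum fun z _ => ((hl z).analyticAt hΩ hY).differentiableAt.fun_mul
      (hs z).differentiableAt, sum_apply, ← Finset.sum_add_distrib]
  refine Finset.sum_congr rfl fun z _ => ?_
  rw [fderiv_fun_mul ((hl z).analyticAt hΩ hY).differentiableAt (hs z).differentiableAt, add_apply,
    smul_apply, smul_apply, (hs z).fderiv, ContinuousLinearMap.comp_apply, L.fderiv_shiftCol hv,
    Z, cY_ofSeq (Nat.zero_le _), if_pos rfl, smul_eq_mul, smul_eq_mul]
  have e : (S.mulMatrix (cY N 0 Y) ((Cx S Y).mulVec (L.col i (cY N 0 Y)))).mulVec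
      (L.shiftCol (z.2 + 1) j (cY N 0 Y)) z.1 = ∑ γ, ∑ ε,
      S.mulMatrix (cY N 0 Y) (fun α => Cx S Y α γ) z.1 ε *
        (L.shiftCol 0 i (cY N 0 Y) γ * L.shiftCol (z.2 + 1) j (cY N 0 Y) ε) := by
    have e1 : (Cx S Y).mulVec (L.col i (cY N 0 Y)) =
        ∑ γ, L.shiftCol 0 i (cY N 0 Y) γ • fun α => Cx S Y α γ := by
      ext α
      simp [Matrix.mulVec, dotProduct, shiftCol_zero, mul_comm]
    rw [e1, mulMatrix_sum, Matrix.sum_mulVec, Finset.sum_apply]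
    refine Finset.sum_congr rfl fun γ _ => ?_
    rw [mulMatrix_smul, Matrix.smul_mulVec, Pi.smul_apply, smul_eq_mul, Matrix.mulVec, dotProduct,
      Finset.mul_sum]
    exact Finset.sum_congr rfl fun ε _ => by ring
  rw [e]
  ring

end

/-! ### Weight estimates for solutions of the constraints, and the special case of genus one -/

section

open FrobeniusManifold Laurent LeveltSystem

variable {n N : ℕ} [NeZero n] {S : FrobeniusManifold n} {L : LeveltSystem S}

/-! ### The semisimple points form an open set -/

/-- Expresses simplicity of the spectrum by the nonvanishing of one analytic function of the matrix,
`det χ'(A)`, so that it is seen to be an open condition. -/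
theorem isCoprime_charpoly_iff (A : Matrix (Fin n) (Fin n) ℂ) :
    IsCoprime A.charpoly A.charpoly.derivative ↔
      (Polynomial.aeval A A.charpoly.derivative).det ≠ 0 := by
  refine ⟨fun ⟨a, b, h⟩ => ?_, fun h => ?_⟩
  · have h1 := congrArg (Polynomial.aeval A) h
    rw [map_add, map_mul, map_mul, Matrix.aeval_self_charpoly, mul_zero, zero_add, map_one] at h1
    have h2 := congrArg Matrix.det h1
    rw [Matrix.det_mul, Matrix.det_one] at h2
    exact right_ne_zero_of_mul (h2 ▸ one_ne_zero)
  · rw [Polynomial.isCoprime_iff_aeval_ne_zero_of_isAlgClosed ℂ ℂ]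
    intro a
    by_contra hc
    rw [not_or, not_not, not_not] at hc
    have h1 : (Matrix.scalar (Fin n) a - A).det = 0 := by
      rw [← Matrix.eval_charpoly]; simpa using hc.1
    obtain ⟨f, hf, hf0⟩ := Matrix.exists_mulVec_eq_zero_iff.2 h1
    have hf1 : A.mulVec f = a • f := by
      rw [Matrix.sub_mulVec, sub_eq_zero] at hf0
      rw [← hf0]; ext j; simp [Matrix.scalar_apply, Matrix.mulVec_diagonal]
    have h2 := aeval_mulVec_eigen hf1 A.charpoly.derivative
    have h3 : A.charpoly.derivative.eval a = 0 := by simpa using hc.2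
    rw [h3, zero_smul] at h2
    exact h (Matrix.exists_mulVec_eq_zero_iff.1 ⟨f, hf, h2⟩)

theorem isCoprime_of_mem_Mss {v : Fin n → ℂ} (hv : v ∈ S.Mss) :
    IsCoprime (S.U v).charpoly (S.U v).charpoly.derivative :=
  (Polynomial.nodup_roots_iff_of_splits (S.U v).charpoly_monic.ne_zero
    (IsAlgClosed.splits _)).1 hv.2

theorem analyticAt_matrix_pow {E : Type*} [NormedAddCommGroup E] [NormedSpace ℂ E] {x : E}
    {A : E → Matrix (Fin n) (Fin n) ℂ} (hA : ∀ i j, AnalyticAt ℂ (fun x => A x i j) x) (k : ℕ)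
    (i j : Fin n) : AnalyticAt ℂ (fun x => (A x ^ k) i j) x := by
  induction k generalizing i j with
  | zero => simp only [pow_zero]; exact analyticAt_const
  | succ k ih => simp only [pow_succ]; exact analyticAt_matrix_mul ih hA i j

theorem isOpen_Mss : IsOpen S.Mss := by
  rw [isOpen_iff_mem_nhds]
  intro v hv
  have ha : AnalyticAt ℂ (fun v => (Polynomial.aeval (S.U v) (S.U v).charpoly.derivative).det) v := by
    refine analyticAt_det fun i j => ?_
    have e : ∀ v, Polynomial.aeval (S.U v) (S.U v).charpoly.derivative =
        ∑ k ∈ Finset.range (n + 1), (S.U v).charpoly.derivative.coeff k • S.U v ^ k := fun v =>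
      Polynomial.aeval_eq_sum_range' (Nat.lt_succ_of_le ((Polynomial.natDegree_derivative_le _).trans
        (by rw [Matrix.charpoly_natDegree_eq_dim, Fintype.card_fin]; omega))) _
    simp only [e, Matrix.sum_apply, Matrix.smul_apply, smul_eq_mul, Polynomial.coeff_derivative]
    exact Finset.analyticAt_fun_sum _ fun k _ => ((analyticAt_coeff_charpoly (analyticAt_U hv.1)
      _).fun_mul analyticAt_const).fun_mul (analyticAt_matrix_pow (analyticAt_U hv.1) k i j)
  filter_upwards [S.isOpen_carrier.mem_nhds hv.1, ha.continuousAt.eventually_ne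
    ((isCoprime_charpoly_iff _).1 (isCoprime_of_mem_Mss hv))] with w hw hw'
  exact ⟨hw, (Polynomial.nodup_roots_iff_of_splits (S.U w).charpoly_monic.ne_zero
    (IsAlgClosed.splits _)).2 ((isCoprime_charpoly_iff _).2 hw')⟩

/-! ### Weights of the solutions of the constraints -/

variable {Ω : Set (Chart n N)} {w : ℤ}

/-- Downward induction on the coordinate `y_r`, testing on `χ^r X^m`. Components of the constraint
field below `r` vanish; the one along `y_r` has weight zero and is nondegenerate, so
`Filt.of_sum_mul` inverts it; the one along `y_q`, `q > r`, has weight `q - r` and multiplies a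
derivative of weight `w - q`. -/
theorem filt_of_constraint (L : LeveltSystem S) (hΩ : IsOpen Ω) (hsub : Ω ⊆ dom0 S N)
    (hss : ∀ Y ∈ Ω, cY N 0 Y ∈ S.Mss) {H : Chart n N → ℂ} (hH : ∀ Y ∈ Ω, AnalyticAt ℂ H Y)
    {c : Chart n N → ℕ → ℂ}
    (h : ∀ Y ∈ Ω, ∀ M : ℕ, fderiv ℂ H Y (DM S Y (Polynomial.X ^ M)) + c Y M = 0)
    (hc : ∀ r m : ℕ, Filt Ω (w - (r : ℤ)) fun Y => polyT (c Y) (testPoly S r m (cY N 0 Y)))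
    (q : ℕ) (γ : Fin n) : Filt Ω (w - (q : ℤ)) (dy q γ H) := by
  suffices hd : ∀ d q : ℕ, N < q + d → ∀ γ, Filt Ω (w - (q : ℤ)) (dy q γ H) from
    hd (N + 1) q (by omega) γ
  intro d
  induction d with
  | zero => exact fun q hq γ => .zero fun Y _ => by rw [dy, inc_of_lt (by omega)]; simp
  | succ d ih =>
  intro r hr γ
  by_cases hrN : N < r
  · exact ih r (by omega) γ
  have hrN' : r ≤ N := by omega
  refine Filt.of_sum_mul hΩ
    (K := fun m γ Y => cY N r (DM S Y (testPoly S r m (cY N 0 Y))) γ) (f := fun γ => dy r γ H)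
    (fun m γ => (filt_DM L hΩ hsub r m hrN' γ).mono (by omega)) (fun Y hY x hx => ?_)
    (fun γ Y hY => analyticAt_fderiv_apply (hH Y hY) _) (fun m => ?_) γ
  · obtain ⟨F⟩ := exists_frame (hss Y hY)
    refine eq_zero_of_topVec F (hsub hY) r fun m => ?_
    rw [← cY_DM_self F (hsub hY) hrN']
    exact hx m
  · have hF : Filt Ω (w - (r : ℤ)) fun Y => -1 * polyT (c Y) (testPoly S r m (cY N 0 Y)) +
        ∑ q ∈ Finset.range (N + 1), if r < q then
          -1 * ∑ δ, dy q δ H Y * cY N q (DM S Y (testPoly S r m (cY N 0 Y))) δ else 0 := by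
      refine ((hc r m).const_mul hΩ _).add hΩ (Filt.sum hΩ _ fun q hq => ?_)
      rw [Finset.mem_range] at hq
      split_ifs with hqr
      · refine Filt.const_mul hΩ _ (Filt.sum hΩ _ fun δ _ => ?_)
        exact ((ih q (by omega) δ).mul hΩ (filt_DM L hΩ hsub r m (by omega) δ)).mono (by omega)
      · exact .zero fun _ _ => rfl
    refine hF.congr hΩ fun Y hY => ?_
    have h1 := apply_DM_polyT (h Y hY) (testPoly S r m (cY N 0 Y))
    rw [clm_apply_eq_sum_dy] at h1
    have h2 : ∀ q ∈ Finset.range (N + 1),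
        ∑ δ, dy q δ H Y * cY N q (DM S Y (testPoly S r m (cY N 0 Y))) δ =
        (if q = r then ∑ δ, dy r δ H Y * cY N r (DM S Y (testPoly S r m (cY N 0 Y))) δ else 0) -
        (if r < q then
          -1 * ∑ δ, dy q δ H Y * cY N q (DM S Y (testPoly S r m (cY N 0 Y))) δ else 0) := by
      intro q hq
      rw [Finset.mem_range] at hq
      rcases lt_trichotomy q r with hlt | rfl | hgt
      · rw [testPoly, cY_DM_lt hlt (by omega), if_neg (by omega), if_neg (by omega)]
        simp
      · simp
      · rw [if_neg (by omega), if_pos hgt]; ring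
    rw [Finset.sum_congr rfl h2, Finset.sum_sub_distrib, Finset.sum_ite_eq' (Finset.range (N + 1)),
      if_pos (Finset.mem_range.2 (by omega))] at h1
    linear_combination -h1

/-! ### The inhomogeneous term of genus one -/

variable (L) in
/-- The inhomogeneous term `∑ a_{ij} Ω_{ji}(v) + κ δ_{M,1}` of the constraint of genus one. -/
def genusOne (κ : ℂ) (v : Fin n → ℂ) (M : ℕ) : ℂ :=
  (∑ i ∈ box n M, ∑ j ∈ box n M, L.a M i j * L.Ω j i v) + if M = 1 then κ else 0

theorem apply_mul_eq_zero {T : Polynomial ℂ →ₗ[ℂ] ℂ} {A : Polynomial ℂ}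
    (h : ∀ m : ℕ, T (A * Polynomial.X ^ m) = 0) (g : Polynomial ℂ) : T (A * g) = 0 := by
  induction g using Polynomial.induction_on' with
  | add p q hp hq => rw [mul_add, map_add, hp, hq, add_zero]
  | monomial m x =>
    rw [← Polynomial.C_mul_X_pow_eq_monomial, mul_left_comm, ← Polynomial.smul_eq_C_mul, map_smul,
      h, smul_zero]

variable (L) in
-- The two unshifted columns extract the coefficient lying 2 below the top, which is lost once `χ`
-- appears to a power at least 3.
theorem polyT_bil_col {v : Fin n → ℂ} (hv : v ∈ S.carrier) {r : ℕ} (hr : 3 ≤ r)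
    (g : Polynomial ℂ) : polyT (fun M => ∑ i ∈ box n M, ∑ j ∈ box n M,
      L.a M i j * bil S (L.col j v) (L.col i v)) ((S.U v).charpoly ^ r * g) = 0 := by
  refine apply_mul_eq_zero (fun m => ?_) g
  have e : (fun M => ∑ i ∈ box n M, ∑ j ∈ box n M, L.a M i j * bil S (L.col j v) (L.col i v)) =
      fun M => ∑ γ, ∑ δ, S.η γ δ * ∑ i ∈ box n M, ∑ j ∈ box n M,
        L.a M i j * (L.shiftCol 0 i v δ * L.shiftCol 0 j v γ) := by
    funext M
    simp only [bil, dotProduct, Matrix.mulVec, shiftCol_zero, Finset.mul_sum]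
    simp only [Finset.sum_comm (s := (Finset.univ : Finset (Fin n))) (t := box n M)]
    refine Finset.sum_congr rfl fun i _ => Finset.sum_congr rfl fun j _ =>
      Finset.sum_congr rfl fun γ _ => Finset.sum_congr rfl fun δ _ => by ring
  rw [e, polyT_sum]
  refine Finset.sum_eq_zero fun γ _ => ?_
  rw [polyT_sum]
  refine Finset.sum_eq_zero fun δ _ => ?_
  have h := polyT_quad (L := L) hv r m (δ, 0) (γ, 0)
  rw [Np_eq_zero (by simp; omega)] at h
  rw [polyT_mul]
  simp only [testPoly] at h
  rw [h]
  simp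

theorem hasDerivAt_genusOne {v : Fin n → ℂ} (hv : v ∈ S.carrier) (κ : ℂ) (M : ℕ) :
    HasDerivAt (fun s : ℂ => genusOne L κ (v + s • unit n) M)
      (∑ i ∈ box n M, ∑ j ∈ box n M, L.a M i j * bil S (L.col j v) (L.col i v)) 0 := by
  have h : ∀ i j, HasDerivAt (fun s : ℂ => L.Ω j i (v + s • unit n))
      (bil S (L.col j v) (L.col i v)) 0 := by
    intro i j
    have hv0 : v + (0 : ℂ) • unit n = v := by simp
    have h1 := hasDerivAt_shift (L.Ω j i) v 0
      (by rw [hv0]; exact (L.analyticAt_Ω hv j i).differentiableAt)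
    rw [hv0, pd, L.fderiv_Ω hv] at h1
    have h2 : S.mulMatrix v (Pi.single 0 1) = 1 := mulMatrix_unit hv
    rwa [h2, Matrix.one_mulVec] at h1
  exact (HasDerivAt.fun_sum fun i _ => HasDerivAt.fun_sum fun j _ =>
    (h i j).const_mul _).add_const _

/-- Moving along the unity replaces `χ(X)` by `χ(X - s)`, so test polynomials have to be
differentiated under this substitution. -/
theorem hasDerivAt_coeff_comp (q : Polynomial ℂ) (k : ℕ) :
    HasDerivAt (fun s : ℂ => (q.comp (Polynomial.X - Polynomial.C s)).coeff k)
      (-q.derivative.coeff k) 0 := by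
  have e : (fun s : ℂ => (q.comp (Polynomial.X - Polynomial.C s)).coeff k) =
      fun s => (Polynomial.hasseDeriv k q).eval (-s) := by
    funext s
    rw [← Polynomial.taylor_coeff, Polynomial.taylor_apply, Polynomial.C_neg, sub_eq_add_neg]
  rw [e]
  have h := ((Polynomial.hasseDeriv k q).hasDerivAt (-(0 : ℂ))).comp (0 : ℂ) (hasDerivAt_neg 0)
  have h2 : (Polynomial.hasseDeriv k q).derivative.eval (-(0 : ℂ)) = q.derivative.coeff k := by
    rw [neg_zero, ← Polynomial.coeff_zero_eq_eval_zero, Polynomial.coeff_derivative,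
      Polynomial.hasseDeriv_coeff, Polynomial.coeff_derivative, zero_add, add_comm 1 k,
      Nat.choose_succ_self_right]
    push_cast
    ring
  rw [h2, mul_neg_one] at h
  exact h

/-- Differentiate the vanishing on `χ^{R+1} g` along the unity. The derivative of `Ω` contributes
nothing by `polyT_bil_col`, which needs `R + 1 ≥ 3`, and that of the polynomial gives vanishing on
`χ^R χ' g`. As `χ` and `χ'` are coprime on `M_ss`, vanishing on all `χ^R g` follows. -/
theorem polyT_genusOne_descend {O : Set (Fin n → ℂ)} (hO : IsOpen O) (hsub : O ⊆ S.Mss) {κ : ℂ}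
    {R : ℕ} (hR : 2 ≤ R)
    (h : ∀ v ∈ O, ∀ g, polyT (genusOne L κ v) ((S.U v).charpoly ^ (R + 1) * g) = 0)
    {v : Fin n → ℂ} (hv : v ∈ O) (g : Polynomial ℂ) :
    polyT (genusOne L κ v) ((S.U v).charpoly ^ R * g) = 0 := by
  have hvc := (hsub hv).1
  have key : ∀ g, polyT (genusOne L κ v)
      ((S.U v).charpoly ^ R * ((S.U v).charpoly.derivative * g)) = 0 := by
    intro g
    set χ := (S.U v).charpoly with hχ
    set q := χ ^ (R + 1) * g with hq
    have hmem : ∀ᶠ s in 𝓝 (0 : ℂ), v + s • unit n ∈ O := by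
      have hc : ContinuousAt (fun s : ℂ => v + s • unit n) 0 := by fun_prop
      exact hc.eventually (hO.mem_nhds (by simpa using hv))
    have hz : (fun s : ℂ => ∑ M ∈ Finset.range (q.natDegree + 1),
        (q.comp (Polynomial.X - Polynomial.C s)).coeff M * genusOne L κ (v + s • unit n) M) =ᶠ[𝓝 0]
        fun _ => 0 := by
      filter_upwards [hmem, eventually_U_shift hvc] with s hs hU
      have h1 := h _ hs (g.comp (Polynomial.X - Polynomial.C s))
      rw [hU, charpoly_add_smul_one, ← Polynomial.pow_comp, ← Polynomial.mul_comp] at h1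
      rw [← h1, ← polyT_apply]
      rw [Polynomial.natDegree_comp, Polynomial.natDegree_X_sub_C, mul_one]
      exact Nat.lt_succ_self _
    have hd := (HasDerivAt.fun_sum fun M (_ : M ∈ Finset.range (q.natDegree + 1)) =>
      (hasDerivAt_coeff_comp q M).fun_mul (hasDerivAt_genusOne (L := L) hvc κ M))
    have h0 := (hd.congr_of_eventuallyEq hz.symm).unique (hasDerivAt_const (0 : ℂ) (0 : ℂ))
    simp only [Polynomial.C_0, sub_zero, Polynomial.comp_X, zero_smul, add_zero,
      Finset.sum_add_distrib, neg_mul, Finset.sum_neg_distrib] at h0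
    rw [← polyT_apply _ (Nat.lt_succ_self _), ← polyT_apply (p := q.derivative) _
      (Nat.lt_succ_of_le ((Polynomial.natDegree_derivative_le _).trans (Nat.sub_le _ _))), hq,
      polyT_bil_col L hvc (by omega), add_zero, neg_eq_zero, Polynomial.derivative_mul,
      map_add, h v hv, add_zero, Polynomial.derivative_pow_succ] at h0
    have e : Polynomial.C ((R : ℂ) + 1) * χ ^ R * Polynomial.derivative χ * g =
        ((R : ℂ) + 1) • (χ ^ R * (Polynomial.derivative χ * g)) := by
      rw [Polynomial.smul_eq_C_mul]; ring
    rw [e, map_smul, smul_eq_mul] at h0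
    exact (mul_eq_zero.1 h0).resolve_left (by exact_mod_cast R.succ_ne_zero)
  obtain ⟨a, b, hab⟩ := isCoprime_of_mem_Mss (hsub hv)
  have e : (S.U v).charpoly ^ R * g = (S.U v).charpoly ^ (R + 1) * (a * g) +
      (S.U v).charpoly ^ R * ((S.U v).charpoly.derivative * (b * g)) := by
    linear_combination (-(S.U v).charpoly ^ R * g) * hab
  rw [e, map_add, h v hv, key, add_zero]

/-- The term depends on `v` alone, so weight `1 - r` means vanishing for `r ≥ 2`. This holds for
powers of `χ` above `N` because of the constraint itself, and is then propagated downwards by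
`polyT_genusOne_descend`. -/
theorem filt_genusOne (hsub : Ω ⊆ dom0 S N) (hΩ : IsOpen Ω)
    (hss : ∀ Y ∈ Ω, cY N 0 Y ∈ S.Mss) {κ : ℂ} {H : Chart n N → ℂ}
    (h : ∀ Y ∈ Ω, ∀ M : ℕ, fderiv ℂ H Y (DM S Y (Polynomial.X ^ M)) +
      genusOne L κ (cY N 0 Y) M = 0) (r m : ℕ) :
    Filt Ω (1 - (r : ℤ)) fun Y => polyT (genusOne L κ (cY N 0 Y)) (testPoly S r m (cY N 0 Y)) := by
  have hO : IsOpen (cY N 0 '' Ω) := (ContinuousLinearMap.isOpenMap (cY N 0) fun x =>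
    ⟨inc N 0 x, cY_inc_self (Nat.zero_le _) x⟩) _ hΩ
  have hOss : cY N 0 '' Ω ⊆ S.Mss := by rintro _ ⟨Y, hY, rfl⟩; exact hss Y hY
  have hz : ∀ d, ∀ R, 2 ≤ R → N + 1 ≤ R + d → ∀ v ∈ cY N 0 '' Ω, ∀ g,
      polyT (genusOne L κ v) ((S.U v).charpoly ^ R * g) = 0 := by
    intro d
    induction d with
    | zero =>
      rintro R hR hd _ ⟨Y, hY, rfl⟩ g
      obtain ⟨k, rfl⟩ : ∃ k, R = N + 1 + k := ⟨R - (N + 1), by omega⟩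
      -- The constraint vector field at `χ^{N+1}` times anything has no component in the chart, so
      -- only the inhomogeneous term remains.
      have h1 := apply_DM_polyT (h Y hY)
        ((S.U (cY N 0 Y)).charpoly ^ (N + 1) * ((S.U (cY N 0 Y)).charpoly ^ k * g))
      rw [apply_DM_eq_zero (fun q hq w => by rw [inc_of_lt hq]; simp), zero_add] at h1
      rw [pow_add, mul_assoc, h1]
    | succ d ih =>
      intro R hR hd v hv g
      exact polyT_genusOne_descend hO hOss hR (ih (R + 1) (by omega) (by omega)) hv g
  by_cases hr : 2 ≤ r
  · exact .zero fun Y hY => hz (N + 1) r hr (by omega) _ ⟨Y, hY, rfl⟩ _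
  · refine Filt.mono (w := 0) ?_ (by omega)
    simp only [polyT_apply _ (natDegree_testPoly r m _)]
    refine Filt.comp_v (h := fun v => ∑ M ∈ Finset.range (n * r + m + 1),
      (testPoly S r m v).coeff M * genusOne L κ v M) fun Y hY => ?_
    refine Finset.analyticAt_fun_sum _ fun M _ =>
      (analyticAt_coeff_testPoly (hsub hY).1 r m M).fun_mul ?_
    exact (Finset.analyticAt_fun_sum _ fun i _ => Finset.analyticAt_fun_sum _ fun j _ =>
      analyticAt_const.fun_mul (L.analyticAt_Ω (hsub hY).1 j i)).fun_add analyticAt_const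

end

section

open FrobeniusManifold Laurent LeveltSystem

variable {n N : ℕ} [NeZero n] {S : FrobeniusManifold n} {L : LeveltSystem S}
variable {F : ℕ → JetFunction S} {κ : ℂ} {k : ℕ}

/-! ### The orders of the free energies -/

variable (L) in
/-- The semisimple points of the chart whose jets lie in the domains of `𝓕^{[1]}, …, 𝓕^{[k]}`. -/
def regDom (F : ℕ → JetFunction S) (k N : ℕ) : Set (Chart n N) :=
  (dom0 S N ∩ cY N 0 ⁻¹' S.Mss) ∩ ⋂ l ∈ Finset.Icc 1 k, L.domOf (F l) N

theorem isOpen_regDom : IsOpen (regDom L F k N) :=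
  (isOpen_dom0.inter (isOpen_Mss.preimage (cY N 0).continuous)).inter
    (isOpen_biInter_finset fun l _ => L.isOpen_domOf (F l))

theorem mem_domOf_of_mem_regDom {Y : Chart n N} (hY : Y ∈ regDom L F k N) {l : ℕ} (h1 : 1 ≤ l)
    (hl : l ≤ k) : Y ∈ L.domOf (F l) N :=
  Set.mem_iInter₂.1 hY.2 l (Finset.mem_Icc.2 ⟨h1, hl⟩)

theorem exists_solution_regDom (hN : ∀ l ≤ k, (F l).order + 1 < N) {Y : Chart n N}
    (hY : Y ∈ regDom L F k N) : ∃ s : Solution L, s.Ych N 0 = Y ∧ InDom F k (s.jet 0) ∧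
      ∀ l ≤ k, (F l).trunc (s.jet 0) = L.jetOf (F l).order Y := by
  obtain ⟨s, hs⟩ := L.exists_solution_Ych hY.1.1
  have h : ∀ l ≤ k, (F l).trunc (s.jet 0) = L.jetOf (F l).order Y := fun l hl => by
    have := hN l hl
    rw [← hs]
    exact (s.near_jetOf (N := N) (r := (F l).order) (by omega) (by omega)).at_zero
  refine ⟨s, hs, fun l h1 hl => ?_, h⟩
  rw [h l hl]
  exact (mem_domOf_of_mem_regDom hY h1 hl).2

variable (L) in
/-- The derivatives of `𝓕^{[l]}` along the times, as functions on the chart. -/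
def dF (F : ℕ → JetFunction S) (l : ℕ) (i : Fin n × ℕ) (Y : Chart n N) : ℂ :=
  fderiv ℂ (L.hat (F l)) Y (L.Z i Y)

theorem constraint_regDom (h : VirasoroConstraints L F κ) (hN : ∀ l ≤ k, (F l).order + 1 < N)
    {Y : Chart n N} (hY : Y ∈ regDom L F k N) {m : ℕ} (hm1 : 1 ≤ m) (hm : m + 1 ≤ k) (M : ℕ) :
    fderiv ℂ (L.hat (F (m + 1))) Y (DM S Y (Polynomial.X ^ M)) +
      ((∑ i ∈ box n M, ∑ j ∈ box n M, L.a M i j *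
        ((∑ l ∈ Finset.range m, dF L F (l + 1) i Y * dF L F (m - l) j Y) +
          if m = 1 then L.Ω j i (cY N 0 Y) else fderiv ℂ (dF L F (m - 1) j) Y (L.Z i Y))) +
      if M = 1 ∧ m = 1 then κ else 0) = 0 := by
  obtain ⟨s, hs, hd, -⟩ := exists_solution_regDom hN hY
  have e := (h s (m + 1) (fun l h1 hl => hd l h1 (by omega)) M).at_zero
  have hdt : ∀ l, 1 ≤ l → l ≤ k → ∀ i, dt i (s.eval (F l)) 0 = dF L F l i Y := fun l h1 hl i => by
    have := hN l hl
    rw [(s.near_dt_eval (N := N) (by omega) (hd l h1 hl) i).at_zero, hs]; rfl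
  have hN' := hN (m + 1) hm
  rw [s.virasoroCoeff_sub, s.linearized_zero (N := N) (by omega) (hd _ (by omega) hm), hs,
    Solution.inhom, if_pos hm1, add_assoc] at e
  refine Eq.trans ?_ e
  congr 2
  simp only [mul_add, Finset.sum_add_distrib, Finset.mul_sum]
  congr 1
  · rw [Finset.sum_comm (s := Finset.range m)]
    refine Finset.sum_congr rfl fun i _ => ?_
    rw [Finset.sum_comm (s := Finset.range m)]
    refine Finset.sum_congr rfl fun j _ => Finset.sum_congr rfl fun l hl => ?_
    rw [Finset.mem_range] at hl
    rw [hdt (l + 1) (by omega) (by omega), hdt (m - l) (by omega) (by omega), mul_assoc]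
  · refine Finset.sum_congr rfl fun i _ => Finset.sum_congr rfl fun j _ => ?_
    congr 1
    by_cases h1 : m = 1
    · subst h1
      rw [if_pos rfl, Solution.logTau, if_pos rfl, (s.dt_dt_F0 i j).at_zero, ← hs, s.cY_zero_Ych]
    · have := hN (m - 1) (by omega)
      rw [if_neg h1, Solution.logTau, if_neg (by omega), (s.near_dt_dt_eval (N := N) (by omega)
        (hd (m - 1) (by omega) (by omega)) i j).at_zero, hs]
      rfl

theorem fderiv_hat_odd (hS : S.IsSemisimple) (h : VirasoroConstraints L F κ)
    (hN : ∀ l ≤ k, (F l).order + 1 < N) {Y : Chart n N} (hY : Y ∈ regDom L F k N) {l : ℕ}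
    (hl : Odd l) (hlk : l ≤ k) (w : Chart n N) : fderiv ℂ (L.hat (F l)) Y w = 0 := by
  obtain ⟨s, hs, hd, ht⟩ := exists_solution_regDom hN hY
  rw [L.fderiv_hat_eq_sum (mem_domOf_of_mem_regDom hY hl.pos hlk) (ht l hlk) le_rfl]
  refine Finset.sum_eq_zero fun r _ => Finset.sum_eq_zero fun γ _ => ?_
  rw [partialDeriv_odd hS h hl (fun l' h1 h2 => hd l' h1 (by omega)), zero_mul]

/-- Strong induction on the genus. The products of genera `f` and `g - f` have total weight `3g -
4`, and so does the second derivative of genus `g - 1`; contraction with `a` adds `2`, and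
`filt_of_constraint` returns the bound `3g - 2 - q`. -/
theorem filt_dy_hat (hS : S.IsSemisimple) (h : VirasoroConstraints L F κ)
    (hN : ∀ l ≤ k, (F l).order + 1 < N) (g : ℕ) (hg : 1 ≤ g) (hgk : 2 * g ≤ k) (q : ℕ) (γ : Fin n) :
    Filt (regDom L F k N) (3 * (g : ℤ) - 2 - (q : ℤ)) (dy q γ (L.hat (F (2 * g)))) := by
  induction g using Nat.strong_induction_on generalizing q γ with
  | _ g ih =>
  have hΩ : IsOpen (regDom L F k N) := isOpen_regDom
  have hsub : regDom L F k N ⊆ dom0 S N := fun Y hY => hY.1.1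
  have hss : ∀ Y ∈ regDom L F k N, cY N 0 Y ∈ S.Mss := fun Y hY => hY.1.2
  have hH : ∀ Y ∈ regDom L F k N, AnalyticAt ℂ (L.hat (F (2 * g))) Y := fun Y hY =>
    (L.ord_hat (F (2 * g))).1 Y (mem_domOf_of_mem_regDom hY (by omega) hgk)
  have hodd : ∀ l, Odd l → l ≤ k → ∀ Y ∈ regDom L F k N, ∀ i, dF L F l i Y = 0 :=
    fun l hl hlk Y hY i => fderiv_hat_odd hS h hN hY hl hlk _
  have heven : ∀ f, 1 ≤ f → f < g → Fam L (regDom L F k N) (3 * (f : ℤ) - 2) (dF L F (2 * f)) :=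
    fun f h1 hf => fam_Z L hΩ hsub fun q γ => ih f hf h1 (by omega) q γ
  obtain ⟨m, hm⟩ : ∃ m, 2 * g = m + 1 := ⟨2 * g - 1, by omega⟩
  have hEQ := fun Y hY M => constraint_regDom h hN (Y := Y) hY (m := m) (by omega) (by omega) M
  rw [← hm] at hEQ
  by_cases h1 : g = 1
  · subst h1
    obtain rfl : m = 1 := by omega
    have hEQ' : ∀ Y ∈ regDom L F k N, ∀ M, fderiv ℂ (L.hat (F (2 * 1))) Y
        (DM S Y (Polynomial.X ^ M)) + genusOne L κ (cY N 0 Y) M = 0 := fun Y hY M => by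
      have e := hEQ Y hY M
      rw [genusOne]
      simpa only [Finset.sum_range_one, hodd (0 + 1) odd_one (by omega) Y hY, zero_mul, zero_add,
        if_true, and_true] using e
    exact (filt_of_constraint L hΩ hsub hss hH hEQ' (w := 1)
      (filt_genusOne hsub hΩ hss hEQ') q γ).mono (by push_cast; omega)
  · have hG : Fam2 L (regDom L F k N) (3 * (g : ℤ) - 4) fun i j Y =>
        (∑ l ∈ Finset.range m, dF L F (l + 1) i Y * dF L F (m - l) j Y) +
          fderiv ℂ (dF L F (m - 1) j) Y (L.Z i Y) := by
      refine (Fam2.sum hΩ _ fun l hl => ?_).add hΩ ?_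
      · rw [Finset.mem_range] at hl
        rcases Nat.even_or_odd' (l + 1) with ⟨f, hf | hf⟩
        · rw [hf, show m - l = 2 * (g - f) by omega]
          refine ((heven f (by omega) (by omega)).mul hΩ hsub
            (heven (g - f) (by omega) (by omega))).mono ?_
          push_cast [show f ≤ g by omega]; omega
        -- The complementary order is odd as well. Derivatives of odd orders vanish, so any weights
        -- may be assigned to them.
        · refine (Fam.mul hΩ hsub (w := 3 * (g : ℤ) - 4) (w' := 0)
            (fam_of_eq_zero (hodd (l + 1) ⟨f, hf⟩ (by omega)))
            (fam_of_eq_zero (hodd (m - l) ⟨g - f - 1, by omega⟩ (by omega)))).mono (by omega)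
      · rw [show m - 1 = 2 * (g - 1) by omega]
        refine ((heven (g - 1) (by omega) (by omega)).deriv hΩ hsub).mono ?_
        push_cast [hg]; omega
    refine filt_of_constraint L hΩ hsub hss hH (c := fun Y M => ∑ i ∈ box n M, ∑ j ∈ box n M,
      L.a M i j * ((∑ l ∈ Finset.range m, dF L F (l + 1) i Y * dF L F (m - l) j Y) +
          fderiv ℂ (dF L F (m - 1) j) Y (L.Z i Y))) (fun Y hY M => ?_)
      (fun r m => (hG r m).mono (by omega)) q γ
    have e := hEQ Y hY M
    simpa only [show m ≠ 1 by omega, if_false, and_false, add_zero] using e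

/-- For `q > 3g - 2` the weight `3g - 2 - q` is negative, so the derivative along `y_q` is zero. On
good jets triangularity carries this from the chart to the jet coordinates, and density extends it
to the whole domain. -/
theorem partialDeriv_eq_zero_of_lt (hS : S.IsSemisimple) (h : VirasoroConstraints L F κ) {g : ℕ}
    (hg : 1 ≤ g) {j : ℕ → Fin n → ℂ} (hj : InDom F (2 * g) j) (γ : Fin n) {r : ℕ}
    (hr : 3 * g - 2 < r) : (F (2 * g)).partialDeriv γ r j = 0 := by
  have hgood : ∀ j ∈ goodJets S, InDom F (2 * g) j → (F (2 * g)).partialDeriv γ r j = 0 := by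
    intro j hjg hj
    obtain ⟨K, hK⟩ : ∃ K, ∀ l ≤ 2 * g, (F l).order ≤ K :=
      ⟨(Finset.range (2 * g + 1)).sup fun l => (F l).order, fun l hl =>
        Finset.le_sup (f := fun l => (F l).order) (Finset.mem_range.2 (by omega))⟩
    obtain ⟨Y, hY, hjet⟩ := L.exists_chart (N := K + 2) (by omega) j hjg.1.1 hjg.2.2
    have ht : ∀ l ≤ 2 * g, (F l).trunc j = L.jetOf (F l).order Y := fun l hl =>
      funext fun q => funext fun δ => (hjet q (by have := hK l hl; omega) δ).symm
    have hdom : ∀ l, 1 ≤ l → l ≤ 2 * g → Y ∈ L.domOf (F l) (K + 2) := fun l h1 hl =>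
      ⟨hY, by rw [← ht l hl]; exact hj l h1 hl⟩
    have h0 : cY (K + 2) 0 Y = j 0 := funext fun δ => hjet 0 (by omega) δ
    have hreg : Y ∈ regDom L F (2 * g) (K + 2) :=
      ⟨⟨hY, by rw [Set.mem_preimage, h0]; exact hjg.1⟩, Set.mem_iInter₂.2 fun l hl =>
        hdom l (Finset.mem_Icc.1 hl).1 (Finset.mem_Icc.1 hl).2⟩
    have hz := L.coeff_eq_zero hY (R := (F (2 * g)).order) (m := 3 * g - 1)
      (by have := hK _ le_rfl; omega) (c := fun r γ => (F (2 * g)).partialDeriv γ r j) (by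
        intro q hq _ x
        rw [← L.fderiv_hat_eq_sum (hdom _ (by omega) le_rfl) (ht _ le_rfl) le_rfl]
        refine (clm_eq_dotProduct ((fderiv ℂ (L.hat (F (2 * g))) Y).comp (inc (K + 2) q)) x).trans ?_
        refine Finset.sum_eq_zero fun δ _ => ?_
        have := (filt_dy_hat hS h (N := K + 2) (k := 2 * g) (fun l hl => by
          have := hK l hl; omega) g hg le_rfl q δ).eq_zero (by omega) hreg
        exact mul_eq_zero_of_left this _)
    by_cases hro : r ≤ (F (2 * g)).order
    · exact congrFun (hz r (by omega) hro) γ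
    · rw [JetFunction.partialDeriv, dif_neg (by omega)]
  by_contra hne
  have hm := hj (2 * g) (by omega) le_rfl
  obtain ⟨O, hO, hOo, hjO⟩ := eventually_nhds_iff.1
    ((((F (2 * g)).continuousAt_partialDeriv hm γ r).eventually_ne hne).and
      ((isOpen_inDom F (2 * g)).mem_nhds hj))
  obtain ⟨j', hj'O, hjg⟩ := exists_goodJet hS hOo hjO ((F (2 * g)).dom_sub _ hm)
  exact (hO j' hj'O).1 (hgood j' hjg (hO j' hj'O).2)

end
end Dubrovin

end

theorem mainTheorem2 {n : ℕ} [NeZero n] (S : Dubrovin.FrobeniusManifold n)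
    (hS : S.IsSemisimple) (L : Dubrovin.LeveltSystem S) :
    -- the linearized Virasoro constraints: rational in `λ`, with the highest order poles
    (∀ (G : Dubrovin.JetFunction S) (s : Dubrovin.Solution L),
      s.v 0 ∈ S.Mss → G.trunc (s.jet 0) ∈ G.dom →
      ∃ (u : Fin n → ℂ) (π : Fin n → Fin n → ℂ) (u' : Fin n → ℂ) (A : Fin n → ℕ → ℂ),
        S.IsCanonicalFrame (s.v 0) u π ∧
        (s.jet 0 1 = ∑ i, u' i • π i) ∧
        (∀ z : ℂ, (∀ i, ‖u i‖ < ‖z‖) →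
          HasSum (fun M : ℕ => s.linearized M G 0 / z ^ (M + 1))
            (∑ i, ∑ r ∈ Finset.range (G.order + 1), A i r / (z - u i) ^ (r + 1))) ∧
        ∀ i,
          A i G.order = -(u' i ^ G.order * Dubrovin.poleConst G.order) *
            ∑ γ, π i γ * G.partialDeriv γ G.order (s.jet 0) ∧
          u' i ^ G.order * Dubrovin.poleConst G.order ≠ 0) ∧
    -- the homogeneous equation has only the trivial solution
    (∀ G : Dubrovin.JetFunction S,
      (∀ s : Dubrovin.Solution L, G.trunc (s.jet 0) ∈ G.dom →
        ∀ M : ℕ, Dubrovin.HoldsNear fun t => s.linearized M G t = 0) →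
      ∀ y ∈ G.dom, fderiv ℂ G.toFun y = 0) ∧
    -- uniqueness of the solution of the system of Virasoro constraints
    (∀ (F F' : ℕ → Dubrovin.JetFunction S) (κ κ' : ℂ),
      Dubrovin.VirasoroConstraints L F κ → Dubrovin.VirasoroConstraints L F' κ' →
      (∀ k, 1 ≤ k → ∀ j, Dubrovin.InDom F k j → Dubrovin.InDom F' k j →
        ∀ γ r, (F k).partialDeriv γ r j = (F' k).partialDeriv γ r j) ∧
      ((∃ j, Dubrovin.InDom F 2 j ∧ Dubrovin.InDom F' 2 j) → κ = κ')) ∧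
    -- linearization of the Virasoro symmetries implies the Virasoro constraints
    (∀ (F : ℕ → Dubrovin.JetFunction S) (κ : ℂ),
      Dubrovin.LinearizesVirasoro L F κ → Dubrovin.VirasoroConstraints L F κ) ∧
    -- only even powers of `ε`, and `𝓕_g = 𝓕^{[2g]}` depends on the jets up to order `3g - 2`
    (∀ (F : ℕ → Dubrovin.JetFunction S) (κ : ℂ), Dubrovin.VirasoroConstraints L F κ →
      (∀ k, Odd k → ∀ j, Dubrovin.InDom F k j → ∀ γ r, (F k).partialDeriv γ r j = 0) ∧
      (∀ g, 1 ≤ g → ∀ j, Dubrovin.InDom F (2 * g) j →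
        ∀ γ r, 3 * g - 2 < r → (F (2 * g)).partialDeriv γ r j = 0) ∧
      (∀ s : Dubrovin.Solution L, (∀ k, Dubrovin.InDom F k (s.jet 0)) →
        ∀ α k, Odd k → PowerSeries.coeff k (s.quasiMiura F α) = 0)) := by
  refine ⟨Dubrovin.linearized_generating_function,
    fun G h => Dubrovin.fderiv_eq_zero_of_linearized hS h,
    fun F F' κ κ' h h' => Dubrovin.virasoro_unique hS h h',
    fun F κ h => Dubrovin.virasoroConstraints_of_linearizes h,
    fun F κ h => ⟨fun k hk j hj γ r => Dubrovin.partialDeriv_odd hS h hk hj γ r,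
      fun g hg j hj γ r hr => Dubrovin.partialDeriv_eq_zero_of_lt hS h hg hj γ hr,
      fun s hs α k hk => Dubrovin.quasiMiura_odd hS h s hs α hk⟩⟩
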